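/- The model is the word RAM: memory cells are signed words, and each arithmetic, bitwise or comparison operation on words, each memory access, each conditional test and each toss of a fair coin takes one step; a program may not produce a value that does not fit into a word. \textbf{Exact Node Weighted $P_4$}: given an undirected graph $G=(V,E)$ (as an adjacency matrix) with integer vertex weights, decide whether $G$ has a simple path on four vertices whose total weight is $0$. It is solved in $O(|V|^{2.05})$ time if one fixed deterministic program decides every instance with $|V|\ge 1$ in at most $C\,|V|^{2.05}$ steps, for a constant $C$; if $|V|$ and all the weights have at most $L$ bits, words of $O(L+1)$ bits are available. \textbf{Subset Sum}: given integers $w_1,\dots,w_n$ and $t$, decide whether some $S\subseteq\{1,\dots,n\}$ has $\sum_{i\in S}w_i=t$. It is solved in randomized $O^*(2^{\alpha n})$ time if one fixed coin-tossing program halts on every instance of input size $s$ (the total number of bits), for all outcomes of its coins, within $C\,s^{c}\,2^{\alpha n}$ steps on words of $O(s)$ bits, for constants $C,c$, and answers correctly with probability at least $2/3$. \textbf{Theorem.} If Exact Node Weighted $P_4$ on a graph $G=(V,E)$ can be solved in $O(|V|^{2.05})$ time, then there is a $\delta>0$ such that Subset Sum can be solved in randomized $O^*(2^{(0.5-\delta)n})$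 time. -/

import Mathlib

open MeasureTheory

/-! ## The word RAM -/

namespace WordRAM

/-- The binary word operations. Divisions are integer divisions (with `x / 0 = 0` and `x % 0 = x`),
the bitwise operations act on two's complement, comparisons return `0` or `1`. -/
inductive Op
  | add | sub | mul | div | mod | land | lor | xor | shl | shr | lt | eq

/-- The value of a word operation. -/
def Op.eval : Op → ℤ → ℤ → ℤ
  | .add, x, y => x + y
  | .sub, x, y => x - y
  | .mul, x, y => x * y
  | .div, x, y => x / y
  | .mod, x, y => x % y
  | .land, x, y => Int.land x y
  | .lor, x, y => Int.lor x y
  | .xor, x, y => Int.xor x y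
  | .shl, x, y => x * 2 ^ y.toNat
  | .shr, x, y => x / 2 ^ y.toNat
  | .lt, x, y => if x < y then 1 else 0
  | .eq, x, y => if x = y then 1 else 0

/-- Programs. The natural numbers `x y z` name registers and `a` names an array. -/
inductive Prog
  /-- `x := c` -/
  | const (x : ℕ) (c : ℤ)
  /-- `x := y o z` -/
  | op (o : Op) (x y z : ℕ)
  /-- `x := a[y]` -/
  | load (x a y : ℕ)
  /-- `a[y] := z` -/
  | store (a y z : ℕ)
  /-- `x :=` the outcome (`0` or `1`) of a fresh fair coin -/
  | flip (x : ℕ)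
  /-- `p` and then `q` -/
  | seq (p q : Prog)
  /-- `p` if `x ≠ 0`, and `q` otherwise -/
  | ite (x : ℕ) (p q : Prog)
  /-- `p` as long as `x ≠ 0` -/
  | loop (x : ℕ) (p : Prog)

/-- A memory state: the registers, the arrays, and the outcomes of the coins not yet flipped. -/
@[ext]
structure State where
  reg : ℕ → ℤ
  arr : ℕ → ℕ → ℤ
  coins : ℕ → Bool

/-- The state after writing `v` into register `x`. -/
def State.setReg (σ : State) (x : ℕ) (v : ℤ) : State :=
  { σ with reg := Function.update σ.reg x v }

/-- The state after writing `v` into cell `i` of array `a`. -/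
def State.setArr (σ : State) (a i : ℕ) (v : ℤ) : State :=
  { σ with arr := Function.update σ.arr a (Function.update (σ.arr a) i v) }

/-- The state after removing the first coin. -/
def State.dropCoin (σ : State) : State :=
  { σ with coins := fun i => σ.coins (i + 1) }

/-- The outcome of the first coin, as a number. -/
def State.coin (σ : State) : ℤ := if σ.coins 0 then 1 else 0

/-- `v` fits into a (signed) word with `b` bits besides the sign. -/
def Fits (b : ℕ) (v : ℤ) : Prop := |v| < 2 ^ b

/-- `Exec b p σ τ σ'`: on the word RAM with words of length `b`, the program `p` started in the
state `σ` halts in the state `σ'` after `τ` steps. Every operation, memory access, coin flip and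
branching test is one step. There is no successful run if a value that does not fit into a word
is produced, or if an array is accessed at a negative index. -/
inductive Exec (b : ℕ) : Prog → State → ℕ → State → Prop
  | const {σ : State} {x : ℕ} {c : ℤ} (hb : Fits b c) :
      Exec b (.const x c) σ 1 (σ.setReg x c)
  | op {σ : State} {o : Op} {x y z : ℕ} (hb : Fits b (o.eval (σ.reg y) (σ.reg z))) :
      Exec b (.op o x y z) σ 1 (σ.setReg x (o.eval (σ.reg y) (σ.reg z)))
  | load {σ : State} {x a y i : ℕ} (hi : σ.reg y = (i : ℤ)) (hb : Fits b (σ.arr a i)) :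
      Exec b (.load x a y) σ 1 (σ.setReg x (σ.arr a i))
  | store {σ : State} {a y z i : ℕ} (hi : σ.reg y = (i : ℤ)) :
      Exec b (.store a y z) σ 1 (σ.setArr a i (σ.reg z))
  | flip {σ : State} {x : ℕ} (hb : Fits b σ.coin) :
      Exec b (.flip x) σ 1 (σ.dropCoin.setReg x σ.coin)
  | seq {σ σ' σ'' : State} {p q : Prog} {τ τ' : ℕ}
      (hp : Exec b p σ τ σ') (hq : Exec b q σ' τ' σ'') :
      Exec b (.seq p q) σ (τ + τ') σ''
  | iteTrue {σ σ' : State} {x : ℕ} {p q : Prog} {τ : ℕ}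
      (hx : σ.reg x ≠ 0) (hp : Exec b p σ τ σ') :
      Exec b (.ite x p q) σ (τ + 1) σ'
  | iteFalse {σ σ' : State} {x : ℕ} {p q : Prog} {τ : ℕ}
      (hx : σ.reg x = 0) (hq : Exec b q σ τ σ') :
      Exec b (.ite x p q) σ (τ + 1) σ'
  | loopTrue {σ σ' σ'' : State} {x : ℕ} {p : Prog} {τ τ' : ℕ}
      (hx : σ.reg x ≠ 0) (hp : Exec b p σ τ σ') (hl : Exec b (.loop x p) σ' τ' σ'') :
      Exec b (.loop x p) σ (τ + τ' + 1) σ''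
  | loopFalse {σ : State} {x : ℕ} {p : Prog} (hx : σ.reg x = 0) :
      Exec b (.loop x p) σ 1 σ

/-- A halting state accepts if register `0` is not zero. -/
def State.Accepts (σ : State) : Prop := σ.reg 0 ≠ 0

/-- The law of an infinite sequence of independent fair coins. -/
noncomputable def fairCoins : Measure (ℕ → Bool) :=
  Measure.infinitePi fun _ => (PMF.uniformOfFintype Bool).toMeasure

end WordRAM

open WordRAM

/-! ## Exact Node Weighted `P₄` -/

/-- The graph `G` with vertex weights `wt` has a simple path on four vertices of total weight `0`. -/
def HasZeroWeightP4 {V : Type*} (G : SimpleGraph V) (wt : V → ℤ) : Prop :=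
  ∃ (u v : V) (p : G.Walk u v), p.IsPath ∧ p.length = 3 ∧ (p.support.map wt).sum = 0

open Classical in
/-- The input of Exact Node Weighted `P₄`: register `0` holds the number `N` of vertices, array `0`
the weights, array `1` the adjacency matrix, row by row. All else is `0`. -/
noncomputable def p4Input {N : ℕ} (G : SimpleGraph (Fin N)) (wt : Fin N → ℤ) (ω : ℕ → Bool) :
    State where
  reg := Function.update 0 0 (N : ℤ)
  arr a i :=
    if a = 0 then
      if h : i < N then wt ⟨i, h⟩ else 0
    else if a = 1 then
      if ∃ u v : Fin N, G.Adj u v ∧ i = u * N + v then 1 else 0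
    else 0
  coins := ω

/-- Exact Node Weighted `P₄` can be solved (deterministically) in `O(|V| ^ e)` time: some program
decides every instance whose number of vertices and whose weights have at most `L` bits in at most
`C * |V| ^ e` steps on words of `O(L)` bits, whatever the coins show. -/
def ExactNodeWeightedP4SolvableInTime (e : ℝ) : Prop :=
  ∃ (P : Prog) (C : ℝ) (k : ℕ),
    ∀ (N : ℕ) (G : SimpleGraph (Fin N)) (wt : Fin N → ℤ) (L : ℕ),
      0 < N → N < 2 ^ L → (∀ v, |wt v| < 2 ^ L) →
      ∀ ω : ℕ → Bool, ∃ (τ : ℕ) (σ : State),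
        Exec (k * (L + 1)) P (p4Input G wt ω) τ σ ∧
        (τ : ℝ) ≤ C * (N : ℝ) ^ e ∧
        (σ.Accepts ↔ HasZeroWeightP4 G wt)

/-! ## Subset Sum -/

/-- Some subset of the integers `w 0, …, w (n - 1)` sums to `t`. -/
def HasSubsetSum {n : ℕ} (w : Fin n → ℤ) (t : ℤ) : Prop :=
  ∃ S : Finset (Fin n), ∑ i ∈ S, w i = t

/-- The number of bits of an instance of Subset Sum (one sign bit for each number). -/
def subsetSumSize {n : ℕ} (w : Fin n → ℤ) (t : ℤ) : ℕ :=
  ∑ i, ((w i).natAbs.size + 1) + (t.natAbs.size + 1)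

/-- The input of Subset Sum: register `0` holds `n`, register `1` the target, array `0` the
integers. All else is `0`. -/
def subsetSumInput {n : ℕ} (w : Fin n → ℤ) (t : ℤ) (ω : ℕ → Bool) : State where
  reg := Function.update (Function.update 0 0 (n : ℤ)) 1 t
  arr a i :=
    if a = 0 then
      if h : i < n then w ⟨i, h⟩ else 0
    else 0
  coins := ω

/-- Subset Sum can be solved in randomized `O*(2 ^ (α n))` time: on words whose length is linear in
the input size `s`, some program halts on every instance within `C * s ^ c * 2 ^ (α * n)` steps,
whatever the coins show, and its answer is correct with probability at least `2 / 3`. -/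
def SubsetSumSolvableInRandomizedTime (α : ℝ) : Prop :=
  ∃ (Q : Prog) (C : ℝ) (c k : ℕ),
    ∀ (n : ℕ) (w : Fin n → ℤ) (t : ℤ),
      (∀ ω : ℕ → Bool, ∃ (τ : ℕ) (σ : State),
        Exec (k * subsetSumSize w t) Q (subsetSumInput w t ω) τ σ ∧
        (τ : ℝ) ≤ C * (subsetSumSize w t : ℝ) ^ c * (2 : ℝ) ^ (α * (n : ℝ))) ∧
      2 / 3 ≤ fairCoins.real {ω : ℕ → Bool | ∃ (τ : ℕ) (σ : State),
        Exec (k * subsetSumSize w t) Q (subsetSumInput w t ω) τ σ ∧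
        (σ.Accepts ↔ HasSubsetSum w t)}

namespace WordRAM

/-! ## A structured language compiled to the word RAM -/

/-! The numbers, padded by zeros, are cut into `74 * q` blocks of `B` numbers each, where `q` is one
million. Meeting in the middle with `37 * q` blocks on either side takes about `2 ^ (37 * q * B)`
steps, that is `2 ^ (n / 2)` up to a constant factor. It suffices to save a factor `2 ^ B`, since
`B` is a constant fraction of `n`. As the number of blocks is constant, every way of assigning roles
to blocks can be tried, and all these trials are written into the program.

Let `S` be a solution.

(1) If `S` has at least `10074 * B` fewer items than half, it can be cut into two sparse halves
along blocks, and Hoeffding's bound leaves at most `2 ^ ((37 * q - 1) * B)` sets on each side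
(`found_of_card_le`). If it has that many more, the complement of `S` is sought instead.

(2) If some `16 * q` blocks have at most `2 ^ ((16 * q - 2) * B)` different subset sums, an uneven
cut, `37 * q + 1` blocks against `37 * q - 1`, gives two short lists (`found_of_card_sums_le`).

(3) Otherwise the blocks are sorted into parts P0, P1, P2 of `16 * q` blocks and P3, P4 of `13 * q`
blocks such that `S` takes about half of each of P0, P1, P2 (`exists_balanced`). For r = 0, 1, 2 the
set `S` ∩ Pr is split into Tr and a remainder Ur, both about a quarter of Pr. Then (S ∩ P3) ∪ T0, U0
∪ T1, U1 ∪ T2, U2 ∪ (S ∩ P4) is a path in the graph whose vertices are the possible sets of the four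
layers and whose edges join disjoint sets of neighbouring layers. Layers that are not neighbours
have no part in common, so disjointness along the edges is all that a solution needs, and the vertex
weights express that the four sums add up to `t` (`solvable_of_hasZeroWeightP4`).

A quarter-size subset of `16 * q` blocks can be chosen in about `2 ^ (13 * q * B)` ways, so each
layer has about `2 ^ (26 * q * B)` sets (`card_candidates`), which is too many. But `S` can be split
in about `2 ^ (8 * q * B)` ways in each of the three parts, and as case (2) fails these splits have
nearly as many different sums (`card_partials`). Therefore a random hash function may discard all
but a fraction of about `2 ^ (-8 * q * B)` of the vertices and still keep some path of `S`
(`hasPath_of_splits`). About `2 ^ (18 * q * B)` vertices remain, and `2.05 * 18 < 37`, with room for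
the error terms because `q` is large.

The hash function is `u ↦ a * u + c` modulo `2 ^ m`, and a value is kept if it falls below `2 ^ d`.
Two sums at distance less than `2 ^ d` are kept independently of each other (`sum_card_pair`), so
Chebyshev's inequality bounds the probability of losing all splits (`card_miss`), and Markov's
inequality bounds the number of vertices (`card_crowded`). The program never accepts without a
solution, so the coins matter only in case (3).

On the word RAM, lists of subset sums are produced without repetitions in time proportional to a cap
on their length, with directly addressed arrays as tables (`runs_enum`), and the given program for
paths is embedded as a subroutine by renaming its registers and arrays (`Exec.rename`). -/

theorem Exec.mono {b b' : ℕ} (hb : b ≤ b') {p : Prog} {σ σ' : State} {τ : ℕ}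
    (h : Exec b p σ τ σ') : Exec b' p σ τ σ' := by
  have hF : ∀ v, Fits b v → Fits b' v := fun v hv =>
    lt_of_lt_of_le hv (pow_le_pow_right₀ (by norm_num) hb)
  induction h with
  | const h => exact .const (hF _ h)
  | op h => exact .op (hF _ h)
  | load hi h => exact .load hi (hF _ h)
  | store hi => exact .store hi
  | flip h => exact .flip (hF _ h)
  | seq _ _ h1 h2 => exact .seq h1 h2
  | iteTrue hx _ h => exact .iteTrue hx h
  | iteFalse hx _ h => exact .iteFalse hx h
  | loopTrue hx _ _ h1 h2 => exact .loopTrue hx h1 h2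
  | loopFalse hx => exact .loopFalse hx

/-- The low-level register that holds the variable `x`. -/
def fmap (x : ℕ) : ℕ := if x < 2 then x else 2 * x

/-- Low-level scratch registers. -/
def tmp (d : ℕ) : ℕ := 2 * d + 3

theorem fmap_injective : Function.Injective fmap := by
  intro x y h
  unfold fmap at h
  split_ifs at h <;> omega

/-- Variables `0` and `1` keep their registers because the input and the answer are passed there.
All other variables sit in even registers from `4` on, and the odd registers from `3` on are scratch
space. -/
theorem tmp_ne_fmap (d x : ℕ) : tmp d ≠ fmap x := by
  unfold tmp fmap
  split_ifs <;> omega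

theorem tmp_ne_tmp {d e : ℕ} (h : d ≠ e) : tmp d ≠ tmp e := by
  unfold tmp
  omega

/-- The low-level state `ρ` represents the state of variables `σ`. -/
structure Sim (ρ σ : State) : Prop where
  reg : ∀ x, ρ.reg (fmap x) = σ.reg x
  arr : ρ.arr = σ.arr
  coins : ρ.coins = σ.coins

theorem Sim.setTmp {ρ σ : State} (h : Sim ρ σ) (d : ℕ) (v : ℤ) : Sim (ρ.setReg (tmp d) v) σ where
  reg x := by
    simp only [State.setReg]
    rw [Function.update_of_ne (tmp_ne_fmap d x).symm, h.reg]
  arr := h.arr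
  coins := h.coins

theorem Sim.setVar {ρ σ : State} (h : Sim ρ σ) (x : ℕ) (v : ℤ) :
    Sim (ρ.setReg (fmap x) v) (σ.setReg x v) where
  reg y := by
    simp only [State.setReg]
    by_cases hy : y = x
    · subst hy; simp
    · rw [Function.update_of_ne hy, Function.update_of_ne (fmap_injective.ne hy), h.reg]
  arr := h.arr
  coins := h.coins

/-- Arithmetic expressions. -/
inductive Expr
  | var (x : ℕ)
  | num (c : ℤ)
  | bin (o : Op) (e₁ e₂ : Expr)
  | ld (a : ℕ) (e : Expr)

namespace Expr

instance : Add Expr := ⟨bin .add⟩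
instance : Sub Expr := ⟨bin .sub⟩
instance : Mul Expr := ⟨bin .mul⟩
instance : Div Expr := ⟨bin .div⟩
instance : Mod Expr := ⟨bin .mod⟩

/-- The value of an expression. -/
def eval (σ : State) : Expr → ℤ
  | var x => σ.reg x
  | num c => c
  | bin o e₁ e₂ => o.eval (e₁.eval σ) (e₂.eval σ)
  | ld a e => σ.arr a (e.eval σ).toNat

/-- No overflow occurs at the last operation. Comparisons never overflow. -/
def FitsAfter (b : ℕ) (o : Op) (v : ℤ) : Prop :=
  match o with
  | .lt => True
  | .eq => True
  | _ => Fits b v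

/-- The evaluation of the expression succeeds. -/
def Ok (b : ℕ) (σ : State) : Expr → Prop
  | var _ => True
  | num c => Fits b c
  | bin o e₁ e₂ => e₁.Ok b σ ∧ e₂.Ok b σ ∧ FitsAfter b o (o.eval (e₁.eval σ) (e₂.eval σ))
  | ld a e => e.Ok b σ ∧ 0 ≤ e.eval σ ∧ Fits b (σ.arr a (e.eval σ).toNat)

/-- The evaluation time. -/
def cost : Expr → ℕ
  | var _ => 1
  | num _ => 1
  | bin _ e₁ e₂ => e₁.cost + e₂.cost + 1
  | ld _ e => e.cost + 1

/-- The register that holds the value. -/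
def src (d : ℕ) : Expr → ℕ
  | var x => fmap x
  | _ => tmp d

/-- The code of an expression, using scratch registers from `d` on. -/
def code : ℕ → Expr → Prog
  -- There is no empty program, so a variable costs one dummy instruction. Its value is later read
  -- from its own register through `src`.
  | d, var _ => .const (tmp d) 0
  | d, num c => .const (tmp d) c
  | d, bin o e₁ e₂ =>
      .seq (.seq (code d e₁) (code (d + 1) e₂)) (.op o (tmp d) (src d e₁) (src (d + 1) e₂))
  | d, ld a e => .seq (code d e) (.load (tmp d) a (src d e))

variable (σ : State) (b : ℕ) (e f : Expr)

@[simp] theorem eval_var (x : ℕ) : (var x).eval σ = σ.reg x := rfl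
@[simp] theorem eval_num (c : ℤ) : (num c).eval σ = c := rfl
@[simp] theorem eval_ld (a : ℕ) : (ld a e).eval σ = σ.arr a (e.eval σ).toNat := rfl
@[simp] theorem eval_add : (e + f).eval σ = e.eval σ + f.eval σ := rfl
@[simp] theorem eval_sub : (e - f).eval σ = e.eval σ - f.eval σ := rfl
@[simp] theorem eval_mul : (e * f).eval σ = e.eval σ * f.eval σ := rfl
@[simp] theorem eval_div : (e / f).eval σ = e.eval σ / f.eval σ := rfl
@[simp] theorem eval_mod : (e % f).eval σ = e.eval σ % f.eval σ := rfl
@[simp] theorem eval_land : (bin .land e f).eval σ = Int.land (e.eval σ) (f.eval σ) := rfl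
@[simp] theorem eval_shl : (bin .shl e f).eval σ = e.eval σ * 2 ^ (f.eval σ).toNat := rfl
@[simp] theorem eval_lt : (bin .lt e f).eval σ = if e.eval σ < f.eval σ then 1 else 0 := rfl
@[simp] theorem eval_eq : (bin .eq e f).eval σ = if e.eval σ = f.eval σ then 1 else 0 := rfl

@[simp] theorem ok_var (x : ℕ) : (var x).Ok b σ ↔ True := Iff.rfl
@[simp] theorem ok_num (c : ℤ) : (num c).Ok b σ ↔ Fits b c := Iff.rfl
@[simp] theorem ok_ld (a : ℕ) : (ld a e).Ok b σ ↔
    e.Ok b σ ∧ 0 ≤ e.eval σ ∧ Fits b (σ.arr a (e.eval σ).toNat) := Iff.rfl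
@[simp] theorem ok_add : (e + f).Ok b σ ↔
    e.Ok b σ ∧ f.Ok b σ ∧ Fits b (e.eval σ + f.eval σ) := Iff.rfl
@[simp] theorem ok_sub : (e - f).Ok b σ ↔
    e.Ok b σ ∧ f.Ok b σ ∧ Fits b (e.eval σ - f.eval σ) := Iff.rfl
@[simp] theorem ok_mul : (e * f).Ok b σ ↔
    e.Ok b σ ∧ f.Ok b σ ∧ Fits b (e.eval σ * f.eval σ) := Iff.rfl
@[simp] theorem ok_div : (e / f).Ok b σ ↔
    e.Ok b σ ∧ f.Ok b σ ∧ Fits b (e.eval σ / f.eval σ) := Iff.rfl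
@[simp] theorem ok_mod : (e % f).Ok b σ ↔
    e.Ok b σ ∧ f.Ok b σ ∧ Fits b (e.eval σ % f.eval σ) := Iff.rfl
@[simp] theorem ok_land : (bin .land e f).Ok b σ ↔
    e.Ok b σ ∧ f.Ok b σ ∧ Fits b (Int.land (e.eval σ) (f.eval σ)) := Iff.rfl
@[simp] theorem ok_shl : (bin .shl e f).Ok b σ ↔
    e.Ok b σ ∧ f.Ok b σ ∧ Fits b (e.eval σ * 2 ^ (f.eval σ).toNat) := Iff.rfl
@[simp] theorem ok_lt : (bin .lt e f).Ok b σ ↔ e.Ok b σ ∧ f.Ok b σ := by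
  simp [Ok, FitsAfter]
@[simp] theorem ok_eq : (bin .eq e f).Ok b σ ↔ e.Ok b σ ∧ f.Ok b σ := by
  simp [Ok, FitsAfter]

end Expr

theorem fits_zero (b : ℕ) : Fits b 0 := by
  simp [Fits]

theorem fits_one {b : ℕ} (hb : 1 ≤ b) : Fits b 1 := by
  have : (2 : ℤ) ^ 1 ≤ 2 ^ b := pow_le_pow_right₀ (by norm_num) hb
  simp only [Fits, abs_one]
  linarith

theorem fits_bool {b : ℕ} (hb : 1 ≤ b) (p : Prop) [Decidable p] :
    Fits b (if p then 1 else 0) := by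
  split_ifs
  · exact fits_one hb
  · exact fits_zero b

theorem Expr.fits_of_fitsAfter {b : ℕ} (hb : 1 ≤ b) {o : Op} {x y : ℤ}
    (h : Expr.FitsAfter b o (o.eval x y)) : Fits b (o.eval x y) := by
  cases o
  case lt => exact fits_bool hb _
  case eq => exact fits_bool hb _
  all_goals exact h

/-- The last clause carries the induction: the right operand only uses scratch registers from `d +
1` on, so the left operand survives in `tmp d`. -/
theorem Expr.exec_code {b : ℕ} (hb : 1 ≤ b) {σ : State} (e : Expr) :
    ∀ (d : ℕ) (ρ : State), Sim ρ σ → e.Ok b σ →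
      ∃ ρ', Exec b (e.code d) ρ e.cost ρ' ∧ Sim ρ' σ ∧ ρ'.reg (e.src d) = e.eval σ ∧
        ∀ d' < d, ρ'.reg (tmp d') = ρ.reg (tmp d') := by
  induction e with
  | var x =>
    intro d ρ h _
    refine ⟨_, .const (fits_zero b), h.setTmp d 0, ?_, ?_⟩
    · exact (h.setTmp d 0).reg x
    · intro d' hd
      exact Function.update_of_ne (tmp_ne_tmp hd.ne) _ _
  | num c =>
    intro d ρ h hok
    refine ⟨_, .const hok, h.setTmp d c, ?_, ?_⟩
    · simp [Expr.src, Expr.eval, State.setReg]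
    · intro d' hd
      exact Function.update_of_ne (tmp_ne_tmp hd.ne) _ _
  | bin o e₁ e₂ h1 h2 =>
    intro d ρ h ⟨ok1, ok2, ok3⟩
    obtain ⟨ρ₁, x1, s1, v1, k1⟩ := h1 d ρ h ok1
    obtain ⟨ρ₂, x2, s2, v2, k2⟩ := h2 (d + 1) ρ₁ s1 ok2
    have v1' : ρ₂.reg (e₁.src d) = e₁.eval σ := by
      rw [← v1]
      cases e₁ with
      | var x => simp only [Expr.src]; rw [s2.reg, s1.reg]
      | _ => exact k2 d (Nat.lt_succ_self d)
    have hf := Expr.fits_of_fitsAfter hb ok3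
    rw [← v1', ← v2] at hf
    refine ⟨_, .seq (.seq x1 x2) (.op hf), s2.setTmp d _, ?_, ?_⟩
    · show (ρ₂.setReg (tmp d) _).reg (tmp d) = o.eval (e₁.eval σ) (e₂.eval σ)
      rw [← v1', ← v2]
      exact Function.update_self ..
    · intro d' hd
      rw [show (ρ₂.setReg (tmp d) _).reg (tmp d') = ρ₂.reg (tmp d') from
        Function.update_of_ne (tmp_ne_tmp hd.ne) _ _, k2 d' (by omega), k1 d' hd]
  | ld a e h1 =>
    intro d ρ h ⟨ok1, ok2, ok3⟩
    obtain ⟨ρ₁, x1, s1, v1, k1⟩ := h1 d ρ h ok1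
    have hi : ρ₁.reg (e.src d) = ((e.eval σ).toNat : ℤ) := by
      rw [v1, Int.toNat_of_nonneg ok2]
    have ha : ρ₁.arr a (e.eval σ).toNat = σ.arr a (e.eval σ).toNat := by rw [s1.arr]
    refine ⟨_, .seq x1 (.load hi (by rw [ha]; exact ok3)), s1.setTmp d _, ?_, ?_⟩
    · simp [Expr.src, Expr.eval, State.setReg, ha]
    · intro d' hd
      rw [show (ρ₁.setReg (tmp d) _).reg (tmp d') = ρ₁.reg (tmp d') from
        Function.update_of_ne (tmp_ne_tmp hd.ne) _ _, k1 d' hd]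

/-- `p`, started in the state of variables `σ`, halts within `T` steps in a state with `Q`. -/
def Runs (b : ℕ) (p : Prog) (σ : State) (T : ℕ) (Q : State → Prop) : Prop :=
  ∀ ρ, Sim ρ σ → ∃ τ ρ' σ', τ ≤ T ∧ Exec b p ρ τ ρ' ∧ Sim ρ' σ' ∧ Q σ'

theorem Runs.mono {b : ℕ} {p : Prog} {σ : State} {T T' : ℕ} {Q Q' : State → Prop}
    (h : Runs b p σ T Q) (hT : T ≤ T') (hQ : ∀ σ', Q σ' → Q' σ') : Runs b p σ T' Q' := by
  intro ρ hρ
  obtain ⟨τ, ρ', σ', h1, h2, h3, h4⟩ := h ρ hρ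
  exact ⟨τ, ρ', σ', h1.trans hT, h2, h3, hQ _ h4⟩

theorem Runs.seq {b : ℕ} {p q : Prog} {σ : State} {T T' : ℕ} {R Q : State → Prop}
    (hp : Runs b p σ T R) (hq : ∀ σ', R σ' → Runs b q σ' T' Q) :
    Runs b (.seq p q) σ (T + T') Q := by
  intro ρ hρ
  obtain ⟨τ, ρ', σ', h1, h2, h3, h4⟩ := hp ρ hρ
  obtain ⟨τ', ρ'', σ'', k1, k2, k3, k4⟩ := hq σ' h4 ρ' h3
  exact ⟨_, ρ'', σ'', add_le_add h1 k1, .seq h2 k2, k3, k4⟩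

/-- Loop-free programs. -/
inductive Stm
  /-- `x := e` -/
  | set (x : ℕ) (e : Expr)
  /-- `a[e] := f` -/
  | put (a : ℕ) (e f : Expr)
  /-- `p` if `e ≠ 0` -/
  | cond (e : Expr) (p : Stm)
  /-- `p` and then `q` -/
  | seq (p q : Stm)

infixr:60 " ;; " => Stm.seq

namespace Stm

/-- The state after a loop-free program. -/
def run : Stm → State → State
  | set x e, σ => σ.setReg x (e.eval σ)
  | put a e f, σ => σ.setArr a (e.eval σ).toNat (f.eval σ)
  | cond e p, σ => if e.eval σ ≠ 0 then p.run σ else σ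
  | seq p q, σ => q.run (p.run σ)

/-- A value moved between registers has to fit. -/
def fitsIfVar (b : ℕ) (σ : State) : Expr → Prop
  | .var x => Fits b (σ.reg x)
  | _ => True

/-- The loop-free program does not fail. -/
def Ok (b : ℕ) : Stm → State → Prop
  | set _ e, σ => e.Ok b σ ∧ fitsIfVar b σ e
  | put _ e f, σ => e.Ok b σ ∧ f.Ok b σ ∧ 0 ≤ e.eval σ
  | cond e p, σ => e.Ok b σ ∧ (e.eval σ ≠ 0 → p.Ok b σ)
  | seq p q, σ => p.Ok b σ ∧ q.Ok b (p.run σ)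

/-- A bound on the running time. -/
def cost : Stm → ℕ
  | set _ e => e.cost + 2
  | put _ e f => e.cost + f.cost + 1
  | cond e p => e.cost + p.cost + 2
  | seq p q => p.cost + q.cost

/-- The code of a loop-free program. -/
def code : Stm → Prog
  -- There is no move instruction, so the value is added to a zero. For this reason a copied
  -- variable has to fit into a word.
  | set x e => .seq (e.code 0) (.seq (.const (tmp 1) 0) (.op .add (fmap x) (e.src 0) (tmp 1)))
  | put a e f => .seq (.seq (e.code 0) (f.code 1)) (.store a (e.src 0) (f.src 1))
  | cond e p => .seq (e.code 0) (.ite (e.src 0) p.code (.const (tmp 0) 0))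
  | seq p q => .seq p.code q.code

end Stm

theorem Expr.fits_eval {b : ℕ} (hb : 1 ≤ b) {σ : State} (e : Expr) (h : e.Ok b σ)
    (h' : Stm.fitsIfVar b σ e) : Fits b (e.eval σ) := by
  cases e with
  | var x => exact h'
  | num c => exact h
  | bin o e₁ e₂ => exact Expr.fits_of_fitsAfter hb h.2.2
  | ld a e => exact h.2.2

theorem Stm.runs {b : ℕ} (hb : 1 ≤ b) (p : Stm) :
    ∀ {σ : State} {Q : State → Prop}, p.Ok b σ → Q (p.run σ) → Runs b p.code σ p.cost Q := by
  induction p with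
  | set x e =>
    intro σ Q ⟨h1, h2⟩ hQ ρ hρ
    obtain ⟨ρ₁, x1, s1, v1, k1⟩ := e.exec_code hb 0 ρ hρ h1
    have s2 := s1.setTmp 1 0
    have v2 : (ρ₁.setReg (tmp 1) 0).reg (e.src 0) = e.eval σ := by
      rw [← v1]
      cases e with
      | var x => simp only [Expr.src]; rw [s2.reg, s1.reg]
      | _ => exact Function.update_of_ne (tmp_ne_tmp zero_ne_one) (0 : ℤ) ρ₁.reg
    have v3 : (ρ₁.setReg (tmp 1) 0).reg (tmp 1) = 0 := by simp [State.setReg]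
    have hv : Op.add.eval ((ρ₁.setReg (tmp 1) 0).reg (e.src 0)) ((ρ₁.setReg (tmp 1) 0).reg (tmp 1))
        = e.eval σ := by
      rw [v2, v3]; simp [Op.eval]
    refine ⟨_, _, _, le_of_eq ?_, .seq x1 (.seq (.const (fits_zero b)) (.op ?_)), ?_, hQ⟩
    · rfl
    · rw [hv]; exact e.fits_eval hb h1 h2
    · rw [hv]; exact s2.setVar x _
  | put a e f =>
    intro σ Q ⟨h1, h2, h3⟩ hQ ρ hρ
    obtain ⟨ρ₁, x1, s1, v1, k1⟩ := e.exec_code hb 0 ρ hρ h1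
    obtain ⟨ρ₂, x2, s2, v2, k2⟩ := f.exec_code hb 1 ρ₁ s1 h2
    have v1' : ρ₂.reg (e.src 0) = e.eval σ := by
      rw [← v1]
      cases e with
      | var x => simp only [Expr.src]; rw [s2.reg, s1.reg]
      | _ => exact k2 0 one_pos
    refine ⟨_, _, _, le_of_eq ?_, .seq (.seq x1 x2)
      (.store (i := (e.eval σ).toNat) (by rw [v1', Int.toNat_of_nonneg h3])), ?_, hQ⟩
    · rfl
    · exact ⟨fun x => s2.reg x, by simp [State.setArr, s2.arr, v2, Stm.run], s2.coins⟩
  | cond e p ih =>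
    intro σ Q ⟨h1, h2⟩ hQ ρ hρ
    obtain ⟨ρ₁, x1, s1, v1, k1⟩ := e.exec_code hb 0 ρ hρ h1
    by_cases h : e.eval σ = 0
    · refine ⟨_, _, _, ?_, .seq x1 (.iteFalse (by rw [v1, h]) (.const (fits_zero b))),
        s1.setTmp 0 0, ?_⟩
      · simp only [Stm.cost]; omega
      · simpa [Stm.run, h] using hQ
    · obtain ⟨τ, ρ', σ', t1, t2, t3, t4⟩ := ih (h2 h) (Q := Q) (by simpa [Stm.run, h] using hQ) ρ₁ s1
      refine ⟨_, _, _, ?_, .seq x1 (.iteTrue (by rw [v1]; exact h) t2), t3, t4⟩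
      simp only [Stm.cost]; omega
  | seq p q ih1 ih2 =>
    intro σ Q ⟨h1, h2⟩ hQ
    exact (ih1 h1 (Q := fun σ' => σ' = p.run σ) rfl).seq fun σ' h => by
      subst h; exact ih2 h2 hQ

/-- `p` as long as `x < y`. -/
def whileLt (x y : ℕ) (p : Prog) : Prog :=
  .seq (.op .lt (tmp 0) (fmap x) (fmap y)) (.loop (tmp 0) (.seq p (.op .lt (tmp 0) (fmap x) (fmap y))))

/-- The invariant is indexed by the number of completed rounds, and exactly `k` rounds are run. Each
costs its body, one evaluation of the guard and one loop test. The final `2` pays for the first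
evaluation and for the failing test. -/
theorem Runs.whileLt {b : ℕ} (hb : 1 ≤ b) {x y : ℕ} {p : Prog} (I : ℕ → State → Prop) (k T : ℕ)
    (hI : ∀ i < k, ∀ σ, I i σ → σ.reg x < σ.reg y ∧ Runs b p σ T (I (i + 1)))
    (hk : ∀ σ, I k σ → ¬ σ.reg x < σ.reg y) {σ : State} (h0 : I 0 σ) :
    Runs b (whileLt x y p) σ (k * (T + 2) + 2) (I k) := by
  have guard : ∀ {ρ σ : State}, Sim ρ σ → ∃ ρ', Exec b (.op .lt (tmp 0) (fmap x) (fmap y)) ρ 1 ρ' ∧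
      Sim ρ' σ ∧ (ρ'.reg (tmp 0) ≠ 0 ↔ σ.reg x < σ.reg y) := by
    intro ρ σ h
    refine ⟨_, .op (fits_bool hb _), h.setTmp 0 _, ?_⟩
    simp only [State.setReg, Function.update_self, Op.eval, h.reg]
    split_ifs <;> simp [*]
  have key : ∀ m i, i + m = k → ∀ σ, I i σ → ∀ ρ, Sim ρ σ →
      (ρ.reg (tmp 0) ≠ 0 ↔ σ.reg x < σ.reg y) →
      ∃ τ ρ' σ', τ ≤ m * (T + 2) + 1 ∧
        Exec b (.loop (tmp 0) (.seq p (.op .lt (tmp 0) (fmap x) (fmap y)))) ρ τ ρ' ∧ Sim ρ' σ' ∧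
        I k σ' := by
    intro m
    induction m with
    | zero =>
      intro i hi σ hσ ρ hρ hg
      obtain rfl : i = k := by omega
      refine ⟨1, ρ, σ, by omega, .loopFalse ?_, hρ, hσ⟩
      by_contra h
      exact hk σ hσ (hg.1 h)
    | succ m ih =>
      intro i hi σ hσ ρ hρ hg
      obtain ⟨hlt, hrun⟩ := hI i (by omega) σ hσ
      obtain ⟨τ₁, ρ₁, σ₁, t1, e1, s1, q1⟩ := hrun ρ hρ
      obtain ⟨ρ₂, e2, s2, g2⟩ := guard s1
      obtain ⟨τ₃, ρ₃, σ₃, t3, e3, s3, q3⟩ := ih (i + 1) (by omega) σ₁ q1 ρ₂ s2 g2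
      refine ⟨_, ρ₃, σ₃, ?_, .loopTrue (hg.2 hlt) (.seq e1 e2) e3, s3, q3⟩
      have : (m + 1) * (T + 2) = m * (T + 2) + T + 2 := by ring
      omega
  intro ρ hρ
  obtain ⟨ρ₁, e1, s1, g1⟩ := guard hρ
  obtain ⟨τ, ρ', σ', t, e, s, q⟩ := key k 0 (by omega) σ h0 ρ₁ s1 g1
  exact ⟨_, ρ', σ', by omega, .seq e1 e, s, q⟩

/-- `p` if `x < y`, and `q` otherwise. -/
def ifLt (x y : ℕ) (p q : Prog) : Prog :=
  .seq (.op .lt (tmp 0) (fmap x) (fmap y)) (.ite (tmp 0) p q)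

theorem Runs.ifLt {b : ℕ} (hb : 1 ≤ b) {x y : ℕ} {p q : Prog} {σ : State} {T : ℕ}
    {Q : State → Prop} (hp : σ.reg x < σ.reg y → Runs b p σ T Q)
    (hq : ¬ σ.reg x < σ.reg y → Runs b q σ T Q) : Runs b (ifLt x y p q) σ (T + 2) Q := by
  intro ρ h
  have e0 : Exec b (.op .lt (tmp 0) (fmap x) (fmap y)) ρ 1 _ := .op (fits_bool hb _)
  have s0 := h.setTmp 0 (Op.lt.eval (ρ.reg (fmap x)) (ρ.reg (fmap y)))
  by_cases hlt : σ.reg x < σ.reg y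
  · obtain ⟨τ, ρ', σ', t, e, s, hQ⟩ := hp hlt _ s0
    refine ⟨_, ρ', σ', ?_, .seq e0 (.iteTrue ?_ e), s, hQ⟩
    · omega
    · simp [State.setReg, Op.eval, h.reg, hlt]
  · obtain ⟨τ, ρ', σ', t, e, s, hQ⟩ := hq hlt _ s0
    refine ⟨_, ρ', σ', ?_, .seq e0 (.iteFalse ?_ e), s, hQ⟩
    · omega
    · simp only [State.setReg, Op.eval, h.reg, hlt]; simp

theorem Runs.flip {b : ℕ} (hb : 1 ≤ b) {x : ℕ} {σ : State} {Q : State → Prop}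
    (hQ : Q (σ.dropCoin.setReg x σ.coin)) : Runs b (.flip (fmap x)) σ 1 Q := by
  intro ρ h
  have hc : ρ.coin = σ.coin := by simp [State.coin, h.coins]
  refine ⟨1, _, _, le_rfl, .flip (fits_bool hb _), ?_, hQ⟩
  rw [hc]
  have h' : Sim ρ.dropCoin σ.dropCoin := ⟨h.reg, h.arr, by simp [State.dropCoin, h.coins]⟩
  exact h'.setVar x _

/-- The programs of a list one after the other. -/
def seqList : List Prog → Prog
  | [] => .const (tmp 0) 0
  | p :: l => .seq p (seqList l)

/-- This serves loops of constant length, which are unrolled in the program text, so that the body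
may depend on data that the machine never sees. The invariant records the list of finished bodies.
-/
theorem Runs.seqList {b : ℕ} {α : Type*} (f : α → Prog) (I : List α → State → Prop) (T : ℕ)
    (l : List α) (done : List α) {σ : State} (h0 : I done σ)
    (h : ∀ a ∈ l, ∀ done σ, I done σ → Runs b (f a) σ T (I (done ++ [a]))) :
    Runs b (WordRAM.seqList (l.map f)) σ (l.length * T + 1) (I (done ++ l)) := by
  induction l generalizing done σ with
  | nil =>
    intro ρ hρ
    exact ⟨1, _, σ, by simp, .const (fits_zero b), hρ.setTmp 0 0, by simpa using h0⟩
  | cons a l ih =>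
    refine Runs.mono ((h a (by simp) done σ h0).seq fun σ' h' =>
      ih (done ++ [a]) h' fun a' ha' => h a' (by simp [ha'])) ?_ ?_
    · simp only [List.length_cons]
      have : (l.length + 1) * T = l.length * T + T := by ring
      omega
    · intro σ'; simp

/-! ## Subroutines -/

/-- The program with its registers and arrays renamed. -/
def Prog.rename (f g : ℕ → ℕ) : Prog → Prog
  | const x c => const (f x) c
  | op o x y z => op o (f x) (f y) (f z)
  | load x a y => load (f x) (g a) (f y)
  | store a y z => store (g a) (f y) (f z)
  | flip x => flip (f x)
  | seq p q => seq (p.rename f g) (q.rename f g)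
  | ite x p q => ite (f x) (p.rename f g) (q.rename f g)
  | loop x p => loop (f x) (p.rename f g)

/-- The state `σ` is found in `ρ` at the places given by `f` and `g`. -/
structure Embeds (f g : ℕ → ℕ) (ρ σ : State) : Prop where
  reg : ∀ x, ρ.reg (f x) = σ.reg x
  arr : ∀ a, ρ.arr (g a) = σ.arr a
  coins : ρ.coins = σ.coins

/-- `ρ` and `ρ'` agree outside the places given by `f` and `g`. -/
structure AgreeOff (f g : ℕ → ℕ) (ρ ρ' : State) : Prop where
  reg : ∀ x ∉ Set.range f, ρ'.reg x = ρ.reg x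
  arr : ∀ a ∉ Set.range g, ρ'.arr a = ρ.arr a

theorem Embeds.setReg {f g : ℕ → ℕ} (hf : f.Injective) {ρ σ : State} (h : Embeds f g ρ σ)
    (x : ℕ) (v : ℤ) : Embeds f g (ρ.setReg (f x) v) (σ.setReg x v) where
  reg y := by
    simp only [State.setReg]
    by_cases hy : y = x
    · subst hy; simp
    · rw [Function.update_of_ne hy, Function.update_of_ne (hf.ne hy), h.reg]
  arr := h.arr
  coins := h.coins

theorem AgreeOff.setReg (f g : ℕ → ℕ) (ρ : State) (x : ℕ) (v : ℤ) :
    AgreeOff f g ρ (ρ.setReg (f x) v) where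
  reg _ hy := Function.update_of_ne (fun h => hy ⟨x, h.symm⟩) _ _
  arr _ _ := rfl

theorem AgreeOff.trans {f g : ℕ → ℕ} {ρ ρ' ρ'' : State} (h : AgreeOff f g ρ ρ')
    (h' : AgreeOff f g ρ' ρ'') : AgreeOff f g ρ ρ'' where
  reg x hx := (h'.reg x hx).trans (h.reg x hx)
  arr a ha := (h'.arr a ha).trans (h.arr a ha)

/-- Injective renamings preserve every single step. `AgreeOff` is carried along because the caller
has to know that its own memory is untouched. -/
theorem Exec.rename {f g : ℕ → ℕ} (hf : f.Injective) (hg : g.Injective) {b : ℕ} {p : Prog}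
    {σ σ' : State} {τ : ℕ} (h : Exec b p σ τ σ') :
    ∀ ρ, Embeds f g ρ σ → ∃ ρ', Exec b (p.rename f g) ρ τ ρ' ∧ Embeds f g ρ' σ' ∧
      AgreeOff f g ρ ρ' := by
  induction h with
  | const hb =>
    intro ρ h
    exact ⟨_, .const hb, h.setReg hf _ _, .setReg _ _ _ _ _⟩
  | @op σ _ _ y z hb =>
    intro ρ h
    rw [← h.reg y, ← h.reg z] at hb ⊢
    exact ⟨_, .op hb, h.setReg hf _ _, .setReg _ _ _ _ _⟩
  | @load σ _ a _ i hi hb =>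
    intro ρ h
    rw [← h.arr a] at hb ⊢
    exact ⟨_, .load (by rw [h.reg, hi]) hb, h.setReg hf _ _, .setReg _ _ _ _ _⟩
  | @store σ a y z i hi =>
    intro ρ h
    refine ⟨_, .store (by rw [h.reg, hi]), ⟨h.reg, fun a' => ?_, h.coins⟩, ⟨fun _ _ => rfl,
      fun a' ha' => Function.update_of_ne (fun h => ha' ⟨a, h.symm⟩) _ _⟩⟩
    simp only [State.setArr]
    by_cases ha : a' = a
    · subst ha; simp [h.arr, h.reg]
    · rw [Function.update_of_ne ha, Function.update_of_ne (hg.ne ha), h.arr]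
  | @flip σ x hb =>
    intro ρ h
    have hc : ρ.coin = σ.coin := by simp [State.coin, h.coins]
    rw [← hc] at hb ⊢
    have h' : Embeds f g ρ.dropCoin σ.dropCoin :=
      ⟨h.reg, h.arr, by simp [State.dropCoin, h.coins]⟩
    exact ⟨_, .flip hb, h'.setReg hf _ _, ⟨(AgreeOff.setReg f g ρ x _).reg, fun _ _ => rfl⟩⟩
  | seq _ _ h1 h2 =>
    intro ρ h
    obtain ⟨ρ₁, e1, m1, a1⟩ := h1 ρ h
    obtain ⟨ρ₂, e2, m2, a2⟩ := h2 ρ₁ m1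
    exact ⟨ρ₂, .seq e1 e2, m2, a1.trans a2⟩
  | iteTrue hx _ h1 =>
    intro ρ h
    obtain ⟨ρ₁, e1, m1, a1⟩ := h1 ρ h
    exact ⟨ρ₁, .iteTrue (by rw [h.reg]; exact hx) e1, m1, a1⟩
  | iteFalse hx _ h1 =>
    intro ρ h
    obtain ⟨ρ₁, e1, m1, a1⟩ := h1 ρ h
    exact ⟨ρ₁, .iteFalse (by rw [h.reg]; exact hx) e1, m1, a1⟩
  | loopTrue hx _ _ h1 h2 =>
    intro ρ h
    obtain ⟨ρ₁, e1, m1, a1⟩ := h1 ρ h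
    obtain ⟨ρ₂, e2, m2, a2⟩ := h2 ρ₁ m1
    exact ⟨ρ₂, .loopTrue (by rw [h.reg]; exact hx) e1 e2, m2, a1.trans a2⟩
  | loopFalse hx =>
    intro ρ h
    exact ⟨ρ, .loopFalse (by rw [h.reg]; exact hx), h, ⟨fun _ _ => rfl, fun _ _ => rfl⟩⟩

/-- The program as a subroutine on the variables from `100` on and on the even arrays from `10`
on. -/
def Prog.sub (P : Prog) : Prog := P.rename (fun x => fmap (x + 100)) (fun a => 2 * a + 10)

/-- The subroutine finds its own initial state `σ₀` at variables `100, 101, …` and at arrays `10,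
12, …`. The caller gets back the final registers of the subroutine and its own variables below
`100`, which is all that is needed after the call. -/
theorem Runs.sub {b : ℕ} {P : Prog} {σ σ₀ σ₁ : State} {τ : ℕ} {Q : State → Prop}
    (hreg : ∀ x, σ.reg (x + 100) = σ₀.reg x) (harr : ∀ a, σ.arr (2 * a + 10) = σ₀.arr a)
    (hcoins : σ.coins = σ₀.coins) (hP : Exec b P σ₀ τ σ₁)
    (hQ : ∀ σ' : State, (∀ x, σ'.reg (x + 100) = σ₁.reg x) → (∀ x < 100, σ'.reg x = σ.reg x) →
      Q σ') : Runs b P.sub σ τ Q := by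
  intro ρ h
  obtain ⟨ρ', e, m, a⟩ := hP.rename (f := fun x => fmap (x + 100)) (g := fun a => 2 * a + 10)
    (fun x y hxy => by have := fmap_injective hxy; omega) (fun x y hxy => by simpa using hxy) ρ
    ⟨fun x => by rw [h.reg, hreg], fun a => by rw [h.arr, harr], by rw [h.coins, hcoins]⟩
  refine ⟨τ, ρ', ⟨fun x => ρ'.reg (fmap x), ρ'.arr, ρ'.coins⟩, le_rfl, e,
    ⟨fun _ => rfl, rfl, rfl⟩, hQ _ m.reg fun x hx => ?_⟩
  show ρ'.reg (fmap x) = _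
  rw [a.reg, h.reg]
  rintro ⟨y, hy⟩
  have := fmap_injective hy
  omega


/-! ### Frame conditions: which registers and arrays a program leaves unchanged. -/

@[simp] theorem State.reg_setReg (σ : State) (x y : ℕ) (v : ℤ) :
    (σ.setReg x v).reg y = if y = x then v else σ.reg y := by
  simp [State.setReg, Function.update_apply]

@[simp] theorem State.arr_setReg (σ : State) (x : ℕ) (v : ℤ) : (σ.setReg x v).arr = σ.arr := rfl

@[simp] theorem State.coins_setReg (σ : State) (x : ℕ) (v : ℤ) :
    (σ.setReg x v).coins = σ.coins := rfl

@[simp] theorem State.reg_setArr (σ : State) (a i : ℕ) (v : ℤ) : (σ.setArr a i v).reg = σ.reg := rfl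

@[simp] theorem State.coins_setArr (σ : State) (a i : ℕ) (v : ℤ) :
    (σ.setArr a i v).coins = σ.coins := rfl

theorem State.arr_setArr (σ : State) (a a' i j : ℕ) (v : ℤ) :
    (σ.setArr a i v).arr a' j = if a' = a ∧ j = i then v else σ.arr a' j := by
  simp only [State.setArr]
  by_cases h : a' = a
  · subst h
    by_cases h' : j = i
    · subst h'; simp
    · simp [h']
  · simp [h]

theorem State.arr_setArr_of_ne (σ : State) {a a' : ℕ} (h : a' ≠ a) (i : ℕ) (v : ℤ) :
    (σ.setArr a i v).arr a' = σ.arr a' := by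
  funext j
  rw [State.arr_setArr, if_neg (fun h' => h h'.1)]

theorem fits_of_abs_le {b : ℕ} {X v : ℤ} (hX : X < 2 ^ b) (h : |v| ≤ X) : Fits b v :=
  lt_of_le_of_lt h hX

theorem fits_of_nonneg {b : ℕ} {X v : ℤ} (hX : X < 2 ^ b) (h0 : 0 ≤ v) (h : v ≤ X) : Fits b v :=
  fits_of_abs_le hX (by rwa [abs_of_nonneg h0])

/-- The states agree outside the registers `R` and the arrays `A`. -/
structure Same (R A : Set ℕ) (σ σ' : State) : Prop where
  reg : ∀ r ∉ R, σ'.reg r = σ.reg r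
  arr : ∀ a ∉ A, σ'.arr a = σ.arr a

theorem Same.refl (R A : Set ℕ) (σ : State) : Same R A σ σ := ⟨fun _ _ => rfl, fun _ _ => rfl⟩

theorem Same.trans {R A : Set ℕ} {σ σ' σ'' : State} (h : Same R A σ σ') (h' : Same R A σ' σ'') :
    Same R A σ σ'' :=
  ⟨fun r hr => (h'.reg r hr).trans (h.reg r hr), fun a ha => (h'.arr a ha).trans (h.arr a ha)⟩

theorem Same.mono {R A R' A' : Set ℕ} {σ σ' : State} (h : Same R A σ σ') (hR : R ⊆ R')
    (hA : A ⊆ A') : Same R' A' σ σ' :=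
  ⟨fun r hr => h.reg r fun h' => hr (hR h'), fun a ha => h.arr a fun h' => ha (hA h')⟩

theorem Same.setReg {R A : Set ℕ} {σ σ' : State} (h : Same R A σ σ') {x : ℕ} (hx : x ∈ R) (v : ℤ) :
    Same R A σ (σ'.setReg x v) :=
  ⟨fun r hr => by
    have : r ≠ x := fun h => hr (h ▸ hx)
    simp [this, h.reg r hr], h.arr⟩

theorem Same.setArr {R A : Set ℕ} {σ σ' : State} (h : Same R A σ σ') {a : ℕ} (ha : a ∈ A) (i : ℕ)
    (v : ℤ) : Same R A σ (σ'.setArr a i v) :=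
  ⟨h.reg, fun a' ha' => by
    rw [State.arr_setArr_of_ne _ (fun h => ha' (by rw [h]; exact ha)), h.arr a' ha']⟩

/-! ## Enumeration of subset sums -/

/-- The values of the subset sums of the selected numbers among `E 0, …, E (i - 1)`, where a partial
sum is dropped if its remainder modulo `Z` is not less than `c`. -/
def reach (E : ℕ → ℤ) (sel : ℕ → Bool) (Z c : ℤ) : ℕ → Finset ℤ
  | 0 => {0}
  | i + 1 =>
    if sel i then
      reach E sel Z c i ∪ ((reach E sel Z c i).image (· + E i)).filter fun v => v % Z < c
    else reach E sel Z c i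

theorem reach_subset_succ (E : ℕ → ℤ) (sel : ℕ → Bool) (Z c : ℤ) (i : ℕ) :
    reach E sel Z c i ⊆ reach E sel Z c (i + 1) := by
  simp only [reach]
  split_ifs
  · exact Finset.subset_union_left
  · exact subset_rfl

theorem reach_mono (E : ℕ → ℤ) (sel : ℕ → Bool) (Z c : ℤ) : Monotone (reach E sel Z c) :=
  monotone_nat_of_le_succ (reach_subset_succ E sel Z c)

theorem abs_le_of_mem_reach {E : ℕ → ℤ} {sel : ℕ → Bool} {Z c : ℤ} {i : ℕ} :
    ∀ {v : ℤ}, v ∈ reach E sel Z c i → |v| ≤ ∑ k ∈ Finset.range i, |E k| := by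
  induction i with
  | zero => intro v hv; simp [reach] at hv; simp [hv]
  | succ i ih =>
    intro v hv
    rw [Finset.sum_range_succ]
    have h0 := abs_nonneg (E i)
    simp only [reach] at hv
    split_ifs at hv
    · simp only [Finset.mem_union, Finset.mem_filter, Finset.mem_image] at hv
      rcases hv with hv | ⟨⟨u, hu, rfl⟩, -⟩
      · linarith [ih hv]
      · linarith [ih hu, abs_add_le u (E i)]
    · linarith [ih hv]

/-- The body of the inner loop of `enum`. -/
def enumStep (o tb : ℕ) : Stm :=
  .set 38 (.ld o (.var 36) + .var 35) ;;
  .cond (.bin .lt (.var 38 % .var 13) (.var 32))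
    -- The list stops growing at the cap in register `16`, which bounds the running time whatever
    -- the data are.
    (.cond (.bin .lt (.var 33) (.var 16))
      (.cond (.bin .eq (.ld tb (.var 38 + .var 15)) (.num 0))
        (.put tb (.var 38 + .var 15) (.num 1) ;;
         .put o (.var 33) (.var 38) ;;
         .set 33 (.var 33 + .num 1)))) ;;
  .set 36 (.var 36 + .num 1)

/-- The start of the body of the outer loop of `enum`. -/
def enumHead : Stm :=
  .set 35 (.ld 1 (.var 34 / .var 2)) ;;
  -- Register `37` bounds the inner loop. It remains `0` for an item of an unselected block, whose
  -- flag is `-1`, so that the loop is skipped.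
  .set 37 (.num 0) ;;
  .set 36 (.num 0) ;;
  .cond (.bin .lt (.num (-1)) (.var 35))
    (.set 37 (.var 33) ;;
     .set 35 (.ld 0 (.var 34) * .var 30 + .bin .shl (.num 1) (.var 34) * .var 31 + .var 35))

/-- Writes the distinct subset sums of the selected numbers into the array `o` and their number
into register `33`, using the table `tb`. -/
def enum (o tb : ℕ) : Prog :=
  .seq (Stm.code (.set 33 (.num 1) ;; .put o (.num 0) (.num 0) ;; .put tb (.var 15) (.num 1) ;;
    .set 34 (.num 0)))
  (whileLt 34 3 (.seq enumHead.code (.seq (whileLt 36 37 (enumStep o tb).code)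
    (Stm.code (.set 34 (.var 34 + .num 1))))))

/-- The registers and arrays changed by `enum`. -/
def enumRegs : Set ℕ := {r | 33 ≤ r ∧ r ≤ 38}

/-- The parameters of an enumeration. -/
structure EnumParams where
  n : ℕ
  B : ℕ
  N : ℕ
  w : ℕ → ℤ
  g : ℕ → ℤ
  z₁ : ℤ
  z₂ : ℤ
  Z : ℤ
  c : ℤ
  V : ℤ

/-- The number that stands for the item `i`. -/
def EnumParams.E (p : EnumParams) (i : ℕ) : ℤ := p.w i * p.z₁ + 2 ^ i * p.z₂ + p.g (i / p.B)

/-- The selected items. -/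
def EnumParams.sel (p : EnumParams) (i : ℕ) : Bool := -1 < p.g (i / p.B)

/-- The possible outcomes of an enumeration. -/
def EnumParams.reach (p : EnumParams) : ℕ → Finset ℤ := WordRAM.reach p.E p.sel p.Z p.c

/-- The parameters are found in the state. -/
structure EnumParams.In (p : EnumParams) (σ : State) : Prop where
  n : σ.reg 3 = p.n
  B : σ.reg 2 = p.B
  N : σ.reg 16 = p.N
  w : ∀ i < p.n, σ.arr 0 i = p.w i
  g : ∀ i < p.n, σ.arr 1 (i / p.B) = p.g (i / p.B)
  z₁ : σ.reg 30 = p.z₁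
  z₂ : σ.reg 31 = p.z₂
  Z : σ.reg 13 = p.Z
  c : σ.reg 32 = p.c
  V : σ.reg 15 = p.V

/-- No overflow occurs. -/
structure EnumParams.Bounded (p : EnumParams) (b : ℕ) : Prop where
  one_le : 1 ≤ b
  B_pos : 0 < p.B
  N_pos : 0 < p.N
  Z_pos : 0 < p.Z
  sum_le : ∑ k ∈ Finset.range p.n, |p.E k| ≤ p.V
  V_fits : 2 * p.V < 2 ^ b
  N_fits : (p.N : ℤ) + 1 < 2 ^ b
  n_fits : (p.n : ℤ) + 1 < 2 ^ b
  Z_fits : p.Z < 2 ^ b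
  w_fits : ∀ i < p.n, Fits b (p.w i)
  g_fits : ∀ i < p.n, Fits b (p.g (i / p.B))
  wz_fits : ∀ i < p.n, Fits b (p.w i * p.z₁)
  pow_fits : ∀ i < p.n, Fits b (2 ^ i)
  powz_fits : ∀ i < p.n, Fits b (2 ^ i * p.z₂)
  wzpowz_fits : ∀ i < p.n, Fits b (p.w i * p.z₁ + 2 ^ i * p.z₂)

/-- The list `L` is stored in the array `o`, and its members are marked in the table `tb`. -/
structure Listed (o tb : ℕ) (V : ℤ) (N : ℕ) (L : List ℤ) (σ : State) : Prop where
  nodup : L.Nodup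
  length_le : L.length ≤ N
  length : σ.reg 33 = L.length
  get : ∀ j (h : j < L.length), σ.arr o j = L[j]
  table : ∀ v, |v| ≤ V → σ.arr tb (v + V).toNat = if v ∈ L then 1 else 0

section
variable {b o tb : ℕ} {p : EnumParams}

theorem EnumParams.In.of_same {A : Set ℕ} {σ σ' : State} (h : p.In σ)
    (hs : Same enumRegs A σ σ') (h0 : 0 ∉ A) (h1 : 1 ∉ A) : p.In σ' := by
  constructor
  · rw [hs.reg 3 (by simp [enumRegs]), h.n]
  · rw [hs.reg 2 (by simp [enumRegs]), h.B]
  · rw [hs.reg 16 (by simp [enumRegs]), h.N]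
  · rw [hs.arr 0 h0]; exact h.w
  · rw [hs.arr 1 h1]; exact h.g
  · rw [hs.reg 30 (by simp [enumRegs]), h.z₁]
  · rw [hs.reg 31 (by simp [enumRegs]), h.z₂]
  · rw [hs.reg 13 (by simp [enumRegs]), h.Z]
  · rw [hs.reg 32 (by simp [enumRegs]), h.c]
  · rw [hs.reg 15 (by simp [enumRegs]), h.V]

theorem Listed.congr {V : ℤ} {N : ℕ} {L : List ℤ} {σ σ' : State} (h : Listed o tb V N L σ)
    (h33 : σ'.reg 33 = σ.reg 33) (ho : σ'.arr o = σ.arr o) (ht : σ'.arr tb = σ.arr tb) :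
    Listed o tb V N L σ' :=
  ⟨h.nodup, h.length_le, by rw [h33, h.length], by rw [ho]; exact h.get, by rw [ht]; exact h.table⟩

theorem Listed.push {V : ℤ} {N : ℕ} {L : List ℤ} {σ σ' : State} (h : Listed o tb V N L σ)
    (hot : o ≠ tb) {v : ℤ} (hv : |v| ≤ V) (hvL : v ∉ L) (hN : L.length < N)
    (h33 : σ'.reg 33 = σ.reg 33 + 1)
    (ha : σ'.arr = ((σ.setArr tb (v + V).toNat 1).setArr o L.length v).arr) :
    Listed o tb V N (L ++ [v]) σ' := by
  constructor
  · rw [List.nodup_append]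
    exact ⟨h.nodup, by simp, fun a ha b hb => by simp at hb; rintro rfl; exact hvL (hb ▸ ha)⟩
  · simp; omega
  · rw [h33, h.length]; simp
  · intro j hj
    rw [ha, State.arr_setArr]
    simp only [List.length_append, List.length_singleton] at hj
    by_cases hj' : j = L.length
    · subst hj'; simp
    · rw [if_neg (fun h => hj' h.2), State.arr_setArr_of_ne _ hot, h.get j (by omega),
        List.getElem_append_left (by omega)]
  · intro u hu
    rw [ha, State.arr_setArr_of_ne _ hot.symm, State.arr_setArr, h.table u hu]
    have : (u + V).toNat = (v + V).toNat ↔ u = v := by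
      have := abs_le.1 hu
      have := abs_le.1 hv
      constructor <;> intro <;> omega
    simp only [true_and, this, List.mem_append, List.mem_singleton]
    by_cases huv : u = v <;> simp [huv]

/-- What is known about the list after `j` steps of the inner loop with the number `e`. -/
structure InnerInv (p : EnumParams) (o tb i : ℕ) (L₀ : List ℤ) (σ₀ : State) (j : ℕ) (σ : State) :
    Prop where
  same : Same {r | r = 33 ∨ r = 36 ∨ r = 38} {a | a = o ∨ a = tb} σ₀ σ
  counter : σ.reg 36 = j
  list : ∃ L, L₀ <+: L ∧ Listed o tb p.V p.N L σ ∧ (∀ v ∈ L, v ∈ p.reach (i + 1)) ∧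
    ((p.reach p.n).card ≤ p.N → ∀ j', (h : j' < L₀.length) → j' < j →
      (L₀[j'] + p.E i) % p.Z < p.c → L₀[j'] + p.E i ∈ L)


theorem fits_neg_one (hb : 1 ≤ b) : Fits b (-1) := by
  have := fits_one hb
  simpa [Fits] using this

theorem EnumParams.abs_reach_le (hp : p.Bounded b) {i : ℕ} (hi : i ≤ p.n) {v : ℤ}
    (hv : v ∈ p.reach i) : |v| ≤ p.V :=
  (abs_le_of_mem_reach hv).trans (le_trans (Finset.sum_le_sum_of_subset_of_nonneg
    (Finset.range_subset_range.2 hi) fun _ _ _ => abs_nonneg _) hp.sum_le)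

theorem EnumParams.abs_reach_add_le (hp : p.Bounded b) {i : ℕ} (hi : i < p.n) {v : ℤ}
    (hv : v ∈ p.reach i) : |v + p.E i| ≤ p.V := by
  have h1 := abs_le_of_mem_reach hv
  have h2 : ∑ k ∈ Finset.range (i + 1), |p.E k| ≤ p.V :=
    le_trans (Finset.sum_le_sum_of_subset_of_nonneg
      (Finset.range_subset_range.2 hi) fun _ _ _ => abs_nonneg _) hp.sum_le
  rw [Finset.sum_range_succ] at h2
  linarith [abs_add_le v (p.E i)]

/-- The list grows while it is being read. Since `L₀` remains a prefix of it, position `j` still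
holds `L₀[j]`, and since a value is appended only if its table cell is empty, there are no
repetitions. -/
theorem runs_enumStep (hp : p.Bounded b) (hot : o ≠ tb) {i : ℕ} (hi : i < p.n)
    (hsel : p.sel i = true) {L₀ : List ℤ} (hL₀ : ∀ v ∈ L₀, v ∈ p.reach i) {σ₀ : State}
    (h13 : σ₀.reg 13 = p.Z) (h32 : σ₀.reg 32 = p.c) (h16 : σ₀.reg 16 = p.N)
    (h15 : σ₀.reg 15 = p.V) (h35 : σ₀.reg 35 = p.E i) {j : ℕ} (hj : j < L₀.length) {σ : State}
    (h : InnerInv p o tb i L₀ σ₀ j σ) :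
    Runs b (enumStep o tb).code σ 60 (InnerInv p o tb i L₀ σ₀ (j + 1)) := by
  obtain ⟨hs, h36, L, hpre, hL, hsub, hcomp⟩ := h
  have hb := hp.one_le
  rw [← hs.reg 13 (by simp)] at h13
  rw [← hs.reg 32 (by simp)] at h32
  rw [← hs.reg 16 (by simp)] at h16
  rw [← hs.reg 15 (by simp)] at h15
  rw [← hs.reg 35 (by simp)] at h35
  have hjL : j < L.length := lt_of_lt_of_le hj hpre.length_le
  have hget : σ.arr o j = L₀[j] := by
    rw [hL.get j hjL, List.IsPrefix.getElem hpre hj]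
  have hmem : L₀[j] ∈ p.reach i := hL₀ _ (List.getElem_mem hj)
  have hV0 := p.abs_reach_le hp hi.le hmem
  have hV1 := p.abs_reach_add_le hp hi hmem
  set u := L₀[j] with hu
  set v := u + p.E i with hv
  obtain ⟨hVl, hVu⟩ := abs_le.1 hV1
  have hmod0 := Int.emod_nonneg v hp.Z_pos.ne'
  have hmod1 := Int.emod_lt_of_pos v hp.Z_pos
  have hV := hp.V_fits
  have hlen : (L.length : ℤ) ≤ p.N := by exact_mod_cast hL.length_le
  have hlen' : (L₀.length : ℤ) ≤ L.length := by exact_mod_cast hpre.length_le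
  have hN := hp.N_fits
  have hjZ : (j : ℤ) < L₀.length := by exact_mod_cast hj
  have hnew : v % p.Z < p.c → v ∈ p.reach (i + 1) := by
    intro hlt
    simp only [EnumParams.reach, WordRAM.reach, hsel, if_true, Finset.mem_union, Finset.mem_filter,
      Finset.mem_image]
    exact Or.inr ⟨⟨u, hmem, rfl⟩, hlt⟩
  have hfin : ∀ v ∈ p.reach (i + 1), v ∈ p.reach p.n := fun v hv =>
    reach_mono p.E p.sel p.Z p.c hi hv
  have htab := hL.table v hV1
  refine Runs.mono (Stm.runs hb (enumStep o tb)
    (Q := InnerInv p o tb i L₀ σ₀ (j + 1)) ?_ ?_) (Nat.le_of_ble_eq_true rfl) fun _ h => h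
  · simp [enumStep, Stm.Ok, Stm.run, Stm.fitsIfVar, h36, hget, h35, h13, h32, hL.length, h16,
      h15, ← hv]
    have hu1 := abs_le.1 hV0
    have fv : Fits b (v + p.V) := fits_of_nonneg (X := 2 * p.V) hV (by linarith) (by linarith)
    have fone := fits_one hb
    refine ⟨⟨fits_of_abs_le (X := 2 * p.V) hV (by linarith [abs_nonneg u]),
      fits_of_abs_le (X := 2 * p.V) hV (by linarith [abs_nonneg v])⟩,
      ⟨fits_of_nonneg hp.Z_fits hmod0 hmod1.le, fun _ hl => ⟨⟨⟨fv, by linarith, ?_⟩, fits_zero b⟩,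
        fun _ => ⟨⟨fv, fone, by linarith⟩, fone, fits_of_nonneg hN (by positivity) (by omega)⟩⟩⟩,
      fone, ?_⟩
    · rw [htab]; exact fits_bool hb _
    · refine fits_of_nonneg (X := p.N + 1) hN ?_ ?_ <;> split_ifs <;> simp [h36] <;> omega
  · simp [enumStep, Stm.run, h36, hget, h35, h13, h32, hL.length, h16,
      h15, ← hv]
    have hpost : ∀ τ : State, τ.reg 36 = j →
        Same {r | r = 33 ∨ r = 36 ∨ r = 38} {a | a = o ∨ a = tb} σ₀ τ →
        (∃ L', L <+: L' ∧ Listed o tb p.V p.N L' τ ∧ (∀ v ∈ L', v ∈ p.reach (i + 1)) ∧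
          ((p.reach p.n).card ≤ p.N → v % p.Z < p.c → v ∈ L')) →
        InnerInv p o tb i L₀ σ₀ (j + 1) (τ.setReg 36 (τ.reg 36 + 1)) := by
      rintro τ h36τ hsame ⟨L', hLL', hL', hsub', hv'⟩
      refine ⟨hsame.setReg (by simp) _, by simp [h36τ], L', hpre.trans hLL',
        hL'.congr (by simp) (by simp) (by simp), hsub', fun hc j' hj' hjj' hm => ?_⟩
      rcases Nat.lt_succ_iff_lt_or_eq.1 hjj' with h | rfl
      · exact hLL'.subset (hcomp hc j' hj' h hm)
      · exact hv' hc hm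
    have hs' : Same {r | r = 33 ∨ r = 36 ∨ r = 38} {a | a = o ∨ a = tb} σ₀ (σ.setReg 38 v) :=
      hs.setReg (by simp) v
    have hskip : ((p.reach p.n).card ≤ p.N → v % p.Z < p.c → v ∈ L) →
        InnerInv p o tb i L₀ σ₀ (j + 1)
          ((σ.setReg 38 v).setReg 36 ((σ.setReg 38 v).reg 36 + 1)) := fun h =>
      hpost _ (by simp [h36]) hs' ⟨L, List.prefix_rfl, hL.congr (by simp) (by simp) (by simp), hsub, h⟩
    split_ifs with c1 c2 c3
    · have hvL : v ∉ L := by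
        intro hvL
        rw [htab, if_pos hvL] at c3
        exact one_ne_zero c3
      refine hpost _ (by simp [h36]) (((hs'.setArr (by simp) _ _).setArr (by simp) _ _).setReg
        (by simp) _) ⟨L ++ [v], List.prefix_append _ _, hL.push hot hV1 hvL c2 (by simp [hL.length])
        rfl, ?_, fun _ _ => by simp⟩
      intro x hx
      rcases List.mem_append.1 hx with hx | hx
      · exact hsub x hx
      · rw [List.mem_singleton.1 hx]; exact hnew c1
    · refine hskip fun _ _ => ?_
      by_contra hvL
      rw [htab, if_neg hvL] at c3
      exact c3 rfl
    · refine hskip fun hc _ => ?_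
      by_contra hvL
      -- A value is lost only if the list is full. Then the listed values and the lost one are more
      -- than `p.N` members of the final set, which contradicts the assumption on its size.
      have h1 : (insert v L.toFinset) ⊆ p.reach p.n := by
        intro x hx
        rcases Finset.mem_insert.1 hx with rfl | hx
        · exact hfin _ (hnew c1)
        · exact hfin _ (hsub x (List.mem_toFinset.1 hx))
      have h2 := Finset.card_le_card h1
      rw [Finset.card_insert_of_notMem (by simpa using hvL), List.toFinset_card_of_nodup hL.nodup]
        at h2
      omega
    · exact hskip fun _ h => absurd h c1

/-- What is known before the item `i` is treated. -/
structure OuterInv (p : EnumParams) (o tb : ℕ) (σ₀ : State) (i : ℕ) (σ : State) : Prop where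
  same : Same enumRegs {a | a = o ∨ a = tb} σ₀ σ
  counter : σ.reg 34 = i
  list : ∃ L, Listed o tb p.V p.N L σ ∧ (∀ v ∈ L, v ∈ p.reach i) ∧
    ((p.reach p.n).card ≤ p.N → ∀ v ∈ p.reach i, v ∈ L)

theorem runs_enumHead (hp : p.Bounded b) {σ : State} (h : p.In σ) {i len : ℕ} (hi : i < p.n)
    (h34 : σ.reg 34 = i) (h33 : σ.reg 33 = len) (hlen : len ≤ p.N) :
    Runs b enumHead.code σ 40 fun σ' =>
      Same {r | r = 35 ∨ r = 36 ∨ r = 37} ∅ σ σ' ∧ σ'.reg 36 = 0 ∧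
      (p.sel i = true → σ'.reg 35 = p.E i ∧ σ'.reg 37 = len) ∧
      (p.sel i = false → σ'.reg 37 = 0) := by
  have hb := hp.one_le
  have hdiv : (i : ℤ) / p.B = ((i / p.B : ℕ) : ℤ) := by simp
  have hdivn : ((i : ℤ) / p.B).toNat = i / p.B := by rw [hdiv, Int.toNat_natCast]
  have hw := h.w i hi
  have hg := h.g i hi
  have hiN := hp.n_fits
  have hlenN : (len : ℤ) ≤ p.N := by exact_mod_cast hlen
  have fE : Fits b (p.E i) := by
    refine fits_of_abs_le (X := 2 * p.V) hp.V_fits ?_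
    have : |p.E i| ≤ ∑ k ∈ Finset.range p.n, |p.E k| :=
      Finset.single_le_sum (f := fun k => |p.E k|) (fun _ _ => abs_nonneg _) (Finset.mem_range.2 hi)
    linarith [hp.sum_le, abs_nonneg (p.E i)]
  refine Runs.mono (Stm.runs hb enumHead (Q := fun σ' =>
      Same {r | r = 35 ∨ r = 36 ∨ r = 37} ∅ σ σ' ∧ σ'.reg 36 = 0 ∧
      (p.sel i = true → σ'.reg 35 = p.E i ∧ σ'.reg 37 = len) ∧
      (p.sel i = false → σ'.reg 37 = 0)) ?_ ?_) (Nat.le_of_ble_eq_true rfl) fun _ h => h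
  · simp [enumHead, Stm.Ok, Stm.run, Stm.fitsIfVar, h34, h33, h.B, h.z₁, h.z₂, hdivn, hw, hg]
    refine ⟨⟨?_, by positivity, hp.g_fits i hi⟩, fits_zero b, fits_neg_one hb,
      fun _ => ?_⟩
    · refine fits_of_nonneg hiN (by positivity) ?_
      have : ((i / p.B : ℕ) : ℤ) ≤ i := by exact_mod_cast Nat.div_le_self _ _
      rw [hdiv]
      have : (i : ℤ) < p.n := by exact_mod_cast hi
      linarith
    · have fl : Fits b len := fits_of_nonneg hp.N_fits (by positivity) (by linarith)
      have := hp.w_fits i hi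
      have := hp.wz_fits i hi
      have := hp.pow_fits i hi
      have := hp.powz_fits i hi
      have := hp.wzpowz_fits i hi
      have := fits_one hb
      have fE' := fE
      rw [EnumParams.E] at fE'
      and_intros <;> assumption
  · simp [enumHead, Stm.run, h34, h33, h.B, h.z₁, h.z₂, hdivn, hw, hg]
    have hsame : Same {r | r = 35 ∨ r = 36 ∨ r = 37} ∅ σ
        (((σ.setReg 35 (p.g (i / p.B))).setReg 37 0).setReg 36 0) :=
      (((Same.refl _ _ σ).setReg (by simp) _).setReg (by simp) _).setReg (by simp) _
    by_cases hsel : -1 < p.g (i / p.B)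
    · rw [if_pos hsel]
      exact ⟨(hsame.setReg (by simp) _).setReg (by simp) _, by simp, by simp [EnumParams.E],
        by simp [EnumParams.sel, hsel]⟩
    · rw [if_neg hsel]
      exact ⟨hsame, by simp, by simp [EnumParams.sel, hsel], by simp⟩

/-- The result of an enumeration. -/
structure Enumerated (p : EnumParams) (o : ℕ) (L : List ℤ) (σ : State) : Prop where
  nodup : L.Nodup
  length_le : L.length ≤ p.N
  length : σ.reg 33 = L.length
  get : ∀ j (h : j < L.length), σ.arr o j = L[j]
  sound : ∀ v ∈ L, v ∈ p.reach p.n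
  complete : (p.reach p.n).card ≤ p.N → ∀ v ∈ p.reach p.n, v ∈ L

/-- The inner loop runs over the list as it was before the item came, because its length is frozen
in register `37`. Hence no item is used twice in a sum. -/
theorem runs_enumItem (hp : p.Bounded b) (hot : o ≠ tb) (ho : 2 ≤ o) (ht : 2 ≤ tb)
    {σ₀ : State} (h0 : p.In σ₀) {i : ℕ} (hi : i < p.n) {σ : State} (h : OuterInv p o tb σ₀ i σ) :
    Runs b (.seq enumHead.code (.seq (whileLt 36 37 (enumStep o tb).code)
      (Stm.code (.set 34 (.var 34 + .num 1))))) σ (62 * p.N + 52) (OuterInv p o tb σ₀ (i + 1)) := by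
  have hb := hp.one_le
  obtain ⟨hs, h34, L, hL, hsub, hcomp⟩ := h
  have hIn : p.In σ := h0.of_same hs (by simp; omega) (by simp; omega)
  refine Runs.mono ((runs_enumHead hp hIn hi h34 hL.length hL.length_le).seq
    (T' := 62 * p.N + 12) ?_) (by omega) fun _ h => h
  rintro σ₁ ⟨hs₁, h36, hsel, hnsel⟩
  have hs₁' : Same enumRegs {a | a = o ∨ a = tb} σ₀ σ₁ :=
    hs.trans (hs₁.mono (by intro r hr; simp [enumRegs] at hr ⊢; omega) (Set.empty_subset _))
  have hL₁ : Listed o tb p.V p.N L σ₁ :=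
    hL.congr (hs₁.reg 33 (by simp)) (hs₁.arr _ (by simp)) (hs₁.arr _ (by simp))
  have h34₁ : σ₁.reg 34 = i := by rw [hs₁.reg 34 (by simp), h34]
  have hIn₁ : p.In σ₁ := h0.of_same hs₁' (by simp; omega) (by simp; omega)
  have hend : ∀ τ : State, Same enumRegs {a | a = o ∨ a = tb} σ₀ τ → τ.reg 34 = i →
      (∃ L, Listed o tb p.V p.N L τ ∧ (∀ v ∈ L, v ∈ p.reach (i + 1)) ∧
        ((p.reach p.n).card ≤ p.N → ∀ v ∈ p.reach (i + 1), v ∈ L)) →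
      Runs b (Stm.code (.set 34 (.var 34 + .num 1))) τ 10 (OuterInv p o tb σ₀ (i + 1)) := by
    rintro τ hτ h34τ ⟨L', hL', h1, h2⟩
    refine Runs.mono (Stm.runs hb _ (Q := OuterInv p o tb σ₀ (i + 1)) ?_ ?_)
      (Nat.le_of_ble_eq_true rfl) fun _ h => h
    · simp [Stm.Ok, Stm.fitsIfVar, h34τ]
      have := hp.n_fits
      exact ⟨fits_one hb, fits_of_nonneg hp.n_fits (by positivity) (by omega)⟩
    · simp only [Stm.run]
      exact ⟨hτ.setReg (by simp [enumRegs]) _, by simp [h34τ], L',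
        hL'.congr (by simp) (by simp) (by simp), h1, h2⟩
  cases hsi : p.sel i with
  | false =>
    have hr : p.reach (i + 1) = p.reach i := by simp [EnumParams.reach, reach, hsi]
    refine Runs.mono ((Runs.whileLt hb (fun _ σ' => σ' = σ₁) 0 0 (by intro i hi; omega)
      (by rintro _ rfl; rw [h36, hnsel hsi]; simp) rfl).seq (T' := 10) ?_) (by omega) fun _ h => h
    rintro _ rfl
    exact hend _ hs₁' h34₁ ⟨L, hL₁, by rw [hr]; exact hsub, by rw [hr]; exact hcomp⟩
  | true =>
    obtain ⟨h35, h37⟩ := hsel hsi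
    have hlen := hL.length_le
    have hlen' := Nat.mul_le_mul_right 62 hlen
    have h37' : σ₁.reg 37 = L.length := h37
    refine Runs.mono ((Runs.whileLt hb (InnerInv p o tb i L σ₁) L.length 60 ?_ ?_ ?_).seq
      (T' := 10) ?_) (by omega) fun _ h => h
    · intro j hj σ' h
      refine ⟨?_, runs_enumStep hp hot hi hsi hsub hIn₁.Z hIn₁.c hIn₁.N hIn₁.V h35 hj h⟩
      rw [h.counter, h.same.reg 37 (by simp), h37']
      exact_mod_cast hj
    · intro σ' h
      rw [h.counter, h.same.reg 37 (by simp), h37']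
      simp
    · exact ⟨Same.refl _ _ _, by simpa using h36, L, List.prefix_rfl, hL₁,
        fun v hv => reach_subset_succ _ _ _ _ _ (hsub v hv), fun _ j' _ h => absurd h (by omega)⟩
    · rintro τ ⟨hτ, -, L', hpre, hL', h1, h2⟩
      refine hend τ (hs₁'.trans (hτ.mono (by intro r hr; simp [enumRegs] at hr ⊢; omega)
        subset_rfl)) (by rw [hτ.reg 34 (by simp), h34₁]) ⟨L', hL', h1, fun hc v hv => ?_⟩
      simp only [EnumParams.reach, reach, hsi, if_true, Finset.mem_union, Finset.mem_filter,
        Finset.mem_image] at hv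
      rcases hv with hv | ⟨⟨u, hu, rfl⟩, hm⟩
      · exact hpre.subset (hcomp hc v hv)
      · obtain ⟨j, hj, rfl⟩ := List.getElem_of_mem (hcomp hc u hu)
        exact h2 hc j hj hj hm

/-- The time is linear in the cap `p.N` on the list and not in the number of subsets. The table is
never cleaned up, and so every call needs one that is still blank. -/
theorem runs_enum (hp : p.Bounded b) (hot : o ≠ tb) (ho : 2 ≤ o) (ht : 2 ≤ tb)
    {σ : State} (h : p.In σ) (hz : ∀ i, σ.arr tb i = 0) :
    Runs b (enum o tb) σ ((p.n + 1) * (62 * p.N + 60)) fun σ' =>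
      Same enumRegs {a | a = o ∨ a = tb} σ σ' ∧ ∃ L, Enumerated p o L σ' := by
  have hb := hp.one_le
  have hV0 : 0 ≤ p.V := le_trans (Finset.sum_nonneg fun _ _ => abs_nonneg _) hp.sum_le
  refine Runs.mono ((Stm.runs hb _ (Q := OuterInv p o tb σ 0) ?_ ?_).seq
    (Q := OuterInv p o tb σ p.n) (T' := p.n * (62 * p.N + 52 + 2) + 2) ?_) ?_ ?_
  · simp [Stm.Ok, Stm.run, Stm.fitsIfVar, h.V]
    exact ⟨fits_one hb, fits_zero b, ⟨fits_one hb, hV0⟩, fits_zero b⟩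
  · simp only [Stm.run, Expr.eval_num, Expr.eval_var, State.reg_setReg, State.reg_setArr]
    simp only [h.V, show (15 : ℕ) ≠ 33 by norm_num, if_false]
    refine ⟨((((Same.refl _ _ σ).setReg (by simp [enumRegs]) _).setArr (by simp) _ _).setArr
      (by simp) _ _).setReg (by simp [enumRegs]) _, by simp, [0], ⟨by simp, ?_, by simp, ?_, ?_⟩,
      by simp [EnumParams.reach, reach], by simp [EnumParams.reach, reach]⟩
    · exact hp.N_pos
    · intro j hj
      obtain rfl : j = 0 := by simpa using hj
      simp [State.arr_setArr, hot]
    · intro v hv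
      have := abs_le.1 hv
      have hiff : (v + p.V).toNat = p.V.toNat ↔ v = 0 := by omega
      simp [State.arr_setArr, hot.symm, hiff, hz]
  · intro σ' h0
    refine Runs.whileLt hb (OuterInv p o tb σ) p.n _ ?_ ?_ h0
    · intro i hi τ hτ
      refine ⟨?_, runs_enumItem hp hot ho ht h hi hτ⟩
      rw [hτ.counter, hτ.same.reg 3 (by simp [enumRegs]), h.n]
      exact_mod_cast hi
    · intro τ hτ
      rw [hτ.counter, hτ.same.reg 3 (by simp [enumRegs]), h.n]
      simp
  · have : (Stm.cost (.set 33 (.num 1) ;; .put o (.num 0) (.num 0) ;; .put tb (.var 15) (.num 1) ;;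
      .set 34 (.num 0))) ≤ 20 := Nat.le_of_ble_eq_true rfl
    nlinarith
  · rintro σ' ⟨h1, h2, L, hL, h3, h4⟩
    exact ⟨h1, L, hL.nodup, hL.length_le, hL.length, hL.get, h3, h4⟩

end


/-- Dropping a partial sum as soon as the test fails loses nothing when the tested property is
inherited by subsets: the partial sums of an admissible set belong to its initial segments, which
are admissible too. The test only sees a residue of the sum, so that residue is assumed to decide
the property. -/
theorem mem_reach_iff {E : ℕ → ℤ} {sel : ℕ → Bool} {Z c : ℤ} {n : ℕ} (P : Finset ℕ → Prop)
    (h0 : P ∅) (hmono : ∀ A A', A ⊆ A' → P A' → P A)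
    (hP : ∀ A ⊆ (Finset.range n).filter (sel ·), (∑ i ∈ A, E i) % Z < c ↔ P A) :
    ∀ i ≤ n, ∀ v, v ∈ reach E sel Z c i ↔
      ∃ A ⊆ (Finset.range i).filter (sel ·), P A ∧ ∑ i ∈ A, E i = v := by
  intro i
  induction i with
  | zero =>
    intro _ v
    simp only [reach, Finset.mem_singleton, Finset.range_zero, Finset.filter_empty,
      Finset.subset_empty]
    constructor
    · rintro rfl; exact ⟨∅, rfl, h0, by simp⟩
    · rintro ⟨A, rfl, -, h⟩; simpa using h.symm
  | succ i ih =>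
    intro hi v
    have hsub : (Finset.range i).filter (sel ·) ⊆ (Finset.range (i + 1)).filter (sel ·) :=
      Finset.filter_subset_filter _ (Finset.range_subset_range.2 (Nat.le_succ i))
    have hnot : ∀ A ⊆ (Finset.range i).filter (sel ·), i ∉ A := fun A hA h => by
      simpa using (Finset.mem_filter.1 (hA h)).1
    have hsub' : (Finset.range (i + 1)).filter (sel ·) ⊆ (Finset.range n).filter (sel ·) :=
      Finset.filter_subset_filter _ (Finset.range_subset_range.2 hi)
    simp only [reach]
    split_ifs with hs
    · rw [Finset.mem_union, Finset.mem_filter, Finset.mem_image, ih (by omega)]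
      constructor
      · rintro (⟨A, hA, hPA, rfl⟩ | ⟨⟨u, hu, rfl⟩, hm⟩)
        · exact ⟨A, hA.trans hsub, hPA, rfl⟩
        · obtain ⟨A, hA, hPA, rfl⟩ := (ih (by omega) u).1 hu
          have hiA := hnot A hA
          have hA' : insert i A ⊆ (Finset.range (i + 1)).filter (sel ·) :=
            Finset.insert_subset (by simp [hs]) (hA.trans hsub)
          refine ⟨insert i A, hA', (hP _ (hA'.trans hsub')).1 ?_, ?_⟩
          · rw [Finset.sum_insert hiA, add_comm]; exact hm
          · rw [Finset.sum_insert hiA, add_comm]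
      · rintro ⟨A, hA, hPA, rfl⟩
        by_cases hiA : i ∈ A
        · right
          refine ⟨⟨∑ k ∈ A.erase i, E k, (ih (by omega) _).2 ⟨A.erase i, fun k hk => ?_,
            hmono _ _ (Finset.erase_subset _ _) hPA, rfl⟩, ?_⟩, (hP _ (hA.trans hsub')).2 hPA⟩
          · have h1 := Finset.mem_erase.1 hk
            have h2 := Finset.mem_filter.1 (hA h1.2)
            have h3 := Finset.mem_range.1 h2.1
            exact Finset.mem_filter.2 ⟨Finset.mem_range.2 (by omega), h2.2⟩
          · exact Finset.sum_erase_add _ _ hiA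
        · left
          refine ⟨A, fun k hk => ?_, hPA, rfl⟩
          have h2 := Finset.mem_filter.1 (hA hk)
          have h3 := Finset.mem_range.1 h2.1
          have : k ≠ i := fun h => hiA (h ▸ hk)
          exact Finset.mem_filter.2 ⟨Finset.mem_range.2 (by omega), h2.2⟩
    · rw [ih (by omega)]
      constructor
      · rintro ⟨A, hA, h⟩
        exact ⟨A, hA.trans hsub, h⟩
      · rintro ⟨A, hA, h⟩
        refine ⟨A, fun k hk => ?_, h⟩
        have h2 := Finset.mem_filter.1 (hA hk)
        have h3 := Finset.mem_range.1 h2.1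
        have : k ≠ i := fun h => hs (h ▸ h2.2)
        exact Finset.mem_filter.2 ⟨Finset.mem_range.2 (by omega), h2.2⟩

/-- Writes the values of `g 0, …, g (K - 1)` into array `1`. -/
def fill (K : ℕ) (g : ℕ → Expr) : Prog :=
  seqList ((List.range K).map fun j : ℕ => Stm.code (.put 1 (.num (j : ℤ)) (g j)))

theorem runs_fill {b : ℕ} (hb : 1 ≤ b) {K : ℕ} {e : ℕ → Expr} {g : ℕ → ℤ} (hK : (K : ℤ) < 2 ^ b)
    (σ : State) (he : ∀ j < K, ∀ τ, Same ∅ {1} σ τ →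
      (e j).Ok b τ ∧ (e j).eval τ = g j ∧ (e j).cost = 1) :
    Runs b (fill K e) σ (K * 3 + 1) fun σ' =>
      Same ∅ {1} σ σ' ∧ ∀ j < K, σ'.arr 1 j = g j := by
  refine Runs.mono (Runs.seqList (fun j : ℕ => Stm.code (.put 1 (.num (j : ℤ)) (e j)))
    (fun done σ' => Same ∅ {1} σ σ' ∧ ∀ j ∈ done, σ'.arr 1 j = g j) 3 (List.range K) []
    ⟨Same.refl _ _ _, by simp⟩ ?_) (by simp) fun σ' h => ⟨h.1, fun j hj => h.2 j (by simpa using hj)⟩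
  rintro j hj done τ ⟨h1, h2⟩
  rw [List.mem_range] at hj
  obtain ⟨e1, e2, e3⟩ := he j hj τ h1
  refine Runs.mono (Stm.runs hb _ (Q := fun σ' => Same ∅ {1} σ σ' ∧
    ∀ j' ∈ done ++ [j], σ'.arr 1 j' = g j') ?_ ?_)
    (by simp only [Stm.cost, Expr.cost, e3]; omega) fun _ h => h
  · exact ⟨fits_of_nonneg hK (by positivity) (by exact_mod_cast hj.le), e1, Int.natCast_nonneg j⟩
  · simp only [Stm.run, Expr.eval_num, Int.toNat_natCast, e2]
    refine ⟨h1.setArr (by simp) _ _, fun j' hj' => ?_⟩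
    rw [State.arr_setArr]
    by_cases h : j' = j
    · simp [h]
    · simp [h, h2 j' (by simpa [h] using hj')]

/-- The data of a run of the algorithm that do not depend on the coins: there are `K` blocks of `B`
numbers each. -/
structure Setup where
  K : ℕ
  B : ℕ
  N₁ : ℕ
  w : ℕ → ℤ
  t : ℤ
  V : ℤ

/-! ### Instances in blocks, and one bound for all numbers that occur. -/

namespace Setup

variable (s : Setup)

/-- The number of items. -/
def n : ℕ := s.K * s.B

/-- The sum of all numbers. -/
def total : ℤ := ∑ i ∈ Finset.range s.n, s.w i

/-- A bound on all subset sums and the target. -/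
def W : ℤ := ∑ i ∈ Finset.range s.n, |s.w i| + |s.t|

/-- The data are found in the state. -/
structure In (σ : State) : Prop where
  t : σ.reg 1 = s.t
  B : σ.reg 2 = s.B
  n : σ.reg 3 = s.n
  total : σ.reg 5 = s.total
  Z : σ.reg 13 = s.n + 1
  V : σ.reg 15 = s.V
  N₁ : σ.reg 16 = s.N₁
  w : ∀ i < s.n, σ.arr 0 i = s.w i

/-- No overflow occurs. -/
structure Bounded (b : ℕ) : Prop where
  K_pos : 0 < s.K
  B_pos : 0 < s.B
  N₁_pos : 0 < s.N₁
  V_le : 4 * (s.W + 1) * (s.n + 1) ^ 3 * 2 ^ s.n ≤ s.V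
  V_fits : 8 * s.V < 2 ^ b
  N₁_fits : (s.N₁ : ℤ) + 1 < 2 ^ b

/-- The registers that the loops may change. -/
def volatile : Set ℕ := {r | r = 17 ∨ r = 18 ∨ (26 ≤ r ∧ r < 100)}

theorem In.of_same {s : Setup} {A : Set ℕ} {σ σ' : State} (h : s.In σ)
    (hs : Same volatile A σ σ') (h0 : 0 ∉ A) : s.In σ' := by
  constructor
  · rw [hs.reg 1 (by simp [volatile]), h.t]
  · rw [hs.reg 2 (by simp [volatile]), h.B]
  · rw [hs.reg 3 (by simp [volatile]), h.n]
  · rw [hs.reg 5 (by simp [volatile]), h.total]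
  · rw [hs.reg 13 (by simp [volatile]), h.Z]
  · rw [hs.reg 15 (by simp [volatile]), h.V]
  · rw [hs.reg 16 (by simp [volatile]), h.N₁]
  · rw [hs.arr 0 h0]; exact h.w

/-- The parameters of an enumeration with weights multiplied by `z₁`, masks by `z₂`, and `g` per
block. -/
def enumParams (g : ℕ → ℤ) (z₁ z₂ c : ℤ) : EnumParams where
  n := s.n
  B := s.B
  N := s.N₁
  w := s.w
  g := g
  z₁ := z₁
  z₂ := z₂
  Z := s.n + 1
  c := c
  V := s.V

variable {s} {b : ℕ}

theorem Bounded.one_le (h : s.Bounded b) : 1 ≤ b := by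
  have := h.N₁_fits
  have := h.N₁_pos
  by_contra h
  obtain rfl : b = 0 := by omega
  simp at *
  omega

theorem W_nonneg : 0 ≤ s.W := add_nonneg (Finset.sum_nonneg fun _ _ => abs_nonneg _) (abs_nonneg _)

theorem Bounded.n_pos (h : s.Bounded b) : 0 < s.n := Nat.mul_pos h.K_pos h.B_pos

/-- Every number in an enumeration is controlled by products of a sum of weights, a power of `n + 1`
with exponent at most three, and a number of the size of a mask. `V` exceeds four times any such
product, so that a few of them may be added. -/
theorem Bounded.le_V (h : s.Bounded b) {x y z u : ℤ} (hx : x ≤ s.W + 1) (hx0 : 0 ≤ x)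
    (hy0 : 0 ≤ y) (hz0 : 0 ≤ z) (hy : y ≤ (s.n + 1) ^ 3) (hz : z ≤ 2 ^ s.n) (hu : u = x * y * z) :
    4 * u ≤ s.V := by
  have h1 : x * y * z ≤ (s.W + 1) * (s.n + 1) ^ 3 * 2 ^ s.n :=
    mul_le_mul (mul_le_mul hx hy hy0 (by linarith)) hz hz0
      (mul_nonneg (by linarith) (by positivity))
  have := h.V_le
  rw [hu]
  linarith

theorem Bounded.V_pos (h : s.Bounded b) : 4 ≤ s.V := by
  have := h.le_V (x := 1) (y := 1) (z := 1) (by linarith [s.W_nonneg]) (by norm_num)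
    (by norm_num) (by norm_num) (one_le_pow₀ (by linarith [Int.natCast_nonneg s.n]))
    (one_le_pow₀ (by norm_num)) rfl
  linarith

theorem Bounded.fits (h : s.Bounded b) {v : ℤ} (hv : |v| ≤ 8 * s.V) : Fits b v :=
  fits_of_abs_le h.V_fits hv

theorem abs_w_le {i : ℕ} (hi : i < s.n) : |s.w i| ≤ s.W := by
  have : |s.w i| ≤ ∑ k ∈ Finset.range s.n, |s.w k| :=
    Finset.single_le_sum (f := fun k => |s.w k|) (fun _ _ => abs_nonneg _) (Finset.mem_range.2 hi)
  have := abs_nonneg s.t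
  unfold W
  linarith

theorem sum_two_pow_lt (n : ℕ) : ∑ k ∈ Finset.range n, (2 : ℤ) ^ k < 2 ^ n := by
  induction n with
  | zero => simp
  | succ n ih => rw [Finset.sum_range_succ, pow_succ]; linarith

/-- The numbers standing for the items have three ingredients: scaled weights, scaled powers of two,
and block flags. The sums of their absolute values are at most `W * q * 2 ^ n`, less than `q * 2 ^
n`, and at most `n * (n + 2) ≤ q`, respectively, with the local `q = (n + 1) ^ 2`. -/
theorem Bounded.enumParams (h : s.Bounded b) {g : ℕ → ℤ} {z₁ z₂ : ℤ} (c : ℤ)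
    (hg : ∀ j < s.K, |g j| ≤ s.n + 2) (hz₁ : 0 ≤ z₁) (hz₁' : z₁ ≤ (s.n + 1) ^ 2 * 2 ^ s.n)
    (hz₂ : 0 ≤ z₂) (hz₂' : z₂ ≤ (s.n + 1) ^ 2) : (s.enumParams g z₁ z₂ c).Bounded b := by
  have hW := s.W_nonneg
  have hn : (1 : ℤ) ≤ s.n := by exact_mod_cast h.n_pos
  have hp : (1 : ℤ) ≤ 2 ^ s.n := one_le_pow₀ (by norm_num)
  set q : ℤ := (s.n + 1) ^ 2 with hq
  have hq3 : ((s.n : ℤ) + 1) ^ 3 = q * (s.n + 1) := by rw [hq]; ring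
  have hq2 : 2 * (s.n : ℤ) + 2 ≤ q := by rw [hq]; nlinarith
  have hq3' : q ≤ ((s.n : ℤ) + 1) ^ 3 := by rw [hq3]; nlinarith
  have hV := h.V_pos
  have hgi : ∀ i < s.n, |g (i / s.B)| ≤ s.n + 2 := fun i hi =>
    hg _ (Nat.div_lt_of_lt_mul (by rw [mul_comm]; exact hi))
  have b1 : 4 * ((s.W + 1) * q * 2 ^ s.n) ≤ s.V :=
    h.le_V le_rfl (by linarith) (by linarith) (by linarith) hq3' le_rfl rfl
  have b2 : 4 * (1 * (s.n + 1 : ℤ) ^ 3 * 1) ≤ s.V :=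
    h.le_V (by linarith) (by linarith) (by positivity) (by linarith) le_rfl hp rfl
  have hqp : (0 : ℤ) ≤ q * 2 ^ s.n := by positivity
  have b1' : 4 * (s.W * (q * 2 ^ s.n)) + 4 * (q * 2 ^ s.n) ≤ s.V := by linarith
  have hWq : 0 ≤ s.W * (q * 2 ^ s.n) := mul_nonneg hW hqp
  have hpq : (2 : ℤ) ^ s.n ≤ q * 2 ^ s.n := by nlinarith
  have hwz : ∀ i < s.n, |s.w i * z₁| ≤ s.W * (q * 2 ^ s.n) := fun i hi => by
    rw [abs_mul, abs_of_nonneg hz₁]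
    exact mul_le_mul (abs_w_le hi) hz₁' hz₁ hW
  have hpow : ∀ i < s.n, (2 : ℤ) ^ i ≤ 2 ^ s.n := fun i hi =>
    pow_le_pow_right₀ (by norm_num) hi.le
  have hpz : ∀ i < s.n, |2 ^ i * z₂| ≤ q * 2 ^ s.n := fun i hi => by
    rw [abs_of_nonneg (by positivity), mul_comm]
    exact mul_le_mul hz₂' (hpow i hi) (by positivity) (by linarith)
  constructor
  · exact h.one_le
  · exact h.B_pos
  · exact h.N₁_pos
  · exact Int.lt_add_one_of_le (Int.natCast_nonneg _)
  · have hE : ∀ i ∈ Finset.range s.n, |(s.enumParams g z₁ z₂ c).E i| ≤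
        |s.w i| * (q * 2 ^ s.n) + 2 ^ i * q + (s.n + 2) := by
      intro i hi
      have hi := Finset.mem_range.1 hi
      simp only [EnumParams.E, Setup.enumParams]
      refine (abs_add_le _ _).trans (add_le_add ((abs_add_le _ _).trans (add_le_add ?_ ?_))
        (hgi i hi))
      · rw [abs_mul, abs_of_nonneg hz₁]
        exact mul_le_mul_of_nonneg_left hz₁' (abs_nonneg _)
      · rw [abs_of_nonneg (by positivity)]
        exact mul_le_mul_of_nonneg_left hz₂' (by positivity)
    refine (Finset.sum_le_sum hE).trans ?_
    rw [Finset.sum_add_distrib, Finset.sum_add_distrib, ← Finset.sum_mul, ← Finset.sum_mul]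
    simp only [Finset.sum_const, Finset.card_range, nsmul_eq_mul]
    have e1 : (∑ i ∈ Finset.range s.n, |s.w i|) * (q * 2 ^ s.n) ≤ s.W * (q * 2 ^ s.n) :=
      mul_le_mul_of_nonneg_right (by unfold W; linarith [abs_nonneg s.t]) hqp
    have e2 := mul_le_mul_of_nonneg_right (sum_two_pow_lt s.n).le (show 0 ≤ q by linarith)
    have e3 : (s.n : ℤ) * (s.n + 2) ≤ q := by rw [hq]; nlinarith
    show _ ≤ s.V
    nlinarith
  · show 2 * s.V < 2 ^ b; linarith [h.V_fits]
  · exact h.N₁_fits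
  · show (s.n : ℤ) + 1 < 2 ^ b; nlinarith [h.V_fits]
  · show (s.n : ℤ) + 1 < 2 ^ b; nlinarith [h.V_fits]
  · intro i hi
    refine h.fits ?_
    have := abs_w_le hi
    have : s.W ≤ s.W * (q * 2 ^ s.n) := by nlinarith
    simp only [Setup.enumParams]
    linarith
  · intro i hi
    exact h.fits ((hgi i hi).trans (by nlinarith))
  · intro i hi
    exact h.fits ((hwz i hi).trans (by linarith))
  · intro i hi
    have := hpow i hi
    exact h.fits (by rw [abs_of_nonneg (by positivity)]; linarith)
  · intro i hi
    exact h.fits ((hpz i hi).trans (by linarith))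
  · intro i hi
    have h1 := hwz i hi
    have h2 := hpz i hi
    exact h.fits ((abs_add_le (s.w i * z₁) (2 ^ i * z₂)).trans (by linarith))

end Setup


/-! ## Meet in the middle -/

/-- The items of the selected blocks. -/
def Setup.items (s : Setup) (sel : ℕ → Bool) : Finset ℕ :=
  (Finset.range s.n).filter fun i => sel (i / s.B)

/-- The sum of the numbers of a set of items. -/
def Setup.sum (s : Setup) (A : Finset ℕ) : ℤ := ∑ i ∈ A, s.w i

/-- The target, or the target for the complement of a solution. -/
def Setup.target (s : Setup) (neg : Bool) : ℤ := if neg then s.total - s.t else s.t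

/-- A program for `Setup.target`. -/
def targetExpr (neg : Bool) : Expr := if neg then .var 5 - .var 1 else .var 1 + .num 0

/-- The possible encoded subset sums with at most `c * B` summands. -/
def Setup.coded (s : Setup) (sel : ℕ → Bool) (c : ℕ) : Finset ℤ :=
  (((s.items sel).powerset).filter fun A => A.card ≤ c * s.B).image
    fun A => s.sum A * (s.n + 1) + A.card

/-- Block `j` contributes `1` if it is selected. -/
def blockFlag (sel : ℕ → Bool) (j : ℕ) : ℤ := if sel j then 1 else -1

namespace Setup

variable {s : Setup} {b : ℕ}

theorem abs_sum_le {A : Finset ℕ} (hA : A ⊆ Finset.range s.n) : |s.sum A| + |s.t| ≤ s.W := by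
  unfold Setup.sum W
  have := Finset.abs_sum_le_sum_abs s.w A
  have := Finset.sum_le_sum_of_subset_of_nonneg hA (f := fun i => |s.w i|)
    fun _ _ _ => abs_nonneg _
  linarith

theorem abs_sum_le' {A : Finset ℕ} (hA : A ⊆ Finset.range s.n) : |s.sum A| ≤ s.W := by
  linarith [abs_sum_le hA, abs_nonneg s.t]

theorem abs_target_le (neg : Bool) : |s.target neg| ≤ s.W := by
  have h := s.abs_sum_le (A := Finset.range s.n) subset_rfl
  have h' : s.sum (Finset.range s.n) = s.total := rfl
  rw [h'] at h
  unfold target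
  split_ifs
  · exact (abs_sub _ _).trans h
  · linarith [abs_nonneg s.total]

theorem Bounded.W_le (h : s.Bounded b) : 4 * (s.W + 1) ≤ s.V :=
  h.le_V (x := s.W + 1) (y := 1) (z := 1) le_rfl (by linarith [s.W_nonneg]) (by norm_num)
    (by norm_num) (one_le_pow₀ (by linarith [Int.natCast_nonneg s.n]))
    (one_le_pow₀ (by norm_num)) (by ring)

theorem Bounded.n_le (h : s.Bounded b) : 4 * ((s.n : ℤ) + 1) ≤ s.V := by
  have hn : (0 : ℤ) ≤ s.n := Int.natCast_nonneg s.n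
  refine h.le_V (x := 1) (y := s.n + 1) (z := 1) (by linarith [s.W_nonneg]) (by norm_num)
    (by linarith) (by norm_num) ?_ (one_le_pow₀ (by norm_num)) (by ring)
  exact le_self_pow₀ (by linarith) (by norm_num)

theorem items_subset (s : Setup) (sel : ℕ → Bool) : s.items sel ⊆ Finset.range s.n :=
  Finset.filter_subset _ _

theorem Bounded.params_coded (h : s.Bounded b) (sel : ℕ → Bool) (c : ℕ) :
    (s.enumParams (blockFlag sel) (s.n + 1) 0 (c * s.B + 1)).Bounded b := by
  have hn : (0 : ℤ) ≤ s.n := Int.natCast_nonneg s.n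
  refine h.enumParams _ ?_ (by linarith) ?_ le_rfl (by positivity)
  · intro j _
    unfold blockFlag
    split_ifs <;> simp <;> linarith
  · have h1 : (1 : ℤ) ≤ 2 ^ s.n := one_le_pow₀ (by norm_num)
    have h2 : (s.n + 1 : ℤ) ≤ (s.n + 1) ^ 2 := le_self_pow₀ (by linarith) (by norm_num)
    nlinarith

/-- Each item contributes its weight times `n + 1`, plus one. A set has at most `n` items, so the
residue modulo `n + 1` is the number of items, and cutting off at residue `c * B + 1` means a limit
on the cardinality. -/
theorem reach_coded (s : Setup) (sel : ℕ → Bool) (c : ℕ) :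
    (s.enumParams (blockFlag sel) (s.n + 1) 0 (c * s.B + 1)).reach s.n = s.coded sel c := by
  set p := s.enumParams (blockFlag sel) (s.n + 1) 0 (c * s.B + 1) with hp
  have hsel : ∀ i, p.sel i = sel (i / s.B) := by
    intro i
    simp only [hp, EnumParams.sel, Setup.enumParams, blockFlag]
    cases sel (i / s.B) <;> simp
  have hfil : (Finset.range s.n).filter (p.sel ·) = s.items sel := by
    simp only [items, hsel]
  have hE : ∀ A ⊆ s.items sel, ∑ i ∈ A, p.E i = s.sum A * (s.n + 1) + A.card := by
    intro A hA
    rw [Setup.sum, Finset.sum_mul, Finset.card_eq_sum_ones, Nat.cast_sum, ← Finset.sum_add_distrib]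
    refine Finset.sum_congr rfl fun i hi => ?_
    have := (Finset.mem_filter.1 (hA hi)).2
    simp [hp, EnumParams.E, Setup.enumParams, blockFlag, this]
  have key := mem_reach_iff (E := p.E) (sel := p.sel) (Z := p.Z) (c := p.c) (n := s.n)
    (fun A => A.card ≤ c * s.B) (by simp) (fun A A' h h' => (Finset.card_le_card h).trans h') (by
      intro A hA
      rw [hfil] at hA
      rw [hE A hA]
      have h1 : A.card ≤ s.n := by
        simpa using Finset.card_le_card (hA.trans (s.items_subset sel))
      simp only [hp, Setup.enumParams]
      rw [Int.add_comm, Int.add_mul_emod_self_right, Int.emod_eq_of_lt (by positivity) (by omega)]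
      constructor
      · intro h; exact_mod_cast Int.lt_add_one_iff.1 h
      · intro h; apply Int.lt_add_one_iff.2; exact_mod_cast h) s.n le_rfl
  ext v
  rw [show v ∈ p.reach s.n ↔ v ∈ reach p.E p.sel p.Z p.c s.n from Iff.rfl, key, hfil]
  simp only [coded, Finset.mem_image, Finset.mem_filter, Finset.mem_powerset, and_assoc]
  constructor
  · rintro ⟨A, hA, hc, hv⟩
    exact ⟨A, hA, hc, by rw [← hE A hA, hv]⟩
  · rintro ⟨A, hA, hc, hv⟩
    exact ⟨A, hA, hc, by rw [hE A hA, hv]⟩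

theorem code_div {A : Finset ℕ} (hA : A ⊆ Finset.range s.n) :
    (s.sum A * (s.n + 1) + A.card) / (s.n + 1 : ℤ) = s.sum A := by
  have h1 : A.card ≤ s.n := by simpa using Finset.card_le_card hA
  rw [add_comm, Int.add_mul_ediv_right _ _ (by positivity),
    Int.ediv_eq_zero_of_lt (by positivity) (by omega), zero_add]

theorem runs_set {b : ℕ} (hb : 1 ≤ b) {x : ℕ} {e : Expr} {v : ℤ} {σ : State} {Q : State → Prop}
    (hok : e.Ok b σ) (hv : e.eval σ = v) (hf : Stm.fitsIfVar b σ e) (hQ : Q (σ.setReg x v)) :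
    Runs b (Stm.code (.set x e)) σ (e.cost + 2) Q :=
  Stm.runs hb _ ⟨hok, hf⟩ (by simpa only [Stm.run, hv] using hQ)

end Setup

/-- Looks for a solution of at most `c * B` items in the selected blocks and at most `c * B` in the
other blocks. -/
def mitm (K : ℕ) (sel : ℕ → Bool) (c : ℕ) (neg : Bool) (fr : ℕ) : Prog :=
  .seq (Stm.code (.set 30 (.var 13 + .num 0) ;; .set 31 (.num 0) ;;
    .set 32 (.num c * .var 2 + .num 1) ;; .set 26 (targetExpr neg)))
  (.seq (fill K fun j => .num (blockFlag sel j))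
  -- Blank tables are the odd arrays from `11` on, three for each call: two for the enumerations and
  -- one for the marks. The even arrays from `10` on are reserved for the subroutine.
  (.seq (enum 4 (2 * fr + 11))
  (.seq (Stm.code (.set 27 (.var 33) ;; .set 40 (.num 0)))
  (.seq (fill K fun j => .num (blockFlag (fun j => !sel j) j))
  (.seq (enum 5 (2 * fr + 13))
  (.seq (whileLt 40 27 (Stm.code
    -- The shift by `3 * V` keeps the index nonnegative, both for the sums marked here and for the
    -- differences looked up in the last loop.
    (.put (2 * fr + 15) (.ld 4 (.var 40) / .var 13 + .num 3 * .var 15) (.num 1) ;;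
     .set 40 (.var 40 + .num 1))))
  (.seq (Stm.code (.set 40 (.num 0)))
  (whileLt 40 33 (Stm.code
    (.cond (.ld (2 * fr + 15) (.var 26 - .ld 5 (.var 40) / .var 13 + .num 3 * .var 15))
      (.set 17 (.num 1)) ;;
     .set 40 (.var 40 + .num 1)))))))))))

/-- All fresh tables from number `k` on are empty. -/
def Fresh (k : ℕ) (σ : State) : Prop := ∀ j ≥ k, ∀ i, σ.arr (2 * j + 11) i = 0

namespace Setup

variable {s : Setup} {b : ℕ}

/-- The registers changed by `mitm`. -/
def mitmRegs : Set ℕ := {r | r = 17 ∨ (26 ≤ r ∧ r ≤ 40)}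

/-- The arrays changed by `mitm`. -/
def mitmArrs (fr : ℕ) : Set ℕ :=
  {a | a = 1 ∨ a = 4 ∨ a = 5 ∨ a = 2 * fr + 11 ∨ a = 2 * fr + 13 ∨ a = 2 * fr + 15}

/-- The target for `neg` is a subset sum. -/
def Solvable (s : Setup) (neg : Bool) : Prop := ∃ S ⊆ Finset.range s.n, s.sum S = s.target neg

/-- `mitm` finds a solution. -/
def Found (s : Setup) (sel : ℕ → Bool) (c : ℕ) (neg : Bool) : Prop :=
  (s.coded sel c).card ≤ s.N₁ ∧ (s.coded (fun j => !sel j) c).card ≤ s.N₁ ∧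
    ∃ S ⊆ Finset.range s.n, s.sum S = s.target neg ∧
      (S ∩ s.items sel).card ≤ c * s.B ∧ (S ∩ s.items fun j => !sel j).card ≤ c * s.B

/-- Marking of the sums in a list. -/
theorem runs_mark (h : s.Bounded b) {mk : ℕ} (hmk : 5 < mk) {L : List ℤ} {σ : State}
    (h13 : σ.reg 13 = s.n + 1) (h15 : σ.reg 15 = s.V) (h27 : σ.reg 27 = L.length)
    (h40 : σ.reg 40 = 0)
    (hget : ∀ j (h : j < L.length), σ.arr 4 j = L[j]) (hlen : L.length ≤ s.N₁)
    (hz : ∀ i, σ.arr mk i = 0)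
    (hL : ∀ u ∈ L, |u| ≤ s.V ∧ |u / (s.n + 1 : ℤ)| ≤ s.W) :
    Runs b (whileLt 40 27 (Stm.code
      (.put mk (.ld 4 (.var 40) / .var 13 + .num 3 * .var 15) (.num 1) ;;
        .set 40 (.var 40 + .num 1)))) σ (s.N₁ * 32 + 2) fun σ' =>
      Same {40} {mk} σ σ' ∧ ∀ x : ℤ, |x| ≤ 2 * s.V → (σ'.arr mk (x + 3 * s.V).toNat = 0 ∨
          σ'.arr mk (x + 3 * s.V).toNat = 1) ∧
        (σ'.arr mk (x + 3 * s.V).toNat ≠ 0 ↔ ∃ u ∈ L, u / (s.n + 1 : ℤ) = x) := by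
  have hb := h.one_le
  have hV := h.V_pos
  have hWV := h.W_le
  have hW0 := s.W_nonneg
  refine Runs.mono (Runs.whileLt hb (fun j σ' => Same {40} {mk} σ σ' ∧ σ'.reg 40 = j ∧
    ∀ x : ℤ, |x| ≤ 2 * s.V → (σ'.arr mk (x + 3 * s.V).toNat = 0 ∨
          σ'.arr mk (x + 3 * s.V).toNat = 1) ∧ (σ'.arr mk (x + 3 * s.V).toNat ≠ 0 ↔
      ∃ j', ∃ h : j' < L.length, j' < j ∧ L[j'] / (s.n + 1 : ℤ) = x)) L.length 30 ?_ ?_ ?_)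
      (by have := Nat.mul_le_mul_right 32 hlen; omega) ?_
  · rintro j hj τ ⟨hs, h40, hτ⟩
    refine ⟨by rw [h40, hs.reg 27 (by simp), h27]; exact_mod_cast hj, ?_⟩
    obtain ⟨hu1, hu2⟩ := hL _ (List.getElem_mem hj)
    have hge : τ.arr 4 j = L[j] := by rw [hs.arr 4 (by simp; omega), hget j hj]
    rw [← hs.reg 13 (by simp)] at h13
    rw [← hs.reg 15 (by simp)] at h15
    set u := L[j] with hu
    have hu2' := abs_le.1 hu2
    have hjN : (j : ℤ) + 1 ≤ s.N₁ := by exact_mod_cast lt_of_lt_of_le hj hlen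
    refine Runs.mono (Stm.runs hb _ ?_ ?_) (Nat.le_of_ble_eq_true rfl) fun _ h => h
    · simp [Stm.Ok, Stm.run, Stm.fitsIfVar, h40, hge, h13, h15]
      have f1 := fits_one hb
      have f2 : Fits b u := h.fits (by linarith)
      have f3 : Fits b (u / (s.n + 1 : ℤ)) := h.fits (by linarith)
      have f4 : Fits b 3 := h.fits (by norm_num; linarith)
      have f5 : Fits b (3 * s.V) := h.fits (by rw [abs_of_nonneg (by linarith)]; linarith)
      have f6 : Fits b (u / (s.n + 1 : ℤ) + 3 * s.V) :=
        h.fits (by rw [abs_of_nonneg (by linarith)]; linarith)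
      have f7 : Fits b ((j : ℤ) + 1) := fits_of_nonneg h.N₁_fits (by positivity) (by linarith)
      have f8 : 0 ≤ u / (s.n + 1 : ℤ) + 3 * s.V := by linarith
      and_intros <;> assumption
    · simp only [Stm.run, Expr.eval_ld, Expr.eval_add, Expr.eval_div, Expr.eval_mul,
        Expr.eval_var, Expr.eval_num, h40, hge, h13, h15, Int.toNat_natCast]
      refine ⟨(hs.setArr (by simp) _ _).setReg (by simp) _, by simp [h40], fun x hx => ?_⟩
      have hx' := abs_le.1 hx
      have hiff : (x + 3 * s.V).toNat = (u / (s.n + 1 : ℤ) + 3 * s.V).toNat ↔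
          u / (s.n + 1 : ℤ) = x := by omega
      simp only [State.arr_setReg, State.arr_setArr, hiff, true_and]
      by_cases hxu : u / (s.n + 1 : ℤ) = x
      · simp only [hxu, if_true]
        exact ⟨by simp, by simpa using ⟨j, le_rfl, hj, hxu⟩⟩
      · simp only [hxu, if_false]
        refine ⟨(hτ x hx).1, (not_congr Iff.rfl).trans ((hτ x hx).2.trans ⟨?_, ?_⟩)⟩
        · rintro ⟨j', h1, h2, h3⟩; exact ⟨j', h1, by omega, h3⟩
        · rintro ⟨j', h1, h2, h3⟩
          refine ⟨j', h1, lt_of_le_of_ne (by omega) ?_, h3⟩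
          rintro rfl
          exact hxu h3
  · rintro τ ⟨hs, h40, -⟩
    rw [h40, hs.reg 27 (by simp), h27]; simp
  · exact ⟨Same.refl _ _ _, by simpa using h40, fun x _ => by simp [hz]⟩
  · rintro τ ⟨hs, -, hτ⟩
    refine ⟨hs, fun x hx => ⟨(hτ x hx).1, (hτ x hx).2.trans ⟨?_, ?_⟩⟩⟩
    · rintro ⟨j', h1, -, h3⟩; exact ⟨_, List.getElem_mem h1, h3⟩
    · rintro ⟨u, hu, h3⟩
      obtain ⟨j, hj, rfl⟩ := List.getElem_of_mem hu
      exact ⟨j, hj, hj, h3⟩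

/-- Comparison of the sums in a list with the marks. -/
theorem runs_probe (h : s.Bounded b) {mk : ℕ} {L L' : List ℤ} {σ : State} {T : ℤ}
    (h13 : σ.reg 13 = s.n + 1) (h15 : σ.reg 15 = s.V) (h33 : σ.reg 33 = L.length)
    (h40 : σ.reg 40 = 0) (h26 : σ.reg 26 = T) (hT : |T| ≤ s.W)
    (hget : ∀ j (h : j < L.length), σ.arr 5 j = L[j]) (hlen : L.length ≤ s.N₁)
    (hL : ∀ u ∈ L, |u| ≤ s.V ∧ |u / (s.n + 1 : ℤ)| ≤ s.W)
    (hmark : ∀ x : ℤ, |x| ≤ 2 * s.V → (σ.arr mk (x + 3 * s.V).toNat = 0 ∨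
          σ.arr mk (x + 3 * s.V).toNat = 1) ∧
        (σ.arr mk (x + 3 * s.V).toNat ≠ 0 ↔ ∃ u ∈ L', u / (s.n + 1 : ℤ) = x)) :
    Runs b (whileLt 40 33 (Stm.code
      (.cond (.ld mk (.var 26 - .ld 5 (.var 40) / .var 13 + .num 3 * .var 15))
        (.set 17 (.num 1)) ;; .set 40 (.var 40 + .num 1)))) σ (s.N₁ * 32 + 2) fun σ' =>
      Same {17, 40} ∅ σ σ' ∧
      (σ'.reg 17 = σ.reg 17 ∨ (σ'.reg 17 = 1 ∧
        ∃ u ∈ L', ∃ v ∈ L, u / (s.n + 1 : ℤ) + v / (s.n + 1 : ℤ) = T)) ∧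
      ((∃ u ∈ L', ∃ v ∈ L, u / (s.n + 1 : ℤ) + v / (s.n + 1 : ℤ) = T) → σ'.reg 17 = 1) := by
  have hb := h.one_le
  have hV := h.V_pos
  have hWV := h.W_le
  have hW0 := s.W_nonneg
  have hT' := abs_le.1 hT
  refine Runs.mono (Runs.whileLt hb (fun j σ' => Same {17, 40} ∅ σ σ' ∧ σ'.reg 40 = j ∧
      (σ'.reg 17 = σ.reg 17 ∨ (σ'.reg 17 = 1 ∧
        ∃ u ∈ L', ∃ v ∈ L, u / (s.n + 1 : ℤ) + v / (s.n + 1 : ℤ) = T)) ∧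
      ((∃ u ∈ L', ∃ j', ∃ h : j' < L.length, j' < j ∧
        u / (s.n + 1 : ℤ) + L[j'] / (s.n + 1 : ℤ) = T) → σ'.reg 17 = 1)) L.length 30 ?_ ?_ ?_)
      (by have := Nat.mul_le_mul_right 32 hlen; omega) ?_
  · rintro j hj τ ⟨hs, h40, hτ, hτ'⟩
    refine ⟨by rw [h40, hs.reg 33 (by simp), h33]; exact_mod_cast hj, ?_⟩
    obtain ⟨hu1, hu2⟩ := hL _ (List.getElem_mem hj)
    have hge : τ.arr 5 j = L[j] := by rw [hs.arr 5 (by simp), hget j hj]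
    rw [← hs.reg 13 (by simp)] at h13
    rw [← hs.reg 15 (by simp)] at h15
    rw [← hs.reg 26 (by simp)] at h26
    rw [← hs.arr mk (by simp)] at hmark
    set u := L[j] with hu
    have hu2' := abs_le.1 hu2
    have hjN : (j : ℤ) + 1 ≤ s.N₁ := by exact_mod_cast lt_of_lt_of_le hj hlen
    obtain ⟨hm1, hm2⟩ := hmark (T - u / (s.n + 1 : ℤ)) (abs_le.2 ⟨by linarith, by linarith⟩)
    refine Runs.mono (Stm.runs hb _ ?_ ?_) (Nat.le_of_ble_eq_true rfl) fun _ h => h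
    · simp [Stm.Ok, Stm.run, Stm.fitsIfVar, h40, hge, h13, h15, h26]
      have f1 := fits_one hb
      have f2 : Fits b u := h.fits (by linarith)
      have f3 : Fits b (u / (s.n + 1 : ℤ)) := h.fits (by linarith)
      have f4 : Fits b 3 := h.fits (by norm_num; linarith)
      have f5 : Fits b (3 * s.V) := h.fits (by rw [abs_of_nonneg (by linarith)]; linarith)
      have f6 : Fits b (T - u / (s.n + 1 : ℤ) + 3 * s.V) :=
        h.fits (by rw [abs_of_nonneg (by linarith)]; linarith)
      have f6' : Fits b (T - u / (s.n + 1 : ℤ)) :=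
        h.fits (abs_le.2 ⟨by linarith, by linarith⟩)
      have f8 : 0 ≤ T - u / (s.n + 1 : ℤ) + 3 * s.V := by linarith
      have f9 : Fits b (τ.arr mk (T - u / (s.n + 1 : ℤ) + 3 * s.V).toNat) := by
        rcases hm1 with h | h <;> rw [h]
        exacts [fits_zero b, f1]
      have f10 : Fits b ((j : ℤ) + 1) := fits_of_nonneg h.N₁_fits (by positivity) (by linarith)
      and_intros
      all_goals first | assumption | exact fun _ => f1 | (split_ifs <;> simpa [h40] using f10)
    · simp only [Stm.run, Expr.eval_ld, Expr.eval_add, Expr.eval_sub, Expr.eval_div, Expr.eval_mul,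
        Expr.eval_var, Expr.eval_num, h40, hge, h13, h15, h26, Int.toNat_natCast]
      split_ifs with hc
      · have hc' := hm2.1 hc
        obtain ⟨v, hv, hvT⟩ := hc'
        refine ⟨(hs.setReg (by simp) _).setReg (by simp) _, by simp [h40], Or.inr ⟨by simp, v, hv, u,
          List.getElem_mem hj, by linarith⟩, fun _ => by simp⟩
      · refine ⟨hs.setReg (by simp) _, by simp [h40], by simpa using hτ, ?_⟩
        rintro ⟨v, hv, j', h1, h2, h3⟩
        rcases Nat.lt_succ_iff_lt_or_eq.1 h2 with h4 | rfl
        · simpa using hτ' ⟨v, hv, j', h1, h4, h3⟩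
        · exact absurd (hm2.2 ⟨v, hv, by linarith⟩) hc
  · rintro τ ⟨hs, h40, -⟩
    rw [h40, hs.reg 33 (by simp), h33]; simp
  · exact ⟨Same.refl _ _ _, by simpa using h40, Or.inl rfl, by simp⟩
  · rintro τ ⟨hs, -, hτ, hτ'⟩
    refine ⟨hs, hτ, ?_⟩
    rintro ⟨u, hu, v, hv, h⟩
    obtain ⟨j, hj, rfl⟩ := List.getElem_of_mem hv
    exact hτ' ⟨u, hu, j, hj, hj, h⟩

theorem targetExpr_eval {σ : State} (h : s.In σ) (neg : Bool) :
    (targetExpr neg).eval σ = s.target neg := by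
  cases neg <;> simp [targetExpr, target, h.t, h.total]

theorem mem_coded_bounds (h : s.Bounded b) {sel : ℕ → Bool} {c : ℕ} {u : ℤ}
    (hu : u ∈ s.coded sel c) : |u| ≤ s.V ∧ |u / (s.n + 1 : ℤ)| ≤ s.W := by
  constructor
  · rw [← reach_coded] at hu
    exact EnumParams.abs_reach_le (h.params_coded sel c) le_rfl hu
  · simp only [coded, Finset.mem_image, Finset.mem_filter, Finset.mem_powerset] at hu
    obtain ⟨A, ⟨hA, -⟩, rfl⟩ := hu
    rw [code_div (hA.trans (s.items_subset sel))]
    exact abs_sum_le' (hA.trans (s.items_subset sel))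

/-- The state in which `enum` is called from `mitm`. -/
structure MitmReady (s : Setup) (c : ℕ) (neg : Bool) (σ : State) : Prop where
  base : s.In σ
  r30 : σ.reg 30 = s.n + 1
  r31 : σ.reg 31 = 0
  r32 : σ.reg 32 = c * s.B + 1
  r26 : σ.reg 26 = s.target neg

theorem MitmReady.of_same {c : ℕ} {neg : Bool} {A : Set ℕ} {σ σ' : State}
    (h : MitmReady s c neg σ) (hs : Same {r | r = 27 ∨ r = 40 ∨ r ∈ enumRegs} A σ σ') (h0 : 0 ∉ A) :
    MitmReady s c neg σ' where
  base := h.base.of_same (hs.mono (by intro r; simp [enumRegs, volatile]; omega) subset_rfl) h0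
  r30 := by rw [hs.reg 30 (by simp [enumRegs]), h.r30]
  r31 := by rw [hs.reg 31 (by simp [enumRegs]), h.r31]
  r32 := by rw [hs.reg 32 (by simp [enumRegs]), h.r32]
  r26 := by rw [hs.reg 26 (by simp [enumRegs]), h.r26]

theorem MitmReady.enumIn {sel : ℕ → Bool} {c : ℕ} {neg : Bool} {σ : State}
    (h : MitmReady s c neg σ) (hg : ∀ j < s.K, σ.arr 1 j = blockFlag sel j) :
    (s.enumParams (blockFlag sel) (s.n + 1) 0 (c * s.B + 1)).In σ where
  n := h.base.n
  B := h.base.B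
  N := h.base.N₁
  w := h.base.w
  g i hi := hg _ (Nat.div_lt_of_lt_mul (by rw [mul_comm]; exact hi))
  z₁ := h.r30
  z₂ := h.r31
  Z := h.base.Z
  c := h.r32
  V := h.base.V

/-- Filling the block array and enumerating the sums. -/
theorem runs_fill_enum (h : s.Bounded b) {sel : ℕ → Bool} {c : ℕ} {neg : Bool} {σ : State}
    (hr : MitmReady s c neg σ) {o tb : ℕ} (hot : o ≠ tb) (ho : 2 ≤ o) (ht : 2 ≤ tb)
    (hz : ∀ i, σ.arr tb i = 0) {p : Prog} {T : ℕ} {Q : State → Prop}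
    (hQ : ∀ σ', Same enumRegs {a | a = 1 ∨ a = o ∨ a = tb} σ σ' → MitmReady s c neg σ' →
      (∃ L : List ℤ, σ'.reg 33 = L.length ∧ L.length ≤ s.N₁ ∧
        (∀ j (h : j < L.length), σ'.arr o j = L[j]) ∧ (∀ u ∈ L, u ∈ s.coded sel c) ∧
        ((s.coded sel c).card ≤ s.N₁ → ∀ u ∈ s.coded sel c, u ∈ L)) → Runs b p σ' T Q) :
    Runs b (.seq (fill s.K fun j => .num (blockFlag sel j)) (.seq (enum o tb) p)) σ
      ((s.K * 3 + 1) + ((s.n + 1) * (62 * s.N₁ + 60) + T)) Q := by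
  have hb := h.one_le
  have hK : (s.K : ℤ) ≤ s.n := by exact_mod_cast Nat.le_mul_of_pos_right _ h.B_pos
  refine (runs_fill hb (g := blockFlag sel) (lt_of_le_of_lt (by linarith [h.n_le]) h.V_fits) σ
    ?_).seq fun σ₁ ⟨hs₁, hg⟩ => ?_
  · intro j _ τ _
    refine ⟨?_, rfl, rfl⟩
    rw [Expr.ok_num]
    unfold blockFlag
    split_ifs
    exacts [fits_one hb, fits_neg_one hb]
  have hr₁ : MitmReady s c neg σ₁ := hr.of_same (hs₁.mono (Set.empty_subset _) subset_rfl) (by simp)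
  refine (runs_enum (h.params_coded sel c) hot ho ht (hr₁.enumIn hg) (by
    rw [hs₁.arr tb (by simp; omega)]; exact hz)).seq fun σ₂ ⟨hs₂, L, hL⟩ => ?_
  have hco : (s.enumParams (blockFlag sel) (s.n + 1) 0 (c * s.B + 1)).reach
      (s.enumParams (blockFlag sel) (s.n + 1) 0 (c * s.B + 1)).n = s.coded sel c := reach_coded s sel c
  refine hQ σ₂ ((hs₁.mono (Set.empty_subset _) (by intro a; simp; omega)).trans
    (hs₂.mono subset_rfl (by intro a; simp; omega)))
    (hr₁.of_same (hs₂.mono (by intro r; simp; tauto) subset_rfl) (by simp; omega))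
    ⟨L, hL.length, hL.length_le, hL.get, ?_, ?_⟩
  · rw [← hco]; exact hL.sound
  · rw [← hco]; exact hL.complete

/-- The running time of `mitm`. -/
def mitmTime (s : Setup) : ℕ := 2 * ((s.K * 3 + 1) + (s.n + 1) * (62 * s.N₁ + 60)) +
  2 * (s.N₁ * 32 + 2) + 60

/-- Acceptance is sound without any condition: a hit consists of two sets from complementary
collections of blocks, and their union has the right sum. Only completeness requires that neither
list outgrows the cap. -/
theorem runs_mitm (h : s.Bounded b) (sel : ℕ → Bool) {c : ℕ} (hc : c ≤ s.K) (neg : Bool) {fr : ℕ}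
    {σ : State} (hσ : s.In σ) (hfr : Fresh fr σ) :
    Runs b (mitm s.K sel c neg fr) σ s.mitmTime fun σ' =>
      Same mitmRegs (mitmArrs fr) σ σ' ∧
      (σ'.reg 17 = σ.reg 17 ∨ (σ'.reg 17 = 1 ∧ s.Solvable neg)) ∧
      (s.Found sel c neg → σ'.reg 17 = 1) := by
  have hb := h.one_le
  have hV := h.V_pos
  have hWV := h.W_le
  have hW0 := s.W_nonneg
  have hnV := h.n_le
  have hcB : (c * s.B : ℤ) ≤ s.n := by
    rw [Setup.n]; exact_mod_cast Nat.mul_le_mul_right _ hc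
  have hcn : (c : ℤ) ≤ s.n := by
    exact_mod_cast hc.trans (Nat.le_mul_of_pos_right _ h.B_pos)
  have hcB0 : (0 : ℤ) ≤ c * s.B := by positivity
  have hT := abs_le.1 (s.abs_target_le neg)
  refine Runs.mono ((Stm.runs hb _ (Q := fun σ' => Same mitmRegs (mitmArrs fr) σ σ' ∧
    σ'.arr = σ.arr ∧ σ'.reg 17 = σ.reg 17 ∧ MitmReady s c neg σ') ?_ ?_).seq
    (T' := 2 * ((s.K * 3 + 1) + (s.n + 1) * (62 * s.N₁ + 60)) +
      2 * (s.N₁ * 32 + 2) + 20) ?_) ?_ fun _ h => h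
  · have f1 := fits_one hb
    have f0 := fits_zero b
    have f2 : Fits b ((s.n : ℤ) + 1) := h.fits (by rw [abs_of_nonneg (by positivity)]; linarith)
    have f3 : Fits b (c : ℤ) := h.fits (by rw [abs_of_nonneg (by positivity)]; linarith)
    have f4 : Fits b (c * s.B : ℤ) := h.fits (by rw [abs_of_nonneg (by positivity)]; linarith)
    have f5 : Fits b (c * s.B + 1 : ℤ) := h.fits (by rw [abs_of_nonneg (by positivity)]; linarith)
    have f6 : Fits b (s.target neg) := h.fits (abs_le.2 ⟨by linarith, by linarith⟩)
    have f7 : (targetExpr neg).Ok b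
        (((σ.setReg 30 (s.n + 1)).setReg 31 0).setReg 32 (c * s.B + 1)) := by
      cases neg <;> simp [targetExpr, hσ.t, hσ.total]
      · exact ⟨f0, f6⟩
      · exact f6
    have f8 : ∀ τ, Stm.fitsIfVar b τ (targetExpr neg) := fun τ => by
      cases neg <;> exact trivial
    simp [Stm.Ok, Stm.run, hσ.Z, hσ.B]
    refine ⟨⟨⟨f0, f2⟩, trivial⟩, ⟨f0, trivial⟩, ⟨⟨⟨f3, f4⟩, f1, f5⟩, trivial⟩, f7, f8 _⟩
  · simp only [Stm.run]
    have hs : Same mitmRegs (mitmArrs fr) σ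
        ((((σ.setReg 30 (s.n + 1)).setReg 31 0).setReg 32 (c * s.B + 1)).setReg 26 (s.target neg)) :=
      ((((Same.refl _ _ σ).setReg (by simp [mitmRegs]) _).setReg (by simp [mitmRegs]) _).setReg
        (by simp [mitmRegs]) _).setReg (by simp [mitmRegs]) _
    have hIn := hσ.of_same (A := ∅) (σ' := ((σ.setReg 30 (s.n + 1)).setReg 31 0).setReg 32
      (c * s.B + 1)) ((((Same.refl _ _ σ).setReg (by simp [volatile]) _).setReg
        (by simp [volatile]) _).setReg (by simp [volatile]) _) (by simp)
    have e1 : (Expr.var 13 + Expr.num 0).eval σ = s.n + 1 := by simp [hσ.Z]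
    have e2 : (Expr.num c * Expr.var 2 + Expr.num 1).eval ((σ.setReg 30 (s.n + 1)).setReg 31 0) =
      c * s.B + 1 := by simp [hσ.B]
    rw [e1, Expr.eval_num, e2, targetExpr_eval hIn]
    refine ⟨hs, rfl, by simp, hσ.of_same (A := ∅) ⟨fun r hr => hs.reg r ?_, fun _ _ => rfl⟩ (by simp),
      by simp, by simp, by simp, by simp⟩
    exact fun h => hr (by simp [mitmRegs, volatile] at h ⊢; omega)
  · rintro σ₁ ⟨hs₁, ha₁, h17₁, hr₁⟩
    have hfr₁ : ∀ j ≥ fr, ∀ i, σ₁.arr (2 * j + 11) i = 0 := by rw [ha₁]; exact hfr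
    refine Runs.mono (runs_fill_enum h hr₁ (o := 4) (by omega) (by omega) (by omega) (hfr₁ fr le_rfl)
      (T := ((s.K * 3 + 1) + (s.n + 1) * (62 * s.N₁ + 60)) + 2 * (s.N₁ * 32 + 2) + 18) ?_) (by omega)
      fun _ h => h
    rintro σ₂ hs₂ hr₂ ⟨L, hL1, hL2, hL3, hL4, hL5⟩
    have hLN : (L.length : ℤ) + 1 ≤ s.N₁ + 1 := by exact_mod_cast Nat.succ_le_succ hL2
    refine Runs.mono ((Stm.runs hb _ (Q := fun σ' => Same {27, 40} ∅ σ₂ σ' ∧ σ'.reg 27 = L.length ∧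
      σ'.reg 40 = 0) ?_ ?_).seq
      (T' := ((s.K * 3 + 1) + (s.n + 1) * (62 * s.N₁ + 60)) + 2 * (s.N₁ * 32 + 2) + 10) ?_)
      (T := 6 + (((s.K * 3 + 1) + (s.n + 1) * (62 * s.N₁ + 60)) + 2 * (s.N₁ * 32 + 2) + 10))
      (by omega) fun _ h => h
    · simp [Stm.Ok, Stm.run, Stm.fitsIfVar, hL1]
      exact ⟨fits_of_nonneg h.N₁_fits (by positivity) (by linarith), fits_zero b⟩
    · simp only [Stm.run, Expr.eval_var, Expr.eval_num, hL1]
      exact ⟨((Same.refl _ _ _).setReg (by simp) _).setReg (by simp) _, by simp, by simp⟩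
    rintro σ₃ ⟨hs₃, h27₃, h40₃⟩
    have hr₃ := hr₂.of_same (hs₃.mono (by intro r; simp; omega) (Set.empty_subset {1})) (by simp)
    refine Runs.mono (runs_fill_enum h hr₃ (o := 5) (tb := 2 * fr + 13) (by omega) (by omega)
      (by omega) (T := 2 * (s.N₁ * 32 + 2) + 9) ?_ ?_) (by omega) fun _ h => h
    · intro i
      rw [hs₃.arr _ (by simp), hs₂.arr _ (by simp)]
      exact hfr₁ (fr + 1) (by omega) i
    rintro σ₄ hs₄ hr₄ ⟨L', hL'1, hL'2, hL'3, hL'4, hL'5⟩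
    refine Runs.mono ((runs_mark h (mk := 2 * fr + 15) (by omega) (L := L) hr₄.base.Z hr₄.base.V
      (by rw [hs₄.reg 27 (by simp [enumRegs]), h27₃]) (by rw [hs₄.reg 40 (by simp [enumRegs]), h40₃])
      ?_ hL2 ?_ fun u hu => mem_coded_bounds h (hL4 u hu)).seq
      (T' := s.N₁ * 32 + 7) ?_) (by omega) fun _ h => h
    · intro j hj
      rw [hs₄.arr 4 (by simp), hs₃.arr 4 (by simp), hL3 j hj]
    · intro i
      rw [hs₄.arr _ (by simp), hs₃.arr _ (by simp), hs₂.arr _ (by simp)]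
      exact hfr₁ (fr + 2) (by omega) i
    rintro σ₅ ⟨hs₅, hmark⟩
    refine Runs.mono ((Stm.runs hb (.set 40 (.num 0)) (Q := fun σ' => σ' = σ₅.setReg 40 0)
      ?_ ?_).seq (T' := s.N₁ * 32 + 2) ?_)
      (T := 3 + (s.N₁ * 32 + 2)) (by omega) fun _ h => h
    · exact ⟨fits_zero b, trivial⟩
    · rfl
    rintro _ rfl
    have hr₆ : MitmReady s c neg (σ₅.setReg 40 0) :=
      hr₄.of_same ((hs₅.mono (by intro r; simp; omega) subset_rfl).setReg (by simp) 0)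
        (by simp)
    refine Runs.mono (runs_probe h (mk := 2 * fr + 15) (L := L') (L' := L) hr₆.base.Z hr₆.base.V ?_ (by simp)
      hr₆.r26 (s.abs_target_le neg) ?_ hL'2 (fun u hu => mem_coded_bounds h (hL'4 u hu)) hmark) le_rfl ?_
    · simp [hs₅.reg 33, hL'1]
    · intro j hj
      rw [State.arr_setReg, hs₅.arr 5 (by simp), hL'3 j hj]
    rintro σ₇ ⟨hs₇, hfound, hcomp⟩
    have hdisj : Disjoint (s.items sel) (s.items fun j => !sel j) := by
      rw [Finset.disjoint_left]
      intro i hi hi'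
      have h1 := (Finset.mem_filter.1 hi).2
      have h2 := (Finset.mem_filter.1 hi').2
      simp [h1] at h2
    have hM : ∀ r, r ∉ mitmRegs → r ∉ enumRegs ∧ r ≠ 27 ∧ r ≠ 40 ∧ r ≠ 17 := by
      intro r hr
      simp [mitmRegs, enumRegs] at hr ⊢
      omega
    refine ⟨⟨fun r hr => ?_, fun a ha => ?_⟩, ?_, ?_⟩
    · obtain ⟨h1, h2, h3, h4⟩ := hM r hr
      rw [hs₇.reg r (by simp [h3, h4]), State.reg_setReg, if_neg h3, hs₅.reg r (by simp [h3]),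
        hs₄.reg r h1, hs₃.reg r (by simp [h2, h3]), hs₂.reg r h1, hs₁.reg r hr]
    · simp only [mitmArrs, Set.mem_ofPred_eq, not_or] at ha
      rw [hs₇.arr a (by simp), State.arr_setReg, hs₅.arr a (by simp [ha]),
        hs₄.arr a (by simp [ha]), hs₃.arr a (by simp), hs₂.arr a (by simp [ha]), ha₁]
    · refine hfound.imp (fun h => ?_) ?_
      · rw [h, State.reg_setReg, if_neg (by norm_num), hs₅.reg 17 (by simp),
          hs₄.reg 17 (by simp [enumRegs]), hs₃.reg 17 (by simp), hs₂.reg 17 (by simp [enumRegs]), h17₁]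
      · rintro ⟨h1, u, hu, v, hv, huv⟩
        refine ⟨h1, ?_⟩
        have hu' := hL4 u hu
        have hv' := hL'4 v hv
        simp only [coded, Finset.mem_image, Finset.mem_filter, Finset.mem_powerset] at hu' hv'
        obtain ⟨A, ⟨hA, -⟩, rfl⟩ := hu'
        obtain ⟨A', ⟨hA', -⟩, rfl⟩ := hv'
        rw [code_div (hA.trans (s.items_subset _)), code_div (hA'.trans (s.items_subset _))] at huv
        refine ⟨A ∪ A', Finset.union_subset (hA.trans (s.items_subset _))
          (hA'.trans (s.items_subset _)), ?_⟩
        rw [← huv, Setup.sum, Finset.sum_union (Finset.disjoint_of_subset_left hA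
          (Finset.disjoint_of_subset_right hA' hdisj))]
        rfl
    · rintro ⟨hc1, hc2, S, hS, hsum, hcS, hcS'⟩
      -- The two parts of `S`, in the selected blocks and in the others, occur in the two complete
      -- lists.
      refine hcomp ⟨_, hL5 hc1 _ (Finset.mem_image_of_mem _ (Finset.mem_filter.2
        ⟨Finset.mem_powerset.2 Finset.inter_subset_right, hcS⟩)), _, hL'5 hc2 _
        (Finset.mem_image_of_mem _ (Finset.mem_filter.2
        ⟨Finset.mem_powerset.2 Finset.inter_subset_right, hcS'⟩)), ?_⟩
      rw [code_div (Finset.inter_subset_left.trans hS), code_div (Finset.inter_subset_left.trans hS),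
        ← hsum, Setup.sum, Setup.sum, ← Finset.sum_union (Finset.disjoint_of_subset_left
          Finset.inter_subset_right (Finset.disjoint_of_subset_right
          Finset.inter_subset_right hdisj)), ← Finset.inter_union_distrib_left]
      refine Finset.sum_congr ?_ fun _ _ => rfl
      rw [Finset.inter_eq_left]
      intro i hi
      have := hS hi
      simp only [items, Finset.mem_union, Finset.mem_filter]
      cases sel (i / s.B) <;> simp [Finset.mem_range.1 this]
  · have : (Stm.cost (.set 30 (.var 13 + .num 0) ;; .set 31 (.num 0) ;;
      .set 32 (.num c * .var 2 + .num 1) ;; .set 26 (targetExpr neg))) ≤ 40 := by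
      cases neg <;> exact Nat.le_of_ble_eq_true rfl
    unfold mitmTime
    omega

end Setup


/-! ## Generation of the vertices of a layer -/

/-- The random data: a multiplicative hash function modulo `M` with four offsets. -/
structure Hash where
  D : ℤ
  M : ℤ
  a : ℤ
  off : ℕ → ℤ
  cap : ℕ

namespace Hash

/-- The hash data are found in the state. -/
structure In (h : Hash) (n : ℕ) (σ : State) : Prop where
  D : σ.reg 6 = h.D
  M : σ.reg 7 = h.M
  a : σ.reg 8 = h.a
  off : ∀ v < 4, σ.reg (9 + v) = h.off v
  pow : σ.reg 14 = 2 ^ n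
  cap : σ.reg 19 = h.cap + 1
  z₂ : σ.reg 21 = (n + 1) ^ 2
  z₁ : σ.reg 22 = (n + 1) ^ 2 * 2 ^ n

theorem In.of_same {h : Hash} {n : ℕ} {A : Set ℕ} {σ σ' : State} (hσ : h.In n σ)
    (hs : Same Setup.volatile A σ σ') : h.In n σ' := by
  constructor
  · rw [hs.reg 6 (by simp [Setup.volatile]), hσ.D]
  · rw [hs.reg 7 (by simp [Setup.volatile]), hσ.M]
  · rw [hs.reg 8 (by simp [Setup.volatile]), hσ.a]
  · intro v hv; rw [hs.reg (9 + v) (by simp [Setup.volatile]; omega), hσ.off v hv]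
  · rw [hs.reg 14 (by simp [Setup.volatile]), hσ.pow]
  · rw [hs.reg 19 (by simp [Setup.volatile]), hσ.cap]
  · rw [hs.reg 21 (by simp [Setup.volatile]), hσ.z₂]
  · rw [hs.reg 22 (by simp [Setup.volatile]), hσ.z₁]

/-- No overflow occurs. -/
structure Bounded (h : Hash) (s : Setup) (b : ℕ) : Prop where
  M_pos : 0 < h.M
  D_nonneg : 0 ≤ h.D
  D_le : h.D ≤ h.M
  a_nonneg : 0 ≤ h.a
  a_le : h.a ≤ h.M
  off_nonneg : ∀ v < 4, 0 ≤ h.off v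
  off_le : ∀ v < 4, h.off v ≤ h.M
  fits : 4 * h.M * (s.W + 1) < 2 ^ b

end Hash

/-- The kinds of blocks in a layer: those with role `x` and those with role `y`, whose selected items
are counted, and the blocks with role `u`. -/
structure Layer where
  x : ℕ
  y : ℕ
  u : ℕ

/-- The four layers. -/
def layer : ℕ → Layer
  -- All roles are below `5`, so the number `5` stands for a kind of block that is absent.
  | 0 => ⟨0, 5, 3⟩
  | 1 => ⟨0, 1, 5⟩
  | 2 => ⟨1, 2, 5⟩
  | _ => ⟨2, 5, 4⟩

/-- The contribution of a role to the code of a set. -/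
def Layer.flag (l : Layer) (Z : ℤ) (r : ℕ) : ℤ :=
  if r = l.x then 1 else if r = l.y then Z else if r = l.u then 0 else -1

/-- A program for `Layer.flag`. -/
def Layer.expr (l : Layer) (r : ℕ) : Expr :=
  if r = l.x then .num 1 else if r = l.y then .var 13 else if r = l.u then .num 0 else .num (-1)

/-- The roles that occur in a layer. -/
def Layer.sel (l : Layer) (ρ : ℕ → ℕ) (j : ℕ) : Bool := ρ j = l.x ∨ ρ j = l.y ∨ ρ j = l.u

/-- The mask of a set of items. -/
def mask (A : Finset ℕ) : ℤ := ∑ i ∈ A, 2 ^ i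

/-- The code of a layer: four of them add up to zero only if they are all different. -/
def layerCode : ℕ → ℤ
  | 0 => 1
  | 1 => 5
  | 2 => 25
  | _ => -31

namespace Setup

variable (s : Setup)

/-- The items in blocks of role `r`. -/
def part (ρ : ℕ → ℕ) (r : ℕ) : Finset ℕ := s.items fun j => ρ j = r

/-- The weight of a vertex. The tag of a vertex is five times the number of its part of the graph
plus the number of its layer. -/
def weight (x : ℕ × Finset ℕ) : ℤ :=
  s.sum x.2 * 128 + layerCode (x.1 % 5) - s.t * (if x.1 % 5 = 3 then 128 else 0)

/-- The sets that are used as vertices of a layer. -/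
def IsVertex (h : Hash) (ρ : ℕ → ℕ) (v : ℕ) (A : Finset ℕ) : Prop :=
  A ⊆ s.items ((layer v).sel ρ) ∧ (A ∩ s.part ρ (layer v).x).card ≤ h.cap ∧
    (A ∩ s.part ρ (layer v).y).card ≤ h.cap ∧ (h.a * s.sum A + h.off v) % h.M < h.D * 2

/-- The list of vertices is found in the state. -/
structure Vertices (ns : List (ℕ × Finset ℕ)) (σ : State) : Prop where
  length : σ.reg 18 = ns.length
  mask : ∀ j (h : j < ns.length), σ.arr 2 j = mask ns[j].2
  tag : ∀ j (h : j < ns.length), σ.arr 3 j = ns[j].1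
  weight : ∀ j (h : j < ns.length), σ.arr 10 j = s.weight ns[j]
  rest : ∀ j ≥ ns.length, σ.arr 10 j = 0

end Setup

/-- The decoding of a set of items. -/
def genDecode : Stm :=
  .set 41 (.ld 4 (.var 40)) ;;
  .set 42 (.var 41 / .var 21) ;;
  .set 43 (.var 42 % .var 14) ;;
  .set 44 (.var 42 / .var 14)

/-- The test of a set of items, and the creation of a vertex. -/
def genTest (v tag : ℕ) : Stm :=
  .cond (.bin .lt (.var 41 % .var 13) (.var 19))
    (.cond (.bin .lt (.var 41 / .var 13 % .var 13) (.var 19))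
      (.cond (.bin .lt ((.var 8 * .var 44 + .var (9 + v)) % .var 7) (.var 6 * .num 2))
        (.put 2 (.var 18) (.var 43) ;;
         .put 3 (.var 18) (.num tag) ;;
         .put 10 (.var 18) (.var 44 * .num 128 + .num (layerCode v) -
           .var 1 * .num (if v = 3 then 128 else 0)) ;;
         .set 18 (.var 18 + .num 1)))) ;;
  .set 40 (.var 40 + .num 1)

/-- The creation of the vertices of a layer. -/
def gen (K : ℕ) (ρ : ℕ → ℕ) (v tag tb : ℕ) : Prog :=
  .seq (Stm.code (.set 30 (.var 22 + .num 0) ;; .set 31 (.var 21 + .num 0) ;;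
    .set 32 (.var 13 + .num 0)))
  (.seq (fill K fun j => (layer v).expr (ρ j))
  (.seq (enum 4 tb)
  (.seq (Stm.code (.set 40 (.num 0)))
  (whileLt 40 33 (.seq genDecode.code (genTest v tag).code)))))

/-! ### Sets of items as numbers with several digits. -/

namespace Setup

variable {s : Setup} {b : ℕ}

theorem Bounded.W_le' (h : s.Bounded b) : 64 * (s.W + 1) ≤ s.V := by
  have hn : (1 : ℤ) ≤ s.n := by exact_mod_cast h.n_pos
  have h8 : (8 : ℤ) ≤ (s.n + 1) ^ 3 := by
    have : (2 : ℤ) ^ 3 ≤ (s.n + 1) ^ 3 := pow_le_pow_left₀ (by norm_num) (by linarith) 3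
    linarith
  have h2 : (2 : ℤ) ≤ 2 ^ s.n := by
    have : (2 : ℤ) ^ 1 ≤ 2 ^ s.n := pow_le_pow_right₀ (by norm_num) h.n_pos
    linarith
  have := h.le_V (x := s.W + 1) (y := 8) (z := 2) le_rfl (by linarith [s.W_nonneg]) (by norm_num)
    (by norm_num) h8 h2 rfl
  linarith

theorem mask_nonneg (A : Finset ℕ) : 0 ≤ mask A := Finset.sum_nonneg fun _ _ => by positivity

theorem mask_lt {A : Finset ℕ} (hA : A ⊆ Finset.range s.n) : mask A < 2 ^ s.n :=
  lt_of_le_of_lt (Finset.sum_le_sum_of_subset_of_nonneg hA fun _ _ _ => by positivity)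
    (sum_two_pow_lt s.n)

/-- The parameters of the enumeration of a layer. -/
def layerParams (s : Setup) (ρ : ℕ → ℕ) (v : ℕ) : EnumParams :=
  s.enumParams (fun j => (layer v).flag (s.n + 1) (ρ j)) ((s.n + 1) ^ 2 * 2 ^ s.n) ((s.n + 1) ^ 2)
    (s.n + 1)

/-- The code of a set of items in a layer. -/
def code (s : Setup) (ρ : ℕ → ℕ) (v : ℕ) (A : Finset ℕ) : ℤ :=
  (s.sum A * 2 ^ s.n + mask A) * (s.n + 1) ^ 2 +
    ((A ∩ s.part ρ (layer v).y).card * (s.n + 1) + (A ∩ s.part ρ (layer v).x).card)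

theorem Bounded.layerParams (h : s.Bounded b) (ρ : ℕ → ℕ) (v : ℕ) :
    (s.layerParams ρ v).Bounded b := by
  have hn : (0 : ℤ) ≤ s.n := Int.natCast_nonneg s.n
  refine h.enumParams _ ?_ (by positivity) le_rfl (by positivity) le_rfl
  intro j _
  simp only [Layer.flag]
  split_ifs
  · simp; linarith
  · rw [abs_of_nonneg (by linarith)]; linarith
  · simp; linarith
  · simp; linarith

theorem layerParams_sel (s : Setup) (ρ : ℕ → ℕ) (v i : ℕ) :
    (s.layerParams ρ v).sel i = (layer v).sel ρ (i / s.B) := by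
  have hn : (0 : ℤ) ≤ s.n := Int.natCast_nonneg s.n
  simp only [EnumParams.sel, Setup.layerParams, Setup.enumParams, Layer.flag, Layer.sel]
  congr 1
  apply propext
  split_ifs with h1 h2 h3
  · simp [h1]
  · simp [h2]
  · simp [h3]
  · simp [h1, h2, h3]

theorem layer_ne (v : ℕ) : (layer v).x ≠ (layer v).y := by
  unfold layer; split <;> simp

/-- The flags `1`, `n + 1` and `0` turn the sum into a positional system: the two lowest digits to
the base `n + 1` count the items in the parts `x` and `y`, and above them stand the mask and the sum
of weights. -/
theorem sum_E_layerParams (ρ : ℕ → ℕ) (v : ℕ) {A : Finset ℕ}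
    (hA : A ⊆ s.items ((layer v).sel ρ)) : ∑ i ∈ A, (s.layerParams ρ v).E i = s.code ρ v A := by
  have h1 : ∀ r, ((A ∩ s.part ρ r).card : ℤ) = ∑ i ∈ A, if ρ (i / s.B) = r then 1 else 0 := by
    intro r
    rw [Finset.sum_boole]
    congr 2
    ext i
    simp only [part, items, Finset.mem_inter, Finset.mem_filter, decide_eq_true_eq]
    constructor
    · rintro ⟨h, -, h'⟩; exact ⟨h, h'⟩
    · rintro ⟨h, h'⟩; exact ⟨h, (Finset.mem_filter.1 (hA h)).1, h'⟩
  rw [code, h1, h1, Setup.sum, mask, add_mul, Finset.sum_mul, Finset.sum_mul, Finset.sum_mul,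
    Finset.sum_mul, ← Finset.sum_add_distrib, ← Finset.sum_add_distrib, ← Finset.sum_add_distrib]
  refine Finset.sum_congr rfl fun i hi => ?_
  have hsel := (Finset.mem_filter.1 (hA hi)).2
  have hne := layer_ne v
  simp only [Layer.sel, decide_eq_true_eq] at hsel
  simp only [EnumParams.E, Setup.layerParams, Setup.enumParams, Layer.flag]
  by_cases c1 : ρ (i / s.B) = (layer v).x
  · have c2 : ρ (i / s.B) ≠ (layer v).y := fun h => hne (c1.symm.trans h)
    rw [if_pos c1, if_pos c1, if_neg c2]; ring
  · rw [if_neg c1, if_neg c1]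
    by_cases c2 : ρ (i / s.B) = (layer v).y
    · rw [if_pos c2, if_pos c2]; ring
    · rw [if_neg c2, if_neg c2, if_pos (by tauto)]; ring

theorem reach_layer (s : Setup) (ρ : ℕ → ℕ) (v : ℕ) (x : ℤ) :
    x ∈ (s.layerParams ρ v).reach s.n ↔
      ∃ A ⊆ s.items ((layer v).sel ρ), s.code ρ v A = x := by
  have hfil : (Finset.range s.n).filter ((s.layerParams ρ v).sel ·) = s.items ((layer v).sel ρ) := by
    simp only [items, layerParams_sel]
  have key := mem_reach_iff (E := (s.layerParams ρ v).E) (sel := (s.layerParams ρ v).sel)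
    (Z := (s.layerParams ρ v).Z) (c := (s.layerParams ρ v).c) (n := s.n)
    -- The bound on the residue is the modulus itself, so nothing is pruned here. The caps on the
    -- two parts are tested when the code is read.
    (fun _ => True) trivial (fun _ _ _ _ => trivial) (fun A _ =>
      ⟨fun _ => trivial, fun _ => Int.emod_lt_of_pos _ (Int.lt_add_one_of_le (Int.natCast_nonneg _))⟩)
    s.n le_rfl x
  rw [show x ∈ (s.layerParams ρ v).reach s.n ↔ x ∈ reach _ _ _ _ s.n from Iff.rfl, key, hfil]
  constructor
  · rintro ⟨A, hA, -, hx⟩; exact ⟨A, hA, by rw [← sum_E_layerParams ρ v hA, hx]⟩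
  · rintro ⟨A, hA, hx⟩; exact ⟨A, hA, trivial, by rw [sum_E_layerParams ρ v hA, hx]⟩

section
variable {ρ : ℕ → ℕ} {v : ℕ} {A : Finset ℕ}

theorem card_inter_le (hA : A ⊆ Finset.range s.n) (A' : Finset ℕ) :
    ((A ∩ A').card : ℤ) ≤ s.n := by
  exact_mod_cast le_trans (Finset.card_le_card (Finset.inter_subset_left.trans hA)) (by simp)

/-- Both counts are at most `n`, so the two low digits stay below `(n + 1) ^ 2` and there is no
carry. The other digits are recovered in the same way. -/
theorem code_ediv (hA : A ⊆ Finset.range s.n) :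
    s.code ρ v A / (s.n + 1) ^ 2 = s.sum A * 2 ^ s.n + mask A := by
  have h1 := card_inter_le hA (s.part ρ (layer v).x)
  have h2 := card_inter_le hA (s.part ρ (layer v).y)
  rw [code, add_comm, Int.add_mul_ediv_right _ _ (by positivity),
    Int.ediv_eq_zero_of_lt (by positivity) (by nlinarith), zero_add]

theorem code_emod (hA : A ⊆ Finset.range s.n) :
    s.code ρ v A % (s.n + 1) = (A ∩ s.part ρ (layer v).x).card := by
  have h1 := card_inter_le hA (s.part ρ (layer v).x)
  rw [code, show (s.sum A * 2 ^ s.n + mask A) * ((s.n : ℤ) + 1) ^ 2 +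
    ((A ∩ s.part ρ (layer v).y).card * (s.n + 1) + (A ∩ s.part ρ (layer v).x).card) =
    (A ∩ s.part ρ (layer v).x).card + ((s.sum A * 2 ^ s.n + mask A) * (s.n + 1) +
      (A ∩ s.part ρ (layer v).y).card) * (s.n + 1) by ring, Int.add_mul_emod_self_right,
    Int.emod_eq_of_lt (by positivity) (by linarith)]

theorem code_ediv_emod (hA : A ⊆ Finset.range s.n) :
    s.code ρ v A / (s.n + 1) % (s.n + 1) = (A ∩ s.part ρ (layer v).y).card := by
  have h1 := card_inter_le hA (s.part ρ (layer v).x)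
  have h2 := card_inter_le hA (s.part ρ (layer v).y)
  rw [code, show (s.sum A * 2 ^ s.n + mask A) * ((s.n : ℤ) + 1) ^ 2 +
    ((A ∩ s.part ρ (layer v).y).card * (s.n + 1) + (A ∩ s.part ρ (layer v).x).card) =
    (A ∩ s.part ρ (layer v).x).card + ((A ∩ s.part ρ (layer v).y).card +
      ((s.sum A * 2 ^ s.n + mask A) * (s.n + 1))) * (s.n + 1) by ring,
    Int.add_mul_ediv_right _ _ (by positivity),
    Int.ediv_eq_zero_of_lt (by positivity) (by linarith), zero_add, Int.add_mul_emod_self_right,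
    Int.emod_eq_of_lt (by positivity) (by linarith)]

theorem mask_emod (hA : A ⊆ Finset.range s.n) : (s.sum A * 2 ^ s.n + mask A) % 2 ^ s.n = mask A := by
  rw [add_comm, Int.add_mul_emod_self_right, Int.emod_eq_of_lt (mask_nonneg A) (mask_lt hA)]

theorem mask_ediv (hA : A ⊆ Finset.range s.n) : (s.sum A * 2 ^ s.n + mask A) / 2 ^ s.n = s.sum A := by
  rw [add_comm, Int.add_mul_ediv_right _ _ (by positivity),
    Int.ediv_eq_zero_of_lt (mask_nonneg A) (mask_lt hA), zero_add]

end

theorem Vertices.congr {ns : List (ℕ × Finset ℕ)} {σ σ' : State} (h : s.Vertices ns σ)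
    (hr : σ'.reg 18 = σ.reg 18) (h2 : σ'.arr 2 = σ.arr 2) (h3 : σ'.arr 3 = σ.arr 3)
    (h10 : σ'.arr 10 = σ.arr 10) : s.Vertices ns σ' :=
  ⟨by rw [hr, h.length], by rw [h2]; exact h.mask, by rw [h3]; exact h.tag,
    by rw [h10]; exact h.weight, by rw [h10]; exact h.rest⟩

theorem Vertices.push {ns : List (ℕ × Finset ℕ)} {σ : State} (h : s.Vertices ns σ)
    (x : ℕ × Finset ℕ) :
    s.Vertices (ns ++ [x]) ((((σ.setArr 2 ns.length (WordRAM.mask x.2)).setArr 3 ns.length x.1).setArr 10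
      ns.length (s.weight x)).setReg 18 (ns.length + 1)) := by
  constructor
  · simp
  · intro j hj
    simp only [List.length_append, List.length_singleton] at hj
    by_cases hj' : j = ns.length
    · subst hj'; simp [State.arr_setArr]
    · simp [State.arr_setArr, hj', h.mask j (by omega), List.getElem_append_left (show j < ns.length by omega)]
  · intro j hj
    simp only [List.length_append, List.length_singleton] at hj
    by_cases hj' : j = ns.length
    · subst hj'; simp [State.arr_setArr]
    · simp [State.arr_setArr, hj', h.tag j (by omega), List.getElem_append_left (show j < ns.length by omega)]
  · intro j hj
    simp only [List.length_append, List.length_singleton] at hj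
    by_cases hj' : j = ns.length
    · subst hj'; simp [State.arr_setArr]
    · simp [State.arr_setArr, hj', h.weight j (by omega), List.getElem_append_left (show j < ns.length by omega)]
  · intro j hj
    simp only [List.length_append, List.length_singleton] at hj
    simp [State.arr_setArr, show j ≠ ns.length by omega, h.rest j (by omega)]

open Classical in
/-- The vertices made from a list of sets. -/
noncomputable def vertexList (s : Setup) (h : Hash) (ρ : ℕ → ℕ) (v tag : ℕ) (As : List (Finset ℕ)) :
    List (ℕ × Finset ℕ) :=
  (As.filter fun A => s.IsVertex h ρ v A).map fun A => (tag, A)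

/-- The registers changed by `genStep`. -/
def genStepRegs : Set ℕ := {r | r = 18 ∨ (40 ≤ r ∧ r ≤ 44)}

/-- The arrays of the vertices. -/
def vertexArrs : Set ℕ := {a | a = 2 ∨ a = 3 ∨ a = 10}

theorem runs_genDecode (hs : s.Bounded b) {ρ : ℕ → ℕ} {v : ℕ} {A : Finset ℕ}
    (hA : A ⊆ s.items ((layer v).sel ρ)) {σ : State} (h14 : σ.reg 14 = 2 ^ s.n)
    (h21 : σ.reg 21 = (s.n + 1) ^ 2) {j : ℕ} (h40 : σ.reg 40 = j) (hj : σ.arr 4 j = s.code ρ v A) :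
    Runs b genDecode.code σ 30 fun σ' => Same {r | 41 ≤ r ∧ r ≤ 44} ∅ σ σ' ∧
      σ'.reg 41 = s.code ρ v A ∧ σ'.reg 43 = mask A ∧ σ'.reg 44 = s.sum A := by
  have hV := hs.V_pos
  have hW := hs.W_le'
  have hAn : A ⊆ Finset.range s.n := hA.trans (s.items_subset _)
  have hcode : |s.code ρ v A| ≤ s.V :=
    EnumParams.abs_reach_le (hs.layerParams ρ v) le_rfl ((reach_layer s ρ v _).2 ⟨A, hA, rfl⟩)
  have hm0 := mask_nonneg A
  have hm1 := mask_lt hAn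
  have hp : (0 : ℤ) < 2 ^ s.n := by positivity
  have h3 : (1 : ℤ) ≤ (s.n + 1) ^ 3 := one_le_pow₀ (by linarith [Int.natCast_nonneg s.n])
  have hq : 4 * ((1 : ℤ) * 1 * 2 ^ s.n) ≤ s.V :=
    hs.le_V (by linarith [s.W_nonneg]) (by norm_num) (by norm_num) hp.le h3 le_rfl rfl
  have e1 := code_ediv (ρ := ρ) (v := v) hAn
  have e4 := mask_emod hAn
  have e5 := mask_ediv hAn
  have fa : Fits b (s.code ρ v A) := hs.fits (by linarith)
  have f2 : Fits b (s.sum A * 2 ^ s.n + mask A) := by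
    refine hs.fits ?_
    have h1 := s.abs_sum_le' hAn
    have h2 : |s.sum A * 2 ^ s.n| ≤ s.W * 2 ^ s.n := by
      rw [abs_mul, abs_of_pos hp]; exact mul_le_mul_of_nonneg_right h1 hp.le
    have h4 := abs_add_le (s.sum A * 2 ^ s.n) (mask A)
    rw [abs_of_nonneg hm0] at h4
    have h5 : 4 * ((s.W + 1) * 1 * 2 ^ s.n) ≤ s.V :=
      hs.le_V le_rfl (by linarith [s.W_nonneg]) (by norm_num) hp.le h3 le_rfl rfl
    linarith
  have f3 : Fits b (mask A) := hs.fits (by rw [abs_of_nonneg hm0]; linarith)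
  have f4 : Fits b (s.sum A) := hs.fits (by linarith [s.abs_sum_le' hAn])
  refine Runs.mono (Stm.runs hs.one_le _ ?_ ?_) (Nat.le_of_ble_eq_true rfl) fun _ h => h
  · simp [genDecode, Stm.Ok, Stm.run, Stm.fitsIfVar, h40, hj, h21, h14]
    rw [e1, e4, e5]
    exact ⟨fa, f2, f3, f4⟩
  · simp only [genDecode, Stm.run, Expr.eval_ld, Expr.eval_div, Expr.eval_mod, Expr.eval_var, h40, hj,
      Int.toNat_natCast]
    refine ⟨?_, by simp, by simp [h21, h14, e1, e4], by simp [h21, h14, e1, e5]⟩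
    exact ((((Same.refl _ _ σ).setReg (by simp) _).setReg (by simp) _).setReg (by simp) _).setReg
      (by simp) _

theorem runs_genTest {v tag : ℕ} {σ : State} {a Z x y c k u o M D t m : ℤ} {N j : ℕ} (hb : 1 ≤ b)
    (h41 : σ.reg 41 = a) (h13 : σ.reg 13 = Z) (h19 : σ.reg 19 = c) (h8 : σ.reg 8 = k)
    (h44 : σ.reg 44 = u) (ho : σ.reg (9 + v) = o) (h7 : σ.reg 7 = M) (h6 : σ.reg 6 = D)
    (h18 : σ.reg 18 = N) (h43 : σ.reg 43 = m) (h1 : σ.reg 1 = t) (h40 : σ.reg 40 = j)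
    (hx : a % Z = x) (hy : a / Z % Z = y) (f5 : Fits b x) (f6 : Fits b (a / Z)) (f7 : Fits b y)
    (f8 : Fits b (k * u)) (f9 : Fits b (k * u + o)) (f10 : Fits b ((k * u + o) % M))
    (f11 : Fits b (D * 2)) (f12 : Fits b 2) (f13 : Fits b 128) (f14 : Fits b (layerCode v))
    (f15 : Fits b (u * 128)) (f16 : Fits b (u * 128 + layerCode v))
    (f18 : Fits b (t * if v = 3 then 128 else 0))
    (f19 : Fits b (u * 128 + layerCode v - t * if v = 3 then 128 else 0))
    (f20 : Fits b ((N : ℤ) + 1)) (f21 : Fits b ((j : ℤ) + 1)) (f22 : Fits b (tag : ℤ)) :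
    Runs b (genTest v tag).code σ 80 fun σ' => σ' =
      (if x < c ∧ y < c ∧ (k * u + o) % M < D * 2 then
        (((σ.setArr 2 N m).setArr 3 N tag).setArr 10 N
          (u * 128 + layerCode v - t * if v = 3 then 128 else 0)).setReg 18 (N + 1)
      else σ).setReg 40 (j + 1) := by
  have f1 := fits_one hb
  have f17 : Fits b (if v = 3 then 128 else 0) := by split_ifs; exacts [f13, fits_zero b]
  refine Runs.mono (Stm.runs hb _ ?_ ?_) (Nat.le_of_ble_eq_true rfl) fun _ h => h
  · simp only [genTest, Stm.Ok, Stm.run, Stm.fitsIfVar, Expr.ok_lt, Expr.ok_mod, Expr.ok_var,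
      Expr.ok_num, Expr.ok_add, Expr.ok_mul, Expr.ok_div, Expr.ok_sub, Expr.eval_var, Expr.eval_num,
      Expr.eval_div, Expr.eval_mul, Expr.eval_add, Expr.eval_sub, State.reg_setArr,
      h41, h13, h8, h44, ho, h7, h6, h18, h43, h1, hx, hy, true_and, and_true]
    refine ⟨⟨f5, fun _ => ⟨⟨f6, f7⟩, fun _ => ⟨⟨⟨⟨f8, f9⟩, f10⟩, f12, f11⟩, fun _ => ⟨?_, ⟨f22, ?_⟩,
      ⟨⟨⟨⟨f13, f15⟩, f14, f16⟩, ⟨f17, f18⟩, f19⟩, ?_⟩, f1, f20⟩⟩⟩⟩, f1, ?_⟩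
    · positivity
    · positivity
    · positivity
    · split_ifs <;> simpa [h40] using f21
  · simp only [genTest, Stm.run, Expr.eval_var, Expr.eval_num, Expr.eval_lt,
      Expr.eval_mod, Expr.eval_div, Expr.eval_mul, Expr.eval_add, Expr.eval_sub, State.reg_setArr,
      h41, h13, h19, h8, h44, ho, h7, h6, h18, h43, h1, hx, hy, Int.toNat_natCast]
    by_cases c1 : x < c <;> by_cases c2 : y < c <;> by_cases c3 : (k * u + o) % M < D * 2 <;>
      simp [c1, c2, c3, h40]

theorem runs_genStep (hs : s.Bounded b) {h : Hash} (hh : h.Bounded s b) {ρ : ℕ → ℕ} {v tag : ℕ}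
    (hv : v < 4) (htag : tag % 5 = v) (htb : Fits b (tag : ℤ)) {A : Finset ℕ}
    (hA : A ⊆ s.items ((layer v).sel ρ)) {σ : State} (hσ : s.In σ) (hσh : h.In s.n σ) {j : ℕ}
    (h40 : σ.reg 40 = j) (hj : σ.arr 4 j = s.code ρ v A) (hjN : j < s.N₁)
    {ns : List (ℕ × Finset ℕ)} (hns : s.Vertices ns σ) (hlen : (ns.length : ℤ) + 1 < 2 ^ b) :
    Runs b (.seq genDecode.code (genTest v tag).code) σ 110 fun σ' =>
      Same genStepRegs vertexArrs σ σ' ∧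
      σ'.reg 40 = j + 1 ∧ s.Vertices (ns ++ s.vertexList h ρ v tag [A]) σ' := by
  refine Runs.mono ((runs_genDecode hs hA hσh.pow hσh.z₂ h40 hj).seq (T' := 80) ?_) (by omega)
    fun _ h => h
  rintro τ ⟨hτ, h41, h43, h44⟩
  have hV := hs.V_pos
  have hW := hs.W_le'
  have hW0 := s.W_nonneg
  have hnV := hs.n_le
  have hAn : A ⊆ Finset.range s.n := hA.trans (s.items_subset _)
  have hsumt := s.abs_sum_le hAn
  have hsum := abs_le.1 (s.abs_sum_le' hAn)
  have ht := abs_le.1 (show |s.t| ≤ s.W by linarith [abs_nonneg (s.sum A)])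
  have hst := abs_le.1 ((abs_sub (s.sum A) s.t).trans hsumt)
  have hc1 := card_inter_le hAn (s.part ρ (layer v).x)
  have hc2 := card_inter_le hAn (s.part ρ (layer v).y)
  have hlc : -31 ≤ layerCode v ∧ layerCode v ≤ 31 := by unfold layerCode; split <;> norm_num
  have ho0 := hh.off_nonneg v hv
  have ho1 := hh.off_le v hv
  have hM := hh.M_pos
  have hMW : h.M ≤ h.M * (s.W + 1) := le_mul_of_one_le_right hM.le (by linarith)
  have hfitsM : ∀ z : ℤ, |z| ≤ 4 * (h.M * (s.W + 1)) → Fits b z := fun z hz =>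
    fits_of_abs_le hh.fits (by rw [mul_assoc]; exact hz)
  have hau : |h.a * s.sum A| ≤ h.M * (s.W + 1) := by
    rw [abs_mul, abs_of_nonneg hh.a_nonneg]
    exact mul_le_mul hh.a_le (by linarith [s.abs_sum_le' hAn]) (abs_nonneg _) hM.le
  have hauo : |h.a * s.sum A + h.off v| ≤ 2 * (h.M * (s.W + 1)) := by
    have := abs_add_le (h.a * s.sum A) (h.off v)
    rw [abs_of_nonneg ho0] at this
    linarith
  have hm1 := Int.emod_nonneg (h.a * s.sum A + h.off v) hM.ne'
  have hm2 := Int.emod_lt_of_pos (h.a * s.sum A + h.off v) hM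
  have hMW0 : 0 ≤ h.M * (s.W + 1) := by linarith
  have hcode : |s.code ρ v A| ≤ s.V :=
    EnumParams.abs_reach_le (hs.layerParams ρ v) le_rfl ((reach_layer s ρ v _).2 ⟨A, hA, rfl⟩)
  have hZ : (0 : ℤ) < (s.n : ℤ) + 1 := by positivity
  have f6 : Fits b (s.code ρ v A / (s.n + 1)) := by
    have h1 := abs_le.1 hcode
    refine hs.fits (abs_le.2 ⟨?_, ?_⟩)
    · rw [Int.le_ediv_iff_mul_le hZ]; nlinarith
    · rw [← Int.lt_add_one_iff, Int.ediv_lt_iff_lt_mul hZ]; nlinarith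
  have f18 : Fits b (s.t * if v = 3 then 128 else 0) := by
    refine hs.fits ?_
    split_ifs
    · exact abs_le.2 ⟨by linarith, by linarith⟩
    · simp; linarith
  have f19 : Fits b (s.sum A * 128 + layerCode v - s.t * if v = 3 then 128 else 0) := by
    refine hs.fits ?_
    split_ifs
    · exact abs_le.2 ⟨by linarith, by linarith⟩
    · exact abs_le.2 ⟨by linarith, by linarith⟩
  have e40 : τ.reg 40 = j := by rw [hτ.reg 40 (by simp), h40]
  have hnsτ : s.Vertices ns τ := hns.congr (hτ.reg 18 (by simp)) (hτ.arr _ (by simp))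
    (hτ.arr _ (by simp)) (hτ.arr _ (by simp))
  refine Runs.mono (runs_genTest hs.one_le h41 (by rw [hτ.reg 13 (by simp), hσ.Z])
    (by rw [hτ.reg 19 (by simp), hσh.cap]) (by rw [hτ.reg 8 (by simp), hσh.a]) h44
    (by rw [hτ.reg (9 + v) (by simp; omega), hσh.off v hv]) (by rw [hτ.reg 7 (by simp), hσh.M])
    (by rw [hτ.reg 6 (by simp), hσh.D]) hnsτ.length h43 (by rw [hτ.reg 1 (by simp), hσ.t]) e40
    (code_emod hAn) (code_ediv_emod hAn) (hs.fits ?_) f6 (hs.fits ?_) (hfitsM _ ?_) (hfitsM _ ?_)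
    (hfitsM _ ?_) (hfitsM _ ?_) (hs.fits ?_) (hs.fits ?_) (hs.fits ?_) (hs.fits ?_) (hs.fits ?_) f18
    f19 (fits_of_nonneg (X := ns.length + 1) hlen (by positivity) le_rfl)
    (fits_of_nonneg hs.N₁_fits (by positivity) (by omega)) htb) le_rfl ?_
  · rw [abs_of_nonneg (by positivity)]; linarith
  · rw [abs_of_nonneg (by positivity)]; linarith
  · linarith
  · linarith
  · rw [abs_of_nonneg hm1]; linarith
  · rw [abs_of_nonneg (by linarith [hh.D_nonneg])]; linarith [hh.D_le]
  · norm_num; linarith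
  · norm_num; linarith
  · exact abs_le.2 ⟨by linarith, by linarith⟩
  · exact abs_le.2 ⟨by linarith, by linarith⟩
  · exact abs_le.2 ⟨by linarith, by linarith⟩
  · rintro _ rfl
    have hiff : s.IsVertex h ρ v A ↔ ((A ∩ s.part ρ (layer v).x).card : ℤ) < h.cap + 1 ∧
        ((A ∩ s.part ρ (layer v).y).card : ℤ) < h.cap + 1 ∧
        (h.a * s.sum A + h.off v) % h.M < h.D * 2 := by
      simp only [IsVertex, hA, true_and, Int.lt_add_one_iff, Nat.cast_le]
    have hτ' : Same genStepRegs vertexArrs σ τ := hτ.mono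
      (by intro r; simp [genStepRegs]; omega) (Set.empty_subset _)
    by_cases hV : s.IsVertex h ρ v A
    · rw [if_pos (hiff.1 hV)]
      refine ⟨((((hτ'.setArr (by simp [vertexArrs]) _ _).setArr (by simp [vertexArrs]) _ _).setArr
        (by simp [vertexArrs]) _ _).setReg (by simp [genStepRegs]) _).setReg (by simp [genStepRegs]) _,
        by simp, ?_⟩
      have hl : s.vertexList h ρ v tag [A] = [(tag, A)] := by simp [vertexList, hV]
      rw [hl]
      refine (hnsτ.push (tag, A)).congr ?_ ?_ ?_ ?_ <;> simp [Setup.weight, htag]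
    · rw [if_neg fun h => hV (hiff.2 h)]
      refine ⟨hτ'.setReg (by simp [genStepRegs]) _, by simp, ?_⟩
      have hl : s.vertexList h ρ v tag [A] = [] := by simp [vertexList, hV]
      rw [hl, List.append_nil]
      exact hnsτ.congr (by simp) (by simp) (by simp) (by simp)

theorem Layer.expr_spec {l : Layer} {r : ℕ} {σ : State} (hb : 1 ≤ b) (h13 : σ.reg 13 = s.n + 1) :
    (l.expr r).Ok b σ ∧ (l.expr r).eval σ = l.flag (s.n + 1) r ∧ (l.expr r).cost = 1 := by
  unfold Layer.expr Layer.flag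
  split_ifs
  · exact ⟨fits_one hb, rfl, rfl⟩
  · exact ⟨trivial, h13, rfl⟩
  · exact ⟨fits_zero b, rfl, rfl⟩
  · exact ⟨fits_neg_one hb, rfl, rfl⟩

theorem vertexList_append (h : Hash) (ρ : ℕ → ℕ) (v tag : ℕ) (As As' : List (Finset ℕ)) :
    s.vertexList h ρ v tag (As ++ As') = s.vertexList h ρ v tag As ++ s.vertexList h ρ v tag As' := by
  simp [vertexList]

/-- The running time of `gen`. -/
def genTime (s : Setup) : ℕ := s.K * 3 + (s.n + 1) * (62 * s.N₁ + 60) + 112 * s.N₁ + 40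

theorem card_reach_layer_le (ρ : ℕ → ℕ) (v : ℕ) :
    ((s.layerParams ρ v).reach s.n).card ≤ 2 ^ (s.items ((layer v).sel ρ)).card := by
  have : (s.layerParams ρ v).reach s.n ⊆ (s.items ((layer v).sel ρ)).powerset.image (s.code ρ v) := by
    intro x hx
    obtain ⟨A, hA, rfl⟩ := (reach_layer s ρ v x).1 hx
    exact Finset.mem_image_of_mem _ (Finset.mem_powerset.2 hA)
  refine (Finset.card_le_card this).trans (Finset.card_image_le.trans ?_)
  rw [Finset.card_powerset]

theorem exists_map_eq {α β : Type*} {P : α → Prop} (f : α → β) (L : List β)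
    (h : ∀ u ∈ L, ∃ A, P A ∧ f A = u) : ∃ As : List α, As.map f = L ∧ ∀ A ∈ As, P A := by
  induction L with
  | nil => exact ⟨[], rfl, by simp⟩
  | cons u L ih =>
    obtain ⟨A, hA, hu⟩ := h u (by simp)
    obtain ⟨As, h1, h2⟩ := ih fun u hu => h u (by simp [hu])
    exact ⟨A :: As, by simp [hu, h1], by simpa [hA] using h2⟩

/-- All subsets of a layer are enumerated before the hash test. Their number is below the cap by
`hsmall`, so no set is missed, and only the sets that pass the test become vertices. -/
theorem runs_gen (hs : s.Bounded b) {h : Hash} (hh : h.Bounded s b) {ρ : ℕ → ℕ} {v tag tb : ℕ}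
    (hv : v < 4) (htag : tag % 5 = v) (htb : Fits b (tag : ℤ)) (htb' : 10 < tb)
    (hsmall : 2 ^ (s.items ((layer v).sel ρ)).card ≤ s.N₁) {σ : State} (hσ : s.In σ)
    (hσh : h.In s.n σ) (hz : ∀ i, σ.arr tb i = 0) {ns : List (ℕ × Finset ℕ)}
    (hns : s.Vertices ns σ) (hlen : (ns.length : ℤ) + s.N₁ < 2 ^ b) :
    Runs b (gen s.K ρ v tag tb) σ s.genTime fun σ' =>
      Same {r | r = 18 ∨ (30 ≤ r ∧ r ≤ 44)} {a | a = 1 ∨ a = 2 ∨ a = 3 ∨ a = 4 ∨ a = 10 ∨ a = tb} σ σ' ∧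
      ∃ ns' : List (ℕ × Finset ℕ), s.Vertices (ns ++ ns') σ' ∧ ns'.Nodup ∧ ns'.length ≤ s.N₁ ∧
        ∀ x, x ∈ ns' ↔ x.1 = tag ∧ s.IsVertex h ρ v x.2 := by
  have hb := hs.one_le
  have hV := hs.V_pos
  have hW := hs.W_le'
  have hW0 := s.W_nonneg
  have hnV := hs.n_le
  have hn0 : (0 : ℤ) ≤ s.n := Int.natCast_nonneg s.n
  have hq : 4 * ((1 : ℤ) * (s.n + 1) ^ 3 * 2 ^ s.n) ≤ s.V :=
    hs.le_V (by linarith) (by norm_num) (by positivity) (by positivity) le_rfl le_rfl rfl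
  have hp1 : (1 : ℤ) ≤ 2 ^ s.n := one_le_pow₀ (by norm_num)
  have hq2 : ((s.n : ℤ) + 1) ^ 2 ≤ (s.n + 1) ^ 3 := pow_le_pow_right₀ (by linarith) (by norm_num)
  have hq3 : ((s.n : ℤ) + 1) ^ 2 * 2 ^ s.n ≤ (s.n + 1) ^ 3 * 2 ^ s.n :=
    mul_le_mul_of_nonneg_right hq2 (by linarith)
  have hq4 : ((s.n : ℤ) + 1) ^ 2 ≤ (s.n + 1) ^ 2 * 2 ^ s.n := le_mul_of_one_le_right (by positivity) hp1
  have hK : (s.K : ℤ) ≤ s.n := by exact_mod_cast Nat.le_mul_of_pos_right _ hs.B_pos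
  have f0 := fits_zero b
  refine Runs.mono ((Runs.mono (Stm.runs hb _ (Q := fun σ' => σ' = ((σ.setReg 30
    ((s.n + 1) ^ 2 * 2 ^ s.n)).setReg 31 ((s.n + 1) ^ 2)).setReg 32 (s.n + 1)) ?_ ?_) (T' := 20)
    (Nat.le_of_ble_eq_true rfl) fun _ h => h).seq
    (T' := s.K * 3 + 1 + (s.n + 1) * (62 * s.N₁ + 60) + 112 * s.N₁ + 10) ?_)
    (by unfold genTime; omega) fun _ h => h
  · have f1 : Fits b (((s.n : ℤ) + 1) ^ 2 * 2 ^ s.n) :=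
      hs.fits (by rw [abs_of_nonneg (by positivity)]; linarith)
    have f2 : Fits b (((s.n : ℤ) + 1) ^ 2) :=
      hs.fits (by rw [abs_of_nonneg (by positivity)]; linarith)
    have f3 : Fits b ((s.n : ℤ) + 1) := hs.fits (by rw [abs_of_nonneg (by positivity)]; linarith)
    simp [Stm.Ok, Stm.run, Stm.fitsIfVar, hσ.Z, hσh.z₁, hσh.z₂]
    and_intros <;> assumption
  · simp [Stm.run, hσ.Z, hσh.z₁, hσh.z₂]
  rintro σ₁ rfl
  set σ₁ := ((σ.setReg 30 ((s.n + 1) ^ 2 * 2 ^ s.n)).setReg 31 ((s.n + 1) ^ 2)).setReg 32 (s.n + 1)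
    with hσ₁
  have hs₁ : Same {r | r = 18 ∨ (30 ≤ r ∧ r ≤ 44)}
      {a | a = 1 ∨ a = 2 ∨ a = 3 ∨ a = 4 ∨ a = 10 ∨ a = tb} σ σ₁ :=
    (((Same.refl _ _ σ).setReg (by simp) _).setReg (by simp) _).setReg (by simp) _
  have hvol : ∀ r ∈ {r : ℕ | r = 18 ∨ (30 ≤ r ∧ r ≤ 44)}, r ∈ volatile := by
    intro r; simp [volatile]; omega
  refine Runs.mono ((runs_fill hb (g := fun j => (layer v).flag (s.n + 1) (ρ j))
    (lt_of_le_of_lt (by linarith [hs.n_le]) hs.V_fits) σ₁ ?_).seq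
    (T' := (s.n + 1) * (62 * s.N₁ + 60) + 112 * s.N₁ + 9) ?_) (by omega) fun _ h => h
  · intro j _ τ hτ
    exact Layer.expr_spec hb (by rw [hτ.reg 13 (by simp)]; simp [hσ₁, hσ.Z])
  rintro σ₂ ⟨hs₂, hg⟩
  have hs₂' := hs₁.trans (hs₂.mono (Set.empty_subset _) (by simp))
  have hσ₂ := hσ.of_same (hs₂'.mono hvol subset_rfl) (by simp; omega)
  have hIn : (s.layerParams ρ v).In σ₂ := by
    refine ⟨hσ₂.n, hσ₂.B, hσ₂.N₁, hσ₂.w, fun i hi => hg _ (Nat.div_lt_of_lt_mul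
      (by rw [mul_comm]; exact hi)), ?_, ?_, hσ₂.Z, ?_, hσ₂.V⟩
    · rw [hs₂.reg 30 (by simp)]; simp [hσ₁]; rfl
    · rw [hs₂.reg 31 (by simp)]; simp [hσ₁]; rfl
    · rw [hs₂.reg 32 (by simp)]; simp [hσ₁]; rfl
  refine Runs.mono ((runs_enum (hs.layerParams ρ v) (o := 4) (tb := tb) (by omega) (by omega)
    (by omega) hIn ?_).seq (T' := 112 * s.N₁ + 9) ?_)
    (T := (s.n + 1) * (62 * s.N₁ + 60) + (112 * s.N₁ + 9)) (by omega) fun _ h => h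
  · rw [hs₂.arr tb (by simp; omega)]; exact hz
  rintro σ₃ ⟨hs₃, L, hL⟩
  have hs₃' := hs₂'.trans (hs₃.mono (by intro r; simp [enumRegs]; omega) (by intro a; simp; omega))
  have hLle : L.length ≤ s.N₁ := hL.length_le
  obtain ⟨As, hAs, hAs'⟩ := exists_map_eq (s.code ρ v) L fun u hu =>
    (reach_layer s ρ v u).1 (hL.sound u hu)
  have hmem : ∀ A, A ⊆ s.items ((layer v).sel ρ) → A ∈ As := by
    intro A hA
    have h1 := hL.complete (le_trans (card_reach_layer_le ρ v) hsmall) _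
      ((reach_layer s ρ v _).2 ⟨A, hA, rfl⟩)
    rw [← hAs, List.mem_map] at h1
    obtain ⟨A', hA', he⟩ := h1
    have hA'' := hAs' A' hA'
    -- The code contains the mask, and the binary digits of the mask are the set. Hence the listed
    -- code of `A` comes from no other set.
    have h2 : mask A' = mask A := by
      rw [← mask_emod (hA''.trans (s.items_subset _)), ← mask_emod (hA.trans (s.items_subset _)),
        ← code_ediv (ρ := ρ) (v := v) (hA''.trans (s.items_subset _)),
        ← code_ediv (ρ := ρ) (v := v) (hA.trans (s.items_subset _)), he]
    have h3 : ∀ A : Finset ℕ, mask A = ((∑ i ∈ A, 2 ^ i : ℕ) : ℤ) := by intro A; simp [mask]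
    rw [h3, h3, Nat.cast_inj] at h2
    have h4 := congrArg (fun m => m.bitIndices.toFinset) h2
    simp only [Finset.toFinset_bitIndices_sum_two_pow] at h4
    exact h4 ▸ hA'
  have hnodup : As.Nodup := List.Nodup.of_map (s.code ρ v) (by rw [hAs]; exact hL.nodup)
  have hlenAs : As.length = L.length := by rw [← hAs, List.length_map]
  refine Runs.mono ((Stm.runs hb (.set 40 (.num 0)) (Q := fun σ' => σ' = σ₃.setReg 40 0)
    ⟨f0, trivial⟩ rfl).seq (T := 3) (T' := 112 * s.N₁ + 2) ?_) (by omega) fun _ h => h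
  rintro _ rfl
  have hns₃ : s.Vertices ns (σ₃.setReg 40 0) := by
    have h18 : σ₃.reg 18 = σ.reg 18 := by
      rw [hs₃.reg 18 (by simp [enumRegs]), hs₂.reg 18 (by simp)]; simp [hσ₁]
    have harr : ∀ a ∈ vertexArrs, σ₃.arr a = σ.arr a := by
      intro a ha
      simp only [vertexArrs, Set.mem_ofPred_eq] at ha
      rw [hs₃.arr a (by simp; omega), hs₂.arr a (by simp; omega)]; rfl
    exact hns.congr (by simpa using h18) (harr 2 (by simp [vertexArrs]))
      (harr 3 (by simp [vertexArrs])) (harr 10 (by simp [vertexArrs]))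
  refine Runs.mono (Runs.whileLt hb (fun j τ => Same genStepRegs vertexArrs σ₃ τ ∧ τ.reg 40 = j ∧
    s.Vertices (ns ++ s.vertexList h ρ v tag (As.take j)) τ) L.length 110 ?_ ?_ ?_)
    (by have := Nat.mul_le_mul_right 112 hLle; omega) ?_
  · rintro j hj τ ⟨hτ, h40, hvert⟩
    have hjA : j < As.length := by omega
    have hτ' := hs₃'.trans (hτ.mono (R' := {r | r = 18 ∨ (30 ≤ r ∧ r ≤ 44)})
      (A' := {a | a = 1 ∨ a = 2 ∨ a = 3 ∨ a = 4 ∨ a = 10 ∨ a = tb})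
      (by intro r; simp [genStepRegs]; omega) (by intro a; simp [vertexArrs]; omega))
    refine ⟨?_, ?_⟩
    · rw [h40, hτ.reg 33 (by simp [genStepRegs]), hL.length]; exact_mod_cast hj
    refine Runs.mono (runs_genStep hs hh hv htag htb (hAs' As[j] (List.getElem_mem hjA))
      (hσ.of_same (hτ'.mono hvol subset_rfl) (by simp; omega)) (hσh.of_same (hτ'.mono hvol subset_rfl))
      h40 ?_ (by omega) hvert ?_) le_rfl ?_
    · rw [hτ.arr 4 (by simp [vertexArrs]), hL.get j hj]
      simp [← hAs]
    · have h1 : (s.vertexList h ρ v tag (As.take j)).length ≤ j := by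
        simp only [vertexList, List.length_map]
        exact (List.length_filter_le _ _).trans (by simp)
      have : (j : ℤ) + 1 ≤ s.N₁ := by exact_mod_cast lt_of_lt_of_le hj hLle
      have : (((s.vertexList h ρ v tag (As.take j)).length : ℕ) : ℤ) ≤ j := by exact_mod_cast h1
      rw [List.length_append, Nat.cast_add]
      linarith
    · rintro τ' ⟨h1, h2, h3⟩
      refine ⟨hτ.trans h1, by push_cast; exact h2, ?_⟩
      rw [List.take_succ_eq_append_getElem hjA, vertexList_append, ← List.append_assoc]
      exact h3
  · rintro τ ⟨hτ, h40, -⟩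
    rw [h40, hτ.reg 33 (by simp [genStepRegs]), hL.length]; simp
  · refine ⟨(Same.refl _ _ _).setReg (by simp [genStepRegs]) _, by simp, ?_⟩
    simpa [vertexList] using hns₃
  · rintro τ ⟨hτ, -, hvert⟩
    refine ⟨hs₃'.trans (hτ.mono (by intro r; simp [genStepRegs]; omega)
      (by intro a; simp [vertexArrs]; omega)), _, hvert, ?_, ?_, ?_⟩
    · rw [← hlenAs, List.take_length]
      exact (hnodup.filter _).map fun A A' h => by simpa using h
    · simp only [vertexList, List.length_map]
      exact (List.length_filter_le _ _).trans (by simp [hlenAs, hLle])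
    · rintro ⟨x, A⟩
      rw [← hlenAs, List.take_length]
      simp only [vertexList, List.mem_map, List.mem_filter, decide_eq_true_eq, Prod.mk.injEq]
      constructor
      · rintro ⟨A', ⟨-, h⟩, rfl, rfl⟩; exact ⟨rfl, h⟩
      · rintro ⟨rfl, h⟩; exact ⟨A, ⟨hmem A h.1, h⟩, rfl, rfl⟩

end Setup


/-! ## The graph -/

theorem mask_eq_natCast (A : Finset ℕ) : mask A = ((∑ i ∈ A, 2 ^ i : ℕ) : ℤ) := by simp [mask]

theorem testBit_sum_two_pow (A : Finset ℕ) (i : ℕ) : (∑ k ∈ A, 2 ^ k).testBit i = decide (i ∈ A) := by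
  have h := Finset.toFinset_bitIndices_sum_two_pow A
  have h2 : i ∈ (∑ k ∈ A, 2 ^ k).bitIndices.toFinset ↔ i ∈ A := by rw [h]
  rw [List.mem_toFinset, Nat.mem_bitIndices] at h2
  by_cases hi : i ∈ A <;> simp [hi] at h2 ⊢ <;> exact h2

/-- A mask is the characteristic vector of its set, so one bitwise operation tests disjointness.
Thus an entry of the adjacency matrix takes constant time. -/
theorem land_mask_eq_zero_iff (A A' : Finset ℕ) : Int.land (mask A) (mask A') = 0 ↔ Disjoint A A' := by
  rw [mask_eq_natCast, mask_eq_natCast]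
  have h : Int.land ((∑ i ∈ A, 2 ^ i : ℕ) : ℤ) ((∑ i ∈ A', 2 ^ i : ℕ) : ℤ) =
      (((∑ i ∈ A, 2 ^ i) &&& (∑ i ∈ A', 2 ^ i) : ℕ) : ℤ) := rfl
  rw [h, Nat.cast_eq_zero, Finset.disjoint_left]
  constructor
  · intro h0 i hi hi'
    have := congrArg (fun m => m.testBit i) h0
    simp [testBit_sum_two_pow, hi, hi'] at this
  · intro hd
    apply Nat.eq_of_testBit_eq
    intro i
    rw [Nat.testBit_land, testBit_sum_two_pow, testBit_sum_two_pow, Nat.zero_testBit]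
    by_cases hi : i ∈ A
    · simp [hi, hd hi]
    · simp [hi]

/-- Vertices are adjacent if their tags are consecutive and their sets are disjoint. -/
def Linked (x y : ℕ × Finset ℕ) : Prop := (x.1 + 1 = y.1 ∨ y.1 + 1 = x.1) ∧ Disjoint x.2 y.2

/-- The graph of a list of vertices. -/
def listGraph (ns : List (ℕ × Finset ℕ)) : SimpleGraph (Fin ns.length) where
  Adj u v := Linked ns[u] ns[v]
  symm := ⟨fun _ _ h => ⟨h.1.symm, h.2.symm⟩⟩
  loopless := ⟨fun u h => by rcases h.1 with h | h <;> omega⟩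

/-- Writes an entry of the adjacency matrix. -/
def adjStep : Stm :=
  .put 12 (.var 50 * .var 18 + .var 51)
    ((.bin .eq (.ld 3 (.var 50) + .num 1) (.ld 3 (.var 51)) +
      .bin .eq (.ld 3 (.var 51) + .num 1) (.ld 3 (.var 50))) *
      .bin .eq (.bin .land (.ld 2 (.var 50)) (.ld 2 (.var 51))) (.num 0)) ;;
  .set 51 (.var 51 + .num 1)

/-- Writes the adjacency matrix. -/
def adjacency : Prog :=
  .seq (Stm.code (.set 50 (.num 0)))
  (whileLt 50 18 (.seq (Stm.code (.set 51 (.num 0)))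
    (.seq (whileLt 51 18 adjStep.code) (Stm.code (.set 50 (.var 50 + .num 1))))))

namespace Setup

variable {s : Setup} {b : ℕ}

open Classical in
/-- The first `k` entries of the adjacency matrix have been written. -/
structure AdjWritten (ns : List (ℕ × Finset ℕ)) (σ₀ : State) (k : ℕ) (σ : State) : Prop where
  same : Same {50, 51} {12} σ₀ σ
  entry : ∀ i, σ.arr 12 i = if i < k ∧ ∃ u v : Fin ns.length, (listGraph ns).Adj u v ∧
    i = u * ns.length + v then 1 else 0

theorem runs_adjStep (hs : s.Bounded b) {ns : List (ℕ × Finset ℕ)} {σ₀ : State}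
    (h0 : s.Vertices ns σ₀) (hsub : ∀ x ∈ ns, x.2 ⊆ Finset.range s.n)
    (hfit : (ns.length * ns.length : ℤ) < 2 ^ b)
    (htag : ∀ x ∈ ns, Fits b ((x.1 : ℤ) + 1)) {u v : ℕ} (hu : u < ns.length) (hv : v < ns.length)
    {σ : State} (hσ : AdjWritten ns σ₀ (u * ns.length + v) σ) (h50 : σ.reg 50 = u)
    (h51 : σ.reg 51 = v) :
    Runs b adjStep.code σ 60 fun σ' =>
      AdjWritten ns σ₀ (u * ns.length + (v + 1)) σ' ∧ σ'.reg 50 = u ∧ σ'.reg 51 = (v + 1 : ℕ) := by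
  have hb := hs.one_le
  have hV := hs.V_pos
  have hle : ∀ {u v : ℕ}, u < ns.length → v < ns.length →
      u * ns.length + v + 1 ≤ ns.length * ns.length := by
    intro u v hu hv
    have := Nat.mul_le_mul_right ns.length (show u + 1 ≤ ns.length by omega)
    rw [add_mul] at this
    omega
  have hi := hle hu hv
  have hiZ : (u * ns.length + v + 1 : ℤ) ≤ ns.length * ns.length := by exact_mod_cast hi
  -- Division with remainder by the row length recovers the pair of vertices from the position in
  -- the matrix, so each cell has only one pair to describe.
  have huv : ∀ u' v' : ℕ, u' < ns.length → v' < ns.length →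
      (u' * ns.length + v' = u * ns.length + v ↔ u' = u ∧ v' = v) := by
    intro u' v' hu' hv'
    constructor
    · intro h
      have h1 := congrArg (· / ns.length) h
      have h2 := congrArg (· % ns.length) h
      have hpos : 0 < ns.length := by omega
      simp only [Nat.mul_comm _ ns.length, Nat.mul_add_div hpos, Nat.mul_add_mod,
        Nat.mod_eq_of_lt hv, Nat.mod_eq_of_lt hv', Nat.div_eq_of_lt hv, Nat.div_eq_of_lt hv',
        Nat.add_zero] at h1 h2
      exact ⟨h1, h2⟩
    · rintro ⟨rfl, rfl⟩; rfl
  have h18 : σ.reg 18 = ns.length := by rw [hσ.same.reg 18 (by simp), h0.length]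
  have hm : ∀ j (h : j < ns.length), σ.arr 2 j = mask ns[j].2 := by
    rw [hσ.same.arr 2 (by simp)]; exact h0.mask
  have ht : ∀ j (h : j < ns.length), σ.arr 3 j = ns[j].1 := by
    rw [hσ.same.arr 3 (by simp)]; exact h0.tag
  have fm : ∀ A : Finset ℕ, A ⊆ Finset.range s.n → 0 ≤ mask A ∧ mask A ≤ 8 * s.V := by
    intro A hA
    refine ⟨mask_nonneg A, (mask_lt hA).le.trans ?_⟩
    have h3 : (1 : ℤ) ≤ (s.n + 1) ^ 3 := one_le_pow₀ (by linarith [Int.natCast_nonneg s.n])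
    have hq : 4 * ((1 : ℤ) * 1 * 2 ^ s.n) ≤ s.V :=
      hs.le_V (by linarith [s.W_nonneg]) (by norm_num) (by norm_num) (by positivity) h3 le_rfl rfl
    linarith
  have ft : ∀ j (h : j < ns.length), Fits b (ns[j].1 : ℤ) ∧ Fits b ((ns[j].1 : ℤ) + 1) := by
    intro j hj
    have h1 := htag ns[j] (List.getElem_mem hj)
    refine ⟨?_, h1⟩
    have h2 := abs_lt.1 h1
    exact abs_lt.2 ⟨by linarith [pow_pos (show (0 : ℤ) < 2 by norm_num) b,
      Int.natCast_nonneg ns[j].1], by linarith⟩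
  have hland : Fits b (Int.land (mask ns[u].2) (mask ns[v].2)) := by
    rw [mask_eq_natCast, mask_eq_natCast]
    have h : Int.land ((∑ i ∈ ns[u].2, 2 ^ i : ℕ) : ℤ) ((∑ i ∈ ns[v].2, 2 ^ i : ℕ) : ℤ) =
      (((∑ i ∈ ns[u].2, 2 ^ i) &&& (∑ i ∈ ns[v].2, 2 ^ i) : ℕ) : ℤ) := rfl
    rw [h]
    refine hs.fits ?_
    rw [abs_of_nonneg (by positivity)]
    have h2 := (fm _ (hsub _ (List.getElem_mem hu))).2
    rw [mask_eq_natCast] at h2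
    exact le_trans (by exact_mod_cast Nat.and_le_left) h2
  have f0 := fits_zero b
  have f1 := fits_one hb
  have f2 : Fits b 2 := hs.fits (by norm_num; linarith)
  have fi : Fits b ((u * ns.length + v : ℤ)) := fits_of_nonneg hfit (by positivity) (by linarith)
  have fi0 : Fits b ((u * ns.length : ℤ)) := fits_of_nonneg hfit (by positivity) (by linarith)
  have fv : Fits b ((v : ℤ) + 1) := fits_of_nonneg hfit (by positivity)
    (by have := Nat.le_mul_of_pos_left v (show 0 < ns.length by omega)
        have : (0 : ℤ) ≤ u * ns.length := by positivity
        linarith)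
  have fmu := fm _ (hsub _ (List.getElem_mem hu))
  have fmv := fm _ (hsub _ (List.getElem_mem hv))
  have fmu' : Fits b (mask ns[u].2) := hs.fits (by rw [abs_of_nonneg fmu.1]; exact fmu.2)
  have fmv' : Fits b (mask ns[v].2) := hs.fits (by rw [abs_of_nonneg fmv.1]; exact fmv.2)
  obtain ⟨ft1, ft2⟩ := ft u hu
  obtain ⟨ft3, ft4⟩ := ft v hv
  set x := ns[u] with hx
  set y := ns[v] with hy
  -- At most one of the two tags can be the successor of the other, so the sum of the two
  -- comparisons is `0` or `1` and the product is a truth value.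
  have hval : (((if (x.1 : ℤ) + 1 = y.1 then (1 : ℤ) else 0) + if (y.1 : ℤ) + 1 = x.1 then 1 else 0) *
      if Int.land (mask x.2) (mask y.2) = 0 then 1 else 0) = by
        classical exact if Linked x y then 1 else 0 := by
    simp only [land_mask_eq_zero_iff, Linked]
    norm_cast
    by_cases c1 : x.1 + 1 = y.1
    · have c2 : y.1 + 1 ≠ x.1 := by omega
      by_cases c3 : Disjoint x.2 y.2 <;> simp [c1, c2, c3]
    · by_cases c2 : y.1 + 1 = x.1 <;> by_cases c3 : Disjoint x.2 y.2 <;> simp [c1, c2, c3]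
  refine Runs.mono (Stm.runs hb _ ?_ ?_) (Nat.le_of_ble_eq_true rfl) fun _ h => h
  · simp only [adjStep, Stm.Ok, Stm.run, Stm.fitsIfVar, Expr.ok_mul, Expr.ok_add, Expr.ok_var,
      Expr.ok_num, Expr.ok_eq, Expr.ok_ld, Expr.ok_land, Expr.eval_var, Expr.eval_num, Expr.eval_ld,
      Expr.eval_add, Expr.eval_mul, Expr.eval_eq, Expr.eval_land, State.reg_setArr, h50, h51, h18,
      Int.toNat_natCast, hm u hu, hm v hv, ht u hu, ht v hv, ← hx, ← hy, true_and, and_true]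
    have g1 : Fits b ((if (x.1 : ℤ) + 1 = y.1 then (1 : ℤ) else 0) +
        if (y.1 : ℤ) + 1 = x.1 then 1 else 0) := by
      split_ifs
      · exact f2
      · exact f1
      · exact f1
      · exact f0
    have g2 : Fits b (((if (x.1 : ℤ) + 1 = y.1 then (1 : ℤ) else 0) +
        if (y.1 : ℤ) + 1 = x.1 then 1 else 0) *
        if Int.land (mask x.2) (mask y.2) = 0 then 1 else 0) := by
      rw [hval]; split_ifs; exacts [f1, f0]
    have p1 : (0 : ℤ) ≤ u := by positivity
    have p2 : (0 : ℤ) ≤ v := by positivity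
    have p3 : (0 : ℤ) ≤ u * ns.length + v := by positivity
    and_intros <;> assumption
  · simp only [adjStep, Stm.run, Expr.eval_var, Expr.eval_num, Expr.eval_ld,
      Expr.eval_add, Expr.eval_mul, Expr.eval_eq, Expr.eval_land, State.reg_setArr, h50, h51, h18,
      Int.toNat_natCast, hm u hu, hm v hv, ht u hu, ht v hv, ← hx, ← hy]
    rw [hval]
    refine ⟨⟨(hσ.same.setArr (by simp) _ _).setReg (by simp) _, fun i => ?_⟩, by simp [h50], by simp⟩
    have hnat : ((u : ℤ) * ns.length + v).toNat = u * ns.length + v := by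
      rw [← Nat.cast_mul, ← Nat.cast_add, Int.toNat_natCast]
    rw [State.arr_setReg, State.arr_setArr, hσ.entry, hnat]
    simp only [true_and]
    by_cases hiu : i = u * ns.length + v
    · rw [if_pos hiu]
      have : (i < u * ns.length + (v + 1) ∧ ∃ u v : Fin ns.length, (listGraph ns).Adj u v ∧
          i = u * ns.length + v) ↔ Linked x y := by
        constructor
        · rintro ⟨-, u', v', hadj, he⟩
          rw [hiu] at he
          obtain ⟨e1, e2⟩ := (huv u' v' u'.2 v'.2).1 he.symm
          have : Linked ns[u'] ns[v'] := hadj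
          simpa [hx, hy, ← e1, ← e2] using this
        · intro h
          exact ⟨by omega, ⟨u, hu⟩, ⟨v, hv⟩, h, hiu⟩
      by_cases hl : Linked x y
      · rw [if_pos hl, if_pos (this.2 hl)]
      · rw [if_neg hl, if_neg fun h => hl (this.1 h)]
    · rw [if_neg hiu]
      have : i < u * ns.length + (v + 1) ↔ i < u * ns.length + v := by omega
      by_cases hl : i < u * ns.length + v ∧ ∃ u v : Fin ns.length, (listGraph ns).Adj u v ∧
          i = u * ns.length + v
      · rw [if_pos hl, if_pos ⟨this.2 hl.1, hl.2⟩]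
      · rw [if_neg hl, if_neg fun h => hl ⟨this.1 h.1, h.2⟩]

theorem runs_adjacency (hs : s.Bounded b) {ns : List (ℕ × Finset ℕ)} {σ₀ : State}
    (h0 : s.Vertices ns σ₀) (hsub : ∀ x ∈ ns, x.2 ⊆ Finset.range s.n)
    (hfit : (ns.length * ns.length : ℤ) < 2 ^ b)
    (htag : ∀ x ∈ ns, Fits b ((x.1 : ℤ) + 1)) (hz : ∀ i, σ₀.arr 12 i = 0) :
    Runs b adjacency σ₀ (ns.length * (62 * ns.length + 20) + 10) fun σ' =>
      AdjWritten ns σ₀ (ns.length * ns.length) σ' := by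
  have hb := hs.one_le
  have h18 : ∀ {k σ}, AdjWritten ns σ₀ k σ → σ.reg 18 = ns.length := fun hσ => by
    rw [hσ.same.reg 18 (by simp), h0.length]
  refine Runs.mono ((Stm.runs hb (.set 50 (.num 0)) (Q := fun σ' => σ' = σ₀.setReg 50 0)
    ⟨fits_zero b, trivial⟩ rfl).seq (T' := ns.length * (62 * ns.length + 18 + 2) + 2) ?_)
    (by have : Stm.cost (.set 50 (.num 0)) = 3 := rfl
        rw [this, show 62 * ns.length + 18 + 2 = 62 * ns.length + 20 by ring]; omega) fun _ h => h
  rintro _ rfl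
  refine Runs.mono (Runs.whileLt hb (fun u σ => AdjWritten ns σ₀ (u * ns.length) σ ∧ σ.reg 50 = u)
    ns.length (62 * ns.length + 18) ?_ ?_ ?_) le_rfl fun _ h => h.1
  · rintro u hu σ ⟨hσ, h50⟩
    refine ⟨by rw [h50, h18 hσ]; exact_mod_cast hu, ?_⟩
    refine Runs.mono ((Stm.runs hb (.set 51 (.num 0)) (Q := fun σ' => σ' = σ.setReg 51 0)
      ⟨fits_zero b, trivial⟩ rfl).seq (T' := 62 * ns.length + 10) ?_)
      (by have : Stm.cost (.set 51 (.num 0)) = 3 := rfl; rw [this]; omega) fun _ h => h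
    rintro _ rfl
    refine Runs.mono ((Runs.whileLt hb (fun v σ => AdjWritten ns σ₀ (u * ns.length + v) σ ∧
      σ.reg 50 = u ∧ σ.reg 51 = v) ns.length 60 ?_ ?_ ?_).seq (T' := 8) ?_) (by omega) fun _ h => h
    · rintro v hv σ ⟨hσ, h50, h51⟩
      refine ⟨by rw [h51, h18 hσ]; exact_mod_cast hv, ?_⟩
      exact runs_adjStep hs h0 hsub hfit htag hu hv hσ h50 h51
    · rintro σ ⟨hσ, h50, h51⟩
      rw [h51, h18 hσ]; simp
    · exact ⟨⟨hσ.same.setReg (by simp) _, hσ.entry⟩, by simp [h50], by simp⟩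
    · rintro τ ⟨hτ, h50, -⟩
      refine Runs.mono (Stm.runs hb (.set 50 (.var 50 + .num 1)) (Q := fun σ =>
        AdjWritten ns σ₀ ((u + 1) * ns.length) σ ∧ σ.reg 50 = (u + 1 : ℕ)) ?_ ?_)
        (Nat.le_of_ble_eq_true rfl) fun _ h => h
      · simp [Stm.Ok, Stm.fitsIfVar, h50]
        refine ⟨fits_one hb, fits_of_nonneg hfit (by positivity) ?_⟩
        have h1 : ((u : ℤ) + 1) ≤ ns.length := by exact_mod_cast hu
        nlinarith
      · have : (u + 1) * ns.length = u * ns.length + ns.length := by ring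
        rw [this]
        exact ⟨⟨hτ.same.setReg (by simp) _, hτ.entry⟩, by simp [Stm.run, h50]⟩
  · rintro σ ⟨hσ, h50⟩
    rw [h50, h18 hσ]; simp
  · exact ⟨⟨(Same.refl _ _ _).setReg (by simp) _, fun i => by simp [hz]⟩, by simp⟩

end Setup


/-! ## Simple paths on four vertices -/

/-- Neighbours on a walk are different anyway, so being simple amounts to the three inequalities
between vertices that are not consecutive. -/
theorem hasZeroWeightP4_iff {V : Type*} {G : SimpleGraph V} {wt : V → ℤ} :
    HasZeroWeightP4 G wt ↔ ∃ x y z u, G.Adj x y ∧ G.Adj y z ∧ G.Adj z u ∧ x ≠ z ∧ x ≠ u ∧ y ≠ u ∧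
      wt x + wt y + wt z + wt u = 0 := by
  constructor
  · rintro ⟨x, u, p, hp, hl, hs⟩
    match p, hp, hl, hs with
    | .cons (v := y) h1 (.cons (v := z) h2 (.cons h3 .nil)), hp, _, hs =>
      have := hp.support_nodup
      simp at this hs
      exact ⟨x, y, z, u, h1, h2, h3, by tauto, by tauto, by tauto, by rw [← hs]; ring⟩
  · rintro ⟨x, y, z, u, h1, h2, h3, h4, h5, h6, hs⟩
    refine ⟨x, u, .cons h1 (.cons h2 (.cons h3 .nil)), ?_, rfl, ?_⟩
    · rw [SimpleGraph.Walk.isPath_def]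
      simp [h1.ne, h2.ne, h3.ne, h4, h5, h6]
    · simp; rw [← hs]; ring

/-- A finite check: among the sums of four codes only those of four different codes are divisible by
`128`, and these are zero. All other terms of a vertex weight are multiples of `128`, so zero weight
separates into a condition on the layers and one on the sums. -/
theorem layerCode_cases {a b c d : ℕ} (ha : a < 4) (hb : b < 4) (hc : c < 4) (hd : d < 4) {k : ℤ}
    (h : layerCode a + layerCode b + layerCode c + layerCode d = 128 * k) :
    k = 0 ∧ a ≠ b ∧ a ≠ c ∧ a ≠ d ∧ b ≠ c ∧ b ≠ d ∧ c ≠ d := by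
  have key : ∀ a b c d : Fin 4, (layerCode a + layerCode b + layerCode c + layerCode d) % 128 = 0 →
      layerCode a + layerCode b + layerCode c + layerCode d = 0 ∧
        a ≠ b ∧ a ≠ c ∧ a ≠ d ∧ b ≠ c ∧ b ≠ d ∧ c ≠ d := by decide
  obtain ⟨h0, h1⟩ := key ⟨a, ha⟩ ⟨b, hb⟩ ⟨c, hc⟩ ⟨d, hd⟩ (by simp only; omega)
  simp only [ne_eq, Fin.mk.injEq] at h0 h1
  exact ⟨by omega, h1⟩

/-- A path along consecutive integers without repeated layers cannot turn back, so it is monotone.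
The residue `4` modulo `5` is not used, hence the path cannot leave its family of layers and has to
run through all four of them. -/
theorem tags_cases {a b c d : ℕ} (ha : a % 5 < 4) (hb : b % 5 < 4) (hc : c % 5 < 4) (hd : d % 5 < 4)
    (h1 : a + 1 = b ∨ b + 1 = a) (h2 : b + 1 = c ∨ c + 1 = b) (h3 : c + 1 = d ∨ d + 1 = c)
    (hac : a % 5 ≠ c % 5) (hbd : b % 5 ≠ d % 5) (had : a % 5 ≠ d % 5) :
    ∃ j, (a = 5 * j ∧ b = 5 * j + 1 ∧ c = 5 * j + 2 ∧ d = 5 * j + 3) ∨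
      (d = 5 * j ∧ c = 5 * j + 1 ∧ b = 5 * j + 2 ∧ a = 5 * j + 3) := by
  have h2' : (a + 1 = b ∧ b + 1 = c) ∨ (b + 1 = a ∧ c + 1 = b) := by
    rcases h1 with h1 | h1 <;> rcases h2 with h2 | h2 <;> omega
  rcases h2' with ⟨h1, h2⟩ | ⟨h1, h2⟩
  · rcases h3 with h3 | h3
    · exact ⟨a / 5, .inl (by omega)⟩
    · exact absurd (by omega) hbd
  · rcases h3 with h3 | h3
    · exact absurd (by omega) hbd
    · exact ⟨d / 5, .inr (by omega)⟩

namespace Setup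

variable {s : Setup} {b : ℕ}

theorem disjoint_items {f g : ℕ → Bool} (h : ∀ j, ¬ (f j = true ∧ g j = true)) :
    Disjoint (s.items f) (s.items g) := by
  rw [Finset.disjoint_left]
  intro i hi hi'
  exact h _ ⟨(Finset.mem_filter.1 hi).2, (Finset.mem_filter.1 hi').2⟩

/-- The roles are {0, 3}, {0, 1}, {1, 2}, {2, 4}, so only neighbouring layers share one. This is why
a path, rather than a complete graph on four vertices, can certify disjointness. -/
theorem disjoint_layers {ρ : ℕ → ℕ} (hρ : ∀ j, ρ j < 5) : Disjoint (s.items ((layer 0).sel ρ)) (s.items ((layer 2).sel ρ)) ∧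
    Disjoint (s.items ((layer 0).sel ρ)) (s.items ((layer 3).sel ρ)) ∧
    Disjoint (s.items ((layer 1).sel ρ)) (s.items ((layer 3).sel ρ)) := by
  refine ⟨disjoint_items fun j => ?_, disjoint_items fun j => ?_, disjoint_items fun j => ?_⟩ <;>
  · have := hρ j
    simp only [Layer.sel, layer, decide_eq_true_eq]
    omega

/-- The vertices are sets of the parts given by their tags. -/
def WellTagged (s : Setup) (ρ : ℕ → ℕ → ℕ) (ns : List (ℕ × Finset ℕ)) : Prop :=
  ∀ x ∈ ns, x.1 % 5 < 4 ∧ x.2 ⊆ s.items ((layer (x.1 % 5)).sel (ρ (x.1 / 5)))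

theorem solvable_of_path {ρ : ℕ → ℕ → ℕ} (hρ : ∀ j k, ρ j k < 5) {j : ℕ} {A₀ A₁ A₂ A₃ : Finset ℕ}
    (h0 : A₀ ⊆ s.items ((layer 0).sel (ρ j))) (h1 : A₁ ⊆ s.items ((layer 1).sel (ρ j)))
    (h2 : A₂ ⊆ s.items ((layer 2).sel (ρ j))) (h3 : A₃ ⊆ s.items ((layer 3).sel (ρ j)))
    (d1 : Disjoint A₀ A₁) (d2 : Disjoint A₁ A₂) (d3 : Disjoint A₂ A₃)
    (hw : s.sum A₀ + s.sum A₁ + s.sum A₂ + s.sum A₃ = s.t) : s.Solvable false := by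
  obtain ⟨e1, e2, e3⟩ := disjoint_layers (hρ j)
  have e1 := e1.mono h0 h2
  have e2 := e2.mono h0 h3
  have e3 := e3.mono h1 h3
  refine ⟨A₀ ∪ A₁ ∪ A₂ ∪ A₃, ?_, ?_⟩
  · exact Finset.union_subset (Finset.union_subset (Finset.union_subset
      (h0.trans (s.items_subset _)) (h1.trans (s.items_subset _))) (h2.trans (s.items_subset _)))
      (h3.trans (s.items_subset _))
  · unfold Setup.sum at *
    rw [Finset.sum_union, Finset.sum_union, Finset.sum_union d1, hw]
    · simp [target]
    · exact Finset.disjoint_union_left.2 ⟨e1, d2⟩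
    · exact Finset.disjoint_union_left.2 ⟨Finset.disjoint_union_left.2 ⟨e2, e3⟩, d3⟩

/-- Soundness of the graph. It holds for every hash function, since the hash values only decide
which vertices exist. -/
theorem solvable_of_hasZeroWeightP4 {ρ : ℕ → ℕ → ℕ} (hρ : ∀ j k, ρ j k < 5) {ns : List (ℕ × Finset ℕ)}
    (hns : s.WellTagged ρ ns)
    (h : HasZeroWeightP4 (listGraph ns) fun i => s.weight ns[i]) : s.Solvable false := by
  obtain ⟨x, y, z, u, h1, h2, h3, -, -, -, hw⟩ := hasZeroWeightP4_iff.1 h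
  obtain ⟨t1, d1⟩ : Linked ns[x] ns[y] := h1
  obtain ⟨t2, d2⟩ : Linked ns[y] ns[z] := h2
  obtain ⟨t3, d3⟩ : Linked ns[z] ns[u] := h3
  obtain ⟨px, qx⟩ := hns ns[x] (List.getElem_mem _)
  obtain ⟨py, qy⟩ := hns ns[y] (List.getElem_mem _)
  obtain ⟨pz, qz⟩ := hns ns[z] (List.getElem_mem _)
  obtain ⟨pu, qu⟩ := hns ns[u] (List.getElem_mem _)
  set X := ns[x]
  set Y := ns[y]
  set Z := ns[z]
  set U := ns[u]
  have hm : ∀ a : ℕ, s.t * (if a = 3 then 128 else 0) = 128 * (s.t * if a = 3 then 1 else 0) := by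
    intro a; split_ifs <;> ring
  simp only [weight, hm] at hw
  obtain ⟨k0, c1, c2, c3, c4, c5, c6⟩ := layerCode_cases px py pz pu
    (k := (s.t * (if X.1 % 5 = 3 then 1 else 0) + s.t * (if Y.1 % 5 = 3 then 1 else 0) +
      s.t * (if Z.1 % 5 = 3 then 1 else 0) + s.t * (if U.1 % 5 = 3 then 1 else 0)) -
      (s.sum X.2 + s.sum Y.2 + s.sum Z.2 + s.sum U.2)) (by linarith)
  obtain ⟨j, ⟨e1, e2, e3, e4⟩ | ⟨e1, e2, e3, e4⟩⟩ := tags_cases px py pz pu t1 t2 t3 c2 c5 c3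
  · have m0 : X.1 % 5 = 0 ∧ X.1 / 5 = j := by omega
    have m1 : Y.1 % 5 = 1 ∧ Y.1 / 5 = j := by omega
    have m2 : Z.1 % 5 = 2 ∧ Z.1 / 5 = j := by omega
    have m3 : U.1 % 5 = 3 ∧ U.1 / 5 = j := by omega
    rw [m0.1, m0.2] at qx
    rw [m1.1, m1.2] at qy
    rw [m2.1, m2.2] at qz
    rw [m3.1, m3.2] at qu
    simp [m0.1, m1.1, m2.1, m3.1] at k0
    exact solvable_of_path hρ qx qy qz qu d1 d2 d3 (by linarith)
  · have m0 : U.1 % 5 = 0 ∧ U.1 / 5 = j := by omega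
    have m1 : Z.1 % 5 = 1 ∧ Z.1 / 5 = j := by omega
    have m2 : Y.1 % 5 = 2 ∧ Y.1 / 5 = j := by omega
    have m3 : X.1 % 5 = 3 ∧ X.1 / 5 = j := by omega
    rw [m0.1, m0.2] at qu
    rw [m1.1, m1.2] at qz
    rw [m2.1, m2.2] at qy
    rw [m3.1, m3.2] at qx
    simp [m0.1, m1.1, m2.1, m3.1] at k0
    exact solvable_of_path hρ qu qz qy qx d3.symm d2.symm d1.symm (by linarith)

theorem hasZeroWeightP4_of_mem {ns : List (ℕ × Finset ℕ)} {j : ℕ} {A₀ A₁ A₂ A₃ : Finset ℕ}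
    (h0 : (5 * j, A₀) ∈ ns) (h1 : (5 * j + 1, A₁) ∈ ns) (h2 : (5 * j + 2, A₂) ∈ ns)
    (h3 : (5 * j + 3, A₃) ∈ ns) (d1 : Disjoint A₀ A₁) (d2 : Disjoint A₁ A₂) (d3 : Disjoint A₂ A₃)
    (hw : s.sum A₀ + s.sum A₁ + s.sum A₂ + s.sum A₃ = s.t) :
    HasZeroWeightP4 (listGraph ns) fun i => s.weight ns[i] := by
  obtain ⟨x, hx, ex⟩ := List.mem_iff_getElem.1 h0
  obtain ⟨y, hy, ey⟩ := List.mem_iff_getElem.1 h1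
  obtain ⟨z, hz, ez⟩ := List.mem_iff_getElem.1 h2
  obtain ⟨u, hu, eu⟩ := List.mem_iff_getElem.1 h3
  have hne : ∀ {x y : ℕ} (hx : x < ns.length) (hy : y < ns.length), ns[x].1 ≠ ns[y].1 →
      (⟨x, hx⟩ : Fin ns.length) ≠ ⟨y, hy⟩ := by
    rintro x y hx hy h e
    obtain rfl : x = y := by simpa using e
    exact h rfl
  refine hasZeroWeightP4_iff.2 ⟨⟨x, hx⟩, ⟨y, hy⟩, ⟨z, hz⟩, ⟨u, hu⟩, ?_, ?_, ?_, hne _ _ ?_, hne _ _ ?_,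
    hne _ _ ?_, ?_⟩
  · show Linked ns[x] ns[y]
    rw [ex, ey]; exact ⟨.inl rfl, d1⟩
  · show Linked ns[y] ns[z]
    rw [ey, ez]; exact ⟨.inl rfl, d2⟩
  · show Linked ns[z] ns[u]
    rw [ez, eu]; exact ⟨.inl rfl, d3⟩
  · rw [ex, ez]; simp
  · rw [ex, eu]; simp
  · rw [ey, eu]; simp
  · show s.weight ns[x] + s.weight ns[y] + s.weight ns[z] + s.weight ns[u] = 0
    rw [ex, ey, ez, eu]
    have e0 : 5 * j % 5 = 0 := by omega
    have e1 : (5 * j + 1) % 5 = 1 := by omega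
    have e2 : (5 * j + 2) % 5 = 2 := by omega
    have e3 : (5 * j + 3) % 5 = 3 := by omega
    simp only [weight, e0, e1, e2, e3, layerCode]
    norm_num
    linarith

end Setup

/-! ## The call of the algorithm for paths -/

theorem Runs.skip (b : ℕ) {σ : State} {Q : State → Prop} (hQ : Q σ) :
    Runs b (.const (tmp 0) 0) σ 1 Q :=
  fun _ h => ⟨1, _, σ, le_rfl, .const (fits_zero b), h.setTmp 0 0, hQ⟩

/-- Calls the program `P` if the graph is neither empty nor too large. -/
def call (P : Prog) : Prog :=
  .seq (Stm.code (.set 50 (.num 0)))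
    (ifLt 50 18 (ifLt 18 20
      (.seq adjacency (.seq (Stm.code (.set 100 (.var 18 + .num 0)))
        (.seq P.sub (Stm.code (.cond (.var 100) (.set 17 (.num 1)))))))
      (.const (tmp 0) 0)) (.const (tmp 0) 0))

/-- The registers and arrays of the subroutine are empty. -/
structure Clean (σ : State) : Prop where
  reg : ∀ x ≥ 100, σ.reg x = 0
  arr : ∀ a ≥ 1, ∀ i, σ.arr (2 * a + 10) i = 0

namespace Setup

variable {s : Setup} {b : ℕ}

/-- A graph with more than `N₀` vertices is not passed on, which keeps the running time bounded for
all outcomes of the coins. An empty graph is skipped because the subroutine is only specified for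
nonempty ones. -/
theorem runs_call (hs : s.Bounded b) {P : Prog} {ns : List (ℕ × Finset ℕ)} {σ : State}
    (hσ : s.Vertices ns σ) (hcl : Clean σ) (hsub : ∀ x ∈ ns, x.2 ⊆ Finset.range s.n)
    {N₀ T : ℕ} (h20 : σ.reg 20 = N₀ + 1) (hfit : (N₀ * N₀ : ℤ) < 2 ^ b)
    (htag : ∀ x ∈ ns, Fits b ((x.1 : ℤ) + 1))
    (hP : 0 < ns.length → ns.length ≤ N₀ → ∀ ω, ∃ τ σ',
      Exec b P (p4Input (listGraph ns) (fun i => s.weight ns[i]) ω) τ σ' ∧ τ ≤ T ∧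
      (σ'.Accepts ↔ HasZeroWeightP4 (listGraph ns) fun i => s.weight ns[i])) :
    Runs b (call P) σ (N₀ * (62 * N₀ + 20) + T + 40) fun σ' =>
      (σ'.reg 17 = σ.reg 17 ∨ (σ'.reg 17 = 1 ∧
        HasZeroWeightP4 (listGraph ns) fun i => s.weight ns[i])) ∧
      (ns.length ≤ N₀ → (HasZeroWeightP4 (listGraph ns) fun i => s.weight ns[i]) →
        σ'.reg 17 = 1) := by
  have hb := hs.one_le
  have hpos : (HasZeroWeightP4 (listGraph ns) fun i => s.weight ns[i]) → 0 < ns.length := by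
    rintro ⟨u, -⟩; exact u.pos
  refine Runs.mono ((Stm.runs hb (.set 50 (.num 0)) (Q := fun σ' => σ' = σ.setReg 50 0)
    ⟨fits_zero b, trivial⟩ rfl).seq (T' := N₀ * (62 * N₀ + 20) + T + 30 + 2 + 2) ?_)
    (by have : Stm.cost (.set 50 (.num 0)) = 3 := rfl
        rw [this]; omega) fun _ h => h
  rintro _ rfl
  refine Runs.ifLt hb (fun hlt => Runs.ifLt hb (fun hlt' => ?_) fun hlt' => ?_) fun hlt => ?_
  · have h1 : 0 < ns.length := by simpa [hσ.length] using hlt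
    have h2 : ns.length ≤ N₀ := by
      have : (ns.length : ℤ) < N₀ + 1 := by simpa [hσ.length, h20] using hlt'
      omega
    have hfit' : (ns.length * ns.length : ℤ) < 2 ^ b := by
      refine lt_of_le_of_lt ?_ hfit
      exact_mod_cast Nat.mul_le_mul h2 h2
    have hmon : ns.length * (62 * ns.length + 20) ≤ N₀ * (62 * N₀ + 20) := by gcongr
    have hσ' : s.Vertices ns (σ.setReg 50 0) := hσ.congr (by simp) rfl rfl rfl
    refine Runs.mono ((runs_adjacency hs hσ' hsub hfit' htag (fun i => hcl.arr 1 le_rfl i)).seq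
      (T' := T + 20) ?_) (by omega) fun _ h => h
    intro σ₂ h₂
    obtain ⟨τ, σ₁, hex, hτ, hacc⟩ := hP h1 h2 σ₂.coins
    refine Runs.mono ((Stm.runs hb (.set 100 (.var 18 + .num 0))
      (Q := fun σ' => σ' = σ₂.setReg 100 ns.length) ?_ ?_).seq (T' := T + 10) ?_)
      (by have : Stm.cost (.set 100 (.var 18 + .num 0)) = 5 := rfl
          rw [this]; omega) fun _ h => h
    · simp [Stm.Ok, Stm.fitsIfVar, h₂.same.reg 18, hσ.length]
      refine ⟨fits_zero b, fits_of_nonneg hfit' (by positivity) ?_⟩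
      exact_mod_cast Nat.le_mul_self _
    · simp [Stm.run, h₂.same.reg 18, hσ.length]
    rintro _ rfl
    refine Runs.mono (Runs.seq (T' := 6) (Runs.sub (Q := fun σ' => σ'.reg 100 = σ₁.reg 0 ∧
      σ'.reg 17 = σ.reg 17) ?_ ?_ ?_ hex ?_) ?_) (by omega) fun _ h => h
    · intro x
      by_cases hx : x = 0
      · subst hx; simp [p4Input]
      · rw [State.reg_setReg, if_neg (by omega), h₂.same.reg _ (by simp)]
        simp [p4Input, hx, hcl.reg, show x + 100 ≠ 50 by omega]
    · intro a
      rw [State.arr_setReg]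
      match a with
      | 0 =>
        rw [h₂.same.arr _ (by simp)]
        funext i
        simp only [p4Input]
        by_cases hi : i < ns.length
        · simp [hi, hσ.weight i hi]
        · simp [hi, hσ.rest i (by omega)]
      | 1 =>
        funext i
        rw [h₂.entry]
        have hlt : (∃ u v : Fin ns.length, (listGraph ns).Adj u v ∧ i = u * ns.length + v) →
            i < ns.length * ns.length := by
          rintro ⟨u, v, -, rfl⟩
          have := Nat.mul_le_mul_right ns.length (show (u : ℕ) + 1 ≤ ns.length from u.2)
          rw [add_mul] at this
          have := v.2
          omega
        by_cases hi : ∃ u v : Fin ns.length, (listGraph ns).Adj u v ∧ i = u * ns.length + v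
        · rw [if_pos ⟨hlt hi, hi⟩]; simp [p4Input, hi]
        · rw [if_neg fun h => hi h.2]; simp [p4Input, hi]
      | a + 2 =>
        rw [h₂.same.arr _ (by simp)]
        funext i
        simp [p4Input]
        exact hcl.arr (a + 2) (by omega) i
    · rfl
    · intro σ' hr hr'
      refine ⟨hr 0, ?_⟩
      rw [hr' 17 (by norm_num), State.reg_setReg, if_neg (by norm_num), h₂.same.reg _ (by simp)]
      simp
    · rintro σ₃ ⟨k1, k2⟩
      refine Runs.mono (Stm.runs hb (.cond (.var 100) (.set 17 (.num 1))) ?_ ?_)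
        (Nat.le_of_ble_eq_true rfl) fun _ h => h
      · simp [Stm.Ok, Stm.fitsIfVar, fits_one hb]
      · simp only [Stm.run, Expr.eval_var, Expr.eval_num, k1]
        by_cases ha : σ₁.Accepts
        · rw [if_pos (show σ₁.reg 0 ≠ 0 from ha)]
          exact ⟨.inr ⟨by simp, hacc.1 ha⟩, fun _ _ => by simp⟩
        · rw [if_neg (show ¬ σ₁.reg 0 ≠ 0 from ha)]
          exact ⟨.inl k2, fun _ h => absurd (hacc.2 h) ha⟩
  · refine Runs.mono (Runs.skip b ?_) (by omega) fun _ h => h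
    refine ⟨.inl (by simp), fun h => absurd ?_ hlt'⟩
    simp [hσ.length, h20]
    omega
  · refine Runs.mono (Runs.skip b ?_) (by omega) fun _ h => h
    refine ⟨.inl (by simp), fun _ h => absurd ?_ hlt⟩
    simpa [hσ.length] using hpos h

end Setup

end WordRAM

/-! ## Tail bounds for subsets -/

theorem two_pow_le_exp (k : ℕ) : (2 : ℝ) ^ k ≤ Real.exp k := by
  rw [← Real.exp_one_pow]
  exact pow_le_pow_left₀ (by norm_num) (by linarith [Real.add_one_le_exp (1 : ℝ)]) k

/-- The left side is the moment generating function of a sum of independent signs, up to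
normalisation. It factors over the elements, and each factor `2 * cosh y` is at most `2 * exp (y ^ 2
/ 2)`. -/
theorem sum_powerset_exp {ι : Type*} (I : Finset ι) (y : ℝ) :
    ∑ A ∈ I.powerset, Real.exp (y * (I.card - 2 * A.card)) ≤
      2 ^ I.card * Real.exp (I.card * (y ^ 2 / 2)) := by
  have h1 : ∑ A ∈ I.powerset, Real.exp (y * (I.card - 2 * A.card)) =
      (Real.exp (-y) + Real.exp y) ^ I.card := by
    rw [← Finset.sum_pow_mul_eq_add_pow]
    refine Finset.sum_congr rfl fun A hA => ?_
    have hle := Finset.card_le_card (Finset.mem_powerset.1 hA)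
    rw [← Real.exp_nat_mul, ← Real.exp_nat_mul, ← Real.exp_add, Nat.cast_sub hle]
    congr 1; ring
  rw [h1, Real.exp_nat_mul, ← mul_pow]
  refine pow_le_pow_left₀ (by positivity) ?_ _
  have := Real.cosh_le_exp_half_sq y
  rw [Real.cosh_eq] at this
  linarith

/-- Hoeffding's inequality, in integer form and for either tail according to the sign `ε`: a
deviation `x` from the mean has relative frequency at most `exp (-2 * x ^ 2 / m)`, where `m` is the
size of `I`, and this is at most `2 ^ (-k)`. -/
theorem card_tail_aux {ι : Type*} (I : Finset ι) (p : Finset ι → Prop) [DecidablePred p] {k x : ℕ}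
    {ε : ℝ} (hε : ε ^ 2 = 1) (hx : 0 < x) (hk : k * I.card ≤ 2 * x ^ 2)
    (hp : ∀ A ⊆ I, p A → 2 * (x : ℝ) ≤ ε * (I.card - 2 * A.card)) :
    (I.powerset.filter p).card * 2 ^ k ≤ 2 ^ I.card := by
  rcases Nat.eq_zero_or_pos I.card with h0 | h0
  · have : I.powerset.filter p = ∅ := by
      refine Finset.filter_eq_empty_iff.2 fun A hA hpA => ?_
      have hA := Finset.mem_powerset.1 hA
      have h1 := hp A hA hpA
      have h2 : A.card = 0 := Nat.le_zero.1 (h0 ▸ Finset.card_le_card hA)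
      have h3 : (0 : ℝ) < x := by exact_mod_cast hx
      rw [h0, h2] at h1
      simp at h1
      linarith
    rw [this]; simp
  have hm : (0 : ℝ) < I.card := by exact_mod_cast h0
  set m : ℝ := (I.card : ℝ) with hmdef
  -- The value that minimises the Chernoff bound `m * y ^ 2 / 2 - 2 * x * |y|`.
  set y : ℝ := ε * (2 * x / m) with hy
  have key := sum_powerset_exp I y
  have h1 : ((I.powerset.filter p).card : ℝ) * Real.exp (4 * x ^ 2 / m) ≤
      ∑ A ∈ I.powerset, Real.exp (y * (I.card - 2 * A.card)) := by
    rw [← nsmul_eq_mul]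
    refine le_trans ?_ (Finset.sum_le_sum_of_subset_of_nonneg (Finset.filter_subset p _)
      fun _ _ _ => (Real.exp_pos _).le)
    refine Finset.card_nsmul_le_sum _ _ _ fun A hA => ?_
    obtain ⟨hA, hpA⟩ := Finset.mem_filter.1 hA
    have := hp A (Finset.mem_powerset.1 hA) hpA
    rw [Real.exp_le_exp]
    have e : y * (m - 2 * A.card) = (2 * x / m) * (ε * (m - 2 * A.card)) := by rw [hy]; ring
    rw [e]
    calc 4 * (x : ℝ) ^ 2 / m = (2 * x / m) * (2 * x) := by ring
      _ ≤ _ := mul_le_mul_of_nonneg_left this (by positivity)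
  have h2 : m * (y ^ 2 / 2) = 2 * x ^ 2 / m := by
    rw [hy, mul_pow, hε]; field_simp
  rw [← hmdef, h2] at key
  have h3 : (2 : ℝ) ^ k ≤ Real.exp (2 * x ^ 2 / m) := by
    refine (two_pow_le_exp k).trans (Real.exp_le_exp.2 ?_)
    rw [le_div_iff₀ hm, hmdef]
    exact_mod_cast hk
  have h4 : Real.exp (4 * x ^ 2 / m) = Real.exp (2 * x ^ 2 / m) * Real.exp (2 * x ^ 2 / m) := by
    rw [← Real.exp_add]; congr 1; ring
  have h5 := h1.trans key
  rw [h4, ← mul_assoc] at h5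
  have h6 := le_of_mul_le_mul_right h5 (Real.exp_pos _)
  have h7 : ((I.powerset.filter p).card : ℝ) * 2 ^ k ≤ 2 ^ I.card :=
    (mul_le_mul_of_nonneg_left h3 (by positivity)).trans h6
  exact_mod_cast h7

theorem card_low_tail {ι : Type*} (I : Finset ι) {k x c : ℕ} (hx : 0 < x) (hk : k * I.card ≤ 2 * x ^ 2)
    (hc : 2 * c + 2 * x ≤ I.card) :
    (I.powerset.filter fun A => A.card ≤ c).card * 2 ^ k ≤ 2 ^ I.card := by
  refine card_tail_aux I _ (ε := 1) (by norm_num) hx hk fun A _ h => ?_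
  have h1 : (2 * c + 2 * x : ℝ) ≤ I.card := by exact_mod_cast hc
  have h2 : (A.card : ℝ) ≤ c := by exact_mod_cast h
  linarith

theorem card_high_tail {ι : Type*} (I : Finset ι) {k x c : ℕ} (hx : 0 < x) (hk : k * I.card ≤ 2 * x ^ 2)
    (hc : I.card + 2 * x ≤ 2 * c) :
    (I.powerset.filter fun A => c ≤ A.card).card * 2 ^ k ≤ 2 ^ I.card := by
  refine card_tail_aux I _ (ε := -1) (by norm_num) hx hk fun A _ h => ?_
  have h1 : (I.card + 2 * x : ℝ) ≤ 2 * c := by exact_mod_cast hc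
  have h2 : (c : ℝ) ≤ A.card := by exact_mod_cast h
  linarith

/-- Give a set `A` the weight `3 ^ (|I| - |A|)`. The total weight is `4 ^ |I|`, and a small set has
a large weight. For `c` near a quarter of `|I|` this is the entropy bound, which Hoeffding's
inequality would not reach. -/
theorem card_filter_card_le_mul {ι : Type*} (I : Finset ι) (c : ℕ) :
    (I.powerset.filter fun A => A.card ≤ c).card * 3 ^ I.card ≤ 3 ^ c * 4 ^ I.card := by
  have h := Finset.sum_pow_mul_eq_add_pow 1 3 I (R := ℕ)
  norm_num at h
  rw [← h, Finset.mul_sum, ← smul_eq_mul]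
  refine le_trans (Finset.card_nsmul_le_sum (I.powerset.filter fun A => A.card ≤ c)
    (fun A => 3 ^ c * 3 ^ (I.card - A.card)) _ fun A hA => ?_)
    (Finset.sum_le_sum_of_subset (Finset.filter_subset _ _))
  rw [← pow_add]
  have := (Finset.mem_filter.1 hA).2
  exact Nat.pow_le_pow_right (by norm_num) (by omega)

/-! ## Hashing -/

/-- An odd number is invertible modulo `2 ^ m`, so multiplying by it and shifting permutes the
residues. -/
theorem card_filter_emod_of_odd (m : ℕ) {δ : ℤ} (hδ : ¬ (2 : ℤ) ∣ δ) (e : ℤ) (p : ℤ → Prop)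
    [DecidablePred p] :
    ((Finset.range (2 ^ m)).filter fun a : ℕ => p ((a * δ + e) % 2 ^ m)).card =
      ((Finset.range (2 ^ m)).filter fun a : ℕ => p a).card := by
  have hM : (0 : ℤ) < 2 ^ m := by positivity
  set f : ℕ → ℕ := fun a => ((a * δ + e) % 2 ^ m).toNat with hf
  have hfv : ∀ a, (f a : ℤ) = (a * δ + e) % 2 ^ m := fun a =>
    Int.toNat_of_nonneg (Int.emod_nonneg _ hM.ne')
  have hinj : Set.InjOn f (Finset.range (2 ^ m)) := by
    intro a ha a' ha' h
    simp only [Finset.coe_range, Set.mem_Iio] at ha ha'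
    have h1 : (a * δ + e) % 2 ^ m = (a' * δ + e) % 2 ^ m := by rw [← hfv, ← hfv, h]
    have h2 : (2 : ℤ) ^ m ∣ (a' - a : ℤ) * δ := by
      have := Int.ModEq.dvd h1
      rwa [show (a' : ℤ) * δ + e - (a * δ + e) = (a' - a) * δ by ring] at this
    have h3 : IsCoprime ((2 : ℤ) ^ m) δ :=
      ((Int.prime_two.coprime_iff_not_dvd).2 hδ).pow_left
    have h4 := h3.dvd_of_dvd_mul_right h2
    have h5 : |(a' - a : ℤ)| < 2 ^ m := by
      have e1 : (a : ℤ) < 2 ^ m := by exact_mod_cast ha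
      have e2 : (a' : ℤ) < 2 ^ m := by exact_mod_cast ha'
      rw [abs_lt]; constructor <;> linarith [Int.natCast_nonneg a, Int.natCast_nonneg a']
    have := Int.eq_zero_of_abs_lt_dvd h4 h5
    omega
  have himg : (Finset.range (2 ^ m)).image f = Finset.range (2 ^ m) := by
    refine Finset.eq_of_subset_of_card_le ?_ (by rw [Finset.card_image_of_injOn hinj])
    intro x hx
    obtain ⟨a, -, rfl⟩ := Finset.mem_image.1 hx
    rw [Finset.mem_range]
    have : (f a : ℤ) < 2 ^ m := by rw [hfv]; exact Int.emod_lt_of_pos _ hM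
    exact_mod_cast this
  simp only [← hfv]
  nth_rw 2 [← himg]
  rw [Finset.filter_image, Finset.card_image_of_injOn (hinj.mono fun _ h => (Finset.mem_filter.1 h).1)]

theorem card_filter_lt_two_pow {m d : ℕ} (hd : d ≤ m) :
    ((Finset.range (2 ^ m)).filter fun a : ℕ => (a : ℤ) < 2 ^ d).card = 2 ^ d := by
  have : (Finset.range (2 ^ m)).filter (fun i : ℕ => (i : ℤ) < 2 ^ d) = Finset.range (2 ^ d) := by
    ext i
    have := Nat.pow_le_pow_right (show 0 < 2 by norm_num) hd
    have h : (i : ℤ) < 2 ^ d ↔ i < 2 ^ d := by exact_mod_cast Iff.rfl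
    simp only [Finset.mem_filter, Finset.mem_range, h]
    omega
  rw [this, Finset.card_range]

/-- Every factor two of `δ` can be moved out of modulus and window alike, at the price that each
residue is met twice. Because `0 < |δ| < 2 ^ d`, an odd number is reached before the window has
shrunk to a point. The count is thus exactly what a uniformly distributed value would give, although
the modulus is not prime. -/
theorem card_filter_mul_add_emod {m d : ℕ} (hd : d ≤ m) {δ : ℤ} (h0 : δ ≠ 0) (hδ : |δ| < 2 ^ d)
    (e : ℤ) :
    ((Finset.range (2 ^ m)).filter fun a : ℕ => (a * δ + e) % 2 ^ m < 2 ^ d).card = 2 ^ d := by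
  induction d generalizing m δ e with
  | zero =>
    rw [pow_zero, Int.abs_lt_one_iff] at hδ
    exact absurd hδ h0
  | succ d ih =>
    by_cases h2 : (2 : ℤ) ∣ δ
    · obtain ⟨δ', rfl⟩ := h2
      obtain ⟨m, rfl⟩ : ∃ m', m = m' + 1 := ⟨m - 1, by omega⟩
      have hP : (0 : ℤ) < 2 ^ m := by positivity
      have hiff : ∀ a : ℕ, (a * (2 * δ') + e) % 2 ^ (m + 1) < 2 ^ (d + 1) ↔
          (a * δ' + e / 2) % 2 ^ m < 2 ^ d := by
        intro a
        have h1 : (a * (2 * δ') + e) = 2 * (a * δ' + e / 2) + e % 2 := by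
          have := Int.emod_add_mul_ediv e 2
          linarith
        have h3 : (a * (2 * δ') + e) % 2 ^ (m + 1) = 2 * ((a * δ' + e / 2) % 2 ^ m) + e % 2 := by
          rw [h1, Int.emod_def (a * δ' + e / 2), pow_succ]
          rw [show 2 * (a * δ' + e / 2) + e % 2 = 2 * (a * δ' + e / 2 - 2 ^ m * ((a * δ' + e / 2) / 2 ^ m))
            + e % 2 + (2 ^ m * 2) * ((a * δ' + e / 2) / 2 ^ m) by ring, Int.add_mul_emod_self_left]
          rw [← Int.emod_def]
          have l1 := Int.emod_nonneg (a * δ' + e / 2) hP.ne'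
          have l2 := Int.emod_lt_of_pos (a * δ' + e / 2) hP
          exact Int.emod_eq_of_lt (by omega) (by omega)
        rw [h3, pow_succ]
        omega
      simp only [hiff]
      have hδ' : |δ'| < 2 ^ d := by
        rw [abs_mul, abs_two, pow_succ] at hδ
        linarith
      have h3 := ih (m := m) (by omega) (δ := δ') (by rintro rfl; simp at h0) hδ' (e / 2)
      -- The condition depends on `a` only modulo `2 ^ m`, so the two halves of the range contribute
      -- equally.
      have hsplit : Finset.range (2 ^ (m + 1)) = Finset.range (2 ^ m) ∪
          (Finset.range (2 ^ m)).map (addLeftEmbedding (2 ^ m)) := by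
        rw [pow_succ, mul_two]
        exact Finset.range_add_eq_union ..
      rw [hsplit, Finset.filter_union, Finset.card_union_of_disjoint, Finset.filter_map,
        Finset.card_map, h3]
      · have : ((Finset.range (2 ^ m)).filter ((fun a : ℕ => (a * δ' + e / 2) % 2 ^ m < 2 ^ d) ∘
            (addLeftEmbedding (2 ^ m)))).card = 2 ^ d := by
          rw [← h3]
          congr 1
          refine Finset.filter_congr fun a _ => ?_
          simp only [Function.comp, addLeftEmbedding_apply]
          push_cast
          rw [show ((2 : ℤ) ^ m + a) * δ' + e / 2 = a * δ' + e / 2 + 2 ^ m * δ' by ring,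
            Int.add_mul_emod_self_left]
        rw [this, pow_succ]; ring
      · refine Finset.disjoint_filter_filter ?_
        rw [Finset.disjoint_left]
        intro x hx hx'
        obtain ⟨y, -, rfl⟩ := Finset.mem_map.1 hx'
        simp at hx
    · rw [card_filter_emod_of_odd m h2 e (· < 2 ^ (d + 1)), card_filter_lt_two_pow hd]

theorem card_filter_add_emod (m : ℕ) (e : ℤ) (p : ℤ → Prop) [DecidablePred p] :
    ((Finset.range (2 ^ m)).filter fun c : ℕ => p ((e + c) % 2 ^ m)).card =
      ((Finset.range (2 ^ m)).filter fun c : ℕ => p c).card := by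
  rw [← card_filter_emod_of_odd m (δ := 1) (by norm_num) e p]
  simp only [mul_one, add_comm]

/-- The number of elements of `X` that are hashed into the window. -/
def hits (m d : ℕ) (X : Finset ℤ) (a c : ℕ) : ℕ :=
  (X.filter fun u : ℤ => ((a : ℤ) * u + c) % 2 ^ m < 2 ^ d).card

/-- The first moment. For each `a` the offset `c` alone makes the hash value of `u` uniformly
distributed. -/
theorem sum_hits {m d : ℕ} (hd : d ≤ m) (X : Finset ℤ) :
    ∑ a ∈ Finset.range (2 ^ m), ∑ c ∈ Finset.range (2 ^ m), hits m d X a c =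
      X.card * (2 ^ m * 2 ^ d) := by
  have : ∀ a ∈ Finset.range (2 ^ m), ∑ c ∈ Finset.range (2 ^ m), hits m d X a c =
      X.card * 2 ^ d := by
    intro a _
    simp only [hits, Finset.card_filter]
    rw [Finset.sum_comm]
    refine Finset.sum_const_nat fun u _ => ?_
    rw [← Finset.card_filter, card_filter_add_emod m _ (· < 2 ^ d), card_filter_lt_two_pow hd]
  rw [Finset.sum_congr rfl this]
  simp; ring

/-- Pairwise independence. With `v = a * u + c` in place of `c`, the second value is `a * (u' - u) +
v`; for each `v` in the window the number of suitable `a` is given by `card_filter_mul_add_emod`. -/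
theorem sum_card_pair {m d : ℕ} (hd : d ≤ m) {u u' : ℤ} (h : u ≠ u') (hu : |u' - u| < 2 ^ d) :
    ∑ a ∈ Finset.range (2 ^ m), ((Finset.range (2 ^ m)).filter fun c : ℕ =>
      ((a : ℤ) * u + c) % 2 ^ m < 2 ^ d ∧ ((a : ℤ) * u' + c) % 2 ^ m < 2 ^ d).card =
      2 ^ d * 2 ^ d := by
  have h1 : ∀ a ∈ Finset.range (2 ^ m), ((Finset.range (2 ^ m)).filter fun c : ℕ =>
      ((a : ℤ) * u + c) % 2 ^ m < 2 ^ d ∧ ((a : ℤ) * u' + c) % 2 ^ m < 2 ^ d).card =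
      ∑ v ∈ (Finset.range (2 ^ m)).filter (fun v : ℕ => (v : ℤ) < 2 ^ d),
        if ((a : ℤ) * (u' - u) + v) % 2 ^ m < 2 ^ d then 1 else 0 := by
    intro a _
    rw [← Finset.card_filter, Finset.filter_filter,
      ← card_filter_add_emod m (a * u) fun v => v < 2 ^ d ∧ (a * (u' - u) + v) % 2 ^ m < 2 ^ d]
    congr 1
    refine Finset.filter_congr fun c _ => and_congr_right fun _ => ?_
    rw [Int.add_emod_emod, show (a : ℤ) * (u' - u) + (a * u + c) = a * u' + c by ring]
  rw [Finset.sum_congr rfl h1, Finset.sum_comm,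
    Finset.sum_const_nat (m := 2 ^ d) fun v _ => by
      rw [← Finset.card_filter, card_filter_mul_add_emod hd (sub_ne_zero.2 h.symm) hu],
    card_filter_lt_two_pow hd]

/-- The second moment: a square of hits is the number of hits plus the number of ordered pairs of
different elements that both hit. -/
theorem sum_hits_sq {m d : ℕ} (hd : d ≤ m) {X : Finset ℤ}
    (hX : ∀ u ∈ X, ∀ u' ∈ X, |u' - u| < 2 ^ d) :
    ∑ a ∈ Finset.range (2 ^ m), ∑ c ∈ Finset.range (2 ^ m), hits m d X a c ^ 2 ≤
      X.card * (2 ^ m * 2 ^ d) + X.card ^ 2 * (2 ^ d * 2 ^ d) := by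
  classical
  have h1 : ∀ a c, hits m d X a c ^ 2 = hits m d X a c + ∑ x ∈ X.offDiag,
      if ((a : ℤ) * x.1 + c) % 2 ^ m < 2 ^ d ∧ ((a : ℤ) * x.2 + c) % 2 ^ m < 2 ^ d then 1 else 0 := by
    intro a c
    have e1 : (X.offDiag.filter fun x : ℤ × ℤ => ((a : ℤ) * x.1 + c) % 2 ^ m < 2 ^ d ∧
        ((a : ℤ) * x.2 + c) % 2 ^ m < 2 ^ d) =
        (X.filter fun u : ℤ => ((a : ℤ) * u + c) % 2 ^ m < 2 ^ d).offDiag := by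
      ext ⟨x, y⟩
      simp only [Finset.mem_filter, Finset.mem_offDiag]
      tauto
    rw [← Finset.card_filter, e1, Finset.offDiag_card, ← hits, sq]
    have := Nat.le_mul_self (hits m d X a c)
    omega
  simp only [h1, Finset.sum_add_distrib]
  rw [sum_hits hd]
  refine Nat.add_le_add_left ?_ _
  have h2 : ∀ a ∈ Finset.range (2 ^ m), ∑ c ∈ Finset.range (2 ^ m), ∑ x ∈ X.offDiag,
      (if ((a : ℤ) * x.1 + c) % 2 ^ m < 2 ^ d ∧ ((a : ℤ) * x.2 + c) % 2 ^ m < 2 ^ d then 1 else 0) =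
      ∑ x ∈ X.offDiag, ((Finset.range (2 ^ m)).filter fun c : ℕ =>
      ((a : ℤ) * x.1 + c) % 2 ^ m < 2 ^ d ∧ ((a : ℤ) * x.2 + c) % 2 ^ m < 2 ^ d).card := by
    intro a _
    rw [Finset.sum_comm]
    exact Finset.sum_congr rfl fun x _ => (Finset.card_filter _ _).symm
  rw [Finset.sum_congr rfl h2, Finset.sum_comm, Finset.sum_const_nat (m := 2 ^ d * 2 ^ d)]
  · refine Nat.mul_le_mul_right _ ?_
    rw [Finset.offDiag_card, sq]
    omega
  · intro x hx
    obtain ⟨h3, h4, h5⟩ := Finset.mem_offDiag.1 hx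
    exact sum_card_pair hd h5 (hX _ h3 _ h4)

/-- Few pairs `(a, c)` miss a large set. -/
theorem card_miss {m d : ℕ} (hd : d ≤ m) {X : Finset ℤ} (hX : ∀ u ∈ X, ∀ u' ∈ X, |u' - u| < 2 ^ d) :
    (((Finset.range (2 ^ m)) ×ˢ (Finset.range (2 ^ m))).filter fun x => hits m d X x.1 x.2 = 0).card *
      (X.card * 2 ^ d) ≤ 2 ^ m * 2 ^ m * 2 ^ m := by
  set S := (Finset.range (2 ^ m)) ×ˢ (Finset.range (2 ^ m)) with hS
  set Z := (S.filter fun x => hits m d X x.1 x.2 = 0).card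
  rcases Nat.eq_zero_or_pos X.card with h0 | h0
  · rw [h0]; simp
  set M : ℝ := 2 ^ m with hM
  set D : ℝ := 2 ^ d with hD
  set k : ℝ := (X.card : ℝ) with hk
  have hM0 : 0 < M := by positivity
  have hD0 : 0 < D := by positivity
  have hk0 : 0 < k := by simpa [hk] using h0
  have e1 : ∑ x ∈ S, (hits m d X x.1 x.2 : ℝ) = k * (M * D) := by
    have := sum_hits hd X
    rw [hS, Finset.sum_product, hk, hM, hD]
    exact_mod_cast this
  have e2 : ∑ x ∈ S, (hits m d X x.1 x.2 : ℝ) ^ 2 ≤ k * (M * D) + k ^ 2 * (D * D) := by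
    have := sum_hits_sq hd hX
    rw [hS, Finset.sum_product, hk, hM, hD]
    exact_mod_cast this
  have e3 : ∑ x ∈ S, (1 : ℝ) = M * M := by
    simp [hS, hM]
  -- Chebyshev's inequality: the mean number of hits is `k * D / M`, so this is the variance scaled
  -- by `M`. A pair without hits contributes `(k * D) ^ 2` to the sum.
  have h1 : ∑ x ∈ S, (M * hits m d X x.1 x.2 - k * D) ^ 2 ≤ k * D * M ^ 3 := by
    have : ∑ x ∈ S, (M * hits m d X x.1 x.2 - k * D) ^ 2 =
        M ^ 2 * ∑ x ∈ S, (hits m d X x.1 x.2 : ℝ) ^ 2 -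
        2 * M * (k * D) * (∑ x ∈ S, (hits m d X x.1 x.2 : ℝ)) + (k * D) ^ 2 * ∑ x ∈ S, (1 : ℝ) := by
      rw [Finset.mul_sum, Finset.mul_sum, Finset.mul_sum, ← Finset.sum_sub_distrib,
        ← Finset.sum_add_distrib]
      exact Finset.sum_congr rfl fun x _ => by ring
    rw [this, e1, e3]
    have := mul_le_mul_of_nonneg_left e2 (show 0 ≤ M ^ 2 by positivity)
    nlinarith
  have h2 : (Z : ℝ) * (k * D) ^ 2 ≤ ∑ x ∈ S, (M * hits m d X x.1 x.2 - k * D) ^ 2 := by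
    rw [← nsmul_eq_mul]
    refine le_trans (Finset.card_nsmul_le_sum _ (fun x : ℕ × ℕ =>
      (M * hits m d X x.1 x.2 - k * D) ^ 2) _ fun x hx => ?_)
      (Finset.sum_le_sum_of_subset_of_nonneg (Finset.filter_subset _ _) fun _ _ _ => sq_nonneg _)
    rw [(Finset.mem_filter.1 hx).2]
    simp
  have h3 : (Z : ℝ) * (k * D) ≤ M ^ 3 := by
    have : (Z : ℝ) * (k * D) * (k * D) ≤ M ^ 3 * (k * D) := by nlinarith
    exact le_of_mul_le_mul_right this (by positivity)
  have h4 : (Z : ℝ) * (k * D) ≤ M * M * M := by linarith [show M ^ 3 = M * M * M by ring]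
  rw [hk, hM, hD] at h4
  exact_mod_cast h4

namespace WordRAM

/-! ## Coins -/

/-- The number whose binary digits are the first `p` coins. -/
def coinNum (p : ℕ) (ω : ℕ → Bool) : ℕ := ∑ i ∈ (Finset.range p).filter (ω ·), 2 ^ i

theorem coinNum_succ (p : ℕ) (ω : ℕ → Bool) :
    coinNum (p + 1) ω = coinNum p ω + if ω p then 2 ^ p else 0 := by
  simp only [coinNum, Finset.sum_filter, Finset.sum_range_succ]

theorem coinNum_lt (p : ℕ) (ω : ℕ → Bool) : coinNum p ω < 2 ^ p := by
  induction p with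
  | zero => simp [coinNum]
  | succ p ih => rw [coinNum_succ, pow_succ]; split_ifs <;> omega

theorem coinNum_eq_iff {p r : ℕ} (hr : r < 2 ^ p) (ω : ℕ → Bool) :
    coinNum p ω = r ↔ ∀ i < p, ω i = r.testBit i := by
  have h1 : ∀ i, (coinNum p ω).testBit i = (decide (i < p) && ω i) := by
    intro i
    rw [coinNum, testBit_sum_two_pow]
    simp
  constructor
  · rintro rfl i hi
    simp [h1, hi]
  · intro h
    refine Nat.eq_of_testBit_eq fun i => ?_
    rw [h1]
    by_cases hi : i < p
    · simp [hi, h i hi]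
    · have : r.testBit i = false := Nat.testBit_lt_two_pow
        (hr.trans_le (Nat.pow_le_pow_right (by norm_num) (by omega)))
      simp [hi, this]

/-- The event fixes the first `p` coins and nothing else, hence it is a cylinder. -/
theorem fairCoins_coinNum_eq {p r : ℕ} (hr : r < 2 ^ p) :
    fairCoins {ω | coinNum p ω = r} = (2 ^ p)⁻¹ := by
  have : {ω : ℕ → Bool | coinNum p ω = r} =
      Set.pi (Finset.range p) fun i => {r.testBit i} := by
    ext ω
    simp [coinNum_eq_iff hr]
  rw [this, fairCoins, Measure.infinitePi_pi _ (fun _ _ => by measurability)]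
  simp [ENNReal.inv_pow]

open Classical in
theorem fairCoins_coinNum (p : ℕ) (P : ℕ → Prop) :
    fairCoins.real {ω | P (coinNum p ω)} = ((Finset.range (2 ^ p)).filter P).card / 2 ^ p := by
  have h1 : {ω : ℕ → Bool | P (coinNum p ω)} =
      ⋃ r ∈ (Finset.range (2 ^ p)).filter P, {ω | coinNum p ω = r} := by
    ext ω
    simp only [Set.mem_ofPred_eq, Set.mem_iUnion, Finset.mem_filter, Finset.mem_range, exists_prop]
    constructor
    · exact fun h => ⟨_, ⟨coinNum_lt p ω, h⟩, rfl⟩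
    · rintro ⟨r, ⟨-, h⟩, rfl⟩; exact h
  have hmeas : ∀ r, MeasurableSet {ω : ℕ → Bool | coinNum p ω = r} := by
    intro r
    have : Measurable (coinNum p) := by
      unfold coinNum
      simp only [Finset.sum_filter]
      refine Finset.measurable_sum _ fun i _ => ?_
      exact (measurable_from_top (f := fun b : Bool => if b = true then 2 ^ i else 0)).comp
        (measurable_pi_apply i)
    exact this (measurableSet_singleton r)
  rw [Measure.real, h1, measure_biUnion_finset]
  · rw [Finset.sum_congr rfl fun r hr => fairCoins_coinNum_eq
      (Finset.mem_range.1 (Finset.mem_filter.1 hr).1)]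
    simp [div_eq_mul_inv]
  · intro r _ r' _ hrr
    refine Set.disjoint_left.2 fun ω h h' => hrr ?_
    exact h.symm.trans h'
  · exact fun r _ => hmeas r

/-! ## The random hash function -/

/-- Four numbers below `2 ^ m`. -/
def tuples (m : ℕ) : Finset (ℕ × ℕ × ℕ × ℕ) :=
  Finset.range (2 ^ m) ×ˢ Finset.range (2 ^ m) ×ˢ Finset.range (2 ^ m) ×ˢ Finset.range (2 ^ m)

/-- Four numbers below `2 ^ m` from one number. -/
def untuple (m r : ℕ) : ℕ × ℕ × ℕ × ℕ :=
  (r % 2 ^ m, r / 2 ^ m % 2 ^ m, r / 2 ^ m / 2 ^ m % 2 ^ m, r / 2 ^ m / 2 ^ m / 2 ^ m % 2 ^ m)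

theorem card_tuples (m : ℕ) : (tuples m).card = 2 ^ (4 * m) := by
  simp only [tuples, Finset.card_product, Finset.card_range]
  ring

open Classical in
-- Four digits to the base `2 ^ m` make one number, and `untuple` reads them back. Only this
-- inequality is used, because the event of success needs a lower bound.
theorem card_tuples_filter_le (m : ℕ) (P : ℕ × ℕ × ℕ × ℕ → Prop) :
    ((tuples m).filter P).card ≤
      ((Finset.range (2 ^ (4 * m))).filter fun r => P (untuple m r)).card := by
  have hM : 0 < 2 ^ m := by positivity
  set M := 2 ^ m with hMd
  have e : ∀ a b : ℕ, a < M → (a + M * b) % M = a ∧ (a + M * b) / M = b := fun a b ha =>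
    ⟨by rw [Nat.add_mul_mod_self_left, Nat.mod_eq_of_lt ha],
      by rw [Nat.add_mul_div_left _ _ hM, Nat.div_eq_of_lt ha, zero_add]⟩
  have key : ∀ x ∈ tuples m, untuple m (x.1 + M * (x.2.1 + M * (x.2.2.1 + M * x.2.2.2))) = x ∧
      x.1 + M * (x.2.1 + M * (x.2.2.1 + M * x.2.2.2)) < 2 ^ (4 * m) := by
    rintro ⟨a, c₁, c₂, c₃⟩ hx
    simp only [tuples, Finset.mem_product, Finset.mem_range, ← hMd] at hx
    obtain ⟨h0, h1, h2, h3⟩ := hx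
    constructor
    · simp only [untuple, ← hMd, (e a _ h0).1, (e a _ h0).2, (e c₁ _ h1).1, (e c₁ _ h1).2,
        (e c₂ _ h2).1, (e c₂ _ h2).2, Nat.mod_eq_of_lt h3]
    · have hp : 2 ^ (4 * m) = M * (M * (M * M)) := by rw [hMd]; ring
      have step : ∀ {a b N : ℕ}, a < M → b < N → a + M * b < M * N := by
        intro a b N ha hb
        have := Nat.mul_le_mul_left M (show b + 1 ≤ N from hb)
        rw [mul_add] at this
        omega
      rw [hp]
      exact step h0 (step h1 (step h2 h3))
  refine Finset.card_le_card_of_injOn (fun x => x.1 + M * (x.2.1 + M * (x.2.2.1 + M * x.2.2.2)))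
    ?_ ?_
  · intro x hx
    obtain ⟨hx, hp⟩ := Finset.mem_filter.1 hx
    have := key x hx
    simp only [Finset.coe_filter, Finset.mem_range, Set.mem_ofPred_eq]
    exact ⟨this.2, by rw [this.1]; exact hp⟩
  · intro x hx y hy hxy
    have h1 := (key x (Finset.mem_filter.1 hx).1).1
    have h2 := (key y (Finset.mem_filter.1 hy).1).1
    simp only at hxy
    rw [← h1, ← h2, hxy]

/-- The hash function given by four numbers. -/
def hashOf (m d cap : ℕ) (t : ℤ) (x : ℕ × ℕ × ℕ × ℕ) : Hash where
  D := 2 ^ d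
  M := 2 ^ m
  a := x.1
  -- The three random numbers are the offsets of the windows for the three partial sums along a
  -- path. A vertex only knows the difference of two consecutive partial sums, so its offset is the
  -- difference of their offsets, shifted by `2 ^ d` to make the result nonnegative. The last
  -- partial sum is compared with `t`.
  off v := match v with
    | 0 => x.2.1
    | 1 => (x.2.2.1 - x.2.1 + 2 ^ d) % 2 ^ m
    | 2 => (x.2.2.2 - x.2.2.1 + 2 ^ d) % 2 ^ m
    | _ => (2 ^ d - x.1 * t - x.2.2.2) % 2 ^ m
  cap := cap

/-- In the offset of every layer at least one of the random numbers enters with coefficient `1` or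
`-1`. Averaging over it alone shows that a fixed set passes with probability `2 ^ (d + 1) / 2 ^ m`.
-/
theorem card_passing {m d : ℕ} (hd : d + 1 ≤ m) (cap : ℕ) (t u : ℤ) (v : ℕ) :
    ((tuples m).filter fun x => ((hashOf m d cap t x).a * u + (hashOf m d cap t x).off v) %
      (hashOf m d cap t x).M < (hashOf m d cap t x).D * 2).card = 2 ^ m * 2 ^ m * 2 ^ m * 2 ^ (d + 1) := by
  have hD : (2 : ℤ) ^ d * 2 = 2 ^ (d + 1) := (pow_succ 2 d).symm
  have key : ∀ e : ℤ, ∑ c ∈ Finset.range (2 ^ m), (if (e + c) % 2 ^ m < 2 ^ (d + 1) then 1 else 0) =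
      2 ^ (d + 1) := by
    intro e
    rw [← Finset.card_filter, card_filter_add_emod m e (· < 2 ^ (d + 1)), card_filter_lt_two_pow hd]
  have key' : ∀ e : ℤ, ∑ c ∈ Finset.range (2 ^ m), (if (e - c) % 2 ^ m < 2 ^ (d + 1) then 1 else 0) =
      2 ^ (d + 1) := by
    intro e
    rw [← Finset.card_filter, ← card_filter_lt_two_pow hd,
      ← card_filter_emod_of_odd m (δ := -1) (by norm_num) e (· < 2 ^ (d + 1))]
    simp only [mul_neg, mul_one, neg_add_eq_sub]
  rw [Finset.card_filter]
  simp only [tuples, Finset.sum_product, hashOf, hD]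
  match v with
  | 0 =>
    simp only [Finset.sum_const, Finset.card_range, smul_eq_mul, ← Finset.mul_sum, key]
    ring
  | 1 =>
    have : ∀ a c₁ c₂ : ℕ, ((a : ℤ) * u + (c₂ - c₁ + 2 ^ d) % 2 ^ m) % 2 ^ m =
        ((a * u - c₁ + 2 ^ d) + c₂) % 2 ^ m := by
      intro a c₁ c₂
      rw [Int.add_emod_emod]; congr 1; ring
    simp only [this, Finset.sum_const, Finset.card_range, smul_eq_mul, ← Finset.mul_sum, key]
    ring
  | 2 =>
    have : ∀ a c₁ c₂ : ℕ, ((a : ℤ) * u + (c₂ - c₁ + 2 ^ d) % 2 ^ m) % 2 ^ m =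
        ((a * u - c₁ + 2 ^ d) + c₂) % 2 ^ m := by
      intro a c₁ c₂
      rw [Int.add_emod_emod]; congr 1; ring
    simp only [this, Finset.sum_const, Finset.card_range, smul_eq_mul, key]
    ring
  | v + 3 =>
    have : ∀ a c₂ : ℕ, ((a : ℤ) * u + (2 ^ d - a * t - c₂) % 2 ^ m) % 2 ^ m =
        ((a * u - a * t + 2 ^ d) - c₂) % 2 ^ m := by
      intro a c₂
      rw [Int.add_emod_emod]; congr 1; ring
    simp only [this, Finset.sum_const, Finset.card_range, smul_eq_mul, key']
    ring

/-- The event involves the multiplier and one of the three offsets, so the other two offsets are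
free, and `card_miss` gives probability at most `1 / 128`. -/
theorem card_miss_tuples {m d : ℕ} (hd : d ≤ m) {X : Finset ℤ}
    (hX : ∀ u ∈ X, ∀ u' ∈ X, |u' - u| < 2 ^ d) (hc : 128 * 2 ^ m ≤ X.card * 2 ^ d) (f : ℕ × ℕ × ℕ → ℕ)
    (hf : f = (fun x => x.1) ∨ f = (fun x => x.2.1) ∨ f = fun x => x.2.2) :
    128 * ((tuples m).filter fun x => hits m d X x.1 (f x.2) = 0).card ≤ 2 ^ (4 * m) := by
  have h1 := card_miss hd hX
  have h2 : ((tuples m).filter fun x => hits m d X x.1 (f x.2) = 0).card = 2 ^ m * 2 ^ m *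
      (((Finset.range (2 ^ m)) ×ˢ (Finset.range (2 ^ m))).filter
        fun x => hits m d X x.1 x.2 = 0).card := by
    rw [Finset.card_filter, Finset.card_filter]
    set g : ℕ → ℕ → ℕ := fun a c => if hits m d X a c = 0 then 1 else 0
    change ∑ x ∈ tuples m, g x.1 (f x.2) =
      2 ^ m * 2 ^ m * ∑ x ∈ Finset.range (2 ^ m) ×ˢ Finset.range (2 ^ m), g x.1 x.2
    simp only [tuples, Finset.sum_product]
    rcases hf with rfl | rfl | rfl <;>
    · simp only [Finset.sum_const, Finset.card_range, smul_eq_mul, ← Finset.mul_sum]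
      try ring
  rw [h2]
  set Z := (((Finset.range (2 ^ m)) ×ˢ (Finset.range (2 ^ m))).filter
        fun x => hits m d X x.1 x.2 = 0).card
  have hM : 0 < 2 ^ m := by positivity
  have h3 : Z * (128 * 2 ^ m) ≤ 2 ^ m * 2 ^ m * 2 ^ m := (Nat.mul_le_mul_left Z hc).trans h1
  have h4 : (128 * Z) * 2 ^ m ≤ (2 ^ m * 2 ^ m) * 2 ^ m := by linarith
  have h5 := Nat.le_of_mul_le_mul_right h4 hM
  calc 128 * (2 ^ m * 2 ^ m * Z) = 2 ^ m * 2 ^ m * (128 * Z) := by ring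
    _ ≤ 2 ^ m * 2 ^ m * (2 ^ m * 2 ^ m) := Nat.mul_le_mul_left _ h5
    _ = 2 ^ (4 * m) := by ring


namespace Setup

variable {s : Setup}

/-! ## The number of vertices -/

open Classical in
/-- The sets that may become vertices of a layer. -/
noncomputable def candidates (s : Setup) (cap : ℕ) (ρ : ℕ → ℕ) (v : ℕ) : Finset (Finset ℕ) :=
  (s.items ((layer v).sel ρ)).powerset.filter fun A =>
    (A ∩ s.part ρ (layer v).x).card ≤ cap ∧ (A ∩ s.part ρ (layer v).y).card ≤ cap

open Classical in
/-- The vertices of a layer. -/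
noncomputable def vertices (s : Setup) (h : Hash) (ρ : ℕ → ℕ) (v : ℕ) : Finset (Finset ℕ) :=
  (s.items ((layer v).sel ρ)).powerset.filter (s.IsVertex h ρ v)

theorem mem_vertices {h : Hash} {ρ : ℕ → ℕ} {v : ℕ} {A : Finset ℕ} :
    A ∈ s.vertices h ρ v ↔ s.IsVertex h ρ v A := by
  simp only [vertices, Finset.mem_filter, Finset.mem_powerset, and_iff_right_iff_imp]
  exact fun h => h.1

theorem vertices_eq (m d cap : ℕ) (t : ℤ) (x : ℕ × ℕ × ℕ × ℕ) (ρ : ℕ → ℕ) (v : ℕ) :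
    s.vertices (hashOf m d cap t x) ρ v = (s.candidates cap ρ v).filter fun A =>
      ((hashOf m d cap t x).a * s.sum A + (hashOf m d cap t x).off v) %
      (hashOf m d cap t x).M < (hashOf m d cap t x).D * 2 := by
  ext A
  simp only [mem_vertices, candidates, Finset.mem_filter, Finset.mem_powerset, IsVertex]
  rw [and_assoc, and_assoc]
  rfl

/-- The number of vertices. -/
noncomputable def numVertices (s : Setup) (h : Hash) (ρ : ℕ → ℕ → ℕ) (J : ℕ) : ℕ :=
  ∑ i ∈ Finset.range (4 * J), (s.vertices h (ρ (i / 4)) (i % 4)).card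

theorem sum_numVertices {m d cap : ℕ} (hd : d + 1 ≤ m) (t : ℤ) {ρ : ℕ → ℕ → ℕ} {J C : ℕ}
    (hC : ∀ j < J, ∀ v < 4, (s.candidates cap (ρ j) v).card ≤ C) :
    ∑ x ∈ tuples m, s.numVertices (hashOf m d cap t x) ρ J ≤
      4 * J * (C * (2 ^ m * 2 ^ m * 2 ^ m * 2 ^ (d + 1))) := by
  simp only [numVertices]
  rw [Finset.sum_comm]
  refine (Finset.sum_le_card_nsmul _ _ (C * (2 ^ m * 2 ^ m * 2 ^ m * 2 ^ (d + 1))) fun i hi => ?_).trans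
    (by rw [Finset.card_range, smul_eq_mul])
  have hi := Finset.mem_range.1 hi
  simp only [vertices_eq, Finset.card_filter]
  rw [Finset.sum_comm]
  simp only [← Finset.card_filter, card_passing hd]
  rw [Finset.sum_const, smul_eq_mul]
  exact Nat.mul_le_mul_right _ (hC _ (by omega) _ (by omega))

/-- Markov's inequality. The mean number of vertices is at most `4 * J * C * 2 ^ (d + 1) / 2 ^ m`,
and `N₀` is assumed to be ten times as large. -/
theorem card_crowded {m d cap : ℕ} (hd : d + 1 ≤ m) (t : ℤ) {ρ : ℕ → ℕ → ℕ} {J C N₀ : ℕ}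
    (hJ : 0 < J) (hC0 : 0 < C)
    (hC : ∀ j < J, ∀ v < 4, (s.candidates cap (ρ j) v).card ≤ C) (hN : 80 * J * C * 2 ^ d ≤ N₀ * 2 ^ m) :
    10 * ((tuples m).filter fun x => N₀ < s.numVertices (hashOf m d cap t x) ρ J).card ≤
      2 ^ (4 * m) := by
  set Z := ((tuples m).filter fun x => N₀ < s.numVertices (hashOf m d cap t x) ρ J).card
  have h1 : Z * N₀ ≤ 4 * J * (C * (2 ^ m * 2 ^ m * 2 ^ m * 2 ^ (d + 1))) := by
    refine le_trans ?_ (sum_numVertices hd t hC)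
    rw [← smul_eq_mul]
    exact (Finset.card_nsmul_le_sum _ _ _ fun x hx => (Finset.mem_filter.1 hx).2.le).trans
      (Finset.sum_le_sum_of_subset (Finset.filter_subset _ _))
  have h2 : (8 * J * C * 2 ^ d) * (10 * Z) ≤ (8 * J * C * 2 ^ d) * 2 ^ (4 * m) := by
    calc (8 * J * C * 2 ^ d) * (10 * Z) = Z * (80 * J * C * 2 ^ d) := by ring
      _ ≤ Z * (N₀ * 2 ^ m) := Nat.mul_le_mul_left _ hN
      _ = Z * N₀ * 2 ^ m := by ring
      _ ≤ 4 * J * (C * (2 ^ m * 2 ^ m * 2 ^ m * 2 ^ (d + 1))) * 2 ^ m := Nat.mul_le_mul_right _ h1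
      _ = _ := by ring
  exact Nat.le_of_mul_le_mul_left h2 (by positivity)

/-! ## The path of a solution -/

/-- The vertices contain a path that gives a solution. -/
def HasPath (s : Setup) (h : Hash) (ρ : ℕ → ℕ) : Prop :=
  ∃ A₀ A₁ A₂ A₃, s.IsVertex h ρ 0 A₀ ∧ s.IsVertex h ρ 1 A₁ ∧ s.IsVertex h ρ 2 A₂ ∧
    s.IsVertex h ρ 3 A₃ ∧ Disjoint A₀ A₁ ∧ Disjoint A₁ A₂ ∧ Disjoint A₂ A₃ ∧
    s.sum A₀ + s.sum A₁ + s.sum A₂ + s.sum A₃ = s.t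

/-- The sum of the solution `S` before part `r` is split. -/
def base (s : Setup) (ρ : ℕ → ℕ) (S : Finset ℕ) : ℕ → ℤ
  | 0 => s.sum (S ∩ s.part ρ 3)
  | r + 1 => base s ρ S r + s.sum (S ∩ s.part ρ r)

/-- The balanced ways to split the solution `S` in part `r`. -/
def splits (s : Setup) (cap : ℕ) (ρ : ℕ → ℕ) (S : Finset ℕ) (r : ℕ) : Finset (Finset ℕ) :=
  (S ∩ s.part ρ r).powerset.filter fun T =>
    T.card ≤ cap ∧ ((S ∩ s.part ρ r) \ T).card ≤ cap

/-- The partial sums of `S`. -/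
def partials (s : Setup) (cap : ℕ) (ρ : ℕ → ℕ) (S : Finset ℕ) (r : ℕ) : Finset ℤ :=
  (s.splits cap ρ S r).image fun T => s.base ρ S r + s.sum T

theorem disjoint_part {ρ : ℕ → ℕ} {r r' : ℕ} (h : r ≠ r') : Disjoint (s.part ρ r) (s.part ρ r') :=
  disjoint_items fun j => by simp only [decide_eq_true_eq]; omega

theorem part_subset_layer {ρ : ℕ → ℕ} {v r : ℕ}
    (h : r = (layer v).x ∨ r = (layer v).y ∨ r = (layer v).u) :
    s.part ρ r ⊆ s.items ((layer v).sel ρ) := by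
  intro i hi
  obtain ⟨h1, h2⟩ := Finset.mem_filter.1 hi
  refine Finset.mem_filter.2 ⟨h1, ?_⟩
  simp only [decide_eq_true_eq] at h2
  simp only [Layer.sel, decide_eq_true_eq, h2]
  exact h

theorem isVertex_union {h : Hash} {ρ : ℕ → ℕ} {v r r' : ℕ} {A A' : Finset ℕ}
    (hr : r = (layer v).x ∨ r = (layer v).y ∨ r = (layer v).u)
    (hr' : r' = (layer v).x ∨ r' = (layer v).y ∨ r' = (layer v).u) (hne : r ≠ r')
    (hA : A ⊆ s.part ρ r) (hA' : A' ⊆ s.part ρ r')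
    (hc : r ≠ (layer v).u → A.card ≤ h.cap) (hc' : r' ≠ (layer v).u → A'.card ≤ h.cap)
    (hu : (layer v).u ≠ (layer v).x ∧ (layer v).u ≠ (layer v).y)
    (hh : (h.a * s.sum (A ∪ A') + h.off v) % h.M < h.D * 2) : s.IsVertex h ρ v (A ∪ A') := by
  have key : ∀ q, q ≠ (layer v).u → ((A ∪ A') ∩ s.part ρ q).card ≤ h.cap := by
    intro q hq
    rw [Finset.union_inter_distrib_right]
    have e : ∀ {r : ℕ} {A : Finset ℕ}, A ⊆ s.part ρ r → r ≠ q → A ∩ s.part ρ q = ∅ := by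
      intro r A hA hr
      exact Finset.disjoint_iff_inter_eq_empty.1 ((disjoint_part hr).mono_left hA)
    by_cases h1 : r = q
    · subst h1
      rw [e hA' hne.symm, Finset.union_empty]
      exact (Finset.card_le_card Finset.inter_subset_left).trans (hc hq)
    · rw [e hA h1, Finset.empty_union]
      by_cases h2 : r' = q
      · subst h2
        exact (Finset.card_le_card Finset.inter_subset_left).trans (hc' hq)
      · rw [e hA' h2]; simp
  exact ⟨Finset.union_subset (hA.trans (part_subset_layer hr)) (hA'.trans (part_subset_layer hr')),
    key _ hu.1.symm, key _ hu.2.symm, hh⟩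

theorem sum_union_part {ρ : ℕ → ℕ} {r r' : ℕ} {A A' : Finset ℕ} (hne : r ≠ r')
    (hA : A ⊆ s.part ρ r) (hA' : A' ⊆ s.part ρ r') : s.sum (A ∪ A') = s.sum A + s.sum A' :=
  Finset.sum_union ((disjoint_part hne).mono hA hA')

theorem sum_parts {ρ : ℕ → ℕ} (hρ : ∀ j, ρ j < 5) {S : Finset ℕ} (hS : S ⊆ Finset.range s.n) :
    s.sum S = ∑ r ∈ Finset.range 5, s.sum (S ∩ s.part ρ r) := by
  have : S = (Finset.range 5).biUnion fun r => S ∩ s.part ρ r := by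
    ext i
    simp only [Finset.mem_biUnion, Finset.mem_inter, Finset.mem_range, part, items,
      Finset.mem_filter, decide_eq_true_eq]
    constructor
    · exact fun hi => ⟨_, hρ (i / s.B), hi, Finset.mem_range.1 (hS hi), rfl⟩
    · rintro ⟨_, _, hi, _⟩; exact hi
  conv_lhs => rw [this]
  refine Finset.sum_biUnion fun r _ r' _ h => ?_
  exact (disjoint_part h).mono Finset.inter_subset_right Finset.inter_subset_right

/-- Write U0, U1, U2 for the sums `s.base ρ S r + s.sum T` of the three splits. The four sets of the
path have sums U0, U1 - U0, U2 - U1 and `t` - U2, which telescope. If all three partial sums are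
hashed into their windows, then every set passes its own test. In this way three events replace
conditions on four dependent sets. -/
theorem hasPath_of_splits {ρ : ℕ → ℕ} (hρ : ∀ j, ρ j < 5) {S : Finset ℕ} (hS : S ⊆ Finset.range s.n)
    (ht : s.sum S = s.t) {m d cap : ℕ} (hd : d + 1 ≤ m) {x : ℕ × ℕ × ℕ × ℕ} {T₀ T₁ T₂ : Finset ℕ}
    (h0 : T₀ ∈ s.splits cap ρ S 0) (h1 : T₁ ∈ s.splits cap ρ S 1) (h2 : T₂ ∈ s.splits cap ρ S 2)
    (w0 : (x.1 * (s.base ρ S 0 + s.sum T₀) + x.2.1) % 2 ^ m < 2 ^ d)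
    (w1 : (x.1 * (s.base ρ S 1 + s.sum T₁) + x.2.2.1) % 2 ^ m < 2 ^ d)
    (w2 : (x.1 * (s.base ρ S 2 + s.sum T₂) + x.2.2.2) % 2 ^ m < 2 ^ d) :
    s.HasPath (hashOf m d cap s.t x) ρ := by
  obtain ⟨a, c₁, c₂, c₃⟩ := x
  simp only at w0 w1 w2
  simp only [splits, Finset.mem_filter, Finset.mem_powerset] at h0 h1 h2
  obtain ⟨i0, p0, q0⟩ := h0
  obtain ⟨i1, p1, q1⟩ := h1
  obtain ⟨i2, p2, q2⟩ := h2
  have sub : ∀ r, S ∩ s.part ρ r ⊆ s.part ρ r := fun r => Finset.inter_subset_right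
  have dif : ∀ {r : ℕ} {T : Finset ℕ}, T ⊆ S ∩ s.part ρ r →
      s.sum ((S ∩ s.part ρ r) \ T) = s.sum (S ∩ s.part ρ r) - s.sum T := by
    intro r T hT
    exact Finset.sum_sdiff_eq_sub hT
  have hsum := s.sum_parts hρ hS
  simp only [Finset.sum_range_succ, Finset.sum_range_zero, zero_add] at hsum
  have e0 : s.sum (S ∩ s.part ρ 3 ∪ T₀) = s.base ρ S 0 + s.sum T₀ :=
    sum_union_part (by norm_num) (sub 3) (i0.trans (sub 0))
  have e1 : s.sum ((S ∩ s.part ρ 0) \ T₀ ∪ T₁) =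
      (s.base ρ S 1 + s.sum T₁) - (s.base ρ S 0 + s.sum T₀) := by
    rw [sum_union_part (by norm_num) (Finset.sdiff_subset.trans (sub 0)) (i1.trans (sub 1)), dif i0]
    simp only [base]; ring
  have e2 : s.sum ((S ∩ s.part ρ 1) \ T₁ ∪ T₂) =
      (s.base ρ S 2 + s.sum T₂) - (s.base ρ S 1 + s.sum T₁) := by
    rw [sum_union_part (by norm_num) (Finset.sdiff_subset.trans (sub 1)) (i2.trans (sub 2)), dif i1]
    simp only [base]; ring
  have e3 : s.sum ((S ∩ s.part ρ 2) \ T₂ ∪ S ∩ s.part ρ 4) = s.t - (s.base ρ S 2 + s.sum T₂) := by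
    rw [sum_union_part (by norm_num) (Finset.sdiff_subset.trans (sub 2)) (sub 4), dif i2, ← ht, hsum]
    simp only [base]; ring
  have hM : (0 : ℤ) < 2 ^ m := by positivity
  have hDM : (2 : ℤ) ^ d * 2 ≤ 2 ^ m := by
    rw [← pow_succ]; exact pow_le_pow_right₀ (by norm_num) hd
  have n0 := Int.emod_nonneg (a * (s.base ρ S 0 + s.sum T₀) + c₁) hM.ne'
  have n1 := Int.emod_nonneg (a * (s.base ρ S 1 + s.sum T₁) + c₂) hM.ne'
  have n2 := Int.emod_nonneg (a * (s.base ρ S 2 + s.sum T₂) + c₃) hM.ne'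
  -- The difference of two residues below `2 ^ d` lies strictly between `-2 ^ d` and `2 ^ d`. After
  -- the shift it falls into the doubled window, and `d + 1 ≤ m` prevents wrapping around.
  have win : ∀ {x y : ℤ}, 0 ≤ x % 2 ^ m → x % 2 ^ m < 2 ^ d → 0 ≤ y % 2 ^ m → y % 2 ^ m < 2 ^ d →
      (y - x + 2 ^ d) % 2 ^ m < 2 ^ d * 2 := by
    intro x y hx hx' hy hy'
    have : (y - x + 2 ^ d) % 2 ^ m = (y % 2 ^ m - x % 2 ^ m + 2 ^ d) % 2 ^ m := by
      rw [Int.add_emod, Int.sub_emod, ← Int.add_emod]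
    rw [this, Int.emod_eq_of_lt (by linarith) (by linarith)]
    linarith
  have hdis : ∀ {r r' : ℕ} {A A' : Finset ℕ}, r ≠ r' → A ⊆ s.part ρ r → A' ⊆ s.part ρ r' →
      Disjoint A A' := fun h hA hA' => (disjoint_part h).mono hA hA'
  -- Each split part gives one half to a layer and the rest to the next layer, while parts 3 and 4
  -- go undivided to the two ends.
  refine ⟨S ∩ s.part ρ 3 ∪ T₀, (S ∩ s.part ρ 0) \ T₀ ∪ T₁, (S ∩ s.part ρ 1) \ T₁ ∪ T₂,
    (S ∩ s.part ρ 2) \ T₂ ∪ S ∩ s.part ρ 4, ?_, ?_, ?_, ?_, ?_, ?_, ?_, ?_⟩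
  · refine isVertex_union (r := 3) (r' := 0) (by simp [layer]) (by simp [layer]) (by norm_num) (sub 3)
      (i0.trans (sub 0)) (by simp [layer]) (fun _ => p0) (by simp [layer]) ?_
    rw [e0]
    exact lt_of_lt_of_le w0 (by simp [hashOf])
  · refine isVertex_union (r := 0) (r' := 1) (by simp [layer]) (by simp [layer]) (by norm_num)
      (Finset.sdiff_subset.trans (sub 0)) (i1.trans (sub 1)) (fun _ => q0) (fun _ => p1)
      (by simp [layer]) ?_
    rw [e1]
    simp only [hashOf]
    rw [Int.add_emod_emod, show (a : ℤ) * (s.base ρ S 1 + s.sum T₁ - (s.base ρ S 0 + s.sum T₀)) +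
      (c₂ - c₁ + 2 ^ d) = (a * (s.base ρ S 1 + s.sum T₁) + c₂) -
      (a * (s.base ρ S 0 + s.sum T₀) + c₁) + 2 ^ d by ring]
    exact win n0 w0 n1 w1
  · refine isVertex_union (r := 1) (r' := 2) (by simp [layer]) (by simp [layer]) (by norm_num)
      (Finset.sdiff_subset.trans (sub 1)) (i2.trans (sub 2)) (fun _ => q1) (fun _ => p2)
      (by simp [layer]) ?_
    rw [e2]
    simp only [hashOf]
    rw [Int.add_emod_emod, show (a : ℤ) * (s.base ρ S 2 + s.sum T₂ - (s.base ρ S 1 + s.sum T₁)) +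
      (c₃ - c₂ + 2 ^ d) = (a * (s.base ρ S 2 + s.sum T₂) + c₃) -
      (a * (s.base ρ S 1 + s.sum T₁) + c₂) + 2 ^ d by ring]
    exact win n1 w1 n2 w2
  · refine isVertex_union (r := 2) (r' := 4) (by simp [layer]) (by simp [layer]) (by norm_num)
      (Finset.sdiff_subset.trans (sub 2)) (sub 4) (fun _ => q2) (by simp [layer])
      (by simp [layer]) ?_
    rw [e3]
    simp only [hashOf]
    rw [Int.add_emod_emod, show (a : ℤ) * (s.t - (s.base ρ S 2 + s.sum T₂)) +
      (2 ^ d - a * s.t - c₃) = 0 - (a * (s.base ρ S 2 + s.sum T₂) + c₃) + 2 ^ d by ring]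
    exact win n2 w2 (by simp) (by simp)
  · refine Finset.disjoint_union_left.2 ⟨Finset.disjoint_union_right.2 ⟨?_, ?_⟩,
      Finset.disjoint_union_right.2 ⟨Finset.disjoint_sdiff, ?_⟩⟩
    · exact hdis (by norm_num) (sub 3) (Finset.sdiff_subset.trans (sub 0))
    · exact hdis (by norm_num) (sub 3) (i1.trans (sub 1))
    · exact hdis (by norm_num) (i0.trans (sub 0)) (i1.trans (sub 1))
  · refine Finset.disjoint_union_left.2 ⟨Finset.disjoint_union_right.2 ⟨?_, ?_⟩,
      Finset.disjoint_union_right.2 ⟨Finset.disjoint_sdiff, ?_⟩⟩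
    · exact hdis (by norm_num) (Finset.sdiff_subset.trans (sub 0)) (Finset.sdiff_subset.trans (sub 1))
    · exact hdis (by norm_num) (Finset.sdiff_subset.trans (sub 0)) (i2.trans (sub 2))
    · exact hdis (by norm_num) (i1.trans (sub 1)) (i2.trans (sub 2))
  · refine Finset.disjoint_union_left.2 ⟨Finset.disjoint_union_right.2 ⟨?_, ?_⟩,
      Finset.disjoint_union_right.2 ⟨Finset.disjoint_sdiff, ?_⟩⟩
    · exact hdis (by norm_num) (Finset.sdiff_subset.trans (sub 1)) (Finset.sdiff_subset.trans (sub 2))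
    · exact hdis (by norm_num) (Finset.sdiff_subset.trans (sub 1)) (sub 4)
    · exact hdis (by norm_num) (i2.trans (sub 2)) (sub 4)
  · rw [e0, e1, e2, e3]; ring

theorem exists_split_of_hits {ρ : ℕ → ℕ} {S : Finset ℕ} {m d cap a c r : ℕ}
    (h : hits m d (s.partials cap ρ S r) a c ≠ 0) :
    ∃ T ∈ s.splits cap ρ S r, (a * (s.base ρ S r + s.sum T) + c) % 2 ^ m < (2 : ℤ) ^ d := by
  obtain ⟨u, hu⟩ := Finset.card_pos.1 (Nat.pos_of_ne_zero h)
  obtain ⟨h1, h2⟩ := Finset.mem_filter.1 hu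
  obtain ⟨T, hT, rfl⟩ := Finset.mem_image.1 h1
  exact ⟨T, hT, h2⟩

/-- The partial sums share the same base, so their differences are at most `2 * W` and lie in the
range where the hash function is pairwise independent. This is what fixes the choice of `d`. -/
theorem abs_sub_partials_lt {ρ : ℕ → ℕ} {S : Finset ℕ} (hS : S ⊆ Finset.range s.n) {d cap r : ℕ}
    (hd : 2 * s.W < 2 ^ d) :
    ∀ u ∈ s.partials cap ρ S r, ∀ u' ∈ s.partials cap ρ S r, |u' - u| < 2 ^ d := by
  intro u hu u' hu'
  obtain ⟨T, hT, rfl⟩ := Finset.mem_image.1 hu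
  obtain ⟨T', hT', rfl⟩ := Finset.mem_image.1 hu'
  have sub : ∀ {T}, T ∈ s.splits cap ρ S r → |s.sum T| ≤ s.W := fun hT => abs_sum_le'
    (((Finset.mem_powerset.1 (Finset.mem_filter.1 hT).1).trans Finset.inter_subset_left).trans hS)
  have h1 := sub hT
  have h2 := sub hT'
  rw [add_sub_add_left_eq_sub]
  have := abs_sub (s.sum T') (s.sum T)
  linarith

open Classical in
/-- Most hash functions lead to a path in a graph that is not too large. -/
theorem card_good {ρ : ℕ → ℕ → ℕ} {J j : ℕ} (hρ : ∀ k, ρ j k < 5) {S : Finset ℕ}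
    (hS : S ⊆ Finset.range s.n) (ht : s.sum S = s.t) {m d cap C N₀ : ℕ} (hd : d + 1 ≤ m)
    (hW : 2 * s.W < 2 ^ d) (hJ : 0 < J) (hC0 : 0 < C)
    (hC : ∀ j < J, ∀ v < 4, (s.candidates cap (ρ j) v).card ≤ C)
    (hN : 80 * J * C * 2 ^ d ≤ N₀ * 2 ^ m)
    (hX : ∀ r < 3, 128 * 2 ^ m ≤ (s.partials cap (ρ j) S r).card * 2 ^ d) :
    2 * 2 ^ (4 * m) ≤ 3 * ((tuples m).filter fun x =>
      s.numVertices (hashOf m d cap s.t x) ρ J ≤ N₀ ∧ s.HasPath (hashOf m d cap s.t x) (ρ j)).card := by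
  set G := (tuples m).filter fun x => s.numVertices (hashOf m d cap s.t x) ρ J ≤ N₀ ∧
    s.HasPath (hashOf m d cap s.t x) (ρ j)
  have b := card_crowded hd s.t hJ hC0 hC hN
  have hm := fun r => abs_sub_partials_lt (ρ := ρ j) (cap := cap) (r := r) hS hW
  have b0 := card_miss_tuples (by omega) (hm 0) (hX 0 (by norm_num)) (fun x => x.1) (by simp)
  have b1 := card_miss_tuples (by omega) (hm 1) (hX 1 (by norm_num)) (fun x => x.2.1) (by simp)
  have b2 := card_miss_tuples (by omega) (hm 2) (hX 2 (by norm_num)) (fun x => x.2.2) (by simp)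
  set Z := (tuples m).filter fun x => N₀ < s.numVertices (hashOf m d cap s.t x) ρ J
  set Z0 := (tuples m).filter fun x => hits m d (s.partials cap (ρ j) S 0) x.1 x.2.1 = 0
  set Z1 := (tuples m).filter fun x => hits m d (s.partials cap (ρ j) S 1) x.1 x.2.2.1 = 0
  set Z2 := (tuples m).filter fun x => hits m d (s.partials cap (ρ j) S 2) x.1 x.2.2.2 = 0
  -- Union bound: either the graph is too large, with probability at most `1 / 10`, or one of the
  -- three partial sums has no split in its window, with probability at most `1 / 128` each.
  -- Together this is less than `1 / 3`.
  have hcov : tuples m ⊆ G ∪ (Z ∪ (Z0 ∪ (Z1 ∪ Z2))) := by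
    intro x hx
    simp only [Finset.mem_union, G, Z, Z0, Z1, Z2, Finset.mem_filter, hx, true_and]
    by_contra hcon
    push Not at hcon
    obtain ⟨h1, h2, h3, h4, h5⟩ := hcon
    obtain ⟨T₀, t0, w0⟩ := exists_split_of_hits h3
    obtain ⟨T₁, t1, w1⟩ := exists_split_of_hits h4
    obtain ⟨T₂, t2, w2⟩ := exists_split_of_hits h5
    exact h1 h2 (hasPath_of_splits hρ hS ht hd t0 t1 t2 w0 w1 w2)
  have hcard := (Finset.card_le_card hcov).trans ((Finset.card_union_le _ _).trans
    (Nat.add_le_add_left ((Finset.card_union_le _ _).trans (Nat.add_le_add_left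
      ((Finset.card_union_le _ _).trans (Nat.add_le_add_left (Finset.card_union_le _ _) _)) _)) _))
  rw [card_tuples] at hcard
  omega

end Setup

end WordRAM

/-! ## Sorting into classes -/

theorem exists_sorted (N : ℕ) (d : ℕ → ℕ) : ∃ p p' : ℕ → ℕ, (∀ i < N, p i < N ∧ p' (p i) = i) ∧
    (∀ i < N, p' i < N ∧ p (p' i) = i) ∧ ∀ i j, i ≤ j → j < N → d (p i) ≤ d (p j) := by
  set f : Fin N → ℕ := fun i => d i with hf
  set σ := Tuple.sort f
  refine ⟨fun i => if h : i < N then σ ⟨i, h⟩ else i, fun i => if h : i < N then σ.symm ⟨i, h⟩ else i,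
    fun i hi => ?_, fun i hi => ?_, fun i j hij hj => ?_⟩
  · simp [hi]
  · simp [hi]
  · have := Tuple.monotone_sort f (show (⟨i, by omega⟩ : Fin N) ≤ ⟨j, hj⟩ from hij)
    simpa [hj, show i < N by omega, hf] using this

/-- Blocks can be sorted into classes of the same size with almost the same sums. -/
theorem exists_classes (r q B : ℕ) (hr : 0 < r) {d : ℕ → ℕ} (hd : ∀ j, d j ≤ B) :
    ∃ cls : ℕ → ℕ, (∀ j, cls j < r) ∧
      (∀ c < r, ((Finset.range (r * q)).filter (cls · = c)).card = q) ∧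
      ∀ c < r, ∀ c' < r, ∑ j ∈ (Finset.range (r * q)).filter (cls · = c), d j ≤
        (∑ j ∈ (Finset.range (r * q)).filter (cls · = c'), d j) + B := by
  obtain ⟨p, p', hp, hp', hmono⟩ := exists_sorted (r * q) d
  have hlt : ∀ {k c : ℕ}, k < q → c < r → r * k + c < r * q := by
    intro k c hk hc
    have := Nat.mul_le_mul_left r (show k + 1 ≤ q from hk)
    rw [mul_add] at this
    omega
  have key : ∀ (F : ℕ → ℕ), ∀ c < r, ∑ j ∈ (Finset.range (r * q)).filter (p' · % r = c), F j =
      ∑ k ∈ Finset.range q, F (p (r * k + c)) := by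
    intro F c hc
    refine Finset.sum_nbij' (fun j => p' j / r) (fun k => p (r * k + c)) ?_ ?_ ?_ ?_ ?_
    · intro j hj
      simp only [Finset.mem_filter, Finset.mem_range] at hj ⊢
      exact Nat.div_lt_of_lt_mul (hp' j hj.1).1
    · intro k hk
      simp only [Finset.mem_filter, Finset.mem_range] at hk ⊢
      have h := hp _ (hlt hk hc)
      exact ⟨h.1, by rw [h.2, Nat.mul_add_mod, Nat.mod_eq_of_lt hc]⟩
    · intro j hj
      simp only [Finset.mem_filter, Finset.mem_range] at hj
      have : r * (p' j / r) + c = p' j := by rw [← hj.2]; exact Nat.div_add_mod _ _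
      simp only [this]
      exact (hp' j hj.1).2
    · intro k hk
      simp only [(hp _ (hlt (Finset.mem_range.1 hk) hc)).2]
      rw [Nat.mul_add_div hr, Nat.div_eq_of_lt hc, Nat.add_zero]
    · intro j hj
      simp only [Finset.mem_filter, Finset.mem_range] at hj
      have : r * (p' j / r) + c = p' j := by rw [← hj.2]; exact Nat.div_add_mod _ _
      simp only [this, (hp' j hj.1).2]
  -- The sorted blocks are dealt out like cards: the class of a block is its rank modulo `r`.
  refine ⟨fun j => p' j % r, fun j => Nat.mod_lt _ hr, fun c hc => ?_, fun c hc c' hc' => ?_⟩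
  · rw [Finset.card_eq_sum_ones, key _ c hc]; simp
  · rw [key d c hc, key d c' hc']
    -- The sorted sequence is continued by `B`, so that it can be shifted by a whole round. Each
    -- card of one class is at most the next card of any other class, and the surplus at the end is
    -- `B`.
    set g : ℕ → ℕ := fun i => if i < r * q then d (p i) else B with hg
    have hgm : ∀ i j, i ≤ j → g i ≤ g j := by
      intro i j hij
      simp only [hg]
      split_ifs with h1 h2 h2
      · exact hmono i j hij h2
      · exact hd _
      · omega
      · exact le_rfl
    have hg1 : ∀ c < r, ∑ k ∈ Finset.range q, d (p (r * k + c)) =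
        ∑ k ∈ Finset.range q, g (r * k + c) := fun c hc =>
      Finset.sum_congr rfl fun k hk => by simp only [hg, if_pos (hlt (Finset.mem_range.1 hk) hc)]
    rw [hg1 c hc, hg1 c' hc']
    calc ∑ k ∈ Finset.range q, g (r * k + c) ≤ ∑ k ∈ Finset.range q, g (r * (k + 1) + c') :=
          Finset.sum_le_sum fun k _ => hgm _ _ (by rw [mul_add]; omega)
      _ ≤ ∑ k ∈ Finset.range (q + 1), g (r * k + c') := by
          rw [Finset.sum_range_succ' fun k => g (r * k + c')]; omega
      _ ≤ _ := by
          rw [Finset.sum_range_succ]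
          refine Nat.add_le_add_left ?_ _
          simp [hg]

namespace WordRAM

/-! ### How a solution is distributed over the blocks. -/

namespace Setup

variable {s : Setup}

theorem card_inter_items (S : Finset ℕ) (sel : ℕ → Bool) :
    (S ∩ s.items sel).card = ∑ j ∈ (Finset.range s.K).filter (sel ·),
      (S ∩ s.items fun k => k = j).card := by
  rw [Finset.card_eq_sum_card_fiberwise (f := fun i => i / s.B)
    (t := (Finset.range s.K).filter (sel ·))]
  · refine Finset.sum_congr rfl fun j hj => ?_
    congr 1
    ext i
    simp only [items, Finset.mem_filter, Finset.mem_inter, decide_eq_true_eq]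
    constructor
    · rintro ⟨⟨h1, h2, h3⟩, h4⟩; exact ⟨h1, h2, h4⟩
    · rintro ⟨h1, h2, h4⟩
      exact ⟨⟨h1, h2, by rw [h4]; exact (Finset.mem_filter.1 hj).2⟩, h4⟩
  · intro i hi
    obtain ⟨h1, h2⟩ := Finset.mem_inter.1 (Finset.mem_coe.1 hi)
    obtain ⟨h3, h4⟩ := Finset.mem_filter.1 h2
    rw [Finset.mem_coe, Finset.mem_filter, Finset.mem_range]
    refine ⟨Nat.div_lt_of_lt_mul ?_, h4⟩
    rw [mul_comm]; exact Finset.mem_range.1 h3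

theorem card_block (hB : 0 < s.B) {j : ℕ} (hj : j < s.K) : (s.items fun k => k = j).card = s.B := by
  have : (s.items fun k => k = j) = Finset.Ico (j * s.B) ((j + 1) * s.B) := by
    ext i
    have h1 : (j + 1) * s.B ≤ s.n := Nat.mul_le_mul_right _ hj
    simp only [items, Finset.mem_filter, Finset.mem_range, Finset.mem_Ico, decide_eq_true_eq,
      Nat.div_eq_iff hB]
    rw [add_mul, one_mul] at *
    omega
  rw [this, Nat.card_Ico, add_mul, one_mul, Nat.add_sub_cancel_left]

theorem card_items (hB : 0 < s.B) (sel : ℕ → Bool) :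
    (s.items sel).card = ((Finset.range s.K).filter (sel ·)).card * s.B := by
  have h := card_inter_items (s := s) (Finset.range s.n) sel
  rw [Finset.inter_eq_right.2 (s.items_subset sel)] at h
  rw [h]
  refine Finset.sum_const_nat fun j hj => ?_
  rw [Finset.inter_eq_right.2 (s.items_subset _),
    card_block hB (Finset.mem_range.1 (Finset.mem_filter.1 hj).1)]

theorem card_inter_block_le (hB : 0 < s.B) (S : Finset ℕ) (j : ℕ) :
    (S ∩ s.items fun k => k = j).card ≤ s.B := by
  refine (Finset.card_le_card Finset.inter_subset_right).trans ?_
  rw [card_items hB]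
  refine Nat.mul_le_of_le_div _ _ _ ?_
  rw [Nat.div_self hB, Finset.card_le_one]
  intro a ha b hb
  simp only [Finset.mem_filter, decide_eq_true_eq] at ha hb
  rw [ha.2, hb.2]

/-- The classes of the blocks are balanced for the solution `S`. -/
structure Balanced (s : Setup) (q : ℕ) (S : Finset ℕ) (cls : ℕ → ℕ) : Prop where
  lt : ∀ j, cls j < 74
  card : ∀ f : ℕ → Bool, (s.items fun j => f (cls j)).card = ((Finset.range 74).filter (f ·)).card * q * s.B
  le : ∀ f : ℕ → Bool, 74 * (S ∩ s.items fun j => f (cls j)).card ≤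
    ((Finset.range 74).filter (f ·)).card * (S.card + 74 * s.B)
  ge : ∀ f : ℕ → Bool, ((Finset.range 74).filter (f ·)).card * S.card ≤
    74 * ((S ∩ s.items fun j => f (cls j)).card + ((Finset.range 74).filter (f ·)).card * s.B)

/-- Any two of the `74` classes differ by at most `B` in their share of `S`, so each class is within
`B` of the average share. Summing over the classes selected by `f` gives both inequalities. -/
theorem exists_balanced {q : ℕ} (hK : s.K = 74 * q) (hB : 0 < s.B) {S : Finset ℕ}
    (hS : S ⊆ Finset.range s.n) : ∃ cls, s.Balanced q S cls := by
  obtain ⟨cls, h1, h2, h3⟩ := exists_classes 74 q s.B (by norm_num) (fun j => card_inter_block_le hB S j)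
  rw [← hK] at h2 h3
  set D : ℕ → ℕ := fun c => ∑ j ∈ (Finset.range s.K).filter (cls · = c),
    (S ∩ s.items fun k => k = j).card with hD
  have hfib : ∀ (f : ℕ → Bool) (F : ℕ → ℕ), ∑ j ∈ (Finset.range s.K).filter (fun j => f (cls j)), F j =
      ∑ c ∈ (Finset.range 74).filter (f ·), ∑ j ∈ (Finset.range s.K).filter (cls · = c), F j := by
    intro f F
    rw [← Finset.sum_fiberwise_of_maps_to (t := (Finset.range 74).filter (f ·)) (g := cls)]
    · refine Finset.sum_congr rfl fun c hc => ?_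
      congr 1
      ext j
      have := (Finset.mem_filter.1 hc).2
      simp only [Finset.mem_filter]
      constructor
      · rintro ⟨⟨a, b⟩, e⟩; exact ⟨a, e⟩
      · rintro ⟨a, e⟩; exact ⟨⟨a, by rw [e]; exact this⟩, e⟩
    · intro j hj
      exact Finset.mem_filter.2 ⟨Finset.mem_range.2 (h1 j), (Finset.mem_filter.1 hj).2⟩
  have hcount : ∀ f : ℕ → Bool, (S ∩ s.items fun j => f (cls j)).card =
      ∑ c ∈ (Finset.range 74).filter (f ·), D c := by
    intro f
    rw [card_inter_items, hfib]
  have htot : S.card = ∑ c ∈ Finset.range 74, D c := by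
    have := hcount fun _ => true
    simp only [Finset.filter_true] at this
    rw [← this]
    congr 1
    refine (Finset.inter_eq_left.2 fun i hi => ?_).symm
    exact Finset.mem_filter.2 ⟨hS hi, rfl⟩
  have hup : ∀ c ∈ Finset.range 74, 74 * D c ≤ S.card + 74 * s.B := by
    intro c hc
    have : ∑ c' ∈ Finset.range 74, D c ≤ ∑ c' ∈ Finset.range 74, (D c' + s.B) :=
      Finset.sum_le_sum fun c' hc' => h3 c (Finset.mem_range.1 hc) c' (Finset.mem_range.1 hc')
    rw [Finset.sum_add_distrib, ← htot] at this
    simpa using this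
  have hlo : ∀ c ∈ Finset.range 74, S.card ≤ 74 * (D c + s.B) := by
    intro c hc
    have : ∑ c' ∈ Finset.range 74, D c' ≤ ∑ c' ∈ Finset.range 74, (D c + s.B) :=
      Finset.sum_le_sum fun c' hc' => h3 c' (Finset.mem_range.1 hc') c (Finset.mem_range.1 hc)
    rw [← htot] at this
    simpa using this
  refine ⟨cls, h1, fun f => ?_, fun f => ?_, fun f => ?_⟩
  · rw [card_items hB, Finset.card_eq_sum_ones, hfib]
    simp only [← Finset.card_eq_sum_ones]
    rw [Finset.sum_const_nat fun c hc => h2 c (Finset.mem_range.1 (Finset.mem_filter.1 hc).1)]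
  · rw [hcount, Finset.mul_sum]
    exact Finset.sum_le_card_nsmul _ _ _ fun c hc => hup c (Finset.mem_filter.1 hc).1
  · rw [hcount]
    calc _ = ∑ c ∈ (Finset.range 74).filter (f ·), S.card := by simp
      _ ≤ ∑ c ∈ (Finset.range 74).filter (f ·), 74 * (D c + s.B) :=
        Finset.sum_le_sum fun c hc => hlo c (Finset.mem_filter.1 hc).1
      _ = _ := by rw [← Finset.mul_sum, Finset.sum_add_distrib]; simp

end Setup


namespace Setup

variable {s : Setup}

/-! ## Bounds on the numbers of sums and sets -/

/-- The subset sums of a set of items. -/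
def sums (s : Setup) (I : Finset ℕ) : Finset ℤ := I.powerset.image s.sum

theorem card_sums_le (I : Finset ℕ) : (s.sums I).card ≤ 2 ^ I.card :=
  Finset.card_image_le.trans (Finset.card_powerset I).le

/-- A subset sum of the union is fixed by a sum from `I` and a subset of `I'`. Thus coincidences
among the sums of `I` are inherited by every larger set. -/
theorem card_sums_union_le {I I' : Finset ℕ} (h : Disjoint I I') :
    (s.sums (I ∪ I')).card ≤ (s.sums I).card * 2 ^ I'.card := by
  have : s.sums (I ∪ I') ⊆ (s.sums I ×ˢ I'.powerset).image fun x => x.1 + s.sum x.2 := by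
    intro v hv
    obtain ⟨A, hA, rfl⟩ := Finset.mem_image.1 hv
    have hA := Finset.mem_powerset.1 hA
    refine Finset.mem_image.2 ⟨(s.sum (A ∩ I), A ∩ I'), ?_, ?_⟩
    · exact Finset.mem_product.2 ⟨Finset.mem_image_of_mem _ (Finset.mem_powerset.2
        Finset.inter_subset_right), Finset.mem_powerset.2 Finset.inter_subset_right⟩
    · have e : A = A ∩ I ∪ A ∩ I' := by
        rw [← Finset.inter_union_distrib_left, Finset.inter_eq_left.2 hA]
      conv_rhs => rw [e]
      exact (Finset.sum_union (h.mono Finset.inter_subset_right Finset.inter_subset_right)).symm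
  refine (Finset.card_le_card this).trans (Finset.card_image_le.trans ?_)
  rw [Finset.card_product, Finset.card_powerset]

theorem card_coded_le (sel : ℕ → Bool) (c : ℕ) :
    (s.coded sel c).card ≤ (s.n + 1) * (s.sums (s.items sel)).card := by
  have : s.coded sel c ⊆ (Finset.range (s.n + 1) ×ˢ s.sums (s.items sel)).image
      fun x => x.2 * (s.n + 1) + x.1 := by
    intro v hv
    obtain ⟨A, hA, rfl⟩ := Finset.mem_image.1 hv
    have hA := (Finset.mem_filter.1 hA).1
    refine Finset.mem_image.2 ⟨(A.card, s.sum A), Finset.mem_product.2 ⟨?_,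
      Finset.mem_image_of_mem _ hA⟩, rfl⟩
    have := Finset.card_le_card ((Finset.mem_powerset.1 hA).trans (s.items_subset sel))
    rw [Finset.card_range] at this
    rw [Finset.mem_range]; omega
  refine (Finset.card_le_card this).trans (Finset.card_image_le.trans ?_)
  rw [Finset.card_product, Finset.card_range]

theorem card_coded_le' (sel : ℕ → Bool) (c : ℕ) :
    (s.coded sel c).card ≤ ((s.items sel).powerset.filter fun A => A.card ≤ c * s.B).card :=
  Finset.card_image_le

theorem card_half {q : ℕ} {S : Finset ℕ} {cls : ℕ → ℕ} (h : s.Balanced q S cls) {a b : ℕ} (hb : b ≤ 74) :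
    (s.items fun j => decide (a ≤ cls j ∧ cls j < b)).card = (b - a) * q * s.B ∧
    74 * (S ∩ s.items fun j => decide (a ≤ cls j ∧ cls j < b)).card ≤
      (b - a) * (S.card + 74 * s.B) ∧
    (b - a) * S.card ≤ 74 * ((S ∩ s.items fun j => decide (a ≤ cls j ∧ cls j < b)).card +
      (b - a) * s.B) := by
  have e : ((Finset.range 74).filter fun c => decide (a ≤ c ∧ c < b) = true).card = b - a := by
    have : ((Finset.range 74).filter fun c => decide (a ≤ c ∧ c < b) = true) = Finset.Ico a b := by
      ext c
      simp only [Finset.mem_filter, Finset.mem_range, decide_eq_true_eq, Finset.mem_Ico]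
      omega
    rw [this, Nat.card_Ico]
  have h1 := h.card fun c => decide (a ≤ c ∧ c < b)
  have h2 := h.le fun c => decide (a ≤ c ∧ c < b)
  have h3 := h.ge fun c => decide (a ≤ c ∧ c < b)
  rw [e] at h1 h2 h3
  exact ⟨h1, h2, h3⟩

/-- At most `c * B` items means a deviation of at least `5000 * B` from half of `37 * q * B`. Since
`37 * q ≤ 2 * 5000 ^ 2`, Hoeffding's bound saves the factor `2 ^ B`. -/
theorem card_coded_half {q : ℕ} (hq : 37 * q ≤ 2 * 5000 ^ 2) (hB : 0 < s.B) {sel : ℕ → Bool} {c : ℕ}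
    (hI : (s.items sel).card = 37 * q * s.B) (hc : 2 * c + 2 * 5000 ≤ 37 * q) (hq1 : 1 ≤ q) :
    (s.coded sel c).card ≤ 2 ^ ((37 * q - 1) * s.B) := by
  refine (card_coded_le' sel c).trans ?_
  have h := card_low_tail (s.items sel) (k := s.B) (x := 5000 * s.B) (c := c * s.B)
    (Nat.mul_pos (by norm_num) hB) ?_ ?_
  · have e : 2 ^ (s.items sel).card = 2 ^ ((37 * q - 1) * s.B) * 2 ^ s.B := by
      rw [← pow_add, hI]
      congr 1
      rw [← Nat.succ_mul]
      congr 1; omega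
    rw [e] at h
    exact Nat.le_of_mul_le_mul_right h (by positivity)
  · rw [hI]
    calc s.B * (37 * q * s.B) = 37 * q * s.B ^ 2 := by ring
      _ ≤ 2 * 5000 ^ 2 * s.B ^ 2 := Nat.mul_le_mul_right _ hq
      _ = _ := by ring
  · rw [hI]
    calc _ = (2 * c + 2 * 5000) * s.B := by ring
      _ ≤ _ := Nat.mul_le_mul_right _ hc

/-- Sparse solutions are found. -/
theorem found_of_card_le {q : ℕ} (hq : 37 * q ≤ 2 * 5000 ^ 2) (hq1 : 1 ≤ q) (hK : s.K = 74 * q)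
    (hB : 0 < s.B) (hN : s.N₁ = (s.n + 1) * 2 ^ ((37 * q - 1) * s.B)) {neg : Bool} {S : Finset ℕ}
    (hS : S ⊆ Finset.range s.n) (ht : s.sum S = s.target neg) {c : ℕ}
    (hc : 2 * c + 2 * 5000 = 37 * q) (hcard : S.card + 10074 * s.B ≤ 37 * q * s.B) :
    ∃ sel, s.Found sel c neg := by
  obtain ⟨cls, hcls⟩ := exists_balanced hK hB hS
  obtain ⟨i1, l1, -⟩ := card_half hcls (a := 0) (b := 37) (by norm_num)
  obtain ⟨i2, l2, -⟩ := card_half hcls (a := 37) (b := 74) (by norm_num)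
  set sel : ℕ → Bool := fun j => decide (0 ≤ cls j ∧ cls j < 37) with hsel
  have hnot : (fun j => decide (37 ≤ cls j ∧ cls j < 74)) = fun j => !sel j := by
    funext j
    have := hcls.lt j
    simp only [hsel, Bool.decide_and, zero_le, decide_true, Bool.true_and]
    by_cases h : cls j < 37
    · simp [h]
    · simp [h, this, show 37 ≤ cls j by omega]
  rw [hnot] at i2 l2
  norm_num at i1 i2 l1 l2
  -- Of the slack `10074 * B`, the balancing of the classes consumes `74 * B` and the definition of
  -- `c` consumes `10000 * B`.
  have hle : ∀ x, 74 * x ≤ 37 * (S.card + 74 * s.B) → x ≤ c * s.B := by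
    intro x hx
    have h2 : 2 * (c * s.B) + 10000 * s.B = 37 * q * s.B := by rw [← hc]; ring
    omega
  have h1 : ∀ x, x ≤ 2 ^ ((37 * q - 1) * s.B) → x ≤ s.N₁ := fun x hx => by
    rw [hN]; exact hx.trans (Nat.le_mul_of_pos_left _ (Nat.succ_pos _))
  exact ⟨sel, h1 _ (card_coded_half hq hB i1 hc.le hq1), h1 _ (card_coded_half hq hB i2 hc.le hq1),
    S, hS, ht, hle _ l1, hle _ l2⟩

/-- If the subset sums of `16 * q` blocks coincide often, then solutions are found. -/
theorem found_of_card_sums_le {q : ℕ} (hq1 : 1 ≤ q) (hK : s.K = 74 * q)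
    (hB : 0 < s.B) (hN : s.N₁ = (s.n + 1) * 2 ^ ((37 * q - 1) * s.B)) {S : Finset ℕ}
    (hS : S ⊆ Finset.range s.n) (ht : s.sum S = s.t) {f : ℕ → Bool}
    (hf : (s.items f).card = 16 * q * s.B)
    (hsum : (s.sums (s.items f)).card ≤ 2 ^ ((16 * q - 2) * s.B)) :
    ∃ sel, s.Found sel s.K false := by
  rw [card_items hB] at hf
  have hf := Nat.eq_of_mul_eq_mul_right hB hf
  -- The cut is off balance by one block. The side that contains the coinciding sums has `37 * q +
  -- 1` blocks and saves two of them in the exponent; the other side is smaller by itself. Both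
  -- exponents become `(37 * q - 1) * B`.
  obtain ⟨F, h1, h2, h3⟩ := Finset.exists_subsuperset_card_eq (n := 37 * q + 1)
    (Finset.filter_subset (f ·) (Finset.range s.K)) (by omega) (by rw [Finset.card_range]; omega)
  set sel : ℕ → Bool := fun j => decide (j ∈ F) with hsel
  have e1 : ((Finset.range s.K).filter (sel ·)).card = 37 * q + 1 := by
    rw [← h3]
    congr 1
    ext j
    simp only [hsel, Finset.mem_filter, decide_eq_true_eq]
    exact ⟨fun h => h.2, fun h => ⟨h2 h, h⟩⟩
  have e2 : ((Finset.range s.K).filter fun j => (!sel j) = true).card = 37 * q - 1 := by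
    have := Finset.card_filter_add_card_filter_not (s := Finset.range s.K) (sel ·)
    rw [e1, Finset.card_range] at this
    simp only [Bool.not_eq_true'] at *
    simp only [Bool.not_eq_true] at this
    omega
  have hcap : ∀ g, (S ∩ s.items g).card ≤ s.K * s.B := by
    intro g
    have := Finset.card_le_card (Finset.inter_subset_left.trans hS : S ∩ s.items g ⊆ _)
    rwa [Finset.card_range] at this
  refine ⟨sel, ?_, ?_, S, hS, by simpa [target] using ht, hcap _, hcap _⟩
  · refine (card_coded_le sel _).trans ?_
    rw [hN]
    refine Nat.mul_le_mul_left _ ?_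
    have hun : s.items sel = s.items f ∪ s.items fun j => sel j && !f j := by
      ext i
      simp only [items, Finset.mem_union, Finset.mem_filter, Finset.mem_range]
      constructor
      · rintro ⟨a, b⟩
        by_cases hfi : f (i / s.B) = true
        · exact .inl ⟨a, hfi⟩
        · exact .inr ⟨a, by simp [b, hfi]⟩
      · rintro (⟨a, b⟩ | ⟨a, b⟩)
        · refine ⟨a, ?_⟩
          rw [hsel]
          refine decide_eq_true (h1 (Finset.mem_filter.2 ⟨Finset.mem_range.2 ?_, b⟩))
          exact Nat.div_lt_of_lt_mul (by rw [mul_comm]; exact a)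
        · simp only [Bool.and_eq_true] at b
          exact ⟨a, b.1⟩
    have hdis : Disjoint (s.items f) (s.items fun j => sel j && !f j) :=
      disjoint_items fun j => by cases f j <;> simp
    have hc := Finset.card_union_of_disjoint hdis
    rw [← hun, card_items hB, e1, card_items hB, hf] at hc
    rw [hun]
    refine (card_sums_union_le hdis).trans ((Nat.mul_le_mul_right _ hsum).trans ?_)
    rw [← pow_add]
    refine Nat.pow_le_pow_right (by norm_num) ?_
    obtain ⟨q, rfl⟩ : ∃ q', q = q' + 1 := ⟨q - 1, by omega⟩
    rw [show 16 * (q + 1) - 2 = 16 * q + 14 by omega, show 37 * (q + 1) - 1 = 37 * q + 36 by omega]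
    have : (37 * (q + 1) + 1) * s.B = 16 * (q + 1) * s.B + (21 * q + 22) * s.B := by ring
    have : (37 * q + 36) * s.B = (16 * q + 14) * s.B + (21 * q + 22) * s.B := by ring
    omega
  · refine (card_coded_le _ _).trans ?_
    rw [hN]
    refine Nat.mul_le_mul_left _ ((card_sums_le _).trans ?_)
    rw [card_items hB, e2]

/-- If there are many subset sums, then a solution has many partial sums. -/
theorem card_partials {q l : ℕ} (hq : 4 * (8 * q + 2535) ≤ 2 * 6000 ^ 2) (hB : 0 < s.B)
    (hl : l + 2545 * s.B = 8 * q * s.B) {S : Finset ℕ} {ρ : ℕ → ℕ} {r : ℕ}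
    (hpart : (s.part ρ r).card = 16 * q * s.B) (hlo : 8 * q * s.B ≤ (S ∩ s.part ρ r).card + 2535 * s.B)
    (hup : (S ∩ s.part ρ r).card ≤ (8 * q + 2535) * s.B)
    (hsum : 2 ^ ((16 * q - 2) * s.B) ≤ (s.sums (s.part ρ r)).card) (hq1 : 2000 ≤ q) :
    128 * 2 ^ l ≤ (s.partials ((4 * q + 7535) * s.B) ρ S r).card := by
  set P := s.part ρ r
  set I := S ∩ P with hI
  set cap := (4 * q + 7535) * s.B with hcap
  set X := s.partials cap ρ S r with hX
  have hIP : (P \ S).card + I.card = 16 * q * s.B := by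
    rw [hI, Finset.inter_comm, Finset.card_sdiff_add_card_inter, hpart]
  have hPI : P = I ∪ P \ S := by
    rw [hI, Finset.inter_comm, Finset.union_comm, Finset.sdiff_union_inter]
  have hdis : Disjoint I (P \ S) := (Finset.disjoint_sdiff (s := S) (t := P)).mono_left
    Finset.inter_subset_left
  have h12B : 12000 * s.B ≤ I.card := by
    nlinarith
  -- The part falls short of all different sums by a factor of at most `2 ^ (2 * B)`. The items
  -- outside `S` can multiply the number of sums only by the number of their subsets, so `I` has no
  -- larger deficit.
  have h1 : 2 ^ (I.card - 2 * s.B) ≤ (s.sums I).card := by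
    have h : 2 ^ ((16 * q - 2) * s.B) ≤ (s.sums I).card * 2 ^ (P \ S).card := by
      refine hsum.trans ?_
      conv_lhs => rw [hPI]
      exact card_sums_union_le hdis
    have e : 2 ^ ((16 * q - 2) * s.B) = 2 ^ (I.card - 2 * s.B) * 2 ^ (P \ S).card := by
      rw [← pow_add, Nat.sub_mul]
      congr 1; omega
    rw [e] at h
    exact Nat.le_of_mul_le_mul_right h (by positivity)
  have hk : 4 * s.B * I.card ≤ 2 * (6000 * s.B) ^ 2 := by
    calc 4 * s.B * I.card ≤ 4 * s.B * ((8 * q + 2535) * s.B) := Nat.mul_le_mul_left _ hup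
      _ = 4 * (8 * q + 2535) * s.B ^ 2 := by ring
      _ ≤ 2 * 6000 ^ 2 * s.B ^ 2 := Nat.mul_le_mul_right _ hq
      _ = _ := by ring
  have hx : 0 < 6000 * s.B := by omega
  have hIc : I.card + 2 * (6000 * s.B) ≤ 2 * cap := by
    have e1 : 2 * cap = (8 * q + 2535) * s.B + 12535 * s.B := by rw [hcap]; ring
    omega
  have hhigh := card_high_tail I (c := cap) hx hk hIc
  have hlow := card_low_tail I (c := I.card - cap) hx hk (by omega)
  -- A subset sum of `I` comes from a balanced split, up to the shift by the base, or from a subset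
  -- that is too large or too small. Sets of the last two kinds deviate by at least `6000 * B` from
  -- half and are rare.
  have hcov : s.sums I ⊆ X.image (fun v => v - s.base ρ S r) ∪
      ((I.powerset.filter fun A => cap ≤ A.card).image s.sum ∪
        (I.powerset.filter fun A => A.card ≤ I.card - cap).image s.sum) := by
    intro v hv
    obtain ⟨T, hT, rfl⟩ := Finset.mem_image.1 hv
    by_cases c1 : cap ≤ T.card
    · exact Finset.mem_union_right _ (Finset.mem_union_left _
        (Finset.mem_image_of_mem _ (Finset.mem_filter.2 ⟨hT, c1⟩)))
    by_cases c2 : T.card ≤ I.card - cap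
    · exact Finset.mem_union_right _ (Finset.mem_union_right _
        (Finset.mem_image_of_mem _ (Finset.mem_filter.2 ⟨hT, c2⟩)))
    refine Finset.mem_union_left _ (Finset.mem_image.2 ⟨s.base ρ S r + s.sum T, ?_, by ring⟩)
    refine Finset.mem_image_of_mem (fun T => s.base ρ S r + s.sum T) (Finset.mem_filter.2 ⟨hT, ?_, ?_⟩)
    · omega
    · rw [Finset.card_sdiff_of_subset (Finset.mem_powerset.1 hT)]
      omega
  have h3 := (Finset.card_le_card hcov).trans ((Finset.card_union_le _ _).trans
    (Nat.add_le_add Finset.card_image_le ((Finset.card_union_le _ _).trans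
      (Nat.add_le_add Finset.card_image_le Finset.card_image_le))))
  set b1 := (I.powerset.filter fun A => cap ≤ A.card).card
  set b2 := (I.powerset.filter fun A => A.card ≤ I.card - cap).card
  -- In units of `2 ^ k` there are at least `256` sums, each tail accounts for at most `64`, and
  -- `128` remain. The constant `2545` covers the deviation `2535`, the deficit `2` and the exponent
  -- `8` of `256`.
  obtain ⟨k, hk'⟩ : ∃ k, I.card = k + 2 * s.B + 1 + 7 := by
    refine ⟨I.card - 2 * s.B - 8, ?_⟩
    omega
  have hlk : l ≤ k := by omega
  have hpow : 2 ^ l ≤ 2 ^ k := Nat.pow_le_pow_right (by norm_num) hlk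
  have hb : ∀ b, b * 2 ^ (4 * s.B) ≤ 2 ^ I.card → b * 4 ≤ 256 * 2 ^ k := by
    intro b h
    obtain ⟨B', hB'⟩ : ∃ B', s.B = B' + 1 := ⟨s.B - 1, by omega⟩
    rw [hk', hB', show 4 * (B' + 1) = (2 * B' + 2) + (2 * B' + 2) by ring,
      show k + 2 * (B' + 1) + 1 + 7 = k + 8 + (2 * B' + 2) by ring, pow_add, pow_add 2 (k + 8),
      ← mul_assoc] at h
    have h := Nat.le_of_mul_le_mul_right h (by positivity)
    have h5 : 4 ≤ 2 ^ (2 * B' + 2) := by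
      rw [pow_add]; exact Nat.le_mul_of_pos_left _ (by positivity)
    have h6 : 2 ^ (k + 8) = 256 * 2 ^ k := by rw [pow_add]; ring
    rw [← h6]
    exact (Nat.mul_le_mul_left b h5).trans h
  have h4 := hb _ hhigh
  have h5 := hb _ hlow
  have h6 : 2 ^ (I.card - 2 * s.B) = 256 * 2 ^ k := by
    rw [hk', show k + 2 * s.B + 1 + 7 - 2 * s.B = k + 8 by omega, pow_add]; ring
  omega

/-- A quarter of `16 * q` blocks costs about `13 * q` blocks of entropy. This is why the undivided
parts have `13 * q` blocks: then all layers have about the same number of candidates. -/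
theorem card_small_sets {q : ℕ} {P : Finset ℕ} (hP : P.card = 16 * q * s.B) :
    (P.powerset.filter fun A => A.card ≤ (4 * q + 7535) * s.B).card ≤ 2 ^ ((13 * q + 12100) * s.B) := by
  have h := card_filter_card_le_mul P ((4 * q + 7535) * s.B)
  rw [hP] at h
  set Z := (P.powerset.filter fun A => A.card ≤ (4 * q + 7535) * s.B).card
  have h1 : (3 ^ (4 * q + 7535) * 4 ^ (16 * q)) ≤ 2 ^ (13 * q + 12100) * 3 ^ (16 * q) := by
    have a1 : 3 ^ 7535 ≤ 2 ^ 12100 := by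
      have h : ∀ a b k : ℕ, 3 ^ a ≤ 2 ^ b → 3 ^ (a * k) ≤ 2 ^ (b * k) := fun a b k h => by
        rw [pow_mul, pow_mul]; exact Nat.pow_le_pow_left h k
      refine (h 5 8 1507 (by norm_num)).trans (Nat.pow_le_pow_right two_pos ?_)
      norm_num
    have a2 : (2 ^ 19) ^ q ≤ (3 ^ 12) ^ q := Nat.pow_le_pow_left (by norm_num) _
    calc 3 ^ (4 * q + 7535) * 4 ^ (16 * q) = 3 ^ (4 * q) * 3 ^ 7535 * (2 ^ (13 * q) * (2 ^ 19) ^ q) := by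
          rw [pow_add, show (4 : ℕ) = 2 ^ 2 by norm_num, ← pow_mul 2 2, ← pow_mul 2 19, ← pow_add]
          congr 2
          ring
      _ ≤ 3 ^ (4 * q) * 2 ^ 12100 * (2 ^ (13 * q) * (3 ^ 12) ^ q) := by gcongr
      _ = _ := by
          rw [pow_add 2, ← pow_mul 3 12, show 16 * q = 4 * q + 12 * q by ring, pow_add 3 (4 * q)]
          ring
  have h2 : Z * 3 ^ (16 * q * s.B) ≤ 2 ^ ((13 * q + 12100) * s.B) * 3 ^ (16 * q * s.B) := by
    refine h.trans ?_
    rw [pow_mul 3 (4 * q + 7535), pow_mul 4 (16 * q), pow_mul 2 (13 * q + 12100), pow_mul 3 (16 * q),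
      ← mul_pow, ← mul_pow]
    exact Nat.pow_le_pow_left h1 _
  exact Nat.le_of_mul_le_mul_right h2 (by positivity)

/-- The roles occur with the right frequencies. -/
structure RightSizes (s : Setup) (q : ℕ) (ρ : ℕ → ℕ) : Prop where
  lt : ∀ j, ρ j < 5
  card : ∀ r < 5, (s.part ρ r).card = (if r < 3 then 16 else 13) * q * s.B

/-- A candidate is determined by its traces on the two parts of its layer. For each trace there are
at most `2 ^ ((13 * q + 12100) * B)` possibilities, either because its size is capped or because the
part itself is small. -/
theorem card_candidates {q : ℕ} {ρ : ℕ → ℕ} (hρ : s.RightSizes q ρ) {v : ℕ} (hv : v < 4) :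
    (s.candidates ((4 * q + 7535) * s.B) ρ v).card ≤ 2 ^ ((26 * q + 24200) * s.B) := by
  set cap := (4 * q + 7535) * s.B
  have small : ∀ r < 3, ((s.part ρ r).powerset.filter fun A => A.card ≤ cap).card ≤
      2 ^ ((13 * q + 12100) * s.B) := fun r hr =>
    card_small_sets (by rw [hρ.card r (by omega), if_pos hr])
  have big : ∀ r, 3 ≤ r → r < 5 → (s.part ρ r).powerset.card ≤ 2 ^ ((13 * q + 12100) * s.B) := by
    intro r h3 hr
    rw [Finset.card_powerset, hρ.card r hr, if_neg (by omega)]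
    exact Nat.pow_le_pow_right (by norm_num) (Nat.mul_le_mul_right _ (by omega))
  have key : ∀ (r r' : ℕ) (F F' : Finset (Finset ℕ)), s.items ((layer v).sel ρ) ⊆ s.part ρ r ∪ s.part ρ r' →
      (∀ A ∈ s.candidates cap ρ v, A ∩ s.part ρ r ∈ F ∧ A ∩ s.part ρ r' ∈ F') →
      F.card ≤ 2 ^ ((13 * q + 12100) * s.B) → F'.card ≤ 2 ^ ((13 * q + 12100) * s.B) →
      (s.candidates cap ρ v).card ≤ 2 ^ ((26 * q + 24200) * s.B) := by
    intro r r' F F' hsub hF c1 c2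
    refine (Finset.card_le_card_of_injOn (t := F ×ˢ F') (fun A => (A ∩ s.part ρ r, A ∩ s.part ρ r'))
      (fun A hA => Finset.mem_coe.2 (Finset.mem_product.2 (hF A hA))) ?_).trans ?_
    · intro A hA A' hA' h
      simp only [Prod.mk.injEq] at h
      have e : ∀ A ∈ s.candidates cap ρ v, A = A ∩ s.part ρ r ∪ A ∩ s.part ρ r' := by
        intro A hA
        rw [← Finset.inter_union_distrib_left, Finset.inter_eq_left.2]
        exact (Finset.mem_powerset.1 (Finset.mem_filter.1 hA).1).trans hsub
      rw [e A hA, e A' hA', h.1, h.2]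
    · rw [Finset.card_product]
      refine (Nat.mul_le_mul c1 c2).trans ?_
      rw [← pow_add]
      refine Nat.pow_le_pow_right (by norm_num) (le_of_eq (by ring))
  have cov : ∀ r r', (∀ j, (layer v).sel ρ j = true → ρ j = r ∨ ρ j = r') →
      s.items ((layer v).sel ρ) ⊆ s.part ρ r ∪ s.part ρ r' := by
    intro r r' h i hi
    obtain ⟨h1, h2⟩ := Finset.mem_filter.1 hi
    rcases h _ h2 with h3 | h3
    · exact Finset.mem_union_left _ (Finset.mem_filter.2 ⟨h1, by simpa using h3⟩)
    · exact Finset.mem_union_right _ (Finset.mem_filter.2 ⟨h1, by simpa using h3⟩)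
  have msmall : ∀ (A P : Finset ℕ), (A ∩ P).card ≤ cap →
      A ∩ P ∈ P.powerset.filter fun A => A.card ≤ cap := fun A P h =>
    Finset.mem_filter.2 ⟨Finset.mem_powerset.2 Finset.inter_subset_right, h⟩
  have mbig : ∀ (A P : Finset ℕ), A ∩ P ∈ P.powerset := fun A P =>
    Finset.mem_powerset.2 Finset.inter_subset_right
  have h5 := hρ.lt
  match v, hv with
  | 0, _ =>
    refine key 0 3 _ _ (cov 0 3 fun j h => ?_) (fun A hA => ⟨msmall _ _ ?_, mbig _ _⟩)
      (small 0 (by norm_num)) (big 3 (by norm_num) (by norm_num))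
    · have := h5 j
      simp [Layer.sel, layer] at h; omega
    · exact (Finset.mem_filter.1 hA).2.1
  | 1, _ =>
    refine key 0 1 _ _ (cov 0 1 fun j h => ?_) (fun A hA => ⟨msmall _ _ ?_, msmall _ _ ?_⟩)
      (small 0 (by norm_num)) (small 1 (by norm_num))
    · have := h5 j
      simp [Layer.sel, layer] at h; omega
    · exact (Finset.mem_filter.1 hA).2.1
    · exact (Finset.mem_filter.1 hA).2.2
  | 2, _ =>
    refine key 1 2 _ _ (cov 1 2 fun j h => ?_) (fun A hA => ⟨msmall _ _ ?_, msmall _ _ ?_⟩)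
      (small 1 (by norm_num)) (small 2 (by norm_num))
    · have := h5 j
      simp [Layer.sel, layer] at h; omega
    · exact (Finset.mem_filter.1 hA).2.1
    · exact (Finset.mem_filter.1 hA).2.2
  | 3, _ =>
    refine key 2 4 _ _ (cov 2 4 fun j h => ?_) (fun A hA => ⟨msmall _ _ ?_, mbig _ _⟩)
      (small 2 (by norm_num)) (big 4 (by norm_num) (by norm_num))
    · have := h5 j
      simp [Layer.sel, layer] at h; omega
    · exact (Finset.mem_filter.1 hA).2.1

end Setup


/-- The role of a block of class `c`. -/
def classRole (c : ℕ) : ℕ := if c < 16 then 0 else if c < 32 then 1 else if c < 48 then 2 else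
  if c < 61 then 3 else 4

theorem classRole_eq_iff {c : ℕ} (hc : c < 74) : (classRole c = 0 ↔ 0 ≤ c ∧ c < 16) ∧
    (classRole c = 1 ↔ 16 ≤ c ∧ c < 32) ∧ (classRole c = 2 ↔ 32 ≤ c ∧ c < 48) ∧
    (classRole c = 3 ↔ 48 ≤ c ∧ c < 61) ∧ (classRole c = 4 ↔ 61 ≤ c ∧ c < 74) := by
  unfold classRole
  split_ifs <;> simp <;> omega

/-! ### The case distinction for a solution. -/

namespace Setup

variable {s : Setup}

/-- A solution is either found by meeting in the middle, or has many partial sums. -/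
theorem found_or_partials {q c l : ℕ} (hq : q = 1000000) (hc : 2 * c + 2 * 5000 = 37 * q)
    (hK : s.K = 74 * q) (hB : 0 < s.B) (hN : s.N₁ = (s.n + 1) * 2 ^ ((37 * q - 1) * s.B))
    (hl : l + 2545 * s.B = 8 * q * s.B) {S : Finset ℕ} (hS : S ⊆ Finset.range s.n) (ht : s.sum S = s.t) :
    (∃ sel neg, s.Found sel c neg ∨ s.Found sel s.K neg) ∨ ∃ ρ, s.RightSizes q ρ ∧
      ∀ r < 3, 128 * 2 ^ l ≤ (s.partials ((4 * q + 7535) * s.B) ρ S r).card := by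
  have hq1 : 1 ≤ q := by rw [hq]; norm_num
  have hq2 : 37 * q ≤ 2 * 5000 ^ 2 := by rw [hq]; norm_num
  have hq3 : 4 * (8 * q + 2535) ≤ 2 * 6000 ^ 2 := by rw [hq]; norm_num
  have hq4 : 2000 ≤ q := by rw [hq]; norm_num
  clear hq
  by_cases hlow : S.card + 10074 * s.B ≤ 37 * q * s.B
  · obtain ⟨sel, h⟩ := found_of_card_le (neg := false) hq2 hq1 hK hB hN hS (by simpa [target] using ht)
      hc hlow
    exact .inl ⟨sel, _, .inl h⟩
  have hcard : (Finset.range s.n \ S).card + S.card = 74 * q * s.B := by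
    rw [Finset.card_sdiff_add_card_eq_card hS, Finset.card_range, Setup.n, hK]
  -- A very large solution is treated through its complement, which solves the instance with target
  -- `s.total - s.t`.
  by_cases hhigh : (Finset.range s.n \ S).card + 10074 * s.B ≤ 37 * q * s.B
  · obtain ⟨sel, h⟩ := found_of_card_le (neg := true) (S := Finset.range s.n \ S) hq2 hq1 hK hB hN
      Finset.sdiff_subset (by rw [target, if_pos rfl, ← ht]; exact Finset.sum_sdiff_eq_sub hS) hc hhigh
    exact .inl ⟨sel, _, .inl h⟩
  obtain ⟨cls, hcls⟩ := exists_balanced hK hB hS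
  set ρ : ℕ → ℕ := fun j => classRole (cls j) with hρ
  have hpart : ∀ r a b, (∀ c < 74, classRole c = r ↔ a ≤ c ∧ c < b) →
      s.part ρ r = s.items fun j => decide (a ≤ cls j ∧ cls j < b) := by
    intro r a b h
    unfold part items
    congr 1
    funext i
    simp only [hρ, h _ (hcls.lt _)]
  have e0 := hpart 0 0 16 fun c hc => (classRole_eq_iff hc).1
  have e1 := hpart 1 16 32 fun c hc => (classRole_eq_iff hc).2.1
  have e2 := hpart 2 32 48 fun c hc => (classRole_eq_iff hc).2.2.1
  have e3 := hpart 3 48 61 fun c hc => (classRole_eq_iff hc).2.2.2.1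
  have e4 := hpart 4 61 74 fun c hc => (classRole_eq_iff hc).2.2.2.2
  have h0 := card_half hcls (a := 0) (b := 16) (by norm_num)
  have h1 := card_half hcls (a := 16) (b := 32) (by norm_num)
  have h2 := card_half hcls (a := 32) (b := 48) (by norm_num)
  have h3 := (card_half hcls (a := 48) (b := 61) (by norm_num)).1
  have h4 := (card_half hcls (a := 61) (b := 74) (by norm_num)).1
  rw [← e0] at h0
  rw [← e1] at h1
  rw [← e2] at h2
  rw [← e3] at h3
  rw [← e4] at h4
  have hsizes : s.RightSizes q ρ := by
    constructor
    · intro j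
      simp only [hρ, classRole]
      split_ifs <;> norm_num
    · intro r hr
      interval_cases r
      · simpa using h0.1
      · simpa using h1.1
      · simpa using h2.1
      · simpa using h3
      · simpa using h4
  have hM : ∀ r < 3, 74 * (S ∩ s.part ρ r).card ≤ 16 * (S.card + 74 * s.B) ∧
      16 * S.card ≤ 74 * ((S ∩ s.part ρ r).card + 16 * s.B) := by
    intro r hr
    interval_cases r
    · exact h0.2
    · exact h1.2
    · exact h2.2
  by_cases hsum : ∃ r < 3, (s.sums (s.part ρ r)).card ≤ 2 ^ ((16 * q - 2) * s.B)
  · obtain ⟨r, hr, h⟩ := hsum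
    obtain ⟨sel, h⟩ := found_of_card_sums_le hq1 hK hB hN hS ht (f := fun j => ρ j = r)
      (by have := hsizes.card r (by omega); rwa [if_pos hr] at this) h
    exact .inl ⟨sel, _, .inr h⟩
  push Not at hsum
  -- Here `S` deviates by less than `10074 * B` from half of all items, and balancing adds at most
  -- `74 * B`. A part receives the share `16 / 74` of this, which is below `2535 * B`.
  refine .inr ⟨ρ, hsizes, fun r hr => card_partials hq3 hB hl ?_ ?_ ?_ (hsum r hr).le hq4⟩
  · have := hsizes.card r (by omega); rwa [if_pos hr] at this
  · have := (hM r hr).2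
    simp only [mul_assoc, add_mul] at *
    omega
  · have := (hM r hr).1
    simp only [mul_assoc, add_mul] at *
    omega

end Setup


/-! ## Preparations -/

/-- Assignments one after the other. -/
def assign : List (ℕ × Expr) → Prog
  | [] => .const (tmp 0) 0
  | x :: l => .seq (Stm.code (.set x.1 x.2)) (assign l)

/-- The running time of `assign`. -/
def assignCost : List (ℕ × Expr) → ℕ
  | [] => 1
  | x :: l => x.2.cost + 2 + assignCost l

/-- The values `vs` are assigned, and then `Q` holds. -/
def AssignOk (b : ℕ) : List (ℕ × Expr) → List ℤ → State → (State → Prop) → Prop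
  | [], [], σ, Q => Q σ
  | x :: l, v :: vs, σ, Q => (x.2.Ok b σ ∧ Stm.fitsIfVar b σ x.2 ∧ x.2.eval σ = v) ∧
      AssignOk b l vs (σ.setReg x.1 v) Q
  | _, _, _, _ => False

theorem runs_assign {b : ℕ} (hb : 1 ≤ b) {l : List (ℕ × Expr)} {vs : List ℤ} {σ : State}
    {Q : State → Prop} (h : AssignOk b l vs σ Q) : Runs b (assign l) σ (assignCost l) Q := by
  induction l generalizing vs σ with
  | nil =>
    cases vs with
    | nil => exact Runs.skip b h
    | cons _ _ => exact h.elim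
  | cons x l ih =>
    cases vs with
    | nil => exact h.elim
    | cons v vs =>
      obtain ⟨⟨h1, h2, h3⟩, h4⟩ := h
      exact (Setup.runs_set hb h1 h3 h2 (Q := fun σ' => σ' = σ.setReg x.1 v) rfl).seq
        fun σ' h' => by rw [h']; exact ih h4

/-- Computes the sum of the numbers and of their absolute values. -/
def sumLoop : Prog :=
  whileLt 50 0 (assign [(51, .ld 0 (.var 50)),
      -- The absolute value is computed without a branch, as the number minus twice itself if it is
      -- negative.
      (4, .var 4 + (.var 51 - .num 2 * .var 51 * .bin .lt (.var 51) (.num 0))),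
      (5, .var 5 + .var 51), (50, .var 50 + .num 1)])

/-- Computes a power of two. -/
def powLoop : Prog :=
  whileLt 6 52 (assign [(6, .var 6 + .var 6)])

/-- Reads a random number off the coins. -/
def coinLoop : Prog :=
  whileLt 50 52 (.seq (.flip (fmap 53)) (assign [(51, .var 51 + .var 53 * .var 50),
      (50, .var 50 + .var 50)]))

theorem runs_sumLoop {b : ℕ} (hb : 1 ≤ b) {n : ℕ} {w : ℕ → ℤ} {σ : State} (h0 : σ.reg 0 = n)
    (h4 : σ.reg 4 = 0) (h5 : σ.reg 5 = 0) (h50 : σ.reg 50 = 0) (hw : σ.arr 0 = w)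
    (hfit : 2 * ∑ i ∈ Finset.range n, |w i| + n + 2 < 2 ^ b) :
    Runs b sumLoop σ (n * 42 + 2) fun σ' =>
        Same {4, 5, 50, 51} ∅ σ σ' ∧ σ'.coins = σ.coins ∧
        σ'.reg 4 = ∑ i ∈ Finset.range n, |w i| ∧ σ'.reg 5 = ∑ i ∈ Finset.range n, w i := by
  refine Runs.mono (Runs.whileLt hb (fun k σ' => (Same {4, 5, 50, 51} ∅ σ σ' ∧ σ'.coins = σ.coins ∧
    σ'.reg 4 = ∑ i ∈ Finset.range k, |w i| ∧ σ'.reg 5 = ∑ i ∈ Finset.range k, w i) ∧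
    σ'.reg 50 = k) n 40 ?_ ?_ ?_) le_rfl fun _ h => h.1
  · rintro k hk τ ⟨⟨hs, hc, t4, t5⟩, t50⟩
    have hle : ∑ i ∈ Finset.range (k + 1), |w i| ≤ ∑ i ∈ Finset.range n, |w i| :=
      Finset.sum_le_sum_of_subset_of_nonneg (Finset.range_subset_range.2 hk) fun _ _ _ => abs_nonneg _
    have e4 := Finset.sum_range_succ (fun i => |w i|) k
    have e5 := Finset.sum_range_succ w k
    have p4 : 0 ≤ ∑ i ∈ Finset.range k, |w i| := Finset.sum_nonneg fun _ _ => abs_nonneg _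
    have p5 : |∑ i ∈ Finset.range (k + 1), w i| ≤ ∑ i ∈ Finset.range (k + 1), |w i| :=
      Finset.abs_sum_le_sum_abs _ _
    have hab : w k - (if w k < 0 then 2 * w k else 0) = |w k| := by
      split_ifs with h
      · rw [abs_of_neg h]; ring
      · rw [abs_of_nonneg (not_lt.1 h)]; ring
    have pk := abs_nonneg (w k)
    have hkn : (k : ℤ) + 1 ≤ n := by exact_mod_cast hk
    have F : ∀ v : ℤ, |v| ≤ 2 * (∑ i ∈ Finset.range n, |w i|) + n + 2 → Fits b v := fun v hv =>
      lt_of_le_of_lt hv hfit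
    have k0 : (0 : ℤ) ≤ k := by positivity
    refine ⟨by rw [t50, hs.reg 0 (by simp), h0]; exact_mod_cast hk, ?_⟩
    refine Runs.mono (runs_assign hb (vs := [w k, ∑ i ∈ Finset.range (k + 1), |w i|,
      ∑ i ∈ Finset.range (k + 1), w i, (k + 1 : ℕ)]) ?_) (Nat.le_of_ble_eq_true rfl) fun _ h => h
    simp [AssignOk, Stm.fitsIfVar, t50, t4, t5, hs.arr 0, hw, hab, e4, e5, k0]
    rw [← e4, ← e5]
    have a2 : |2 * w k| = 2 * |w k| := by rw [abs_mul, abs_two]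
    refine ⟨F _ ?_, ⟨⟨⟨⟨F _ ?_, F _ ?_⟩, fits_zero b, F _ ?_⟩, F _ ?_⟩, F _ ?_⟩, F _ ?_,
      ⟨fits_one hb, F _ ?_⟩, ?_, hc⟩
    · linarith
    · rw [abs_two]; linarith
    · rw [a2]; linarith
    · split_ifs
      · rw [a2]; linarith
      · rw [abs_zero]; linarith
    · rw [abs_abs]; linarith
    · rw [abs_of_nonneg (by linarith)]; linarith
    · linarith
    · rw [abs_of_nonneg (by linarith)]; linarith
    · exact (((hs.setReg (by simp) _).setReg (by simp) _).setReg (by simp) _).setReg (by simp) _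
  · rintro τ ⟨⟨hs, -⟩, t50⟩
    rw [t50, hs.reg 0 (by simp), h0]; simp
  · exact ⟨⟨Same.refl _ _ _, rfl, by simp [h4], by simp [h5]⟩, by simp [h50]⟩

/-- The hypotheses on `d` say that it is the least exponent with `Y ≤ 2 ^ d`, so repeated doubling
stops exactly there. -/
theorem runs_powLoop {b : ℕ} (hb : 1 ≤ b) {d : ℕ} {Y : ℤ} {σ : State} (h52 : σ.reg 52 = Y)
    (h6 : σ.reg 6 = 1) (hY : Y ≤ 2 ^ d) (hY' : ∀ k < d, 2 ^ k < Y) (hd : d < b) :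
    Runs b powLoop σ (d * 10 + 2) fun σ' =>
        σ' = σ.setReg 6 (2 ^ d) := by
  refine Runs.mono (Runs.whileLt hb (fun k σ' => σ' = σ.setReg 6 (2 ^ k)) d 8 ?_ ?_ ?_) le_rfl
    fun _ h => h
  · rintro k hk _ rfl
    refine ⟨by simp [h52, hY' k hk], Runs.mono (runs_assign hb (vs := [2 ^ (k + 1)]) ?_)
      (Nat.le_of_ble_eq_true rfl) fun _ h => h⟩
    simp [AssignOk, Stm.fitsIfVar]
    refine ⟨⟨?_, by ring⟩, ?_⟩
    · rw [← two_mul, ← pow_succ', Fits, abs_of_pos (by positivity)]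
      exact pow_lt_pow_right₀ (by norm_num) (by omega)
    · ext x
      · simp only [State.reg_setReg]; split_ifs <;> rfl
      · rfl
      · rfl
  · rintro _ rfl
    simp [h52, hY]
  · ext x
    · simp only [State.reg_setReg, pow_zero]; split_ifs with h
      · rw [h, h6]
      · rfl
    · rfl
    · rfl

/-- Register `50` holds the place value `2 ^ k` of the next coin. The invariant follows the coin
sequence as well, since every toss removes its first member. -/
theorem runs_coinLoop {b : ℕ} (hb : 1 ≤ b) {p : ℕ} {ω : ℕ → Bool} {σ : State} (h50 : σ.reg 50 = 1)
    (h51 : σ.reg 51 = 0) (h52 : σ.reg 52 = 2 ^ p) (hω : σ.coins = ω) (hp : p + 1 < b) :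
    Runs b coinLoop σ (p * 20 + 2) fun σ' =>
        Same {50, 51, 53} ∅ σ σ' ∧ σ'.reg 51 = coinNum p ω := by
  refine Runs.mono (Runs.whileLt hb (fun k σ' => (Same {50, 51, 53} ∅ σ σ' ∧
    σ'.reg 51 = coinNum k ω) ∧ σ'.reg 50 = 2 ^ k ∧ σ'.coins = fun i => ω (i + k)) p 18 ?_ ?_ ?_) le_rfl
    fun _ h => h.1
  · rintro k hk τ ⟨⟨hs, t51⟩, t50, tc⟩
    refine ⟨?_, ?_⟩
    · rw [t50, hs.reg 52 (by simp), h52]; exact pow_lt_pow_right₀ (by norm_num) hk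
    have hcoin : τ.coin = if ω k then 1 else 0 := by simp [State.coin, tc]
    have P : (2 : ℤ) ^ (k + 1) < 2 ^ b := pow_lt_pow_right₀ (by norm_num) (by omega)
    have P0 : (0 : ℤ) < 2 ^ k := by positivity
    have hc := coinNum_lt (k + 1) ω
    have hc' : (coinNum (k + 1) ω : ℤ) < 2 ^ (k + 1) := by exact_mod_cast hc
    have e : (coinNum k ω : ℤ) + (if ω k then 1 else 0) * 2 ^ k = coinNum (k + 1) ω := by
      rw [coinNum_succ]; push_cast; split_ifs <;> simp
    refine Runs.mono ((Runs.flip hb (Q := fun σ' => σ' = τ.dropCoin.setReg 53 τ.coin) rfl).seq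
      (T' := 17) ?_) (by omega) fun _ h => h
    rintro _ rfl
    refine Runs.mono (runs_assign hb (vs := [(coinNum (k + 1) ω : ℕ), 2 ^ (k + 1)]) ?_)
      (Nat.le_of_ble_eq_true rfl) fun _ h => h
    have d50 : τ.dropCoin.reg 50 = 2 ^ k := t50
    have d51 : τ.dropCoin.reg 51 = coinNum k ω := t51
    simp only [AssignOk, Stm.fitsIfVar, Expr.ok_add, Expr.ok_mul, Expr.ok_var, Expr.eval_add,
      Expr.eval_mul, Expr.eval_var, State.reg_setReg, d50, d51, hcoin]
    have F : Fits b (2 ^ (k + 1)) := by rw [Fits, abs_of_pos (by positivity)]; exact P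
    have F1 : Fits b (coinNum (k + 1) ω) := by rw [Fits, abs_of_nonneg (by positivity)]; linarith
    have F2 : Fits b ((if ω k then 1 else 0) * 2 ^ k) := by
      split_ifs
      · rw [one_mul, Fits, abs_of_pos P0]; rw [pow_succ] at P; linarith
      · rw [zero_mul]; exact fits_zero b
    simp only [reduceIte, Nat.reduceEqDiff, true_and, and_true, e, F1, F2]
    refine ⟨⟨?_, ?_⟩, ?_⟩
    · rw [← two_mul, ← pow_succ']; exact F
    · ring
    refine ⟨?_, ?_⟩
    · refine (((hs.trans ?_).setReg (by simp) _).setReg (by simp) _).setReg (by simp) _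
      exact ⟨fun _ _ => rfl, fun _ _ => rfl⟩
    · funext i
      show τ.coins (i + 1) = _
      rw [tc]
      show ω (i + 1 + k) = _
      congr 1; ring
  · rintro τ ⟨⟨hs, -⟩, t50, -⟩
    rw [t50, hs.reg 52 (by simp), h52]; simp
  · exact ⟨⟨Same.refl _ _ _, by simp [h51, coinNum]⟩, by simp [h50], by simp [hω]⟩


/-- `v` has at most `e` bits. -/
def Bits (e : ℕ) (v : ℤ) : Prop := |v| ≤ 2 ^ e

namespace Bits

variable {e f b : ℕ} {u v : ℤ}

theorem fits (h : Bits e v) (he : e < b) : Fits b v :=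
  lt_of_le_of_lt h (pow_lt_pow_right₀ (by norm_num) he)

theorem mono (h : Bits e v) (he : e ≤ f) : Bits f v :=
  le_trans h (pow_le_pow_right₀ (by norm_num) he)

theorem mul (h : Bits e u) (h' : Bits f v) : Bits (e + f) (u * v) := by
  rw [Bits, abs_mul, pow_add]
  exact mul_le_mul h h' (abs_nonneg _) (by positivity)

theorem add (h : Bits e u) (h' : Bits e v) : Bits (e + 1) (u + v) := by
  unfold Bits at *
  have := abs_add_le u v
  rw [pow_succ]; linarith

theorem sub (h : Bits e u) (h' : Bits e v) : Bits (e + 1) (u - v) := by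
  unfold Bits at *
  have := abs_sub u v
  rw [pow_succ]; linarith

theorem two_pow (e : ℕ) : Bits e (2 ^ e) := by
  rw [Bits, abs_of_pos (by positivity)]

theorem one (e : ℕ) : Bits e 1 := by
  rw [Bits, abs_one]; exact one_le_pow₀ (by norm_num)

theorem of_nonneg (h : 0 ≤ v) (h' : v ≤ 2 ^ e) : Bits e v := by
  rwa [Bits, abs_of_nonneg h]

theorem natCast {k : ℕ} (h : k ≤ 2 ^ e) : Bits e (k : ℤ) :=
  of_nonneg (by positivity) (by exact_mod_cast h)

theorem emod {m : ℕ} (u : ℤ) : Bits m (u % 2 ^ m) :=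
  of_nonneg (Int.emod_nonneg _ (by positivity)) (Int.emod_lt_of_pos _ (by positivity)).le

end Bits

/-- The parameters of the algorithm: the number of blocks, the numbers that govern the sizes of the
modulus, the lists, the graph and the caps, and the number of families of roles. -/
structure Params where
  K : ℕ
  l : ℕ
  c₁ : ℕ
  c₀ : ℕ
  cc : ℕ
  J : ℕ

/-- The parameters are meaningful. -/
structure Params.Valid (P : Params) : Prop where
  K_pos : 0 < P.K
  l_le : P.l ≤ P.K
  c₁_le : P.c₁ ≤ P.K
  c₀_le : P.c₀ ≤ P.K
  cc_le : P.cc ≤ P.K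

/-- The size of a block. -/
def Params.B (P : Params) (n₀ : ℕ) : ℕ := n₀ / P.K + 1

/-- The data for `n₀` numbers. -/
def setupOf (P : Params) (n₀ : ℕ) (w : ℕ → ℤ) (t : ℤ) : Setup where
  K := P.K
  B := P.B n₀
  N₁ := (P.K * P.B n₀ + 1) * 2 ^ (P.c₁ * P.B n₀)
  w := w
  t := t
  V := 4 * (∑ i ∈ Finset.range (P.K * P.B n₀), |w i| + |t| + 1) * (P.K * P.B n₀ + 1) ^ 3 *
    2 ^ (P.K * P.B n₀)

namespace Setup

/-- The number of bits of the absolute values of all sums. -/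
def d (s : Setup) : ℕ := Nat.clog 2 (2 * s.W + 1).toNat

theorem two_W_lt (s : Setup) : 2 * s.W + 1 ≤ 2 ^ s.d := by
  have h := Nat.le_pow_clog (b := 2) (by norm_num) (2 * s.W + 1).toNat
  have h' : ((2 * s.W + 1).toNat : ℤ) ≤ 2 ^ s.d := by exact_mod_cast h
  rwa [Int.toNat_of_nonneg (by linarith [s.W_nonneg])] at h'

theorem two_pow_lt (s : Setup) {k : ℕ} (hk : k < s.d) : (2 : ℤ) ^ k < 2 * s.W + 1 := by
  have h : 2 ^ k < (2 * s.W + 1).toNat := (Nat.lt_clog_iff_pow_lt (by norm_num)).1 hk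
  have h' : ((2 ^ k : ℕ) : ℤ) < ((2 * s.W + 1).toNat : ℤ) := by exact_mod_cast h
  rw [Int.toNat_of_nonneg (by linarith [s.W_nonneg])] at h'
  exact_mod_cast h'

end Setup

/-- The number of bits of the modulus. -/
def Params.m (P : Params) (n₀ : ℕ) (w : ℕ → ℤ) (t : ℤ) : ℕ :=
  (setupOf P n₀ w t).d + P.l * P.B n₀

/-- The hash function given by the coins. -/
def Params.hash (P : Params) (n₀ : ℕ) (w : ℕ → ℤ) (t : ℤ) (x : ℕ × ℕ × ℕ × ℕ) : Hash :=
  hashOf (P.m n₀ w t) (setupOf P n₀ w t).d (P.cc * P.B n₀) t x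

/-- The bound on the number of vertices. -/
def Params.N₀ (P : Params) (n₀ : ℕ) : ℕ := 80 * P.J * 2 ^ (P.c₀ * P.B n₀)

theorem Params.Valid.mul_le {P : Params} {c : ℕ} (h : c ≤ P.K) (n₀ : ℕ) :
    c * P.B n₀ ≤ P.K * P.B n₀ := Nat.mul_le_mul_right _ h

theorem Params.le_n (P : Params) (n₀ : ℕ) : P.K ≤ P.K * P.B n₀ := by
  unfold Params.B; nlinarith [Nat.zero_le (P.K * (n₀ / P.K))]

/-- Since `B` exceeds the quotient of `n₀` by `K`, the blocks cover all numbers. The surplus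
positions read zeros of the input array and thus are items of weight zero, which change no sum. -/
theorem Params.lt_n {P : Params} (hK : 0 < P.K) (n₀ : ℕ) : n₀ < P.K * P.B n₀ := by
  have := Nat.lt_mul_div_succ n₀ hK
  exact this

namespace Params

/-- Computes the size of a block and the number of items. -/
def initSizes (P : Params) : List (ℕ × Expr) :=
  [(2, .var 0 / .num P.K + .num 1), (3, .var 2 * .num P.K), (13, .var 3 + .num 1)]

theorem runs_initSizes (P : Params) (hK : 0 < P.K) {n₀ b : ℕ} {σ : State} (h0 : σ.reg 0 = n₀)
    (hb : P.K * P.B n₀ + 2 ≤ b) : Runs b (assign P.initSizes) σ 40 fun σ' =>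
      Same {2, 3, 13} ∅ σ σ' ∧ σ'.coins = σ.coins ∧ σ'.reg 2 = P.B n₀ ∧
        σ'.reg 3 = (P.K * P.B n₀ : ℕ) ∧ σ'.reg 13 = (P.K * P.B n₀ : ℕ) + 1 := by
  have hn : P.K * P.B n₀ < 2 ^ (P.K * P.B n₀) := Nat.lt_two_pow_self
  have hB : P.B n₀ ≤ P.K * P.B n₀ := Nat.le_mul_of_pos_left _ hK
  have e2 : (n₀ : ℤ) / P.K + 1 = P.B n₀ := by simp [B]
  have e3 : (P.B n₀ : ℤ) * P.K = (P.K * P.B n₀ : ℕ) := by push_cast; ring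
  have hb1 : 1 ≤ b := by omega
  have F1 : Fits b ((n₀ : ℤ) / P.K) := by
    have : (n₀ : ℤ) / P.K = (n₀ / P.K : ℕ) := by simp
    rw [this]
    exact (Bits.natCast (e := P.K * P.B n₀) (by unfold B at *; omega)).fits (by omega)
  have F2 : Fits b (P.B n₀ : ℤ) := (Bits.natCast (hB.trans hn.le)).fits (by omega)
  have F3 : Fits b (P.K : ℤ) := (Bits.natCast ((P.le_n n₀).trans hn.le)).fits (by omega)
  have F4 : Fits b ((P.K * P.B n₀ : ℕ) : ℤ) := (Bits.natCast hn.le).fits (by omega)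
  have F5 : Fits b (((P.K * P.B n₀ : ℕ) : ℤ) + 1) := by
    have := (Bits.natCast hn : Bits (P.K * P.B n₀) ((P.K * P.B n₀ + 1 : ℕ) : ℤ))
    push_cast at this ⊢
    exact this.fits (by omega)
  refine Runs.mono (runs_assign hb1 (vs := [P.B n₀, (P.K * P.B n₀ : ℕ), (P.K * P.B n₀ : ℕ) + 1]) ?_)
    (Nat.le_of_ble_eq_true rfl) fun _ h => h
  simp only [initSizes, AssignOk, Stm.fitsIfVar, Expr.ok_add, Expr.ok_mul, Expr.ok_div, Expr.ok_var,
    Expr.ok_num, Expr.eval_add, Expr.eval_mul, Expr.eval_div, Expr.eval_var, Expr.eval_num,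
    State.reg_setReg, h0, e2, e3, F1, F2, F3, F4, F5, fits_one hb1, reduceIte, Nat.reduceEqDiff,
    true_and, and_true]
  exact ⟨(((Same.refl _ _ _).setReg (by simp) _).setReg (by simp) _).setReg (by simp) _, rfl⟩

/-- Adds the absolute value of the target to the bound. -/
def initBound : List (ℕ × Expr) :=
  [(4, .var 4 + (.var 1 - .num 2 * .var 1 * .bin .lt (.var 1) (.num 0))), (6, .num 1),
    (52, .num 2 * .var 4 + .num 1)]

theorem runs_initBound {d b : ℕ} {σ : State} {X t : ℤ} (h4 : σ.reg 4 = X) (h1 : σ.reg 1 = t)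
    (hX : 0 ≤ X) (hd : 2 * (X + |t|) + 1 ≤ 2 ^ d) (hb : d + 2 ≤ b) :
    Runs b (assign initBound) σ 40 fun σ' =>
      Same {4, 6, 52} ∅ σ σ' ∧ σ'.coins = σ.coins ∧ σ'.reg 4 = X + |t| ∧
        σ'.reg 6 = 1 ∧ σ'.reg 52 = 2 * (X + |t|) + 1 := by
  have hb1 : 1 ≤ b := by omega
  have pt := abs_nonneg t
  have F : ∀ v : ℤ, |v| ≤ 2 * (X + |t|) + 1 → Fits b v := fun v hv =>
    Bits.fits (e := d) (hv.trans hd) (by omega)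
  have e1 : t - 2 * t * (if t < 0 then 1 else 0) = |t| := by
    split_ifs with h
    · rw [abs_of_neg h]; ring
    · rw [abs_of_nonneg (not_lt.1 h)]; ring
  have F1 : Fits b (2 * t) := F _ (by rw [abs_mul, abs_two]; linarith)
  have F2 : Fits b (2 * t * (if t < 0 then 1 else 0)) := by
    split_ifs
    · rwa [mul_one]
    · rw [mul_zero]; exact fits_zero b
  have F3 : Fits b |t| := F _ (by rw [abs_abs]; linarith)
  have F4 : Fits b (X + |t|) := F _ (by rw [abs_of_nonneg (by linarith)]; linarith)
  have F5 : Fits b (2 * (X + |t|)) := F _ (by rw [abs_of_nonneg (by linarith)]; linarith)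
  have F6 : Fits b (2 * (X + |t|) + 1) := F _ (by rw [abs_of_nonneg (by linarith)])
  have F7 : Fits b 2 := (Bits.two_pow 1).fits (by omega)
  refine Runs.mono (runs_assign hb1 (vs := [X + |t|, 1, 2 * (X + |t|) + 1]) ?_)
    (Nat.le_of_ble_eq_true rfl) fun _ h => h
  simp only [initBound, AssignOk, Stm.fitsIfVar, Expr.ok_add, Expr.ok_mul, Expr.ok_sub, Expr.ok_var,
    Expr.ok_num, Expr.eval_add, Expr.eval_mul, Expr.eval_sub, Expr.eval_var, Expr.eval_num,
    Expr.ok_lt, Expr.eval_lt, fits_zero b, State.reg_setReg, h4, h1, e1, F1, F2, F3, F4, F5, F6, F7,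
    fits_one hb1, reduceIte, Nat.reduceEqDiff, true_and, and_true]
  exact ⟨(((Same.refl _ _ _).setReg (by simp) _).setReg (by simp) _).setReg (by simp) _, rfl⟩

/-- Computes the numbers that depend only on the sizes. -/
def initConsts (P : Params) : List (ℕ × Expr) :=
  [(7, .bin .shl (.var 6) (.num P.l * .var 2)), (14, .bin .shl (.num 1) (.var 3)),
    (15, .num 4 * (.var 4 + .num 1) * (.var 13 * .var 13 * .var 13) * .var 14),
    (16, .var 13 * .bin .shl (.num 1) (.num P.c₁ * .var 2)), (19, .num P.cc * .var 2 + .num 1),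
    (20, .num (80 * P.J : ℕ) * .bin .shl (.num 1) (.num P.c₀ * .var 2) + .num 1),
    (21, .var 13 * .var 13), (22, .var 21 * .var 14), (52, .var 7 * .var 7 * (.var 7 * .var 7)),
    (50, .num 1), (51, .num 0)]

theorem runs_initConsts {P : Params} (hP : P.Valid) {B d b : ℕ} {W : ℤ} {σ : State} (hB : 0 < B)
    (h2 : σ.reg 2 = B) (h3 : σ.reg 3 = (P.K * B : ℕ)) (h4 : σ.reg 4 = W) (h6 : σ.reg 6 = 2 ^ d)
    (h13 : σ.reg 13 = (P.K * B : ℕ) + 1) (hW : 0 ≤ W) (hd : 2 * W + 1 ≤ 2 ^ d)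
    (hb : 4 * d + 5 * (P.K * B) + 2 * P.J + 20 ≤ b) :
    Runs b (assign P.initConsts) σ 120 fun σ' =>
      Same {7, 14, 15, 16, 19, 20, 21, 22, 50, 51, 52} ∅ σ σ' ∧ σ'.coins = σ.coins ∧
        σ'.reg 7 = 2 ^ (d + P.l * B) ∧ σ'.reg 14 = 2 ^ (P.K * B) ∧
        σ'.reg 15 = 4 * (W + 1) * (((P.K * B : ℕ) : ℤ) + 1) ^ 3 * 2 ^ (P.K * B) ∧
        σ'.reg 16 = (((P.K * B : ℕ) : ℤ) + 1) * 2 ^ (P.c₁ * B) ∧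
        σ'.reg 19 = ((P.cc * B : ℕ) : ℤ) + 1 ∧
        σ'.reg 20 = ((80 * P.J * 2 ^ (P.c₀ * B) : ℕ) : ℤ) + 1 ∧
        σ'.reg 21 = (((P.K * B : ℕ) : ℤ) + 1) ^ 2 ∧
        σ'.reg 22 = (((P.K * B : ℕ) : ℤ) + 1) ^ 2 * 2 ^ (P.K * B) ∧ σ'.reg 50 = 1 ∧ σ'.reg 51 = 0 ∧
        σ'.reg 52 = 2 ^ (4 * (d + P.l * B)) := by
  have hb1 : 1 ≤ b := by omega
  obtain ⟨n, hn⟩ : ∃ n, P.K * B = n := ⟨_, rfl⟩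
  have hKn : P.K ≤ n := hn ▸ Nat.le_mul_of_pos_right _ hB
  have hl : P.l * B ≤ n := hn ▸ Nat.mul_le_mul_right _ hP.l_le
  have hc₁ : P.c₁ * B ≤ n := hn ▸ Nat.mul_le_mul_right _ hP.c₁_le
  have hc₀ : P.c₀ * B ≤ n := hn ▸ Nat.mul_le_mul_right _ hP.c₀_le
  have hcc : P.cc * B ≤ n := hn ▸ Nat.mul_le_mul_right _ hP.cc_le
  rw [hn] at h3 h13 hb ⊢
  have hn2 : n + 1 ≤ 2 ^ n := Nat.lt_two_pow_self
  have N : ∀ k : ℕ, k ≤ n → Fits b (k : ℤ) := fun k hk =>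
    (Bits.natCast (hk.trans (by omega : n ≤ 2 ^ n))).fits (by omega)
  have Z1 : Bits n ((n : ℤ) + 1) := by exact_mod_cast Bits.natCast hn2
  have Z2 := Z1.mul Z1
  have Z3 := Z2.mul Z1
  have el : (P.l : ℤ) * B = ((P.l * B : ℕ) : ℤ) := by push_cast; ring
  have ec₁ : (P.c₁ : ℤ) * B = ((P.c₁ * B : ℕ) : ℤ) := by push_cast; ring
  have ec₀ : (P.c₀ : ℤ) * B = ((P.c₀ * B : ℕ) : ℤ) := by push_cast; ring
  have ecc : (P.cc : ℤ) * B = ((P.cc * B : ℕ) : ℤ) := by push_cast; ring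
  have em : (2 : ℤ) ^ d * 2 ^ (P.l * B) = 2 ^ (d + P.l * B) := (pow_add _ _ _).symm
  have em2 : (2 : ℤ) ^ (d + P.l * B) * 2 ^ (d + P.l * B) = 2 ^ (2 * (d + P.l * B)) := by
    rw [← pow_add]; congr 1; ring
  have em4 : (2 : ℤ) ^ (2 * (d + P.l * B)) * 2 ^ (2 * (d + P.l * B)) = 2 ^ (4 * (d + P.l * B)) := by
    rw [← pow_add]; congr 1; ring
  have eV : 4 * (W + 1) * (((n : ℤ) + 1) * (n + 1) * (n + 1)) * 2 ^ n =
      4 * (W + 1) * ((n : ℤ) + 1) ^ 3 * 2 ^ n := by ring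
  have eZ : ((n : ℤ) + 1) * (n + 1) = (n + 1) ^ 2 := by ring
  have eN : ((80 * P.J : ℕ) : ℤ) * 2 ^ (P.c₀ * B) = (80 * P.J * 2 ^ (P.c₀ * B) : ℕ) := by push_cast; ring
  have Wb : Bits d (W + 1) := Bits.of_nonneg (by linarith) (by linarith)
  have J1 : 80 * P.J ≤ 2 ^ (7 + P.J) := by
    rw [pow_add]; exact Nat.mul_le_mul (by norm_num) Nat.lt_two_pow_self.le
  have J2 : Bits (7 + P.J + n) ((80 * P.J * 2 ^ (P.c₀ * B) : ℕ) : ℤ) := by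
    refine Bits.natCast ?_
    rw [pow_add _ _ n]
    exact Nat.mul_le_mul J1 (Nat.pow_le_pow_right (by norm_num) hc₀)
  have F1 : Fits b (P.l : ℤ) := N _ (hP.l_le.trans hKn)
  have F2 : Fits b (P.c₁ : ℤ) := N _ (hP.c₁_le.trans hKn)
  have F3 : Fits b (P.c₀ : ℤ) := N _ (hP.c₀_le.trans hKn)
  have F4 : Fits b (P.cc : ℤ) := N _ (hP.cc_le.trans hKn)
  have F5 := N _ hl
  have F6 := N _ hc₁
  have F7 := N _ hc₀
  have F8 := N _ hcc
  have F9 : Fits b ((2 : ℤ) ^ (d + P.l * B)) := (Bits.two_pow _).fits (by omega)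
  have F10 : Fits b ((2 : ℤ) ^ (2 * (d + P.l * B))) := (Bits.two_pow _).fits (by omega)
  have F11 : Fits b ((2 : ℤ) ^ (4 * (d + P.l * B))) := (Bits.two_pow _).fits (by omega)
  have F12 : Fits b ((2 : ℤ) ^ n) := (Bits.two_pow _).fits (by omega)
  have F13 : Fits b ((2 : ℤ) ^ (P.c₁ * B)) := (Bits.two_pow _).fits (by omega)
  have F14 : Fits b ((2 : ℤ) ^ (P.c₀ * B)) := (Bits.two_pow _).fits (by omega)
  have F15 : Fits b 4 := (Bits.two_pow 2).fits (by omega)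
  have F16 : Fits b (W + 1) := Wb.fits (by omega)
  have B4 : Bits (2 + d) (4 * (W + 1)) := (Bits.two_pow 2).mul Wb
  have F17 := B4.fits (b := b) (by omega)
  have F18 : Fits b (((n : ℤ) + 1) ^ 2) := eZ ▸ Z2.fits (by omega)
  have F19 : Fits b (((n : ℤ) + 1) ^ 2 * (n + 1)) := eZ ▸ Z3.fits (by omega)
  have F20 : Fits b (4 * (W + 1) * (((n : ℤ) + 1) ^ 2 * (n + 1))) :=
    eZ ▸ (B4.mul Z3).fits (by omega)
  have F21 : Fits b (4 * (W + 1) * ((n : ℤ) + 1) ^ 3 * 2 ^ n) :=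
    eV ▸ ((B4.mul Z3).mul (Bits.two_pow n)).fits (by omega)
  have F22 : Fits b (((n : ℤ) + 1) * 2 ^ (P.c₁ * B)) := (Z1.mul (Bits.two_pow _)).fits (by omega)
  have F23 : Fits b (((P.cc * B : ℕ) : ℤ) + 1) := by
    refine (((Bits.natCast (hcc.trans (by omega : n ≤ 2 ^ n)))).add (Bits.one n)).fits (by omega)
  have F24 : Fits b ((80 * P.J : ℕ) : ℤ) := (Bits.natCast J1).fits (by omega)
  have F25 := J2.fits (b := b) (by omega)
  have F26 := (J2.add (Bits.one _)).fits (b := b) (by omega)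
  have F27 : Fits b (((n : ℤ) + 1) ^ 2 * 2 ^ n) := eZ ▸ (Z2.mul (Bits.two_pow n)).fits (by omega)
  rw [eZ] at eV
  refine Runs.mono (runs_assign hb1 (vs := [2 ^ (d + P.l * B), 2 ^ n,
    4 * (W + 1) * ((n : ℤ) + 1) ^ 3 * 2 ^ n, ((n : ℤ) + 1) * 2 ^ (P.c₁ * B),
    ((P.cc * B : ℕ) : ℤ) + 1, ((80 * P.J * 2 ^ (P.c₀ * B) : ℕ) : ℤ) + 1, ((n : ℤ) + 1) ^ 2,
    ((n : ℤ) + 1) ^ 2 * 2 ^ n, 2 ^ (4 * (d + P.l * B)), 1, 0]) ?_)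
    (Nat.le_of_ble_eq_true rfl) fun _ h => h
  simp only [initConsts, AssignOk, Stm.fitsIfVar, Expr.ok_add, Expr.ok_mul, Expr.ok_var,
    Expr.ok_num, Expr.eval_add, Expr.eval_mul, Expr.eval_var, Expr.eval_num, Expr.ok_shl,
    Expr.eval_shl, State.reg_setReg, h2, h3, h4, h6, h13, el, ec₁, ec₀, ecc, Int.toNat_natCast, em,
    em2, em4, eV, eZ, eN, one_mul, F1, F2, F3, F4, F5, F6, F7, F8, F9, F10, F11, F12, F13, F14, F15,
    F16, F17, F18, F19, F20, F21, F22, F23, F24, F25, F26, F27, fits_one hb1, fits_zero b,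
    reduceIte, Nat.reduceEqDiff, true_and, and_true]
  refine ⟨?_, rfl⟩
  iterate 11 refine Same.setReg ?_ (by simp) _
  exact Same.refl _ _ _

/-- Computes the hash function from the coins. -/
def initHash : List (ℕ × Expr) :=
  [(8, .var 51 % .var 7), (51, .var 51 / .var 7), (9, .var 51 % .var 7), (51, .var 51 / .var 7),
    (53, .var 51 % .var 7), (54, .var 51 / .var 7 % .var 7),
    (10, (.var 53 - .var 9 + .var 6) % .var 7), (11, (.var 54 - .var 53 + .var 6) % .var 7),
    (12, (.var 6 - .var 8 * .var 1 - .var 54) % .var 7)]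

/-- The digits of `r` to the base `2 ^ m` are split off one after another, and the offsets are
formed from them as in `hashOf`. -/
theorem runs_initHash {m d b r cap : ℕ} {t : ℤ} {σ : State} (h1 : σ.reg 1 = t)
    (h6 : σ.reg 6 = 2 ^ d) (h7 : σ.reg 7 = 2 ^ m) (h51 : σ.reg 51 = r) (hr : r < 2 ^ (4 * m))
    (ht : Bits d t) (hdm : d ≤ m) (hb : 4 * m + d + 4 ≤ b) :
    Runs b (assign initHash) σ 120 fun σ' =>
      Same {8, 9, 10, 11, 12, 51, 53, 54} ∅ σ σ' ∧
        σ'.reg 8 = (hashOf m d cap t (untuple m r)).a ∧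
        ∀ v < 4, σ'.reg (9 + v) = (hashOf m d cap t (untuple m r)).off v := by
  have hb1 : 1 ≤ b := by omega
  obtain ⟨⟨a, c₁, c₂, c₃⟩, hx⟩ : ∃ x, untuple m r = x := ⟨_, rfl⟩
  have M0 : 0 < 2 ^ m := by positivity
  have ea : ((r : ℤ) % 2 ^ m) = a := by
    have := congrArg Prod.fst hx; simp only [untuple] at this; rw [← this]; push_cast; rfl
  have e1 : ((r / 2 ^ m : ℕ) : ℤ) % 2 ^ m = c₁ := by
    have := congrArg (·.2.1) hx; simp only [untuple] at this; rw [← this]; push_cast; rfl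
  have e2 : ((r / 2 ^ m / 2 ^ m : ℕ) : ℤ) % 2 ^ m = c₂ := by
    have := congrArg (·.2.2.1) hx; simp only [untuple] at this; rw [← this]; push_cast; rfl
  have e3 : ((r / 2 ^ m / 2 ^ m / 2 ^ m : ℕ) : ℤ) % 2 ^ m = c₃ := by
    have := congrArg (·.2.2.2) hx; simp only [untuple] at this; rw [← this]; push_cast; rfl
  have q : ∀ k : ℕ, (k : ℤ) / 2 ^ m = (k / 2 ^ m : ℕ) := fun k => by push_cast; rfl
  have Rb : ∀ k ≤ r, Fits b (k : ℤ) := fun k hk =>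
    (Bits.natCast (hk.trans hr.le)).fits (by omega)
  have G1 : Fits b ((r / 2 ^ m : ℕ) : ℤ) := Rb _ (Nat.div_le_self _ _)
  have G2 : Fits b ((r / 2 ^ m / 2 ^ m : ℕ) : ℤ) :=
    Rb _ ((Nat.div_le_self _ _).trans (Nat.div_le_self _ _))
  have G3 : Fits b ((r / 2 ^ m / 2 ^ m / 2 ^ m : ℕ) : ℤ) :=
    Rb _ ((Nat.div_le_self _ _).trans ((Nat.div_le_self _ _).trans (Nat.div_le_self _ _)))
  have A : Bits m (a : ℤ) := ea ▸ Bits.emod _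
  have C1 : Bits m (c₁ : ℤ) := e1 ▸ Bits.emod _
  have C2 : Bits m (c₂ : ℤ) := e2 ▸ Bits.emod _
  have C3 : Bits m (c₃ : ℤ) := e3 ▸ Bits.emod _
  have D : Bits m ((2 : ℤ) ^ d) := (Bits.two_pow d).mono hdm
  have E : ∀ u : ℤ, Fits b (u % 2 ^ m) := fun u => (Bits.emod u).fits (by omega)
  have A' := A.fits (b := b) (by omega)
  have C1' := C1.fits (b := b) (by omega)
  have C2' := C2.fits (b := b) (by omega)
  have C3' := C3.fits (b := b) (by omega)
  have S1 := (C2.sub C1).fits (b := b) (by omega)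
  have S2 := ((C2.sub C1).add (D.mono (Nat.le_succ m))).fits (b := b) (by omega)
  have S3 := (C3.sub C2).fits (b := b) (by omega)
  have S4 := ((C3.sub C2).add (D.mono (Nat.le_succ m))).fits (b := b) (by omega)
  have T1 := A.mul ht
  have T1' := T1.fits (b := b) (by omega)
  have T2 := (D.mono (Nat.le_add_right m d)).sub T1
  have T2' := T2.fits (b := b) (by omega)
  have T3 := (T2.sub (C3.mono (by omega))).fits (b := b) (by omega)
  rw [hx]
  refine Runs.mono (runs_assign hb1 (vs := [(a : ℤ), (r / 2 ^ m : ℕ), c₁, (r / 2 ^ m / 2 ^ m : ℕ), c₂,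
    c₃, (c₂ - c₁ + 2 ^ d) % 2 ^ m, (c₃ - c₂ + 2 ^ d) % 2 ^ m, (2 ^ d - a * t - c₃) % 2 ^ m]) ?_)
    (Nat.le_of_ble_eq_true rfl) fun _ h => h
  simp only [initHash, AssignOk, Stm.fitsIfVar, Expr.ok_add, Expr.ok_mul, Expr.ok_sub, Expr.ok_div,
    Expr.ok_mod, Expr.ok_var, Expr.eval_add, Expr.eval_mul, Expr.eval_sub, Expr.eval_div,
    Expr.eval_mod, Expr.eval_var, State.reg_setReg, h1, h6, h7, h51, ea, e1, e2, e3, q, G1, G2, G3,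
    A', C1', C2', C3', S1, S2, S3, S4, T1', T2', T3, E, reduceIte, Nat.reduceEqDiff, true_and,
    and_true]
  refine ⟨trivial, trivial, ?_, rfl, ?_⟩
  · iterate 9 refine Same.setReg ?_ (by simp) _
    exact Same.refl _ _ _
  · intro v hv
    interval_cases v <;> simp [hashOf]

/-- The preparations. -/
def init (P : Params) : Prog :=
  .seq (assign P.initSizes) (.seq sumLoop (.seq (assign initBound) (.seq powLoop
    (.seq (assign P.initConsts) (.seq coinLoop (assign initHash))))))

/-- The preparations are done, and the hash function is given by `x`. -/
structure Ready (P : Params) (n₀ : ℕ) (w : ℕ → ℤ) (t : ℤ) (x : ℕ × ℕ × ℕ × ℕ) (σ : State) : Prop where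
  setup : (setupOf P n₀ w t).In σ
  hash : (P.hash n₀ w t x).In (setupOf P n₀ w t).n σ
  acc : σ.reg 17 = 0
  num : σ.reg 18 = 0
  bound : σ.reg 20 = P.N₀ n₀ + 1
  reg : ∀ x ≥ 100, σ.reg x = 0
  arr : ∀ a ≠ 0, ∀ i, σ.arr a i = 0

theorem bits_t (s : Setup) : Bits s.d s.t := by
  have h : 0 ≤ ∑ i ∈ Finset.range s.n, |s.w i| := Finset.sum_nonneg fun _ _ => abs_nonneg _
  have h' := s.two_W_lt
  have h2 := abs_nonneg s.t
  have h3 : s.W = ∑ i ∈ Finset.range s.n, |s.w i| + |s.t| := rfl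
  rw [Bits]; linarith

theorem runs_init {P : Params} (hP : P.Valid) {n₀ b : ℕ} {w : ℕ → ℤ} {t : ℤ} {σ : State}
    (hw : ∀ i ≥ n₀, w i = 0) (hreg : σ.reg = Function.update (Function.update (0 : ℕ → ℤ) 0 (n₀ : ℤ)) 1 t)
    (harr0 : σ.arr 0 = w) (harr : ∀ a ≠ 0, ∀ i, σ.arr a i = 0)
    (hb : 5 * (setupOf P n₀ w t).d + 5 * (P.K * P.B n₀) + 2 * P.J + 20 ≤ b) :
    Runs b P.init σ (42 * n₀ + 10 * (setupOf P n₀ w t).d + 80 * P.m n₀ w t + 330) fun σ' =>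
      P.Ready n₀ w t (untuple (P.m n₀ w t) (coinNum (4 * P.m n₀ w t) σ.coins)) σ' := by
  obtain ⟨s, hs⟩ : ∃ s, setupOf P n₀ w t = s := ⟨_, rfl⟩
  obtain ⟨B, hB⟩ : ∃ B, P.B n₀ = B := ⟨_, rfl⟩
  obtain ⟨m, hm⟩ : ∃ m, P.m n₀ w t = m := ⟨_, rfl⟩
  have hB0 : 0 < B := by rw [← hB]; exact Nat.succ_pos _
  have hm' : m = s.d + P.l * B := by rw [← hm, ← hB, ← hs]; rfl
  have hn0 := lt_n hP.K_pos n₀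
  have hsn : s.n = P.K * B := by rw [← hs, ← hB]; rfl
  have hst : s.t = t := by rw [← hs]; rfl
  have hsw : s.w = w := by rw [← hs]; rfl
  have sum_eq : ∀ f : ℤ → ℤ, f 0 = 0 →
      ∑ i ∈ Finset.range n₀, f (w i) = ∑ i ∈ Finset.range s.n, f (w i) := by
    intro f hf
    refine Finset.sum_subset (Finset.range_subset_range.2 (by rw [hsn, ← hB]; exact hn0.le)) ?_
    intro i _ hi
    rw [hw i (by simpa using hi), hf]
  have eabs := sum_eq (|·|) abs_zero
  have eid := sum_eq id rfl
  simp only [id] at eid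
  have hW : ∑ i ∈ Finset.range s.n, |w i| + |t| = s.W := by rw [Setup.W, hsw, hst]
  have htot : ∑ i ∈ Finset.range s.n, w i = s.total := by rw [Setup.total, hsw]
  have hl : P.l * B ≤ P.K * B := Nat.mul_le_mul_right _ hP.l_le
  have hd := s.two_W_lt
  have hsum0 : 0 ≤ ∑ i ∈ Finset.range s.n, |w i| := Finset.sum_nonneg fun _ _ => abs_nonneg _
  have ht0 := abs_nonneg t
  rw [hs, hB] at hb
  rw [hs, hm]
  have hb1 : 1 ≤ b := by omega
  have r0 : ∀ x ≥ 2, σ.reg x = 0 := fun x hx => by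
    rw [hreg, Function.update_of_ne (by omega), Function.update_of_ne (by omega)]; rfl
  have hfit : 2 * ∑ i ∈ Finset.range n₀, |w i| + n₀ + 2 < 2 ^ b := by
    have hn2 : P.K * B < 2 ^ (P.K * B) := Nat.lt_two_pow_self
    rw [← hB] at hn2
    have h1 : (n₀ : ℤ) ≤ 2 ^ (P.K * B) := by
      rw [← hB]; exact_mod_cast (hn0.trans hn2).le
    have h2 : (2 : ℤ) ^ s.d ≤ 2 ^ (b - 2) := pow_le_pow_right₀ (by norm_num) (by omega)
    have h3 : (2 : ℤ) ^ (P.K * B) ≤ 2 ^ (b - 2) := pow_le_pow_right₀ (by norm_num) (by omega)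
    have h4 : (2 : ℤ) ^ 1 ≤ 2 ^ (b - 2) := pow_le_pow_right₀ (by norm_num) (by omega)
    have h5 : (2 : ℤ) ^ b = 2 ^ (b - 2) * 4 := by
      rw [show (4 : ℤ) = 2 ^ 2 by norm_num, ← pow_add]; congr 1; omega
    rw [eabs, h5]
    norm_num at h4
    linarith
  refine Runs.mono ((runs_initSizes P hP.K_pos (n₀ := n₀) (σ := σ) (by rw [hreg]; rfl)
    (by rw [hB]; omega)).seq (T' := (n₀ * 42 + 2) + (40 + ((s.d * 10 + 2) + (120 + ((4 * m * 20 + 2) +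
      120))))) ?_) (by omega) fun _ h => h
  rintro σ₁ ⟨s₁, c₁, r2, r3, r13⟩
  rw [hB] at r2 r3 r13
  refine (runs_sumLoop hb1 (n := n₀) (w := w) (by rw [s₁.reg 0 (by simp), hreg]; rfl)
    (by rw [s₁.reg 4 (by simp), r0 4 (by simp)]) (by rw [s₁.reg 5 (by simp), r0 5 (by simp)])
    (by rw [s₁.reg 50 (by simp), r0 50 (by simp)]) (by rw [s₁.arr 0 (by simp), harr0]) hfit).seq ?_
  rintro σ₂ ⟨s₂, c₂, r4, r5⟩
  rw [eabs] at r4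
  rw [eid, htot] at r5
  have t1 : σ₂.reg 1 = t := by
    rw [s₂.reg 1 (by simp), s₁.reg 1 (by simp), hreg]; simp
  refine (runs_initBound (d := s.d) (b := b) r4 t1 hsum0 (by rw [hW]; exact hd) (by omega)).seq ?_
  rintro σ₃ ⟨s₃, c₃, r4, r6, r52⟩
  rw [hW] at r4 r52
  refine (runs_powLoop hb1 (d := s.d) r52 r6 hd (fun k hk => s.two_pow_lt hk) (by omega)).seq ?_
  rintro σ₄ rfl
  refine (runs_initConsts hP (B := B) (d := s.d) (b := b) (W := s.W) hB0
    (by simp [s₃.reg 2, s₂.reg 2, r2]) (by simp [s₃.reg 3, s₂.reg 3, r3]) (by simp [r4]) (by simp)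
    (by simp [s₃.reg 13, s₂.reg 13, r13]) (by rw [← hW]; linarith) hd (by omega)).seq ?_
  rintro σ₅ ⟨s₅, c₅, r7, r14, r15, r16, r19, r20, r21, r22, r50, r51, r52⟩
  rw [← hm'] at r7 r52
  refine (runs_coinLoop hb1 (p := 4 * m) (ω := σ.coins) r50 r51 r52
    (c₅.trans (c₃.trans (c₂.trans c₁))) (by omega)).seq ?_
  rintro σ₆ ⟨s₆, r51⟩
  have t6 : σ₆.reg 6 = 2 ^ s.d := by simp [s₆.reg 6, s₅.reg 6]
  have t1' : σ₆.reg 1 = t := by simp [s₆.reg 1, s₅.reg 1, s₃.reg 1, t1]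
  refine Runs.mono (runs_initHash (m := m) (d := s.d) (b := b) (cap := P.cc * B) t1' t6
    (by simp [s₆.reg 7, r7]) r51 (coinNum_lt _ _) (hst ▸ bits_t s) (by omega) (by omega)) le_rfl ?_
  rintro σ₇ ⟨s₇, r8, roff⟩
  have e : P.hash n₀ w t (untuple m (coinNum (4 * m) σ.coins)) =
      hashOf m s.d (P.cc * B) t (untuple m (coinNum (4 * m) σ.coins)) := by
    rw [hash, hm, hs, hB]
  have A : ∀ a, σ₇.arr a = σ.arr a := fun a => by
    rw [s₇.arr a (by simp), s₆.arr a (by simp), s₅.arr a (by simp), State.arr_setReg,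
      s₃.arr a (by simp), s₂.arr a (by simp), s₁.arr a (by simp)]
  constructor
  · rw [hs]
    constructor
    · simp [s₇.reg 1, t1', hst]
    · simp [s₇.reg 2, s₆.reg 2, s₅.reg 2, s₃.reg 2, s₂.reg 2, r2, ← hs, setupOf, hB]
    · simp [s₇.reg 3, s₆.reg 3, s₅.reg 3, s₃.reg 3, s₂.reg 3, r3, hsn]
    · simp [s₇.reg 5, s₆.reg 5, s₅.reg 5, s₃.reg 5, r5]
    · simp [s₇.reg 13, s₆.reg 13, s₅.reg 13, s₃.reg 13, s₂.reg 13, r13, hsn]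
    · have : s.V = 4 * (s.W + 1) * ((P.K * B : ℕ) + 1) ^ 3 * 2 ^ (P.K * B) := by
        rw [← hW, hsn, ← hs, ← hB]; simp [setupOf]
      simp [s₇.reg 15, s₆.reg 15, r15, this]
    · have : s.N₁ = (P.K * B + 1) * 2 ^ (P.c₁ * B) := by
        rw [← hs, ← hB]; simp [setupOf]
      simp [s₇.reg 16, s₆.reg 16, r16, this]
    · intro i _
      rw [A, harr0, hsw]
  · rw [hs, e]
    constructor
    · simp [s₇.reg 6, t6, hashOf]
    · simp [s₇.reg 7, s₆.reg 7, r7, hashOf]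
    · exact r8
    · exact roff
    · simp [s₇.reg 14, s₆.reg 14, r14, hsn]
    · simp [s₇.reg 19, s₆.reg 19, r19, hashOf]
    · simp [s₇.reg 21, s₆.reg 21, r21, hsn]
    · simp [s₇.reg 22, s₆.reg 22, r22, hsn]
  · simp [s₇.reg 17, s₆.reg 17, s₅.reg 17, s₃.reg 17, s₂.reg 17, s₁.reg 17, r0]
  · simp [s₇.reg 18, s₆.reg 18, s₅.reg 18, s₃.reg 18, s₂.reg 18, s₁.reg 18, r0]
  · simp [s₇.reg 20, s₆.reg 20, r20, N₀, hB]
  · intro x hx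
    have hne : ∀ y < 100, x ≠ y := fun y hy => by omega
    rw [s₇.reg x (by simp; omega), s₆.reg x (by simp; omega), s₅.reg x (by simp; omega),
      State.reg_setReg, if_neg (hne 6 (by norm_num)), s₃.reg x (by simp; omega),
      s₂.reg x (by simp; omega), s₁.reg x (by simp; omega), r0 x (by omega)]
  · intro a ha i
    rw [A, harr a ha]

end Params


/-! ### Sufficient word length, and all searches and layers in sequence. -/

theorem Runs.seqRange {b : ℕ} (f : ℕ → Prog) (I : ℕ → State → Prop) (T m i : ℕ) {σ : State}
    (h0 : I i σ) (h : ∀ k, i ≤ k → k < i + m → ∀ σ, I k σ → Runs b (f k) σ T (I (k + 1))) :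
    Runs b (WordRAM.seqList ((List.range' i m).map f)) σ (m * T + 1) (I (i + m)) := by
  induction m generalizing i σ with
  | zero => exact Runs.mono (Runs.skip b h0) (by simp) fun _ h => h
  | succ m ih =>
    rw [List.range'_succ, List.map_cons]
    refine Runs.mono ((h i le_rfl (by omega) σ h0).seq fun σ' h' => ih (i + 1) h'
      fun k h1 h2 => h k (by omega) (by omega)) ?_ fun σ' h' => ?_
    · rw [Nat.succ_mul]; omega
    · rwa [show i + 1 + m = i + (m + 1) by omega] at h'

namespace Params

variable {P : Params} {n₀ b : ℕ} {w : ℕ → ℤ} {t : ℤ}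

/-- The word length suffices. -/
def Enough (P : Params) (n₀ : ℕ) (w : ℕ → ℤ) (t : ℤ) (b : ℕ) : Prop :=
  5 * (setupOf P n₀ w t).d + 5 * (P.K * P.B n₀) + 2 * P.J + 20 ≤ b

theorem bits_N₁ (hP : P.Valid) : Bits (2 * (P.K * P.B n₀)) ((setupOf P n₀ w t).N₁ : ℤ) := by
  refine Bits.natCast ?_
  show (P.K * P.B n₀ + 1) * 2 ^ (P.c₁ * P.B n₀) ≤ _
  rw [two_mul, pow_add]
  exact Nat.mul_le_mul Nat.lt_two_pow_self
    (Nat.pow_le_pow_right (by norm_num) (Valid.mul_le hP.c₁_le n₀))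

theorem lt_two_pow_N₀ (hP : P.Valid) : P.N₀ n₀ < 2 ^ (8 + P.J + P.K * P.B n₀) := by
  have h1 : 80 * P.J ≤ 2 ^ (7 + P.J) := by
    rw [pow_add]; exact Nat.mul_le_mul (by norm_num) Nat.lt_two_pow_self.le
  have h2 : P.N₀ n₀ ≤ 2 ^ (7 + P.J) * 2 ^ (P.K * P.B n₀) :=
    Nat.mul_le_mul h1 (Nat.pow_le_pow_right (by norm_num) (Valid.mul_le hP.c₀_le n₀))
  rw [← pow_add] at h2
  exact lt_of_le_of_lt h2 (Nat.pow_lt_pow_right (by norm_num) (by omega))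

theorem W_add_one_le (s : Setup) : s.W + 1 ≤ 2 ^ s.d := by
  linarith [s.two_W_lt, s.W_nonneg]

theorem bits_W (s : Setup) : Bits s.d (s.W + 1) :=
  Bits.of_nonneg (by linarith [s.W_nonneg]) (W_add_one_le s)

/-- `V` is a product of `W + 1`, three factors `n + 1`, the power `2 ^ n` and a constant, and the
caps have at most about `2 * n` bits. Hence a word length linear in `d + n` suffices. -/
theorem Enough.bounded (hb : P.Enough n₀ w t b) (hP : P.Valid) : (setupOf P n₀ w t).Bounded b := by
  obtain ⟨s, hs⟩ : ∃ s, setupOf P n₀ w t = s := ⟨_, rfl⟩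
  have hsn : s.n = P.K * P.B n₀ := by rw [← hs]; rfl
  have hV : s.V = 4 * (s.W + 1) * (((P.K * P.B n₀ : ℕ) : ℤ) + 1) ^ 3 * 2 ^ (P.K * P.B n₀) := by
    rw [← hs]; simp [setupOf, Setup.W, Setup.n]
  have hN₁ : s.N₁ = (P.K * P.B n₀ + 1) * 2 ^ (P.c₁ * P.B n₀) := by rw [← hs]; rfl
  have hB : Bits (2 * (P.K * P.B n₀)) (s.N₁ : ℤ) := by rw [← hs]; exact bits_N₁ hP
  have hZ : Bits (P.K * P.B n₀) (((P.K * P.B n₀ : ℕ) : ℤ) + 1) := by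
    exact_mod_cast Bits.natCast (Nat.lt_two_pow_self (n := P.K * P.B n₀))
  have hKs : s.K = P.K := by rw [← hs]; rfl
  have hBs : s.B = P.B n₀ := by rw [← hs]; rfl
  unfold Enough at hb
  rw [hs] at hb ⊢
  constructor
  · rw [hKs]; exact hP.K_pos
  · rw [hBs]; exact Nat.succ_pos _
  · rw [hN₁]; positivity
  · rw [hV, hsn]
  · have h8 := ((Bits.two_pow 3).mul ((((Bits.two_pow 2).mul (bits_W s)).mul
      ((hZ.mul hZ).mul hZ)).mul (Bits.two_pow (P.K * P.B n₀)))).fits (b := b) (by omega)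
    refine lt_of_le_of_lt (le_abs_self _) (lt_of_eq_of_lt ?_ h8)
    rw [hV]; congr 1; ring
  · exact lt_of_le_of_lt (le_abs_self _) ((hB.add (Bits.one _)).fits (b := b) (by omega))

theorem Enough.hash_bounded (hb : P.Enough n₀ w t b) (hP : P.Valid) {x : ℕ × ℕ × ℕ × ℕ}
    (hx : x ∈ tuples (P.m n₀ w t)) : (P.hash n₀ w t x).Bounded (setupOf P n₀ w t) b := by
  have hm : P.m n₀ w t = (setupOf P n₀ w t).d + P.l * P.B n₀ := rfl
  have hl := Valid.mul_le hP.l_le n₀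
  unfold Enough at hb
  obtain ⟨a, c₁, c₂, c₃⟩ := x
  simp only [tuples, Finset.mem_product, Finset.mem_range] at hx
  have hM : (0 : ℤ) < 2 ^ P.m n₀ w t := by positivity
  have he : ∀ u : ℤ, 0 ≤ u % 2 ^ P.m n₀ w t ∧ u % 2 ^ P.m n₀ w t ≤ 2 ^ P.m n₀ w t := fun u =>
    ⟨Int.emod_nonneg _ hM.ne', (Int.emod_lt_of_pos _ hM).le⟩
  have ho : ∀ v, 0 ≤ (P.hash n₀ w t (a, c₁, c₂, c₃)).off v ∧
      (P.hash n₀ w t (a, c₁, c₂, c₃)).off v ≤ 2 ^ P.m n₀ w t := by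
    intro v
    match v with
    | 0 =>
      refine ⟨Int.natCast_nonneg _, ?_⟩
      show (c₁ : ℤ) ≤ 2 ^ P.m n₀ w t
      exact_mod_cast hx.2.1.le
    | 1 => exact he _
    | 2 => exact he _
    | n + 3 => exact he _
  constructor
  · exact hM
  · exact (by positivity : (0 : ℤ) ≤ 2 ^ (setupOf P n₀ w t).d)
  · exact pow_le_pow_right₀ (by norm_num) (by omega)
  · exact Int.natCast_nonneg _
  · show (a : ℤ) ≤ 2 ^ P.m n₀ w t
    exact_mod_cast hx.1.le
  · exact fun v _ => (ho v).1
  · exact fun v _ => (ho v).2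
  · exact lt_of_le_of_lt (le_abs_self _) ((((Bits.two_pow 2).mul (Bits.two_pow (P.m n₀ w t))).mul
      (bits_W (setupOf P n₀ w t))).fits (b := b) (by omega))

theorem Enough.N₀_sq (hb : P.Enough n₀ w t b) (hP : P.Valid) : (P.N₀ n₀ * P.N₀ n₀ : ℤ) < 2 ^ b := by
  have h := Bits.natCast (lt_two_pow_N₀ hP (n₀ := n₀)).le
  unfold Enough at hb
  exact lt_of_le_of_lt (le_abs_self _) ((h.mul h).fits (b := b) (by omega))

end Params

namespace Setup

variable {s : Setup} {b : ℕ}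

/-- All searches, one after the other. A job consists of the selected blocks, the bound on the number
of selected items, and the choice between a set and its complement. -/
def mitms (K : ℕ) (job : ℕ → (ℕ → Bool) × ℕ × Bool) (J : ℕ) : Prog :=
  seqList ((List.range' 0 J).map fun i => mitm K (job i).1 (job i).2.1 (job i).2.2 (3 * i))

/-- Each search uses up three blank tables. Register `17` is a flag that is never cleared, so one
successful search is enough. -/
theorem runs_mitms (hs : s.Bounded b) {job : ℕ → (ℕ → Bool) × ℕ × Bool}
    (hjob : ∀ i, (job i).2.1 ≤ s.K) (J : ℕ) {σ : State} (hσ : s.In σ) (hfr : Fresh 0 σ)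
    (h17 : σ.reg 17 = 0) :
    Runs b (mitms s.K job J) σ (J * s.mitmTime + 1) fun σ' =>
      Same mitmRegs {a | a = 1 ∨ a = 4 ∨ a = 5 ∨ (11 ≤ a ∧ a % 2 = 1)} σ σ' ∧ Fresh (3 * J) σ' ∧
      (σ'.reg 17 = 0 ∨ (σ'.reg 17 = 1 ∧ ∃ neg, s.Solvable neg)) ∧
      ∀ i < J, s.Found (job i).1 (job i).2.1 (job i).2.2 → σ'.reg 17 = 1 := by
  refine Runs.mono (Runs.seqRange _ (fun i σ' => Same mitmRegs
      {a | a = 1 ∨ a = 4 ∨ a = 5 ∨ (11 ≤ a ∧ a % 2 = 1)} σ σ' ∧ Fresh (3 * i) σ' ∧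
      (σ'.reg 17 = 0 ∨ (σ'.reg 17 = 1 ∧ ∃ neg, s.Solvable neg)) ∧
      ∀ k < i, s.Found (job k).1 (job k).2.1 (job k).2.2 → σ'.reg 17 = 1) s.mitmTime J 0
    ⟨Same.refl _ _ _, hfr, .inl h17, fun k hk => absurd hk (Nat.not_lt_zero k)⟩ ?_) le_rfl
    (by simp only [zero_add]; exact fun _ h => h)
  rintro k - hk τ ⟨h1, h2, h3, h4⟩
  have hin : s.In τ := hσ.of_same (h1.mono (fun r hr => by
    simp only [mitmRegs, volatile, Set.mem_ofPred_eq] at *; omega) subset_rfl) (by simp)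
  refine Runs.mono (runs_mitm hs (job k).1 (hjob k) (job k).2.2 hin h2) le_rfl ?_
  rintro τ' ⟨g1, g2, g3⟩
  refine ⟨h1.trans (g1.mono subset_rfl fun a ha => ?_), fun j hj i => ?_, ?_, ?_⟩
  · simp only [mitmArrs, Set.mem_ofPred_eq] at *; omega
  · rw [g1.arr (2 * j + 11) (by simp only [mitmArrs, Set.mem_ofPred_eq]; omega)]
    exact h2 j (by omega) i
  · rcases g2 with g2 | ⟨g2, g2'⟩
    · rw [g2]; exact h3
    · exact .inr ⟨g2, _, g2'⟩
  · intro i hi hf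
    rcases Nat.lt_succ_iff_lt_or_eq.1 hi with hi | rfl
    · rcases g2 with g2 | g2
      · rw [g2]; exact h4 i hi hf
      · exact g2.1
    · exact g3 hf

/-- The creation of all vertices. -/
def gens (K : ℕ) (ρ : ℕ → ℕ → ℕ) (J fr : ℕ) : Prog :=
  seqList ((List.range' 0 (4 * J)).map fun i =>
    gen K (ρ (i / 4)) (i % 4) (5 * (i / 4) + i % 4) (2 * (fr + i) + 11))

theorem length_eq_card {h : Hash} {ρ : ℕ → ℕ} {v tag : ℕ} {ns : List (ℕ × Finset ℕ)} (hn : ns.Nodup)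
    (hm : ∀ x, x ∈ ns ↔ x.1 = tag ∧ s.IsVertex h ρ v x.2) :
    ns.length = (s.vertices h ρ v).card := by
  rw [← List.toFinset_card_of_nodup hn, ← Finset.card_image_of_injective (s.vertices h ρ v)
    (Prod.mk_right_injective tag)]
  congr 1
  ext ⟨a, A⟩
  simp only [List.mem_toFinset, hm, Finset.mem_image, mem_vertices, Prod.mk.injEq]
  constructor
  · rintro ⟨rfl, hA⟩; exact ⟨A, hA, rfl, rfl⟩
  · rintro ⟨_, hA, rfl, rfl⟩; exact ⟨rfl, hA⟩

/-- Step `i` creates layer `i % 4` of the family `i / 4`. One hash function serves all families, and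
the number of vertices is counted over all of them since they form one graph. -/
theorem runs_gens (hs : s.Bounded b) {h : Hash} (hh : h.Bounded s b) {ρ : ℕ → ℕ → ℕ} {J fr : ℕ}
    (hsmall : ∀ j < J, ∀ v < 4, 2 ^ (s.items ((layer v).sel (ρ j))).card ≤ s.N₁)
    (hJ : ((4 * J + 5 : ℕ) : ℤ) * s.N₁ < 2 ^ b) (htags : ((5 * J : ℕ) : ℤ) < 2 ^ b) {σ : State}
    (hσ : s.In σ) (hσh : h.In s.n σ) (hfr : Fresh fr σ) (hns : s.Vertices [] σ) :
    Runs b (gens s.K ρ J fr) σ (4 * J * s.genTime + 1) fun σ' =>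
      Same {r | r = 18 ∨ (30 ≤ r ∧ r ≤ 44)} {a | (1 ≤ a ∧ a ≤ 10) ∨ (11 ≤ a ∧ a % 2 = 1)} σ σ' ∧
      ∃ ns, s.Vertices ns σ' ∧ ns.length = s.numVertices h ρ J ∧
        ∀ x, x ∈ ns ↔ ∃ k < 4 * J, x.1 = 5 * (k / 4) + k % 4 ∧ s.IsVertex h (ρ (k / 4)) (k % 4) x.2 := by
  refine Runs.mono (Runs.seqRange _ (fun i σ' => Same {r | r = 18 ∨ (30 ≤ r ∧ r ≤ 44)}
      {a | (1 ≤ a ∧ a ≤ 10) ∨ (11 ≤ a ∧ a % 2 = 1)} σ σ' ∧ Fresh (fr + i) σ' ∧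
      ∃ ns, s.Vertices ns σ' ∧ ns.length ≤ i * s.N₁ ∧
        ns.length = ∑ k ∈ Finset.range i, (s.vertices h (ρ (k / 4)) (k % 4)).card ∧
        ∀ x, x ∈ ns ↔ ∃ k < i, x.1 = 5 * (k / 4) + k % 4 ∧ s.IsVertex h (ρ (k / 4)) (k % 4) x.2)
    s.genTime (4 * J) 0 ⟨Same.refl _ _ _, hfr, [], hns, by simp, by simp, by simp⟩ ?_) le_rfl ?_
  · rintro k - hk τ ⟨h1, h2, ns, h3, h4, h5, h6⟩
    have hsame : Same volatile {a | (1 ≤ a ∧ a ≤ 10) ∨ (11 ≤ a ∧ a % 2 = 1)} σ τ :=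
      h1.mono (fun r hr => by simp only [volatile, Set.mem_ofPred_eq] at *; omega) subset_rfl
    have hN : (ns.length : ℤ) + s.N₁ < 2 ^ b := by
      refine lt_of_le_of_lt ?_ hJ
      have : ns.length + s.N₁ ≤ (4 * J + 5) * s.N₁ := by nlinarith
      exact_mod_cast this
    refine Runs.mono (runs_gen hs hh (by omega) (by omega) ?_ (by omega) (hsmall _ (by omega) _ (by omega))
      (hσ.of_same hsame (by simp)) (hσh.of_same hsame) (h2 _ le_rfl) h3 hN) le_rfl ?_
    · refine lt_of_le_of_lt ?_ htags
      rw [abs_of_nonneg (by positivity)]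
      exact_mod_cast (by omega : 5 * (k / 4) + k % 4 ≤ 5 * J)
    · rintro τ' ⟨g1, ns', g2, g3, g4, g5⟩
      refine ⟨h1.trans (g1.mono subset_rfl fun a ha => ?_), fun j hj i => ?_, ns ++ ns', g2, ?_, ?_, ?_⟩
      · simp only [Set.mem_ofPred_eq] at *; omega
      · rw [g1.arr (2 * j + 11) (by simp only [Set.mem_ofPred_eq]; omega)]
        exact h2 j (by omega) i
      · rw [List.length_append, Nat.succ_mul]; omega
      · rw [List.length_append, Finset.sum_range_succ, h5, length_eq_card g3 g5]
      · intro x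
        rw [List.mem_append, h6, g5]
        constructor
        · rintro (⟨i, hi, hx⟩ | hx)
          · exact ⟨i, by omega, hx⟩
          · exact ⟨k, by omega, hx⟩
        · rintro ⟨i, hi, hx⟩
          rcases Nat.lt_succ_iff_lt_or_eq.1 hi with hi | rfl
          · exact .inl ⟨i, hi, hx⟩
          · exact .inr hx
  · rintro σ' ⟨h1, -, ns, h3, -, h5, h6⟩
    rw [zero_add] at h5 h6
    exact ⟨h1, ns, h3, h5, h6⟩

end Setup


/-! ### The complete program. -/

namespace Params

variable {P : Params} {n₀ b : ℕ} {w : ℕ → ℤ} {t : ℤ}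

/-- The algorithm for Subset Sum. It calls the algorithm `A` for Exact Node Weighted `P₄`. -/
def main (P : Params) (job : ℕ → (ℕ → Bool) × ℕ × Bool) (J₁ : ℕ) (ρ : ℕ → ℕ → ℕ) (A : Prog) : Prog :=
  .seq P.init (.seq (Setup.mitms P.K job J₁) (.seq (Setup.gens P.K ρ P.J (3 * J₁))
    (.seq (call A) (Stm.code (.set 0 (.var 17))))))

/-- The running time of the algorithm, if `A` takes time `T`. -/
def mainTime (P : Params) (J₁ T n₀ : ℕ) (w : ℕ → ℤ) (t : ℤ) : ℕ :=
  (42 * n₀ + 10 * (setupOf P n₀ w t).d + 80 * P.m n₀ w t + 330) +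
    ((J₁ * (setupOf P n₀ w t).mitmTime + 1) + ((4 * P.J * (setupOf P n₀ w t).genTime + 1) +
      ((P.N₀ n₀ * (62 * P.N₀ n₀ + 20) + T + 40) + 3)))

theorem abs_weight_lt {s : Setup} {x : ℕ × Finset ℕ} (hx : x.2 ⊆ Finset.range s.n) :
    |s.weight x| < 2 ^ (s.d + 7) := by
  have h1 := s.abs_sum_le hx
  have h2 := s.two_W_lt
  have h3 := s.W_nonneg
  have hc : |layerCode (x.1 % 5)| ≤ 31 := by unfold layerCode; split <;> norm_num
  have ht := abs_nonneg s.t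
  have h4 : |s.weight x| ≤ |s.sum x.2 * 128| + |layerCode (x.1 % 5)| +
      |s.t * (if x.1 % 5 = 3 then 128 else 0)| :=
    (abs_sub _ _).trans (add_le_add_left (abs_add_le _ _) _)
  have h5 : |s.sum x.2 * 128| = |s.sum x.2| * 128 := by rw [abs_mul]; norm_num
  have h6 : |s.t * (if x.1 % 5 = 3 then 128 else 0)| ≤ |s.t| * 128 := by
    rw [abs_mul]; split_ifs <;> simp
  rw [pow_add]
  linarith

/-- The three conclusions correspond to soundness for all coins, success of a deterministic search,
and success of the graph for a favourable hash function. The last needs a path for only one family,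
but a bound on the vertices of all. -/
theorem runs_main (hP : P.Valid) {job : ℕ → (ℕ → Bool) × ℕ × Bool} (hjob : ∀ i, (job i).2.1 ≤ P.K)
    {J₁ : ℕ} {ρ : ℕ → ℕ → ℕ} (hρ : ∀ j k, ρ j k < 5)
    (hsmall : ∀ j < P.J, ∀ v < 4, 2 ^ ((setupOf P n₀ w t).items ((layer v).sel (ρ j))).card ≤
      (setupOf P n₀ w t).N₁)
    (hb : P.Enough n₀ w t b) {A : Prog} {T : ℕ}
    (hA : ∀ (N : ℕ) (G : SimpleGraph (Fin N)) (wt : Fin N → ℤ), 0 < N → N ≤ P.N₀ n₀ →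
      (∀ v, |wt v| < 2 ^ ((setupOf P n₀ w t).d + 7)) → ∀ ω, ∃ τ σ',
        Exec b A (p4Input G wt ω) τ σ' ∧ τ ≤ T ∧ (σ'.Accepts ↔ HasZeroWeightP4 G wt))
    {σ : State} (hw : ∀ i ≥ n₀, w i = 0)
    (hreg : σ.reg = Function.update (Function.update (0 : ℕ → ℤ) 0 (n₀ : ℤ)) 1 t)
    (harr0 : σ.arr 0 = w) (harr : ∀ a ≠ 0, ∀ i, σ.arr a i = 0) :
    Runs b (P.main job J₁ ρ A) σ (P.mainTime J₁ T n₀ w t) fun σ' =>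
      (σ'.reg 0 ≠ 0 → ∃ neg, (setupOf P n₀ w t).Solvable neg) ∧
      ((∃ i < J₁, (setupOf P n₀ w t).Found (job i).1 (job i).2.1 (job i).2.2) → σ'.reg 0 ≠ 0) ∧
      ((setupOf P n₀ w t).numVertices
        (P.hash n₀ w t (untuple (P.m n₀ w t) (coinNum (4 * P.m n₀ w t) σ.coins))) ρ P.J ≤ P.N₀ n₀ →
        (∃ j < P.J, (setupOf P n₀ w t).HasPath
          (P.hash n₀ w t (untuple (P.m n₀ w t) (coinNum (4 * P.m n₀ w t) σ.coins))) (ρ j)) →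
        σ'.reg 0 ≠ 0) := by
  have hs := hb.bounded hP
  have hx : untuple (P.m n₀ w t) (coinNum (4 * P.m n₀ w t) σ.coins) ∈ tuples (P.m n₀ w t) := by
    simp only [untuple, tuples, Finset.mem_product, Finset.mem_range]
    exact ⟨Nat.mod_lt _ (by positivity), Nat.mod_lt _ (by positivity), Nat.mod_lt _ (by positivity),
      Nat.mod_lt _ (by positivity)⟩
  obtain ⟨x, hx'⟩ : ∃ x, untuple (P.m n₀ w t) (coinNum (4 * P.m n₀ w t) σ.coins) = x := ⟨_, rfl⟩
  rw [hx'] at hx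
  have hh := hb.hash_bounded hP hx
  have hfit := hb.N₀_sq hP
  have hN₁ := bits_N₁ (n₀ := n₀) (w := w) (t := t) hP
  have hinit := runs_init hP hw hreg harr0 harr hb
  unfold Enough at hb
  obtain ⟨s, hsd⟩ : ∃ s, setupOf P n₀ w t = s := ⟨_, rfl⟩
  obtain ⟨h, hhd⟩ : ∃ h, P.hash n₀ w t x = h := ⟨_, rfl⟩
  have hKs : P.K = s.K := by rw [← hsd]; rfl
  have hsn : s.n = P.K * P.B n₀ := by rw [← hsd]; rfl
  have htags : ((5 * P.J : ℕ) : ℤ) < 2 ^ b := by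
    have : 5 * P.J ≤ 2 ^ (3 + P.J) := by
      rw [pow_add]; exact Nat.mul_le_mul (by norm_num) Nat.lt_two_pow_self.le
    exact lt_of_le_of_lt (le_abs_self _) ((Bits.natCast this).fits (b := b) (by omega))
  have hJ : ((4 * P.J + 5 : ℕ) : ℤ) * s.N₁ < 2 ^ b := by
    have : 4 * P.J + 5 ≤ 2 ^ (4 + P.J) := by
      rw [pow_add]
      have := Nat.lt_two_pow_self (n := P.J)
      omega
    rw [hsd] at hN₁
    exact lt_of_le_of_lt (le_abs_self _) (((Bits.natCast this).mul hN₁).fits (b := b) (by omega))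
  rw [hx'] at hinit
  rw [hx', hhd]
  rw [hhd] at hh
  unfold main mainTime
  rw [hsd] at hs hh hb hinit hsmall hA ⊢
  refine hinit.seq ?_
  rintro σ₁ ⟨i₁, i₂, i₃, i₄, i₅, i₆, i₇⟩
  rw [hsd, hhd] at i₂
  rw [hsd] at i₁
  rw [hKs] at hjob ⊢
  refine (Setup.runs_mitms hs hjob J₁ i₁ (fun j _ i => i₇ _ (by omega) i) i₃).seq ?_
  rintro σ₂ ⟨s₂, f₂, a₂, g₂⟩
  have s₂' : Same Setup.volatile {a | a = 1 ∨ a = 4 ∨ a = 5 ∨ (11 ≤ a ∧ a % 2 = 1)} σ₁ σ₂ :=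
    s₂.mono (fun r hr => by simp only [Setup.mitmRegs, Setup.volatile, Set.mem_ofPred_eq] at *; omega)
      subset_rfl
  have hns : s.Vertices [] σ₂ := by
    constructor
    · rw [s₂.reg 18 (by simp [Setup.mitmRegs]), i₄]; rfl
    · simp
    · simp
    · simp
    · intro j _
      rw [s₂.arr 10 (by simp), i₇ 10 (by norm_num)]
  refine (Setup.runs_gens hs hh hsmall hJ htags (i₁.of_same s₂' (by simp)) (i₂.of_same s₂') f₂ hns).seq ?_
  rintro σ₃ ⟨s₃, ns, v₃, l₃, m₃⟩
  have e17 : σ₃.reg 17 = σ₂.reg 17 := s₃.reg 17 (by simp)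
  have hclean : Clean σ₃ := by
    constructor
    · intro y hy
      rw [s₃.reg y (by simp only [Set.mem_ofPred_eq]; omega),
        s₂.reg y (by simp only [Setup.mitmRegs, Set.mem_ofPred_eq]; omega), i₆ y hy]
    · intro a ha i
      rw [s₃.arr _ (by simp only [Set.mem_ofPred_eq]; omega),
        s₂.arr _ (by simp only [Set.mem_ofPred_eq]; omega), i₇ _ (by omega)]
  have htagged : s.WellTagged ρ ns := by
    intro y hy
    obtain ⟨k, hk, e, hv⟩ := (m₃ y).1 hy
    have e1 : y.1 % 5 = k % 4 := by omega
    have e2 : y.1 / 5 = k / 4 := by omega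
    rw [e1, e2]
    exact ⟨by omega, hv.1⟩
  have hsub : ∀ y ∈ ns, y.2 ⊆ Finset.range s.n := fun y hy => (htagged y hy).2.trans (s.items_subset _)
  have h20 : σ₃.reg 20 = P.N₀ n₀ + 1 := by
    rw [s₃.reg 20 (by simp), s₂.reg 20 (by simp [Setup.mitmRegs]), i₅]
  refine (Setup.runs_call hs v₃ hclean hsub h20 hfit ?_ fun hpos hle ω => hA _ _ _ hpos hle
    (fun i => abs_weight_lt (hsub _ (List.getElem_mem _))) ω).seq ?_
  · intro y hy
    obtain ⟨k, hk, e, -⟩ := (m₃ y).1 hy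
    refine lt_of_le_of_lt ?_ htags
    rw [abs_of_nonneg (by positivity), e]
    exact_mod_cast (by omega : 5 * (k / 4) + k % 4 + 1 ≤ 5 * P.J)
  rintro σ₄ ⟨a₄, c₄⟩
  have f17 : Fits b (σ₄.reg 17) := by
    rcases a₄ with a₄ | ⟨a₄, -⟩
    · rw [a₄, e17]
      rcases a₂ with a₂ | ⟨a₂, -⟩
      · rw [a₂]; exact fits_zero b
      · rw [a₂]; exact fits_one hs.one_le
    · rw [a₄]; exact fits_one hs.one_le
  refine Runs.mono (Stm.runs hs.one_le (.set 0 (.var 17)) (Q := fun σ' => σ'.reg 0 = σ₄.reg 17)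
    ⟨trivial, f17⟩ (by simp [Stm.run])) le_rfl ?_
  intro σ₅ e
  rw [e]
  refine ⟨fun hne => ?_, fun ⟨i, hi, hf⟩ => ?_, fun hle ⟨j, hj, hp⟩ => ?_⟩
  · rcases a₄ with a₄ | ⟨-, a₄⟩
    · rw [a₄, e17] at hne
      rcases a₂ with a₂ | ⟨-, a₂⟩
      · exact absurd a₂ hne
      · exact a₂
    · exact ⟨_, Setup.solvable_of_hasZeroWeightP4 hρ htagged a₄⟩
  · have := g₂ i hi hf
    rcases a₄ with a₄ | ⟨a₄, -⟩
    · rw [a₄, e17, this]; norm_num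
    · rw [a₄]; norm_num
  · obtain ⟨A₀, A₁, A₂, A₃, h0, h1, h2, h3, d1, d2, d3, hsum⟩ := hp
    have mem : ∀ v < 4, ∀ A, s.IsVertex h (ρ j) v A → (5 * j + v, A) ∈ ns := by
      intro v hv A hA
      have e1 : (4 * j + v) / 4 = j := by omega
      have e2 : (4 * j + v) % 4 = v := by omega
      exact (m₃ _).2 ⟨4 * j + v, by omega, by rw [e1, e2], by rw [e1, e2]; exact hA⟩
    rw [c₄ (l₃ ▸ hle) (Setup.hasZeroWeightP4_of_mem (mem 0 (by norm_num) _ h0)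
      (mem 1 (by norm_num) _ h1) (mem 2 (by norm_num) _ h2) (mem 3 (by norm_num) _ h3) d1 d2 d3 hsum)]
    norm_num

end Params


/-! ### Finite lists of all searches and all families of roles. -/

theorem exists_enum_of_finite {β : Type*} {S : Set β} (hS : S.Finite) (z : β) :
    ∃ (J : ℕ) (g : ℕ → β), (∀ j < J, g j ∈ S) ∧ (∀ j ≥ J, g j = z) ∧ ∀ x ∈ S, ∃ j < J, g j = x := by
  refine ⟨hS.toFinset.toList.length, fun j => hS.toFinset.toList.getD j z, fun j hj => ?_,
    fun j hj => List.getD_eq_default _ _ hj, fun x hx => ?_⟩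
  · show hS.toFinset.toList.getD j z ∈ S
    rw [List.getD_eq_getElem _ _ hj, ← hS.mem_toFinset, ← Finset.mem_toList]
    exact List.getElem_mem _
  · have : x ∈ hS.toFinset.toList := by rwa [Finset.mem_toList, hS.mem_toFinset]
    obtain ⟨j, hj, h⟩ := List.mem_iff_getElem.1 this
    exact ⟨j, hj, (List.getD_eq_getElem _ _ hj).trans h⟩

/-- Fixing the values beyond the last block makes the set of functions finite. These values never
matter for the items. -/
theorem finite_functions {β : Type*} (K : ℕ) {V : Set β} (hV : V.Finite) (z : β) :
    {f : ℕ → β | (∀ k < K, f k ∈ V) ∧ ∀ k ≥ K, f k = z}.Finite := by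
  have := hV.to_subtype
  refine (Set.finite_range fun (g : Fin K → V) k => if h : k < K then (g ⟨k, h⟩ : β) else z).subset ?_
  rintro f ⟨h1, h2⟩
  refine ⟨fun k => ⟨f k, h1 k k.2⟩, funext fun k => ?_⟩
  by_cases h : k < K
  · simp [h]
  · simp [h, h2 k (not_lt.1 h)]

/-- There are finitely many searches. -/
theorem exists_jobs {K c : ℕ} (hc : c ≤ K) : ∃ (J : ℕ) (job : ℕ → (ℕ → Bool) × ℕ × Bool),
    (∀ i, (job i).2.1 ≤ K) ∧ ∀ (sel : ℕ → Bool) (c' : ℕ) (neg : Bool), c' = c ∨ c' = K →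
      ∃ i < J, (job i).2.1 = c' ∧ (job i).2.2 = neg ∧ ∀ k < K, (job i).1 k = sel k := by
  have hf : {f : ℕ → Bool | (∀ k < K, f k ∈ Set.univ) ∧ ∀ k ≥ K, f k = false}.Finite :=
    finite_functions K Set.finite_univ false
  obtain ⟨J, job, h1, h2, h3⟩ := exists_enum_of_finite
    (hf.prod ((Set.toFinite {c, K}).prod (Set.finite_univ (α := Bool)))) (fun _ => false, 0, false)
  refine ⟨J, job, fun i => ?_, fun sel c' neg hc' => ?_⟩
  · by_cases hi : i < J
    · rcases (h1 i hi).2.1 with h | h <;> rw [h]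
      exact hc
    · rw [h2 i (not_lt.1 hi)]; exact Nat.zero_le _
  · obtain ⟨i, hi, h⟩ := h3 (fun k => if k < K then sel k else false, c', neg)
      ⟨⟨fun _ _ => trivial, fun k hk => if_neg (not_lt.2 hk)⟩, hc', trivial⟩
    exact ⟨i, hi, by rw [h], by rw [h], fun k hk => by rw [h]; exact if_pos hk⟩

/-- There are finitely many families of roles. -/
theorem exists_roles (K m : ℕ) (hm : 0 < m) (R : (ℕ → ℕ) → Prop) :
    ∃ (J : ℕ) (ρ : ℕ → ℕ → ℕ), (∀ j k, ρ j k < m) ∧ (∀ j < J, R (ρ j)) ∧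
      ∀ f : ℕ → ℕ, (∀ k, f k < m) → (∀ k ≥ K, f k = 0) → R f → ∃ j < J, ρ j = f := by
  obtain ⟨J, ρ, h1, h2, h3⟩ := exists_enum_of_finite
    ((finite_functions K (Set.finite_Iio m) 0).inter_of_left {f | R f}) fun _ => 0
  refine ⟨J, ρ, fun j k => ?_, fun j hj => (h1 j hj).2, fun f f1 f2 f3 =>
    h3 f ⟨⟨fun k _ => f1 k, f2⟩, f3⟩⟩
  by_cases hj : j < J
  · by_cases hk : k < K
    · exact (h1 j hj).1.1 k hk
    · rw [(h1 j hj).1.2 k (not_lt.1 hk)]; exact hm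
  · rw [h2 j (not_lt.1 hj)]; exact hm

namespace Setup

variable {s : Setup}

theorem items_congr {sel sel' : ℕ → Bool} (h : ∀ j < s.K, sel j = sel' j) :
    s.items sel = s.items sel' := by
  refine Finset.filter_congr fun i hi => ?_
  rw [h _ (Nat.div_lt_of_lt_mul (by rw [mul_comm]; exact Finset.mem_range.1 hi))]

theorem part_congr {ρ ρ' : ℕ → ℕ} (h : ∀ j < s.K, ρ j = ρ' j) : s.part ρ = s.part ρ' :=
  funext fun r => items_congr fun j hj => by rw [h j hj]

theorem partials_congr {ρ ρ' : ℕ → ℕ} (h : ∀ j < s.K, ρ j = ρ' j) (cap : ℕ) (S : Finset ℕ) (r : ℕ) :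
    s.partials cap ρ S r = s.partials cap ρ' S r := by
  have hb : ∀ r, s.base ρ S r = s.base ρ' S r := by
    intro r
    induction r with
    | zero => rw [base, base, part_congr h]
    | succ r ih => rw [base, base, ih, part_congr h]
  rw [partials, partials, splits, splits, hb, part_congr h]

theorem Found.congr {sel sel' : ℕ → Bool} (h : ∀ j < s.K, sel j = sel' j) {c : ℕ} {neg : Bool}
    (hf : s.Found sel' c neg) : s.Found sel c neg := by
  unfold Found coded at *
  have h' : (s.items fun j => !sel j) = s.items fun j => !sel' j :=
    items_congr fun j hj => by rw [h j hj]
  rwa [items_congr h, h']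

theorem card_part (hB : 0 < s.B) (ρ : ℕ → ℕ) (r : ℕ) :
    (s.part ρ r).card = ((Finset.range s.K).filter fun k => ρ k = r).card * s.B := by
  rw [part, card_items hB]; simp

/-- A layer meets two parts of at most `16 * q` blocks each. As `32 * q` is below `37 * q - 1`, even
all subsets of a layer fit under the cap of the lists. -/
theorem card_layer_le {q : ℕ} {ρ : ℕ → ℕ} (hρ : s.RightSizes q ρ) {v : ℕ} (hv : v < 4) :
    (s.items ((layer v).sel ρ)).card ≤ 32 * q * s.B := by
  have key : ∀ r r', r < 5 → r' < 5 → (∀ j, (layer v).sel ρ j = true → ρ j = r ∨ ρ j = r') →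
      (s.items ((layer v).sel ρ)).card ≤ 32 * q * s.B := by
    intro r r' hr hr' h
    have hsub : s.items ((layer v).sel ρ) ⊆ s.part ρ r ∪ s.part ρ r' := by
      intro i hi
      obtain ⟨h1, h2⟩ := Finset.mem_filter.1 hi
      rcases h _ h2 with h3 | h3
      · exact Finset.mem_union_left _ (Finset.mem_filter.2 ⟨h1, by simpa using h3⟩)
      · exact Finset.mem_union_right _ (Finset.mem_filter.2 ⟨h1, by simpa using h3⟩)
    refine (Finset.card_le_card hsub).trans ((Finset.card_union_le _ _).trans ?_)
    rw [hρ.card r hr, hρ.card r' hr', ← add_mul, ← add_mul]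
    exact Nat.mul_le_mul_right _ (Nat.mul_le_mul_right _ (by split_ifs <;> norm_num))
  have h5 : ∀ j, ρ j ≠ 5 := fun j => by have := hρ.lt j; omega
  interval_cases v
  · exact key 0 3 (by norm_num) (by norm_num) fun j hj => by
      simpa [layer, Layer.sel, h5] using hj
  · exact key 0 1 (by norm_num) (by norm_num) fun j hj => by
      simpa [layer, Layer.sel, h5] using hj
  · exact key 1 2 (by norm_num) (by norm_num) fun j hj => by
      simpa [layer, Layer.sel, h5] using hj
  · exact key 2 4 (by norm_num) (by norm_num) fun j hj => by
      simpa [layer, Layer.sel, h5] using hj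

end Setup


/-! ## Word length and running time -/

/-- The numbers of an instance as a sequence. -/
def padded {n : ℕ} (w : Fin n → ℤ) (i : ℕ) : ℤ := if h : i < n then w ⟨i, h⟩ else 0

theorem sum_padded {n m : ℕ} (h : n ≤ m) (w : Fin n → ℤ) (f : ℕ → ℤ → ℤ) (hf : ∀ i, f i 0 = 0) :
    ∑ i ∈ Finset.range m, f i (padded w i) = ∑ i : Fin n, f i (w i) := by
  rw [← Finset.sum_subset (Finset.range_subset_range.2 h), Finset.sum_range]
  · simp [padded]
  · intro i _ hi
    rw [padded, dif_neg (by simpa using hi), hf]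

theorem lt_subsetSumSize {n : ℕ} (w : Fin n → ℤ) (t : ℤ) : n < subsetSumSize w t := by
  have h : ∑ _i : Fin n, 1 ≤ ∑ i, ((w i).natAbs.size + 1) :=
    Finset.sum_le_sum fun _ _ => Nat.le_add_left _ _
  simp only [Finset.sum_const, Finset.card_univ, Fintype.card_fin, smul_eq_mul, mul_one] at h
  unfold subsetSumSize
  omega

/-- Each factor `1 + |x|` is at most two to the number of bits of `x`, and the product of all these
factors exceeds the sum of the absolute values. Therefore sums need no more bits than the whole
input. -/
theorem sum_natAbs_lt {n : ℕ} (w : Fin n → ℤ) (t : ℤ) :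
    ∑ i, |w i| + |t| + 1 ≤ 2 ^ (∑ i, (w i).natAbs.size + t.natAbs.size) := by
  have key : ∀ A : Finset (Fin n), ∑ i ∈ A, |w i| + 1 ≤ 2 ^ (∑ i ∈ A, (w i).natAbs.size) := by
    intro A
    induction A using Finset.induction_on with
    | empty => simp
    | insert i A hi ih =>
      rw [Finset.sum_insert hi, Finset.sum_insert hi, pow_add]
      have h1 : |w i| + 1 ≤ 2 ^ (w i).natAbs.size := by
        have := Nat.lt_size_self (w i).natAbs
        rw [← Int.natCast_natAbs]
        exact_mod_cast this
      have h2 : 0 ≤ ∑ i ∈ A, |w i| := Finset.sum_nonneg fun _ _ => abs_nonneg _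
      have h3 := abs_nonneg (w i)
      nlinarith
  have h1 : |t| + 1 ≤ 2 ^ t.natAbs.size := by
    have := Nat.lt_size_self t.natAbs
    rw [← Int.natCast_natAbs]
    exact_mod_cast this
  have h2 : 0 ≤ ∑ i, |w i| := Finset.sum_nonneg fun _ _ => abs_nonneg _
  have h3 := abs_nonneg t
  have h4 := key Finset.univ
  rw [pow_add]
  nlinarith

namespace Params

variable {P : Params} {n₀ : ℕ}

theorem n_le (P : Params) (n₀ : ℕ) : P.K * P.B n₀ ≤ n₀ + P.K := by
  rw [B, mul_add, mul_one]
  exact Nat.add_le_add_right (Nat.mul_div_le _ _) _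

theorem d_le (hK : 0 < P.K) (w : Fin n₀ → ℤ) (t : ℤ) :
    (setupOf P n₀ (padded w) t).d ≤ subsetSumSize w t := by
  have hW : (setupOf P n₀ (padded w) t).W = ∑ i, |w i| + |t| := by
    rw [Setup.W]
    congr 1
    exact sum_padded (lt_n hK n₀).le w (fun _ x => |x|) fun _ => abs_zero
  have h1 := sum_natAbs_lt w t
  have h2 : ∑ i, (w i).natAbs.size + t.natAbs.size + 1 ≤ subsetSumSize w t := by
    rw [subsetSumSize, Finset.sum_add_distrib]; omega
  rw [Setup.d, Nat.clog_le_iff_le_pow (by norm_num), Int.toNat_le, hW]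
  push_cast
  refine le_trans ?_ (pow_le_pow_right₀ (by norm_num) h2)
  rw [pow_succ]
  linarith

/-- The enumerations cost about `n` times the cap on the lists, and the cap contains another factor
`n + 1`; this explains the square. Writing the adjacency matrix costs about the square of `P.N₀ n₀`,
which `2 * c₀ ≤ c₁` keeps below `2 ^ (c₁ * B)` up to a constant. -/
theorem mainTime_le (hP : P.Valid) (hc : 2 * P.c₀ ≤ P.c₁) (J₁ T : ℕ) (w : Fin n₀ → ℤ) (t : ℤ) :
    P.mainTime J₁ T n₀ (padded w) t ≤
      (1000 + (J₁ + 1) * (6 * P.K + 1000) + (4 * P.J + 1) * (6 * P.K + 1000) + 82 * (80 * P.J) ^ 2) *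
        (subsetSumSize w t + P.K + 1) ^ 2 * 2 ^ (P.c₁ * P.B n₀) + T := by
  have h0 := lt_subsetSumSize w t
  have hd := d_le hP.K_pos w t
  have hn := P.n_le n₀
  have hl := Valid.mul_le hP.l_le n₀
  obtain ⟨s, hs⟩ : ∃ s, setupOf P n₀ (padded w) t = s := ⟨_, rfl⟩
  have hsn : s.n = P.K * P.B n₀ := by rw [← hs]; rfl
  have hKs : s.K = P.K := by rw [← hs]; rfl
  have hm : P.m n₀ (padded w) t = s.d + P.l * P.B n₀ := by rw [← hs]; rfl
  have hN₁ : s.N₁ = (P.K * P.B n₀ + 1) * 2 ^ (P.c₁ * P.B n₀) := by rw [← hs]; rfl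
  unfold mainTime Setup.mitmTime Setup.genTime
  rw [hs] at hd ⊢
  rw [hsn, hKs, hm, hN₁]
  obtain ⟨n, hn'⟩ : ∃ n, P.K * P.B n₀ = n := ⟨_, rfl⟩
  obtain ⟨F, hF⟩ : ∃ F, 2 ^ (P.c₁ * P.B n₀) = F := ⟨_, rfl⟩
  obtain ⟨Z, hZ⟩ : ∃ Z, subsetSumSize w t + P.K + 1 = Z := ⟨_, rfl⟩
  have hF1 : 1 ≤ F := by rw [← hF]; exact Nat.one_le_two_pow
  have hN₀ : P.N₀ n₀ * P.N₀ n₀ ≤ (80 * P.J) ^ 2 * F := by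
    have : 2 ^ (P.c₀ * P.B n₀) * 2 ^ (P.c₀ * P.B n₀) ≤ F := by
      rw [← pow_add, ← hF]
      refine Nat.pow_le_pow_right (by norm_num) ?_
      rw [← two_mul, ← mul_assoc]
      exact Nat.mul_le_mul_right _ hc
    calc P.N₀ n₀ * P.N₀ n₀ = (80 * P.J) ^ 2 * (2 ^ (P.c₀ * P.B n₀) * 2 ^ (P.c₀ * P.B n₀)) := by
          unfold N₀; ring
      _ ≤ _ := Nat.mul_le_mul_left _ this
  rw [hn'] at hn hl ⊢
  rw [hF, hZ]
  have hnZ : n + 1 ≤ Z := by omega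
  have hZ1 : 1 ≤ Z := by omega
  obtain ⟨U, hU⟩ : ∃ U, Z ^ 2 * F = U := ⟨_, rfl⟩
  have hZU : Z ≤ U := by rw [← hU]; nlinarith
  have hFU : F ≤ U := by rw [← hU]; nlinarith [Nat.one_le_pow 2 Z hZ1]
  have h1 : (n + 1) * F ≤ U := by
    rw [← hU]; exact Nat.mul_le_mul_right F (hnZ.trans (Nat.le_self_pow two_ne_zero Z))
  have h2 : (n + 1) * ((n + 1) * F) ≤ U := by
    rw [← hU, ← mul_assoc, pow_two]; exact Nat.mul_le_mul_right _ (Nat.mul_le_mul hnZ hnZ)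
  have hA : 42 * n₀ + 10 * s.d + 80 * (s.d + P.l * P.B n₀) + 330 + 50 ≤ 1000 * U := by omega
  have e : (n + 1) * (62 * ((n + 1) * F) + 60) = 62 * ((n + 1) * ((n + 1) * F)) + 60 * (n + 1) := by ring
  have hKU : P.K ≤ P.K * U := Nat.le_mul_of_pos_right _ (by omega)
  have hM : 2 * (P.K * 3 + 1 + (n + 1) * (62 * ((n + 1) * F) + 60)) +
      2 * ((n + 1) * F * 32 + 2) + 60 ≤ (6 * P.K + 1000) * U := by
    rw [e, add_mul (6 * P.K), mul_assoc 6 P.K U]; omega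
  have hG : P.K * 3 + (n + 1) * (62 * ((n + 1) * F) + 60) + 112 * ((n + 1) * F) + 40 ≤
      (6 * P.K + 1000) * U := by
    rw [e, add_mul (6 * P.K), mul_assoc 6 P.K U]; omega
  have hC : P.N₀ n₀ * (62 * P.N₀ n₀ + 20) ≤ 82 * (80 * P.J) ^ 2 * U := by
    have h3 : P.N₀ n₀ ≤ P.N₀ n₀ * P.N₀ n₀ := Nat.le_mul_self _
    have h4 : (80 * P.J) ^ 2 * F ≤ (80 * P.J) ^ 2 * U := Nat.mul_le_mul_left _ hFU
    calc P.N₀ n₀ * (62 * P.N₀ n₀ + 20) = 62 * (P.N₀ n₀ * P.N₀ n₀) + 20 * P.N₀ n₀ := by ring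
      _ ≤ 82 * ((80 * P.J) ^ 2 * U) := by omega
      _ = _ := by ring
  have hM' := Nat.mul_le_mul_left J₁ hM
  have hG' := Nat.mul_le_mul_left (4 * P.J) hG
  have hU' : (1000 + (J₁ + 1) * (6 * P.K + 1000) + (4 * P.J + 1) * (6 * P.K + 1000) +
      82 * (80 * P.J) ^ 2) * Z ^ 2 * F = 1000 * U + J₁ * ((6 * P.K + 1000) * U) +
      4 * P.J * ((6 * P.K + 1000) * U) + 2 * ((6 * P.K + 1000) * U) + 82 * (80 * P.J) ^ 2 * U := by
    rw [← hU]; ring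
  rw [hU']
  generalize (6 * P.K + 1000) * U = X at *
  generalize 82 * (80 * P.J) ^ 2 * U = Y at *
  omega

end Params


/-! ## The algorithm -/

namespace Params

variable {P : Params} {n₀ : ℕ}

theorem hasSubsetSum_of_solvable (hK : 0 < P.K) (w : Fin n₀ → ℤ) (t : ℤ)
    (h : ∃ neg, (setupOf P n₀ (padded w) t).Solvable neg) : HasSubsetSum w t := by
  obtain ⟨s, hs⟩ : ∃ s, setupOf P n₀ (padded w) t = s := ⟨_, rfl⟩
  have hn : n₀ ≤ s.n := by rw [← hs]; exact (lt_n hK n₀).le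
  have hw : s.w = padded w := by rw [← hs]; rfl
  have ht : s.t = t := by rw [← hs]; rfl
  rw [hs] at h
  have key : ∀ S ⊆ Finset.range s.n, s.sum S = t → HasSubsetSum w t := by
    intro S hS hsum
    refine ⟨Finset.univ.filter fun i : Fin n₀ => (i : ℕ) ∈ S, ?_⟩
    have := sum_padded hn w (fun i x => if i ∈ S then x else 0) (by simp)
    rw [Finset.sum_filter, ← this, ← hsum, Setup.sum, ← Finset.sum_filter, hw,
      Finset.filter_mem_eq_inter, Finset.inter_eq_right.2 hS]
  obtain ⟨neg, S, hS, hsum⟩ := h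
  cases neg with
  | false => exact key S hS (by rw [hsum, Setup.target, ht]; rfl)
  | true =>
    refine key (Finset.range s.n \ S) Finset.sdiff_subset ?_
    have h' : s.sum S = s.total - s.t := hsum
    have h1 : s.sum (Finset.range s.n \ S) + s.sum S = s.total := Finset.sum_sdiff (f := s.w) hS
    linarith

theorem solvable_of_hasSubsetSum (hK : 0 < P.K) {w : Fin n₀ → ℤ} {t : ℤ} (h : HasSubsetSum w t) :
    (setupOf P n₀ (padded w) t).Solvable false := by
  obtain ⟨S, hS⟩ := h
  refine ⟨S.map Fin.valEmbedding, fun i hi => ?_, ?_⟩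
  · obtain ⟨j, -, rfl⟩ := Finset.mem_map.1 hi
    exact Finset.mem_range.2 (j.2.trans (lt_n hK n₀))
  · show ∑ i ∈ S.map Fin.valEmbedding, padded w i = t
    rw [Finset.sum_map, ← hS]
    exact Finset.sum_congr rfl fun i _ => by simp [padded]

end Params

instance : IsProbabilityMeasure fairCoins :=
  inferInstanceAs (IsProbabilityMeasure (Measure.infinitePi _))

/-- The parameters for `74 * q` blocks. -/
def paramsOf (q J : ℕ) : Params :=
  -- In units of `B`, the `26 * q + 24200` bits of candidates minus the `8 * q - 2545` bits removed
  -- by hashing leave less than `18 * q + 40000` bits for the vertices.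
  ⟨74 * q, 8 * q - 2545, 37 * q - 1, 18 * q + 40000, 4 * q + 7535, J⟩

theorem paramsOf_valid {q : ℕ} (hq : q = 1000000) (J : ℕ) : (paramsOf q J).Valid := by
  constructor <;> simp only [paramsOf] <;> omega

/-- The role families that are used. -/
def HasSizes (q : ℕ) (f : ℕ → ℕ) : Prop :=
  ∀ r < 5, ((Finset.range (74 * q)).filter fun k => f k = r).card = (if r < 3 then 16 else 13) * q

/-- The searches and the families of roles are complete. -/
structure Complete (q c : ℕ) (job : ℕ → (ℕ → Bool) × ℕ × Bool) (J₁ : ℕ) (ρ : ℕ → ℕ → ℕ) (J : ℕ) :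
    Prop where
  job_le : ∀ i, (job i).2.1 ≤ 74 * q
  job_mem : ∀ (sel : ℕ → Bool) (c' : ℕ) (neg : Bool), c' = c ∨ c' = 74 * q →
    ∃ i < J₁, (job i).2.1 = c' ∧ (job i).2.2 = neg ∧ ∀ k < 74 * q, (job i).1 k = sel k
  lt : ∀ j k, ρ j k < 5
  sizes : ∀ j < J, HasSizes q (ρ j)
  role_mem : ∀ f : ℕ → ℕ, (∀ k, f k < 5) → (∀ k ≥ 74 * q, f k = 0) → HasSizes q f → ∃ j < J, ρ j = f

section

variable {q c J₁ J n₀ b : ℕ} {job : ℕ → (ℕ → Bool) × ℕ × Bool} {ρ : ℕ → ℕ → ℕ}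

theorem rightSizes (hc : Complete q c job J₁ ρ J) (w : ℕ → ℤ) (t : ℤ) {j : ℕ}
    (hj : j < J) : (setupOf (paramsOf q J) n₀ w t).RightSizes q (ρ j) := by
  refine ⟨hc.lt j, fun r hr => ?_⟩
  rw [Setup.card_part (Nat.succ_pos _)]
  show ((Finset.range (74 * q)).filter fun k => ρ j k = r).card * _ = _
  rw [hc.sizes j hj r hr]

/-- A single run for each coin sequence carries the time bound and all three guarantees, so that
they can be combined in the probability statement. -/
theorem exists_exec (hq : q = 1000000) (hc : Complete q c job J₁ ρ J) {A : Prog} {T : ℕ}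
    (w : Fin n₀ → ℤ) (t : ℤ) (hb : (paramsOf q J).Enough n₀ (padded w) t b)
    (hA : ∀ (N : ℕ) (G : SimpleGraph (Fin N)) (wt : Fin N → ℤ), 0 < N → N ≤ (paramsOf q J).N₀ n₀ →
      (∀ v, |wt v| < 2 ^ ((setupOf (paramsOf q J) n₀ (padded w) t).d + 7)) → ∀ ω, ∃ τ σ',
        Exec b A (p4Input G wt ω) τ σ' ∧ τ ≤ T ∧ (σ'.Accepts ↔ HasZeroWeightP4 G wt))
    (ω : ℕ → Bool) : ∃ τ σ', Exec b ((paramsOf q J).main job J₁ ρ A) (subsetSumInput w t ω) τ σ' ∧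
      τ ≤ (paramsOf q J).mainTime J₁ T n₀ (padded w) t ∧ (σ'.Accepts → HasSubsetSum w t) ∧
      ((∃ i < J₁, (setupOf (paramsOf q J) n₀ (padded w) t).Found (job i).1 (job i).2.1 (job i).2.2) →
        σ'.Accepts) ∧
      ((setupOf (paramsOf q J) n₀ (padded w) t).numVertices
        ((paramsOf q J).hash n₀ (padded w) t (untuple ((paramsOf q J).m n₀ (padded w) t)
          (coinNum (4 * (paramsOf q J).m n₀ (padded w) t) ω))) ρ J ≤ (paramsOf q J).N₀ n₀ →
        (∃ j < J, (setupOf (paramsOf q J) n₀ (padded w) t).HasPath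
          ((paramsOf q J).hash n₀ (padded w) t (untuple ((paramsOf q J).m n₀ (padded w) t)
            (coinNum (4 * (paramsOf q J).m n₀ (padded w) t) ω))) (ρ j)) →
        σ'.Accepts) := by
  have hV := paramsOf_valid hq J
  have hsmall : ∀ j < (paramsOf q J).J, ∀ v < 4,
      2 ^ ((setupOf (paramsOf q J) n₀ (padded w) t).items ((layer v).sel (ρ j))).card ≤
      (setupOf (paramsOf q J) n₀ (padded w) t).N₁ := by
    intro j hj v hv
    have h := Setup.card_layer_le (rightSizes (n₀ := n₀) hc (padded w) t hj) hv
    have h' : 32 * q * (paramsOf q J).B n₀ ≤ (37 * q - 1) * (paramsOf q J).B n₀ :=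
      Nat.mul_le_mul_right _ (by omega)
    exact (Nat.pow_le_pow_right (by norm_num) (h.trans h')).trans
      (Nat.le_mul_of_pos_left _ (Nat.succ_pos _))
  -- The input represents itself: variables `0` and `1` are not moved, and all other registers are
  -- zero.
  have hsim : Sim (subsetSumInput w t ω) (subsetSumInput w t ω) := by
    refine ⟨fun x => ?_, rfl, rfl⟩
    unfold fmap
    split_ifs with h
    · rfl
    · have h2 : ∀ y ≥ 2, (subsetSumInput w t ω).reg y = 0 := fun y hy => by
        simp only [subsetSumInput]
        rw [Function.update_of_ne (by omega), Function.update_of_ne (by omega)]; rfl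
      rw [h2 _ (by omega), h2 _ (by omega)]
  obtain ⟨τ, ρ', σ', h1, h2, h3, h4, h5, h6⟩ := Params.runs_main (σ := subsetSumInput w t ω) hV
    (job := job) (J₁ := J₁) (T := T) hc.job_le hc.lt hsmall hb hA
    (fun i hi => dif_neg (not_lt.2 hi)) rfl rfl (fun a ha i => if_neg ha) (subsetSumInput w t ω) hsim
  have h0 : ρ'.reg 0 = σ'.reg 0 := h3.reg 0
  refine ⟨τ, ρ', h2, h1, ?_, ?_, ?_⟩
  · rw [State.Accepts, h0]; exact fun h => Params.hasSubsetSum_of_solvable hV.K_pos w t (h4 h)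
  · rw [State.Accepts, h0]; exact h5
  · rw [State.Accepts, h0]; exact h6

/-- The case distinction depends on the instance only: either a search of the finite list succeeds
whatever the coins show, or the balanced roles belong to one of the listed families and `card_good`
applies to it. -/
theorem found_or_likely (hq : q = 1000000) (hc2 : 2 * c + 2 * 5000 = 37 * q)
    (hc : Complete q c job J₁ ρ J) (w : Fin n₀ → ℤ) (t : ℤ) (hS : HasSubsetSum w t) :
    (∃ i < J₁, (setupOf (paramsOf q J) n₀ (padded w) t).Found (job i).1 (job i).2.1 (job i).2.2) ∨
    2 / 3 ≤ fairCoins.real {ω | (setupOf (paramsOf q J) n₀ (padded w) t).numVertices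
        ((paramsOf q J).hash n₀ (padded w) t (untuple ((paramsOf q J).m n₀ (padded w) t)
          (coinNum (4 * (paramsOf q J).m n₀ (padded w) t) ω))) ρ J ≤ (paramsOf q J).N₀ n₀ ∧
        ∃ j < J, (setupOf (paramsOf q J) n₀ (padded w) t).HasPath
          ((paramsOf q J).hash n₀ (padded w) t (untuple ((paramsOf q J).m n₀ (padded w) t)
            (coinNum (4 * (paramsOf q J).m n₀ (padded w) t) ω))) (ρ j)} := by
  have hV := paramsOf_valid hq J
  obtain ⟨S, hSn, hSt⟩ : (setupOf (paramsOf q J) n₀ (padded w) t).Solvable false :=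
    Params.solvable_of_hasSubsetSum hV.K_pos hS
  have hSt' : (setupOf (paramsOf q J) n₀ (padded w) t).sum S = t := hSt
  obtain ⟨s, hs⟩ : ∃ s, setupOf (paramsOf q J) n₀ (padded w) t = s := ⟨_, rfl⟩
  obtain ⟨B, hB⟩ : ∃ B, (paramsOf q J).B n₀ = B := ⟨_, rfl⟩
  obtain ⟨m, hm⟩ : ∃ m, (paramsOf q J).m n₀ (padded w) t = m := ⟨_, rfl⟩
  have hB0 : 0 < B := by rw [← hB]; exact Nat.succ_pos _
  have hm' : m = s.d + (8 * q - 2545) * B := by rw [← hm, ← hB, ← hs]; rfl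
  have hsK : s.K = 74 * q := by rw [← hs]; rfl
  have hsB : s.B = B := by rw [← hs, ← hB]; rfl
  have hst : s.t = t := by rw [← hs]; rfl
  have hN : s.N₁ = (s.n + 1) * 2 ^ ((37 * q - 1) * s.B) := by rw [← hs]; rfl
  have hh : ∀ x, (paramsOf q J).hash n₀ (padded w) t x = hashOf m s.d ((4 * q + 7535) * s.B) s.t x := by
    intro x; rw [Params.hash, hm, hs, hst, hB, hsB]; rfl
  have hR : ∀ j < J, s.RightSizes q (ρ j) := fun j hj => hs ▸ rightSizes hc (padded w) t hj
  rw [hs] at hSn hSt' ⊢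
  rw [hm]
  simp only [hh]
  have hl : (8 * q - 2545) * s.B + 2545 * s.B = 8 * q * s.B := by
    have : 8 * q - 2545 + 2545 = 8 * q := by omega
    rw [← add_mul, this]
  rcases Setup.found_or_partials hq hc2 hsK (by rw [hsB]; exact hB0) hN hl hSn (by rw [hSt', hst]) with
    ⟨sel, neg, h⟩ | ⟨f, hf, hX⟩
  · left
    rcases h with h | h
    · obtain ⟨i, hi, e1, e2, e3⟩ := hc.job_mem sel c neg (.inl rfl)
      exact ⟨i, hi, by rw [e1, e2]; exact h.congr (by rw [hsK]; exact e3)⟩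
    · obtain ⟨i, hi, e1, e2, e3⟩ := hc.job_mem sel (74 * q) neg (.inr rfl)
      exact ⟨i, hi, by rw [e1, e2, ← hsK]; exact h.congr (by rw [hsK]; exact e3)⟩
  right
  have hpart := fun r => Setup.card_part (s := s) (by rw [hsB]; exact hB0) f r
  -- The roles are reset to `0` beyond the last block, so as to meet the normal form of the finite
  -- list.
  obtain ⟨j, hj, hjf⟩ : ∃ j < J, ρ j = fun k => if k < 74 * q then f k else 0 := by
    refine hc.role_mem _ (fun k => ?_) (fun k hk => if_neg (not_lt.2 hk)) fun r hr => ?_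
    · show (if k < 74 * q then f k else 0) < 5
      split_ifs
      · exact hf.lt k
      · norm_num
    · have h := hf.card r hr
      rw [hpart, hsK] at h
      have h' := Nat.eq_of_mul_eq_mul_right (by rw [hsB]; exact hB0) h
      rw [← h']
      refine congrArg Finset.card (Finset.filter_congr fun k hk => ?_)
      rw [if_pos (Finset.mem_range.1 hk)]
  have hX' : ∀ r < 3, 128 * 2 ^ m ≤ (s.partials ((4 * q + 7535) * s.B) (ρ j) S r).card * 2 ^ s.d := by
    intro r hr
    have e := Setup.partials_congr (s := s) (ρ := ρ j) (ρ' := f)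
      (fun k hk => by rw [hjf]; exact if_pos (hsK ▸ hk)) ((4 * q + 7535) * s.B) S r
    rw [e, hm', pow_add, ← hsB]
    calc 128 * (2 ^ s.d * 2 ^ ((8 * q - 2545) * s.B)) = 128 * 2 ^ ((8 * q - 2545) * s.B) * 2 ^ s.d := by
          ring
      _ ≤ _ := Nat.mul_le_mul_right _ (hX r hr)
  have hlB : 1 ≤ (8 * q - 2545) * B := Nat.mul_pos (by omega) hB0
  have good := Setup.card_good (s := s) (ρ := ρ) (J := J) (j := j) (m := m) (d := s.d)
    (cap := (4 * q + 7535) * s.B) (C := 2 ^ ((26 * q + 24200) * s.B)) (N₀ := (paramsOf q J).N₀ n₀)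
    (hc.lt j) hSn (by rw [hSt', hst]) (by omega) (by linarith [s.two_W_lt]) (by omega) (by positivity)
    (fun j hj v hv => Setup.card_candidates (hR j hj) hv) ?_ hX'
  · have h1 := card_tuples_filter_le m fun x =>
      s.numVertices (hashOf m s.d ((4 * q + 7535) * s.B) s.t x) ρ J ≤ (paramsOf q J).N₀ n₀ ∧
      s.HasPath (hashOf m s.d ((4 * q + 7535) * s.B) s.t x) (ρ j)
    have h2 := fairCoins_coinNum (4 * m) fun r =>
      s.numVertices (hashOf m s.d ((4 * q + 7535) * s.B) s.t (untuple m r)) ρ J ≤ (paramsOf q J).N₀ n₀ ∧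
      s.HasPath (hashOf m s.d ((4 * q + 7535) * s.B) s.t (untuple m r)) (ρ j)
    refine le_trans ?_ (measureReal_mono (μ := fairCoins) (s₁ := {ω | s.numVertices (hashOf m s.d
      ((4 * q + 7535) * s.B) s.t (untuple m (coinNum (4 * m) ω))) ρ J ≤ (paramsOf q J).N₀ n₀ ∧
      s.HasPath (hashOf m s.d ((4 * q + 7535) * s.B) s.t (untuple m (coinNum (4 * m) ω))) (ρ j)})
      fun ω hω => ⟨hω.1, j, hj, hω.2⟩)
    rw [h2, div_le_div_iff₀ (by norm_num) (by positivity)]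
    have h3 := good.trans (Nat.mul_le_mul_left 3 (le_of_eq_of_le (by congr) h1))
    rw [mul_comm _ (3 : ℝ)]
    exact_mod_cast h3
  · have e : (paramsOf q J).N₀ n₀ = 80 * J * 2 ^ ((18 * q + 40000) * s.B) := by rw [hsB, ← hB]; rfl
    rw [e, hm', hsB, mul_assoc (80 * J), mul_assoc (80 * J), ← pow_add, ← pow_add]
    refine Nat.mul_le_mul_left _ (Nat.pow_le_pow_right (by norm_num) ?_)
    have : (26 * q + 24200) * B ≤ (18 * q + 40000) * B + (8 * q - 2545) * B := by
      rw [← add_mul]; exact Nat.mul_le_mul_right _ (by omega)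
    omega

end


/-- The exponent is `37 * q - 1` out of `74 * q` blocks, a fraction `1 / 2 - 1 / (74 * q)` of `n₀`.
Rounding up the size of a block costs the constant factor. -/
theorem two_pow_list_le {q : ℕ} (hq : 0 < q) (J n₀ : ℕ) :
    (2 : ℝ) ^ ((paramsOf q J).c₁ * (paramsOf q J).B n₀) ≤
      2 ^ (paramsOf q J).c₁ * (2 : ℝ) ^ ((0.5 - 1 / (74 * q : ℝ)) * n₀) := by
  rw [← Real.rpow_natCast 2, ← Real.rpow_natCast 2, ← Real.rpow_add (by norm_num)]
  refine Real.rpow_le_rpow_of_exponent_le (by norm_num) ?_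
  have hq0 : (0 : ℝ) < q := by exact_mod_cast hq
  have h1 : ((n₀ / (74 * q) : ℕ) : ℝ) ≤ n₀ / (74 * q : ℝ) := by
    have := Nat.cast_div_le (α := ℝ) (m := n₀) (n := 74 * q)
    push_cast at this
    exact this
  have hc : (((paramsOf q J).c₁ : ℕ) : ℝ) = 37 * q - 1 := by
    show ((37 * q - 1 : ℕ) : ℝ) = _
    rw [Nat.cast_sub (by omega)]; push_cast; ring
  have hc0 : (0 : ℝ) ≤ 37 * q - 1 := by rw [← hc]; positivity
  have hB : (((paramsOf q J).B n₀ : ℕ) : ℝ) = ((n₀ / (74 * q) : ℕ) : ℝ) + 1 := by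
    show ((n₀ / (74 * q) + 1 : ℕ) : ℝ) = _
    push_cast; rfl
  rw [Nat.cast_mul, hc, hB, mul_add, mul_one, add_comm]
  refine add_le_add_right ((mul_le_mul_of_nonneg_left h1 hc0).trans (le_of_eq ?_)) _
  field_simp
  ring

/-- The decisive inequality is `2.05 * (18 * q + 40000) ≤ 37 * q - 1`. As `2.05 * 18 = 36.9`, it
needs `q` above about `820000`; the Hoeffding bounds in turn limit `q` from above, and one million
satisfies both. -/
theorem N₀_rpow_le {q : ℕ} (hq : q = 1000000) (J n₀ : ℕ) :
    (((paramsOf q J).N₀ n₀ : ℕ) : ℝ) ^ (2.05 : ℝ) ≤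
      (80 * J : ℝ) ^ (2.05 : ℝ) * 2 ^ ((paramsOf q J).c₁ * (paramsOf q J).B n₀) := by
  have hc : 205 * (18 * q + 40000) ≤ 100 * (37 * q - 1) := by omega
  have h : 205 * ((paramsOf q J).c₀ * (paramsOf q J).B n₀) ≤
      100 * ((paramsOf q J).c₁ * (paramsOf q J).B n₀) := by
    rw [← mul_assoc, ← mul_assoc]
    exact Nat.mul_le_mul_right _ hc
  have hN : (((paramsOf q J).N₀ n₀ : ℕ) : ℝ) =
      80 * J * (2 : ℝ) ^ ((paramsOf q J).c₀ * (paramsOf q J).B n₀) := by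
    rw [Params.N₀]; push_cast; rfl
  rw [hN]
  generalize (paramsOf q J).c₀ * (paramsOf q J).B n₀ = e₀ at *
  generalize (paramsOf q J).c₁ * (paramsOf q J).B n₀ = e₁ at *
  have h' : (205 : ℝ) * e₀ ≤ 100 * e₁ := by exact_mod_cast h
  clear hq hc h hN
  rw [Real.mul_rpow (by positivity) (by positivity), ← Real.rpow_natCast 2, ← Real.rpow_natCast 2,
    ← Real.rpow_mul (by norm_num)]
  refine mul_le_mul_of_nonneg_left (Real.rpow_le_rpow_of_exponent_le (by norm_num) ?_) (by positivity)
  linarith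

theorem exists_complete (q c : ℕ) (hc : c ≤ 74 * q) :
    ∃ job J₁ ρ J, Complete q c job J₁ ρ J := by
  obtain ⟨J₁, job, h1, h2⟩ := exists_jobs hc
  obtain ⟨J, ρ, h3, h4, h5⟩ := exists_roles (74 * q) 5 (by norm_num) (HasSizes q)
  exact ⟨job, J₁, ρ, J, h1, h2, h3, h4, h5⟩

end WordRAM

theorem mainTheorem5 (hP4 : ExactNodeWeightedP4SolvableInTime 2.05) :
    ∃ δ : ℝ, 0 < δ ∧ SubsetSumSolvableInRandomizedTime (0.5 - δ) := by
  obtain ⟨A, C, k, hA⟩ := hP4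
  obtain ⟨q, hq⟩ : ∃ q, q = 1000000 := ⟨_, rfl⟩
  have hq0 : 0 < q := by omega
  -- The cap of the sparse searches is `5000` blocks below half of `37 * q`; the equation is exact
  -- because `q` is even.
  have hc2 : 2 * (37 * (q / 2) - 5000) + 2 * 5000 = 37 * q := by omega
  obtain ⟨job, J₁, ρ, J, hc⟩ := exists_complete q (37 * (q / 2) - 5000) (by omega)
  have hV := paramsOf_valid hq J
  have hcc : 2 * (paramsOf q J).c₀ ≤ (paramsOf q J).c₁ := by
    show 2 * (18 * q + 40000) ≤ 37 * q - 1
    omega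
  obtain ⟨D, hD⟩ : ∃ D, 1000 + (J₁ + 1) * (6 * (paramsOf q J).K + 1000) +
    (4 * (paramsOf q J).J + 1) * (6 * (paramsOf q J).K + 1000) + 82 * (80 * (paramsOf q J).J) ^ 2 = D :=
    ⟨_, rfl⟩
  -- The gain is one block out of `74 * q`.
  refine ⟨1 / (74 * q : ℝ), by positivity, (paramsOf q J).main job J₁ ρ A,
    (D * ((paramsOf q J).K + 2) ^ 2 + |C| * (80 * J : ℝ) ^ (2.05 : ℝ)) * 2 ^ (paramsOf q J).c₁, 2,
    (k + 5) * ((paramsOf q J).K + J + 20), fun n w t => ?_⟩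
  have hs := lt_subsetSumSize w t
  have hd := Params.d_le hV.K_pos w t
  have hn := (paramsOf q J).n_le n
  obtain ⟨s, hsize⟩ : ∃ s, subsetSumSize w t = s := ⟨_, rfl⟩
  rw [hsize] at hs hd ⊢
  obtain ⟨b, hb⟩ : ∃ b, (k + 5) * ((paramsOf q J).K + J + 20) * s = b := ⟨_, rfl⟩
  rw [hb]
  have hbig : (k + 5) * ((setupOf (paramsOf q J) n (padded w) t).d +
      (paramsOf q J).K * (paramsOf q J).B n + J + 9) ≤ b := by
    rw [← hb, mul_assoc]
    refine Nat.mul_le_mul_left _ ?_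
    nlinarith [Nat.zero_le (J * s), Nat.zero_le ((paramsOf q J).K * s)]
  have hJ : (paramsOf q J).J = J := rfl
  have hE : (paramsOf q J).Enough n (padded w) t b := by
    unfold Params.Enough
    rw [hJ]
    nlinarith
  -- A bound on the time of the call that does not depend on the graph: the size is replaced by its
  -- limit, and `C` by `|C|` as its sign is not known.
  obtain ⟨T, hT⟩ : ∃ T, ⌊|C| * (((paramsOf q J).N₀ n : ℕ) : ℝ) ^ (2.05 : ℝ)⌋₊ = T := ⟨_, rfl⟩
  have hexec := exists_exec hq hc (T := T) w t hE fun N G wt hN hN' hwt ω => by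
    have hlt := Params.lt_two_pow_N₀ hV (n₀ := n)
    -- This number of bits covers the weights, which have at most `d + 7`, as well as the limit on
    -- the number of vertices, which has at most `8 + J + K * B`.
    obtain ⟨τ, σ', h1, h2, h3⟩ := hA N G wt ((setupOf (paramsOf q J) n (padded w) t).d +
      (paramsOf q J).K * (paramsOf q J).B n + J + 8) hN
      ((hN'.trans_lt hlt).trans_le (Nat.pow_le_pow_right (by norm_num) (by omega)))
      (fun v => (hwt v).trans_le (pow_le_pow_right₀ (by norm_num) (by omega))) ω
    refine ⟨τ, σ', h1.mono (le_trans (Nat.mul_le_mul_right _ (by omega)) hbig), ?_, h3⟩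
    rw [← hT]
    refine Nat.le_floor (h2.trans ?_)
    exact mul_le_mul (le_abs_self C) (Real.rpow_le_rpow (by positivity) (by exact_mod_cast hN')
      (by norm_num)) (by positivity) (abs_nonneg C)
  refine ⟨fun ω => ?_, ?_⟩
  · obtain ⟨τ, σ', h1, h2, -⟩ := hexec ω
    refine ⟨τ, σ', h1, ?_⟩
    have hmain := Params.mainTime_le (n₀ := n) hV hcc J₁ T w t
    rw [hD, hsize] at hmain
    have h3 : (τ : ℝ) ≤ ((D * (s + (paramsOf q J).K + 1) ^ 2 *
        2 ^ ((paramsOf q J).c₁ * (paramsOf q J).B n) + T : ℕ) : ℝ) := by exact_mod_cast h2.trans hmain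
    have h4 := N₀_rpow_le hq J n
    have h5 := two_pow_list_le hq0 J n
    have hs1 : (1 : ℝ) ≤ s := by exact_mod_cast (by omega : 1 ≤ s)
    have hE1 : (0 : ℝ) ≤ 2 ^ ((0.5 - 1 / (74 * q : ℝ)) * n) := Real.rpow_nonneg (by norm_num) _
    push_cast at h3
    generalize (2 : ℝ) ^ ((0.5 - 1 / (74 * q : ℝ)) * n) = E at *
    generalize (paramsOf q J).c₁ * (paramsOf q J).B n = e₁ at *
    generalize (paramsOf q J).N₀ n = N₀ at *
    generalize (paramsOf q J).K = K at *
    generalize (paramsOf q J).c₁ = c₁ at *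
    clear hq hc2 hV hcc hD hexec hE hbig hb hn hd hmain
    have hY : (0 : ℝ) ≤ (80 * J : ℝ) ^ (2.05 : ℝ) := by positivity
    have h4' : (T : ℝ) ≤ |C| * ((80 * J : ℝ) ^ (2.05 : ℝ) * 2 ^ e₁) := by
      rw [← hT]
      exact (Nat.floor_le (by positivity)).trans (mul_le_mul_of_nonneg_left h4 (abs_nonneg C))
    generalize (80 * J : ℝ) ^ (2.05 : ℝ) = Y at *
    have hK0 : (0 : ℝ) ≤ K := Nat.cast_nonneg _
    have h6 : ((s : ℝ) + K + 1) ^ 2 ≤ (K + 2) ^ 2 * s ^ 2 := by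
      rw [← mul_pow]
      exact pow_le_pow_left₀ (by positivity) (by nlinarith) 2
    have hs2 : (1 : ℝ) ≤ (s : ℝ) ^ 2 := one_le_pow₀ hs1
    calc (τ : ℝ) ≤ D * (s + K + 1) ^ 2 * 2 ^ e₁ + T := h3
      _ ≤ D * ((K + 2) ^ 2 * s ^ 2) * 2 ^ e₁ + |C| * (Y * 2 ^ e₁) * s ^ 2 := by
          refine add_le_add (by gcongr) (h4'.trans (le_mul_of_one_le_right (by positivity) hs2))
      _ = (D * (K + 2) ^ 2 + |C| * Y) * s ^ 2 * 2 ^ e₁ := by ring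
      _ ≤ (D * (K + 2) ^ 2 + |C| * Y) * s ^ 2 * (2 ^ c₁ * E) := by gcongr
      _ = _ := by ring
  · by_cases hS : HasSubsetSum w t
    · rcases found_or_likely hq hc2 hc w t hS with hf | hf
      · have : {ω : ℕ → Bool | ∃ (τ : ℕ) (σ : State), Exec b ((paramsOf q J).main job J₁ ρ A)
            (subsetSumInput w t ω) τ σ ∧ (σ.Accepts ↔ HasSubsetSum w t)} = Set.univ := by
          refine Set.eq_univ_of_forall fun ω => ?_
          obtain ⟨τ, σ', h1, -, -, h3, -⟩ := hexec ω
          exact ⟨τ, σ', h1, iff_of_true (h3 hf) hS⟩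
        rw [this, probReal_univ]
        norm_num
      · refine hf.trans (measureReal_mono fun ω hω => ?_)
        obtain ⟨τ, σ', h1, -, -, -, h3⟩ := hexec ω
        exact ⟨τ, σ', h1, iff_of_true (h3 hω.1 hω.2) hS⟩
    -- The error is one-sided: without a solution no outcome of the coins leads to acceptance.
    · have : {ω : ℕ → Bool | ∃ (τ : ℕ) (σ : State), Exec b ((paramsOf q J).main job J₁ ρ A)
          (subsetSumInput w t ω) τ σ ∧ (σ.Accepts ↔ HasSubsetSum w t)} = Set.univ := by
        refine Set.eq_univ_of_forall fun ω => ?_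
        obtain ⟨τ, σ', h1, -, h3, -⟩ := hexec ω
        exact ⟨τ, σ', h1, iff_of_false (fun h => hS (h3 h)) hS⟩
      rw [this, probReal_univ]
      norm_num
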